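/- Let $G$ be the universal cover of $\mathrm{SL}(3,\mathbb R)$ and $K=\mathrm{SU}(2)$ the inverse image of $\mathrm{SO}(3)$; here $\mathrm{SU}(2)$ is the group of unit quaternions $\mathbf y=\alpha+\mathbf j\beta$, identified with the matrices $\begin{pmatrix}\alpha&-\overline\beta\\ \beta&\overline\alpha\end{pmatrix}$, and the covering $K\to\mathrm{SO}(3)$ is $\mathbf y\mapsto(\mathbf x\mapsto \mathbf y\mathbf x\overline{\mathbf y})$ on the imaginary quaternions with basis $\mathbf i,\mathbf j,\mathbf k$. Let $\mathfrak g=\mathfrak{sl}(3,\mathbb C)$, let $\mathfrak k\cong\mathfrak{sl}(2,\mathbb C)$ be the complexified Lie algebra of $K$, and let $B=MAN$ be the Borel subgroup of $G$ over the upper triangular matrices, so $M=\{\pm1,\pm\mathbf i,\pm\mathbf j,\pm\mathbf k\}\subset K$. Let $\sigma^0$ be the restriction to $M$ of the defining representation $\mathbb C^2$ of $\mathrm{SU}(2)$. For $a\in\mathbb C$ put $\lambda(2,a)=\frac13(-a-\frac32,\,2a,\,-a+\frac32)$, and for a character $\nu$ of $\mathfrak a$ let $$C^\infty(G,\sigma^0_\nu)^B=\{f\in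 C^\infty(G,\mathbb C^2): f(gmhn)=e^{-\nu(\log h)}\sigma^0(m)^{-1}f(g)\ \ (m\in M,\ h\in A,\ n\in N)\},$$ with $G$ acting by left translation. With $T_{i,j}=E_{i,j}-\frac{\delta_{ij}}3I$, let $$F^a=\Big\{\sum_{i,j,k}A_{i,j}T_{i,k}T_{k,j}-\tfrac a3A \;:\; A\in\mathfrak g\Big\}\subset\mathfrak g+S^2(\mathfrak g).$$ Let $\mathrm{sym}$ be the symmetrization map into $U(\mathfrak g)$, $\iota$ the anti-involution of $U(\mathfrak g)$ with $\iota(X)=-X$ for $X\in\mathfrak g$, and $\Psi(X_1\cdots X_n,f)(g)=\partial_{t_1}\cdots\partial_{t_n}|_{t=0}\,f(ge^{t_1X_1}\cdots e^{t_nX_n})$ the action of $U(\mathfrak g)$ by right differentiation. The second-order intertwining differential operator $D(B,\sigma^0_{-\lambda(2,-a)})$ (for the parameter $a$) sends $f\in C^\infty(G,\sigma^0_{-\lambda(2,-a)})^B$ to the function $g\mapsto\big(w\mapsto\Psi(w,f)(g)\big)$, where $w$ runs through the image $W$ of $\iota(\mathrm{sym}(F^a))$ in the quotient of $U(\mathfrak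 g)$ by the left ideal generated by $\mathrm{Ann}_{U(\mathfrak b)}(\lambda(2,-a))$. The subscript $K$ denotes $K$-finite vectors. For $m\ge0$ let $\mathcal P_m[t]$ be the space of polynomials of degree $\le m$, on which $K$ acts by $g^{-1}q(t)=(\beta t+\overline\alpha)^m q\big(\frac{\alpha t-\overline\beta}{\beta t+\overline\alpha}\big)$ for $g=\begin{pmatrix}\alpha&-\overline\beta\\ \beta&\overline\alpha\end{pmatrix}$, and let $\langle\cdot,\cdot\rangle_m$ be the invariant pairing of $S^m\mathbb C^2$ and $\mathcal P_m[t]$ with $\langle e_1^ie_2^{m-i},t^j\rangle_m=\delta_{ij}\,i!(m-i)!/m!$. For $v\in S^m\mathbb C^2$ and an $M$-invariant pair $(q_1,q_2)\in(\mathcal P_m[t]\otimes\sigma^0)^M$ let $\Phi_m(v\otimes{}^t(q_1,q_2))$ be the function $y\mapsto{}^t(\langle v,yq_1\rangle_m,\langle v,yq_2\rangle_m)$ on $K$, extended to an element of $C^\infty(G,\sigma^0_{-\lambda(2,-a)})^B$ by $G=KAN$. For $a\in\mathbb Z$ and $k\in\mathbb N=\{0,1,2,\dots\}$ put $m(a,k)=2|a|+1+4k$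 and $$q(a,k;t^2)={}_2F_1\Big(-|a|-\tfrac12-2k,\ \tfrac a2-\tfrac{|a|}2-k;\ -\tfrac a2-\tfrac{|a|}2+\tfrac12-k;\ t^2\Big)=\sum_{l=0}^{\frac{|a|-a}2+k}\frac{(-|a|-\frac12-2k)_l\,(\frac a2-\frac{|a|}2-k)_l}{l!\,(-\frac a2-\frac{|a|}2+\frac12-k)_l}\,t^{2l}.$$ **Proposition.** If $a\in\mathbb C\setminus\mathbb Z$, then $\mathrm{Ker}\,D(B,\sigma^0_{-\lambda(2,-a)})_K=0$. If $a\in\mathbb Z$, then $\mathrm{Ker}\,D(B,\sigma^0_{-\lambda(2,-a)})_K$ equals $$\begin{cases}\displaystyle\bigoplus_{k\ge0}\Phi_{m(a,k)}\Big(S^{m(a,k)}\mathbb C^2\otimes\begin{pmatrix}t^{m(a,k)}q(a,k;t^{-2})\\ q(a,k;t^2)\end{pmatrix}\Big)&\text{if $a$ is even,}\\[3mm]\displaystyle\bigoplus_{k\ge0}\Phi_{m(a,k)}\Big(S^{m(a,k)}\mathbb C^2\otimes\begin{pmatrix}q(a,k;t^2)\\ -t^{m(a,k)}q(a,k;t^{-2})\end{pmatrix}\Big)&\text{if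 $a$ is odd,}\end{cases}$$ and it is isomorphic to $\bigoplus_{k\ge0}S^{m(a,k)}\mathbb C^2$ as a $\mathfrak k$-module. -/

import Mathlib

open scoped ContDiff Quaternion DirectSum

noncomputable section

namespace SL3Kernel

/-! ### The double cover `Spin(3) → SO(3)` -/

/-- `K = SU(2)`, as the group of unit quaternions. -/
abbrev K : Type := unitary ℍ[ℝ]

/-- The matrix of left multiplication by the quaternion `y` on `ℍ = ℂ ⊕ 𝐣ℂ`, a right vector space
over `ℂ = ℝ ⊕ ℝ𝐢` with basis `1, 𝐣`. If `y = α + 𝐣β`, it is `!![α, -β̄; β, ᾱ]`. It identifies the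
unit quaternions with `SU(2)`, and the imaginary quaternions with `𝔰𝔲(2)`. -/
def quatMat (y : ℍ[ℝ]) : Matrix (Fin 2) (Fin 2) ℂ :=
  !![⟨y.re, y.imI⟩, ⟨-y.imJ, -y.imK⟩; ⟨y.imJ, -y.imK⟩, ⟨y.re, -y.imI⟩]

/-- The matrix of `x ↦ y x ȳ` on the imaginary quaternions, in the basis `𝐢, 𝐣, 𝐤`. -/
def rotMat (y : ℍ[ℝ]) : Matrix (Fin 3) (Fin 3) ℝ :=
  Matrix.of fun i j =>
    let e : Fin 3 → ℍ[ℝ] := ![⟨0, 1, 0, 0⟩, ⟨0, 0, 1, 0⟩, ⟨0, 0, 0, 1⟩]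
    let z := y * e j * star y
    ![z.imI, z.imJ, z.imK] i

lemma rotMat_eq (y : ℍ[ℝ]) : rotMat y =
    !![y.re ^ 2 + y.imI ^ 2 - y.imJ ^ 2 - y.imK ^ 2, 2 * (y.imI * y.imJ - y.re * y.imK),
        2 * (y.imI * y.imK + y.re * y.imJ);
      2 * (y.imI * y.imJ + y.re * y.imK), y.re ^ 2 - y.imI ^ 2 + y.imJ ^ 2 - y.imK ^ 2,
        2 * (y.imJ * y.imK - y.re * y.imI);
      2 * (y.imI * y.imK - y.re * y.imJ), 2 * (y.imJ * y.imK + y.re * y.imI),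
        y.re ^ 2 - y.imI ^ 2 - y.imJ ^ 2 + y.imK ^ 2] := by
  ext i j
  fin_cases i <;> fin_cases j <;> simp [rotMat] <;> ring

lemma rotMat_one : rotMat 1 = 1 := by
  rw [rotMat_eq]
  ext i j; fin_cases i <;> fin_cases j <;> simp

lemma rotMat_mul (y z : ℍ[ℝ]) : rotMat (y * z) = rotMat y * rotMat z := by
  rw [rotMat_eq, rotMat_eq, rotMat_eq]
  ext i j
  rw [Matrix.mul_apply, Fin.sum_univ_three]
  fin_cases i <;> fin_cases j <;>
    simp only [Quaternion.re_mul, Quaternion.imI_mul, Quaternion.imJ_mul, Quaternion.imK_mul,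
      Matrix.of_apply, Matrix.cons_val', Matrix.cons_val, Fin.zero_eta, Fin.mk_one,
      Fin.reduceFinMk, Matrix.cons_val_zero, Matrix.cons_val_one] <;> ring

lemma normSq_coe (y : K) : Quaternion.normSq (y : ℍ[ℝ]) = 1 := by
  have h1 := Unitary.mul_star_self_of_mem y.2
  rw [Quaternion.self_mul_star] at h1
  exact Quaternion.coe_injective h1

lemma det_rotMat (y : K) : (rotMat (y : ℍ[ℝ])).det = 1 := by
  have h2 : (rotMat (y : ℍ[ℝ])).det = Quaternion.normSq (y : ℍ[ℝ]) ^ 3 := by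
    rw [Matrix.det_fin_three, Quaternion.normSq_def', rotMat_eq]
    simp only [Matrix.of_apply, Matrix.cons_val', Matrix.cons_val, Matrix.cons_val_zero,
      Matrix.cons_val_one]
    ring
  rw [h2, normSq_coe, one_pow]

/-- The two-to-one homomorphism `SU(2) → SO(3) ⊆ SL(3,ℝ)`, `y ↦ (x ↦ y x ȳ)`. -/
def rot : K →* Matrix.SpecialLinearGroup (Fin 3) ℝ where
  toFun y := ⟨rotMat y, det_rotMat y⟩
  map_one' := Subtype.ext rotMat_one
  map_mul' y z := Subtype.ext (rotMat_mul y z)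

/-! ### The universal cover of `SL(3,ℝ)` -/

/-- The subgroup `AN` of `SL(3,ℝ)`: upper triangular matrices with positive diagonal. -/
def AN : Subgroup (Matrix.SpecialLinearGroup (Fin 3) ℝ) where
  carrier := {b | (∀ i j, j < i → b.1 i j = 0) ∧ ∀ i, 0 < b.1 i i}
  one_mem' := by
    refine ⟨fun i j h => ?_, fun i => ?_⟩
    · simp [h.ne']
    · simp
  mul_mem' := by
    rintro b c ⟨hb, hb'⟩ ⟨hc, hc'⟩
    have b10 := hb 1 0 (by decide)
    have b20 := hb 2 0 (by decide)
    have b21 := hb 2 1 (by decide)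
    have c10 := hc 1 0 (by decide)
    have c20 := hc 2 0 (by decide)
    have c21 := hc 2 1 (by decide)
    refine ⟨fun i j h => ?_, fun i => ?_⟩
    · fin_cases i <;> fin_cases j <;>
        simp_all [Matrix.mul_apply, Fin.sum_univ_three]
    · have h1 := mul_pos (hb' i) (hc' i)
      fin_cases i <;> simp_all [Matrix.mul_apply, Fin.sum_univ_three]
  inv_mem' := by
    rintro b ⟨hb, hb'⟩
    have b10 := hb 1 0 (by decide)
    have b20 := hb 2 0 (by decide)
    have b21 := hb 2 1 (by decide)
    have h0 := hb' 0
    have h1 := hb' 1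
    have h2 := hb' 2
    refine ⟨fun i j h => ?_, fun i => ?_⟩
    · fin_cases i <;> fin_cases j <;>
        simp_all [Matrix.adjugate_fin_three]
    · have h01 := mul_pos h0 h1
      have h02 := mul_pos h0 h2
      have h12 := mul_pos h1 h2
      fin_cases i <;> simp_all [Matrix.adjugate_fin_three]

/-- The universal cover `G` of `SL(3,ℝ)`. The group `SL(3,ℝ)` acts on `SO(3) = SL(3,ℝ)/AN`
(Iwasawa decomposition), and `G` consists of the pairs `(g, φ)` of some `g` in `SL(3,ℝ)` and a
homeomorphism `φ` of the double cover `SU(2)` of `SO(3)` which lifts the action of `g`, that is,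
`g · rot y ∈ rot (φ y) · AN` for all `y`. Each `g` has exactly two lifts `±φ`, and `G` contains
`SU(2)` (acting by left multiplication) as the inverse image of `SO(3)`, so that
`G = SU(2) · AN` is simply connected. -/
def G : Subgroup (Matrix.SpecialLinearGroup (Fin 3) ℝ × (K ≃ₜ K)) where
  carrier := {x | ∀ y : K, (rot (x.2 y))⁻¹ * x.1 * rot y ∈ AN}
  one_mem' := fun y => by simp [AN.one_mem]
  mul_mem' := by
    intro u v hu hv y
    have h := AN.mul_mem (hu (v.2 y)) (hv y)
    simpa [mul_assoc] using h
  inv_mem' := by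
    intro u hu y
    have h := AN.inv_mem (hu (u.2⁻¹ y))
    have e : u.2 (u.2⁻¹ y) = y := u.2.apply_symm_apply y
    rw [e] at h
    simpa [mul_assoc] using h

/-- The covering homomorphism `G → SL(3,ℝ)`. -/
def proj : G →* Matrix.SpecialLinearGroup (Fin 3) ℝ :=
  (MonoidHom.fst _ _).comp G.subtype

/-- The embedding of `K = SU(2)` in `G`: `y` acts on `SU(2)` by left multiplication. -/
def embK : K →* G where
  toFun y := ⟨(rot y, Homeomorph.mulLeft y), fun z => by simp [AN.one_mem, mul_assoc]⟩
  map_one' := Subtype.ext (Prod.ext (map_one rot) (Homeomorph.ext fun z => one_mul z))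
  map_mul' y z := Subtype.ext (Prod.ext (map_mul rot y z) (Homeomorph.ext fun w => mul_assoc y z w))

/-- The `K`-component of the Iwasawa decomposition `G = K A N`. -/
def kPart (g : G) : K := g.1.2 1

/-- The image in `SL(3,ℝ)` of the `AN`-component of the Iwasawa decomposition `G = K A N`. -/
def anPart (g : G) : Matrix.SpecialLinearGroup (Fin 3) ℝ := (rot (kPart g))⁻¹ * proj g

/-- The exponential map of `G`, at a real traceless matrix `X`: the value at `1` of the
one-parameter subgroup of `G` that lies over `t ↦ exp (tX)`. (As `(ℝ, +)` is divisible and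
`G → SL(3,ℝ)` has a finite central kernel, there is exactly one homomorphism `ℝ → G` over
`t ↦ exp (tX)`, so that continuity need not be asked for.) -/
def expG (X : Matrix (Fin 3) (Fin 3) ℝ) : G :=
  Classical.epsilon fun h => ∃ γ : Multiplicative ℝ →* G,
    (∀ t : ℝ, (proj (γ (Multiplicative.ofAdd t))).1 = NormedSpace.exp (t • X)) ∧
      γ (Multiplicative.ofAdd 1) = h

/-! ### Functions on `G` and the induced representation -/

/-- `T i j = E i j - (δ i j / 3) I`. -/
def T (i j : Fin 3) : Matrix (Fin 3) (Fin 3) ℝ :=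
  Matrix.single i j 1 - (if i = j then (1 / 3 : ℝ) else 0) • 1

/-- The surjective linear map `c ↦ ∑ c i j • T i j` from `ℝ⁹` onto `𝔰𝔩(3,ℝ)`; it takes a matrix to
its traceless part. -/
def slMat (c : Fin 3 → Fin 3 → ℝ) : Matrix (Fin 3) (Fin 3) ℝ := ∑ i, ∑ j, c i j • T i j

/-- The representation space `ℂ²` of `σ⁰`. -/
abbrev V : Type := Fin 2 → ℂ

/-- Smoothness of a function on the Lie group `G`. For `n = 1` the condition says that `f` is smooth
in the exponential charts `X ↦ g exp X`; a function which is smooth in these charts is smooth along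
all maps `(X₁, …, Xₙ) ↦ g exp X₁ ⋯ exp Xₙ`. -/
def Smooth (f : G → V) : Prop :=
  ∀ (n : ℕ) (g : G), ContDiff ℝ ∞ fun c : Fin n → Fin 3 → Fin 3 → ℝ =>
    f (g * (List.ofFn fun i => expG (slMat (c i))).prod)

/-- The character `exp ν` of `A`, on a diagonal (or triangular) matrix; absolute values are taken,
as the diagonal entries of an element of `Q = MAN` are those of its `A`-component up to signs. -/
def aChar (ν : Fin 3 → ℂ) (g : Matrix.SpecialLinearGroup (Fin 3) ℝ) : ℂ :=
  ∏ i, ((|g.1 i i| : ℝ) : ℂ) ^ ν i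

/-- The Borel subgroup `B = MAN` of `G`: the inverse image of the upper triangular matrices. -/
def B : Set G := {q | ∀ i j, j < i → (proj q).1 i j = 0}

/-- The representation `σ⁰_ν` of `B = MAN` on `ℂ²`: `M = {±1, ±𝐢, ±𝐣, ±𝐤} ⊆ SU(2)` acts by the
restriction of the defining representation of `SU(2)`, `A` by `exp ν`, and `N` trivially. The
`M`-component of an element of `B` is its `K`-component in `G = KAN`. -/
def sigma (ν : Fin 3 → ℂ) (q : G) : Matrix (Fin 2) (Fin 2) ℂ :=
  aChar ν (proj q) • quatMat (kPart q : ℍ[ℝ])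

/-- `λ(2, a) = (1/3) (-a - 3/2, 2a, -a + 3/2)`. -/
def lam2 (a : ℂ) : Fin 3 → ℂ := ![(-a - 3 / 2) / 3, 2 * a / 3, (-a + 3 / 2) / 3]

/-- `C^∞(G, σ⁰_ν)^B`. -/
def Ind (ν : Fin 3 → ℂ) : Set (G → V) :=
  {f | Smooth f ∧ ∀ g : G, ∀ q ∈ B, f (g * q) = (sigma ν q⁻¹).mulVec (f g)}

/-! ### The intertwining differential operator -/

/-- Right differentiation `Ψ(X, f)`: `g ↦ d/dt f (g exp (tX))` at `t = 0`. The iterate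
`rDeriv X (rDeriv Y f)` is `Ψ(XY, f)`. -/
def rDeriv (X : Matrix (Fin 3) (Fin 3) ℝ) (f : G → V) : G → V :=
  fun g => deriv (fun t : ℝ => f (g * expG (t • X))) 0

/-- `Ψ(sym(XY), f)`, where `sym(XY) = (XY + YX)/2` in the enveloping algebra. -/
def rDerivSym (X Y : Matrix (Fin 3) (Fin 3) ℝ) (f : G → V) : G → V :=
  fun g => (1 / 2 : ℂ) • (rDeriv X (rDeriv Y f) g + rDeriv Y (rDeriv X f) g)

/-- The second-order operator `D`, for the parameter `a` and `𝔤 = 𝔰𝔩(3,ℂ)`. The space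
`F^a ⊆ 𝔤 + S²(𝔤)` consists of the elements
`x_A = ∑ A i j T i k T k j - (a/3) A = ∑ A i j (∑ T i k T k j - (a/3) T i j)`, `A ∈ 𝔤`.
The value of `D f` at `g` is the functional `x_A ↦ Ψ(ι(sym x_A), f)(g)`, where `ι` is the
anti-involution `X ↦ -X` of the enveloping algebra, so that
`ι(sym x_A) = ∑ A i j (∑ sym (T i k T k j) + (a/3) T i j)`.
For `f` in the induced representation the functional factors through the image `W` of `F^a` in
`U(𝔤)/I(𝔟, λ)`, and it is the element `D f (g)` of `Hom(W, ℂ²) = W^∨ ⊗ ℂ²`. -/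
def D (a : ℂ) (f : G → V) (g : G) (A : {A : Matrix (Fin 3) (Fin 3) ℂ // A.trace = 0}) : V :=
  ∑ i, ∑ j, A.1 i j • ((∑ k, rDerivSym (T i k) (T k j) f g) + (a / 3) • rDeriv (T i j) f g)

/-- `f` is `K`-finite: its translates `L(y) f`, where `L(y) f (g) = f (y⁻¹ g)`, span a
finite-dimensional space. -/
def KFinite (f : G → V) : Prop :=
  FiniteDimensional ℂ
    (Submodule.span ℂ (Set.range fun (y : K) (g : G) => f ((embK y)⁻¹ * g)))

/-- `Ker D(B, σ⁰_{-λ(2,-a)})_K`. -/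
def kerDK (a : ℂ) : Set (G → V) :=
  {f | f ∈ Ind (-lam2 (-a)) ∧ D a f = 0 ∧ KFinite f}

/-! ### The representations `S^m ℂ²` and `𝒫_m[t]`, and the maps `Φ_m` -/

/-- `S^m ℂ²`: homogeneous polynomials of degree `m` in the basis `X 0, X 1` of `ℂ²`. -/
abbrev SymPow (m : ℕ) : Submodule ℂ (MvPolynomial (Fin 2) ℂ) :=
  MvPolynomial.homogeneousSubmodule (Fin 2) ℂ m

/-- The derivation of `S(ℂ²)` that extends the action of `Z ∈ 𝔰𝔲(2)` on `ℂ²`. -/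
def symDer (Z : ℍ[ℝ]) : MvPolynomial (Fin 2) ℂ →ₗ[ℂ] MvPolynomial (Fin 2) ℂ :=
  (MvPolynomial.mkDerivation ℂ fun j : Fin 2 =>
    ∑ i, MvPolynomial.C (quatMat Z i j) * MvPolynomial.X i).toLinearMap

lemma symDer_mem (Z : ℍ[ℝ]) (m : ℕ) (v : MvPolynomial (Fin 2) ℂ) (hv : v ∈ SymPow m) :
    symDer Z v ∈ SymPow m := by
  have hv' : v.IsHomogeneous m := hv
  have key : symDer Z v = ∑ s ∈ v.support, symDer Z (MvPolynomial.monomial s (v.coeff s)) := by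
    conv_lhs => rw [v.as_sum]
    rw [map_sum]
  rw [key]
  refine Submodule.sum_mem _ fun s hs => ?_
  have hd : s.degree = m := by
    have := hv' (MvPolynomial.mem_support_iff.1 hs)
    rw [Finsupp.degree_eq_weight_one]
    exact this
  change (MvPolynomial.mkDerivation ℂ _ (MvPolynomial.monomial s (v.coeff s))) ∈ _
  rw [MvPolynomial.mkDerivation_monomial, Finsupp.smul_sum]
  refine Submodule.sum_mem _ fun j hj => ?_
  refine Submodule.smul_mem _ _ ?_
  have hj0 : s j ≠ 0 := Finsupp.mem_support_iff.1 hj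
  have hle : Finsupp.single j 1 ≤ s := Finsupp.single_le_iff.2 (Nat.one_le_iff_ne_zero.2 hj0)
  have h1 : (s - Finsupp.single j 1).degree + 1 = m := by
    have h := congrArg Finsupp.degree (tsub_add_cancel_of_le hle)
    rw [map_add, Finsupp.degree_single, hd] at h
    exact h
  rw [← h1]
  refine (MvPolynomial.isHomogeneous_monomial _ rfl).mul ?_
  refine MvPolynomial.IsHomogeneous.sum _ _ _ fun i _ => ?_
  simpa using (MvPolynomial.isHomogeneous_C (Fin 2) (quatMat Z i j)).mul
    (MvPolynomial.isHomogeneous_X ℂ i)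

/-- The action of `Z ∈ 𝔨₀ = 𝔰𝔲(2)` on `S^m ℂ²`. -/
def symAct (m : ℕ) (Z : ℍ[ℝ]) : SymPow m →ₗ[ℂ] SymPow m :=
  (symDer Z).restrict (symDer_mem Z m)

/-- The action of `y ∈ SU(2)` on polynomials of degree `≤ m`. With `y⁻¹ = !![α, -β̄; β, ᾱ]` it is
`q(t) ↦ (β t + ᾱ)^m q((α t - β̄) / (β t + ᾱ))`. -/
def polyAct (m : ℕ) (y : K) (q : Polynomial ℂ) : Polynomial ℂ :=
  let g := quatMat ((y⁻¹ : K) : ℍ[ℝ])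
  ∑ j ∈ Finset.range (m + 1), Polynomial.C (q.coeff j) *
    (Polynomial.C (g 0 0) * Polynomial.X + Polynomial.C (g 0 1)) ^ j *
    (Polynomial.C (g 1 0) * Polynomial.X + Polynomial.C (g 1 1)) ^ (m - j)

/-- The invariant pairing of `S^m ℂ²` and `𝒫_m[t]`:
`⟨e₀^i e₁^(m-i), t^j⟩ = i! (m-i)! / m!` if `i = j`, and `0` otherwise. -/
def pairing (m : ℕ) (q : Polynomial ℂ) : SymPow m →ₗ[ℂ] ℂ :=
  ∑ i ∈ Finset.range (m + 1),
    (((i.factorial * (m - i).factorial : ℕ) : ℂ) / (m.factorial : ℂ) * q.coeff i) •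
      (MvPolynomial.lcoeff ℂ (Finsupp.single 0 i + Finsupp.single 1 (m - i))).comp
        (SymPow m).subtype

/-- `v ↦ Φ_m(v ⊗ (q 0, q 1))`, a map from `S^m ℂ²` to functions on `K`: its value at `y ∈ K` is
`(⟨v, y (q 0)⟩, ⟨v, y (q 1)⟩)`. -/
def PhiK (m : ℕ) (q : Fin 2 → Polynomial ℂ) : SymPow m →ₗ[ℂ] (K → V) :=
  LinearMap.pi fun y => LinearMap.pi fun c => pairing m (polyAct m y (q c))

/-- The inverse of the restriction map from `C^∞(G, σ⁰_ν)^B` to functions on `K`: the function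
`F` on `K` extends to `G = KAN` by `f(y b) = (exp ν)(b)⁻¹ F(y)` for `y ∈ K` and `b ∈ AN`. -/
def extend (ν : Fin 3 → ℂ) : (K → V) →ₗ[ℂ] (G → V) where
  toFun F g := (aChar ν (anPart g))⁻¹ • F (kPart g)
  map_add' F F' := by ext g c; simp [mul_add]
  map_smul' r F := by ext g c; simp [mul_left_comm]

/-- `v ↦ Φ_m(v ⊗ (q 0, q 1))`, with values in functions on `G`. -/
def Phi (ν : Fin 3 → ℂ) (m : ℕ) (q : Fin 2 → Polynomial ℂ) : SymPow m →ₗ[ℂ] (G → V) :=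
  (extend ν).comp (PhiK m q)

/-! ### The hypergeometric polynomials -/

/-- `m(a, k) = 2|a| + 1 + 4k`. -/
def mInd (a : ℤ) (k : ℕ) : ℕ := 2 * a.natAbs + 1 + 4 * k

/-- The Pochhammer symbol `(x)_l = x (x + 1) ⋯ (x + l - 1)`. -/
def poch (x : ℂ) (l : ℕ) : ℂ := ∏ i ∈ Finset.range l, (x + i)

/-- The coefficient of `z ^ l` in
`₂F₁(-|a| - 1/2 - 2k, a/2 - |a|/2 - k; -a/2 - |a|/2 + 1/2 - k; z)`. -/
def hypCoeff (a : ℤ) (k l : ℕ) : ℂ :=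
  let A : ℂ := ((|a| : ℤ) : ℂ)
  poch (-A - 1 / 2 - 2 * k) l * poch (a / 2 - A / 2 - k) l /
    (l.factorial * poch (-a / 2 - A / 2 + 1 / 2 - k) l)

/-- The index `(|a| - a)/2 + k` of the last nonzero term of the series. -/
def hypDeg (a : ℤ) (k : ℕ) : ℕ := ((|a| - a) / 2).toNat + k

/-- The polynomial `q(a, k; t²)` in `t`. -/
def qPoly (a : ℤ) (k : ℕ) : Polynomial ℂ :=
  ∑ l ∈ Finset.range (hypDeg a k + 1), Polynomial.C (hypCoeff a k l) * Polynomial.X ^ (2 * l)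

/-- The polynomial `t^{m(a,k)} q(a, k; t⁻²)` in `t`. -/
def qRev (a : ℤ) (k : ℕ) : Polynomial ℂ :=
  ∑ l ∈ Finset.range (hypDeg a k + 1),
    Polynomial.C (hypCoeff a k l) * Polynomial.X ^ (mInd a k - 2 * l)

/-- The pair of polynomials that spans the kernel of `D` in `(𝒫_m[t] ⊗ σ⁰)^M`, `m = m(a, k)`. -/
def qPair (a : ℤ) (k : ℕ) : Fin 2 → Polynomial ℂ :=
  if Even a then ![qRev a k, qPoly a k] else ![qPoly a k, -qRev a k]

/-! ### The `𝔨`-module structure -/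

/-- The imaginary quaternion with coordinates `z`; these form the Lie algebra `𝔨₀ = 𝔰𝔲(2)`. -/
def imQuat (z : Fin 3 → ℝ) : ℍ[ℝ] := ⟨0, z 0, z 1, z 2⟩

/-- The exponential map `𝔨₀ → K`. -/
def expK (z : Fin 3 → ℝ) : K :=
  ⟨NormedSpace.exp (imQuat z), by
    have h : Quaternion.normSq (NormedSpace.exp (imQuat z)) = 1 := by
      rw [Quaternion.normSq_exp]; simp [imQuat]
    rw [Unitary.mem_iff, Quaternion.self_mul_star, Quaternion.star_mul_self, h]
    simp⟩

/-- `e` intertwines the action of `𝔨` on `⨁ S^{m k} ℂ²` with the differential `dL` of the left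
translation on functions on `G`: `e (Z x) (g) = d/dt e(x) (exp(-tZ) g)` at `t = 0`, for `Z ∈ 𝔨₀`.
(By complex linearity, this extends to the complexification `𝔨` of `𝔨₀`.) -/
def IsKIntertwining (m : ℕ → ℕ) (e : (⨁ k, SymPow (m k)) →ₗ[ℂ] (G → V)) : Prop :=
  ∀ (z : Fin 3 → ℝ) (x : ⨁ k, SymPow (m k)) (g : G),
    HasDerivAt (fun t : ℝ => e x ((embK (expK (t • z)))⁻¹ * g))
      (e (DirectSum.lmap (fun k => symAct (m k) (imQuat z)) x) g) 0

end SL3Kernel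

end

open scoped ContDiff Quaternion DirectSum

noncomputable section

namespace SL3Kernel

/-! The kernel is found by reducing `D` to one operator on `SU(2)` and then solving a two-term
recursion.

Reduction to `K`. A function in the induced representation has zero derivative along `N` and is
multiplied by a scalar by derivatives along `A`. Expanding `D` with these rules leaves equal scalar
multiples of the function on the diagonal, which cancel because the parameter matrix is traceless
(`Ind.Dcoeff_diag`), and kills all other entries except the one at `(2, 0)` (`Ind.Dcoeff_eq_zero`).
Modulo upper triangular matrices the surviving entry is the element `XZ - (a - 1/2) Y` of the
enveloping algebra of `𝔨`, where `X, Y, Z` are the halves of `𝐢, 𝐣, 𝐤` (`Ind.Dcoeff_two_zero`).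
Covariance under `B` shows that its vanishing need only be tested on `K` (`Ind.D_eq_zero_iff_embK`).

From functions to polynomials. A `K`-finite element of the kernel generates a finite-dimensional
space on which `𝔰𝔩(2,ℂ)` acts through left translation. Such a space is spanned by the vectors `F^j
u` with `u` of highest weight (`Sl2.span_eq_top`), and every such `u` of weight `m` defines an
intertwining map on `S^m ℂ²` (`Sl2.hwMap_symAct`). Evaluation at `1` identifies this map with `Φ_m`
for a pair of polynomials (`exists_eq_Phi`), a form of Frobenius reciprocity. The pair is
`M`-invariant, and both components are killed by `recOp`.

The recursion. On coefficients, `𝐢` multiplies that of `t^n` by `I^m (-1)^n`, while `𝐤` reverses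
their order up to `I^m`. Hence a nonzero invariant pair has `m = 2M + 1` odd; one component `p` is
even and the other is its reversal up to sign. For `p` the equation reads `(2j+2)(M+a-2j-1) p_{2j+2}
+ (2M+1-2j)(M-a-2j) p_{2j} = 0`. At the top degree `2j` it forces `a = M - 2j`, so `a` is an
integer, `|a| ≤ M`, and `M - |a|` is even, that is, `m = m(a,k)` (`exists_int_of_recOp`). Then `M +
a - 2j - 1` is odd for every index `j`, so the recursion has a unique solution up to scalars, the
hypergeometric polynomial (`eq_smul_qPoly`). Conversely these polynomials give elements of the
kernel (`Phi_mem_kerDK`).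

Directness. The kernel of the sum of all `Φ_{m(a,k)}` is stable under `𝔨`. The Casimir operator has
distinct eigenvalues `m(m+2)` on the summands, so this kernel contains the components of each of its
elements; on a single summand `Φ` is injective, because `S^m ℂ²` is irreducible
(`PhiSum_injective`).

Foundations. Since `G` is given by matrices together with homeomorphisms of `SU(2)`, its exponential
map has to be built: matrices near `1` are lifted by choosing the quaternion near `1`, and the rest
is obtained by taking powers (`expG_eq`). Also needed are smoothness of the Iwasawa projection
(`contDiff_kPart`) and the fact that the action on `SU(2)` commutes with right multiplication by `M`
(`act_mul_kPart`). -/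

abbrev SL3 : Type := Matrix.SpecialLinearGroup (Fin 3) ℝ
abbrev Mat3 : Type := Matrix (Fin 3) (Fin 3) ℝ

/-! ### Unit quaternions -/

lemma coords_sq (y : K) : (y : ℍ[ℝ]).re ^ 2 + (y : ℍ[ℝ]).imI ^ 2 + (y : ℍ[ℝ]).imJ ^ 2
    + (y : ℍ[ℝ]).imK ^ 2 = 1 := by
  rw [← Quaternion.normSq_def', normSq_coe]

lemma K_ext {y z : K} (h0 : (y : ℍ[ℝ]).re = (z : ℍ[ℝ]).re) (h1 : (y : ℍ[ℝ]).imI = (z : ℍ[ℝ]).imI)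
    (h2 : (y : ℍ[ℝ]).imJ = (z : ℍ[ℝ]).imJ) (h3 : (y : ℍ[ℝ]).imK = (z : ℍ[ℝ]).imK) : y = z :=
  Subtype.ext (QuaternionAlgebra.ext h0 h1 h2 h3)

@[simp] lemma K_neg_re (y : K) : ((-y : K) : ℍ[ℝ]).re = -(y : ℍ[ℝ]).re := rfl
@[simp] lemma K_neg_imI (y : K) : ((-y : K) : ℍ[ℝ]).imI = -(y : ℍ[ℝ]).imI := rfl
@[simp] lemma K_neg_imJ (y : K) : ((-y : K) : ℍ[ℝ]).imJ = -(y : ℍ[ℝ]).imJ := rfl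
@[simp] lemma K_neg_imK (y : K) : ((-y : K) : ℍ[ℝ]).imK = -(y : ℍ[ℝ]).imK := rfl
@[simp] lemma imQuat_re (z : Fin 3 → ℝ) : (imQuat z).re = 0 := rfl
@[simp] lemma imQuat_imI (z : Fin 3 → ℝ) : (imQuat z).imI = z 0 := rfl
@[simp] lemma imQuat_imJ (z : Fin 3 → ℝ) : (imQuat z).imJ = z 1 := rfl
@[simp] lemma imQuat_imK (z : Fin 3 → ℝ) : (imQuat z).imK = z 2 := rfl

/-- The unit quaternion with given coordinates. -/
def mkK (q : ℍ[ℝ]) (h : Quaternion.normSq q = 1) : K :=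
  ⟨q, by rw [Unitary.mem_iff, Quaternion.self_mul_star, Quaternion.star_mul_self, h]; simp⟩

@[simp] lemma coe_mkK (q : ℍ[ℝ]) (h) : (mkK q h : ℍ[ℝ]) = q := rfl

lemma rot_coe (y : K) : (rot y).1 = rotMat (y : ℍ[ℝ]) := rfl

lemma rot_neg (y : K) : rot (-y) = rot y := by
  apply Subtype.ext
  rw [rot_coe, rot_coe, rotMat_eq, rotMat_eq]
  simp

lemma rotMat_transpose (q : ℍ[ℝ]) : (rotMat q).transpose = rotMat (star q) := by
  rw [rotMat_eq, rotMat_eq]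
  ext i j
  fin_cases i <;> fin_cases j <;> simp <;> ring

lemma rot_inv_coe (y : K) : ((rot y)⁻¹).1 = (rotMat (y : ℍ[ℝ])).transpose := by
  rw [← map_inv, rot_coe, rotMat_transpose]; rfl

lemma rotMat_transpose_mul_self (y : K) :
    (rotMat (y : ℍ[ℝ])).transpose * rotMat (y : ℍ[ℝ]) = 1 := by
  rw [← rot_inv_coe, ← rot_coe, ← Matrix.SpecialLinearGroup.coe_mul, inv_mul_cancel]; rfl

lemma rotMat_mul_transpose_self (y : K) :
    rotMat (y : ℍ[ℝ]) * (rotMat (y : ℍ[ℝ])).transpose = 1 := by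
  rw [← rot_inv_coe, ← rot_coe, ← Matrix.SpecialLinearGroup.coe_mul, mul_inv_cancel]; rfl

/-- An orthogonal triangular matrix with positive diagonal is the identity, over which only `±1`
lie. In coordinates, each imaginary part times a sum of two squares is a combination of subdiagonal
entries; were that part nonzero, the two squares would vanish and some diagonal entry could not be
positive. -/
lemma eq_or_neg_of_rot_mem_AN {y : K} (h : rot y ∈ AN) : y = 1 ∨ y = -1 := by
  obtain ⟨h1, h2⟩ := h
  have e10 := h1 1 0 (by decide)
  have e20 := h1 2 0 (by decide)
  have e21 := h1 2 1 (by decide)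
  have d0 := h2 0
  have d1 := h2 1
  have hn := coords_sq y
  rw [rot_coe, rotMat_eq] at e10 e20 e21 d0 d1
  simp at e10 e20 e21 d0 d1
  have key : ∀ w : K, (w : ℍ[ℝ]).imI = 0 → (w : ℍ[ℝ]).imJ = 0 → (w : ℍ[ℝ]).imK = 0 →
      w = 1 ∨ w = -1 := by
    intro w h1 h2 h3
    have hw := coords_sq w
    rw [h1, h2, h3] at hw
    have : ((w : ℍ[ℝ]).re - 1) * ((w : ℍ[ℝ]).re + 1) = 0 := by linarith
    rcases mul_eq_zero.1 this with h | h
    · exact Or.inl (K_ext (sub_eq_zero.1 h) h1 h2 h3)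
    · exact Or.inr (K_ext (eq_neg_of_add_eq_zero_left h) (by simpa using h1) (by simpa using h2)
        (by simpa using h3))
  apply key y
  all_goals
    generalize (y : ℍ[ℝ]).re = a at *
    generalize (y : ℍ[ℝ]).imI = b at *
    generalize (y : ℍ[ℝ]).imJ = c at *
    generalize (y : ℍ[ℝ]).imK = d at *
    by_contra hne
  · have : b * (a ^ 2 + d ^ 2) = 0 := by linear_combination a * e21 + d * e20
    have h3 := (mul_eq_zero.1 this).resolve_left hne
    have ha : a = 0 := by nlinarith
    have hd : d = 0 := by nlinarith
    subst ha hd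
    nlinarith
  · have : c * (a ^ 2 + b ^ 2) = 0 := by linear_combination b * e10 - a * e20
    have h3 := (mul_eq_zero.1 this).resolve_left hne
    have ha : a = 0 := by nlinarith
    have hb : b = 0 := by nlinarith
    subst ha hb
    nlinarith
  · have : d * (a ^ 2 + b ^ 2) = 0 := by linear_combination a * e10 + b * e20
    have h3 := (mul_eq_zero.1 this).resolve_left hne
    have ha : a = 0 := by nlinarith
    have hb : b = 0 := by nlinarith
    subst ha hb
    nlinarith

/-- Uniqueness of the Iwasawa decomposition, on the double cover: the `K`-component is determined up
to sign. -/
lemma eq_or_neg_of_rot_eq {y z : K} (h : (rot y)⁻¹ * rot z ∈ AN) : z = y ∨ z = -y := by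
  rw [← map_inv, ← map_mul] at h
  rcases eq_or_neg_of_rot_mem_AN h with h | h
  · left; rw [inv_mul_eq_one] at h; exact h.symm
  · right; rw [inv_mul_eq_iff_eq_mul] at h; simpa using h

lemma continuous_re_K : Continuous fun y : K => (y : ℍ[ℝ]).re :=
  Quaternion.continuous_re.comp continuous_subtype_val

/-- Compactness gives one neighbourhood of `0` that serves for all points of `K` in
`exists_near_radius`. -/
instance : CompactSpace K := by
  apply isCompact_iff_compactSpace.1
  apply Metric.isCompact_of_isClosed_isBounded
  · have : ((unitary ℍ[ℝ] : Submonoid ℍ[ℝ]) : Set ℍ[ℝ]) = {q | Quaternion.normSq q = 1} := by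
      ext q
      exact ⟨fun h => normSq_coe ⟨q, h⟩, fun h => (mkK q h).2⟩
    rw [this]
    exact isClosed_eq Quaternion.continuous_normSq continuous_const
  · refine (Metric.isBounded_closedBall (x := (0 : ℍ[ℝ])) (r := 1)).subset fun q hq => ?_
    have h := normSq_coe ⟨q, hq⟩
    rw [Quaternion.normSq_eq_norm_mul_self] at h
    rw [mem_closedBall_zero_iff]
    simp only at h
    nlinarith [norm_nonneg q]

/-- Every point is joined to `1` by a one-parameter subgroup. This serves for the connectedness
argument in `sign_const` and for uniqueness of solutions of ODEs in `eq_zero_of_intertwining`. -/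
lemma exists_expK (y : K) : ∃ z : Fin 3 → ℝ, expK z = y := by
  set a := (y : ℍ[ℝ]).re
  have hn := coords_sq y
  by_cases him : (y : ℍ[ℝ]).im = 0
  · have h1 : (y : ℍ[ℝ]).imI = 0 := congrArg (·.imI) him
    have h2 : (y : ℍ[ℝ]).imJ = 0 := congrArg (·.imJ) him
    have h3 : (y : ℍ[ℝ]).imK = 0 := congrArg (·.imK) him
    rw [h1, h2, h3] at hn
    have : ((y : ℍ[ℝ]).re - 1) * ((y : ℍ[ℝ]).re + 1) = 0 := by linarith
    rcases mul_eq_zero.1 this with h | h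
    · refine ⟨0, Subtype.ext ?_⟩
      have : imQuat 0 = 0 := rfl
      change NormedSpace.exp (imQuat 0) = _
      rw [this, NormedSpace.exp_zero]
      apply QuaternionAlgebra.ext <;> simp [h1, h2, h3]; linarith
    -- Here `y = -1`, which is the exponential of any imaginary quaternion of length `π`.
    · refine ⟨![Real.pi, 0, 0], Subtype.ext ?_⟩
      change NormedSpace.exp (imQuat ![Real.pi, 0, 0]) = _
      have hnm : ‖imQuat ![Real.pi, 0, 0]‖ = Real.pi := by
        have := Quaternion.normSq_eq_norm_mul_self (imQuat ![Real.pi, 0, 0])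
        rw [Quaternion.normSq_def'] at this
        simp only [imQuat_re, imQuat_imI, imQuat_imJ, imQuat_imK, Matrix.cons_val] at this
        refine (sq_eq_sq₀ (norm_nonneg _) Real.pi_pos.le).1 ?_
        linarith
      rw [Quaternion.exp_of_re_eq_zero _ rfl, hnm]
      apply QuaternionAlgebra.ext <;> simp [h1, h2, h3]; linarith
  · set r := ‖(y : ℍ[ℝ]).im‖ with hr
    have hr0 : 0 < r := norm_pos_iff.2 him
    have hr2 : r ^ 2 = 1 - a ^ 2 := by
      have := Quaternion.normSq_eq_norm_mul_self (y : ℍ[ℝ]).im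
      rw [Quaternion.normSq_def'] at this
      simp at this
      rw [← hr] at this
      simp only [a]
      nlinarith
    have hu : -1 ≤ a ∧ a ≤ 1 := by constructor <;> nlinarith
    set θ := Real.arccos a
    have hθ : 0 < θ := by
      apply Real.arccos_pos.2
      nlinarith
    have hc : Real.cos θ = a := Real.cos_arccos hu.1 hu.2
    have hs : Real.sin θ = r := by
      rw [Real.sin_arccos, ← hr2, Real.sqrt_sq hr0.le]
    refine ⟨fun i => θ / r * ![(y : ℍ[ℝ]).imI, (y : ℍ[ℝ]).imJ, (y : ℍ[ℝ]).imK] i, Subtype.ext ?_⟩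
    change NormedSpace.exp (imQuat _) = _
    have him' : imQuat (fun i => θ / r * ![(y : ℍ[ℝ]).imI, (y : ℍ[ℝ]).imJ, (y : ℍ[ℝ]).imK] i)
        = (θ / r) • (y : ℍ[ℝ]).im := by
      apply QuaternionAlgebra.ext <;> simp
    rw [him', Quaternion.exp_of_re_eq_zero _ (by simp), norm_smul, ← hr, Real.norm_of_nonneg
      (by positivity), div_mul_cancel₀ _ hr0.ne', hc, hs, smul_smul]
    have : r / θ * (θ / r) = 1 := by field_simp
    rw [this, one_smul]
    exact Quaternion.re_add_im _

lemma expK_zero : expK 0 = 1 := by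
  apply Subtype.ext
  change NormedSpace.exp (imQuat 0) = 1
  have : imQuat 0 = 0 := rfl
  rw [this, NormedSpace.exp_zero]

lemma imQuat_smul (t : ℝ) (z : Fin 3 → ℝ) : imQuat (t • z) = t • imQuat z := by
  apply QuaternionAlgebra.ext <;> simp

lemma expK_add (s t : ℝ) (z : Fin 3 → ℝ) : expK ((s + t) • z) = expK (s • z) * expK (t • z) := by
  apply Subtype.ext
  change NormedSpace.exp (imQuat _) = NormedSpace.exp (imQuat _) * NormedSpace.exp (imQuat _)
  let _ : NormedAlgebra ℚ ℍ[ℝ] := .restrictScalars ℚ ℝ ℍ[ℝ]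
  rw [imQuat_smul, imQuat_smul, imQuat_smul, add_smul, NormedSpace.exp_add_of_commute]
  exact (Commute.refl _).smul_left _ |>.smul_right _

lemma expK_neg (z : Fin 3 → ℝ) : expK (-z) = (expK z)⁻¹ := by
  have h := expK_add (-1) 1 z
  simp only [neg_add_cancel, zero_smul, one_smul, neg_smul, expK_zero] at h
  exact eq_inv_of_mul_eq_one_left h.symm

lemma hasDerivAt_expK (z : Fin 3 → ℝ) :
    HasDerivAt (fun t : ℝ => ((expK (t • z) : K) : ℍ[ℝ])) (imQuat z) 0 := by
  have h := hasDerivAt_exp_smul_const (𝕂 := ℝ) (imQuat z) (0 : ℝ)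
  simp only [zero_smul, NormedSpace.exp_zero, one_mul] at h
  refine h.congr_of_eventuallyEq (Filter.Eventually.of_forall fun t => ?_)
  change NormedSpace.exp (imQuat _) = _
  rw [imQuat_smul]

lemma continuous_expK (z : Fin 3 → ℝ) : Continuous fun t : ℝ => expK (t • z) := by
  let _ : NormedAlgebra ℚ ℍ[ℝ] := .restrictScalars ℚ ℝ ℍ[ℝ]
  refine Continuous.subtype_mk ?_ _
  refine NormedSpace.exp_continuous.comp ?_
  simp_rw [imQuat_smul]
  fun_prop

/-- A continuous choice of sign on `K` is constant. -/
lemma sign_const {φ ψ : K → K} (hφ : Continuous φ) (hψ : Continuous ψ)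
    (h : ∀ y, φ y = ψ y ∨ φ y = -ψ y) (h1 : φ 1 = ψ 1) (y : K) : φ y = ψ y := by
  obtain ⟨z, rfl⟩ := exists_expK y
  -- The quotient of the two maps is `±1`, so its real part is a continuous function on the path
  -- with values `±1`; the intermediate value theorem makes it constant.
  let r : ℝ → ℝ := fun t => (((ψ (expK (t • z)))⁻¹ * φ (expK (t • z)) : K) : ℍ[ℝ]).re
  have hr : Continuous r := by
    have := continuous_expK z
    refine continuous_re_K.comp ?_
    fun_prop
  have hval : ∀ t, r t = 1 ∨ r t = -1 := by
    intro t
    rcases h (expK (t • z)) with h | h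
    · left; simp only [r, h, inv_mul_cancel]; rfl
    · right; simp only [r, h]
      have : (ψ (expK (t • z)))⁻¹ * -ψ (expK (t • z)) = -1 := by simp
      rw [this]; rfl
  have hr0 : r 0 = 1 := by simp only [r, zero_smul, expK_zero, h1, inv_mul_cancel]; rfl
  have hr1 : 0 < r 1 := by
    by_contra hneg
    have hmem : (0 : ℝ) ∈ Set.Icc (r 1) (r 0) := ⟨by linarith, by linarith⟩
    obtain ⟨t, -, ht⟩ := intermediate_value_Icc' zero_le_one hr.continuousOn hmem
    rcases hval t with h | h <;> linarith
  rcases h (expK z) with h | h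
  · exact h
  · exfalso
    have h3 : r 1 = -1 := by
      simp only [r, one_smul, h]
      have : (ψ (expK z))⁻¹ * -ψ (expK z) = -1 := by simp
      rw [this]; rfl
    linarith

end SL3Kernel

/-! ### Lifting matrices near the identity to homeomorphisms of `SU(2)` -/

namespace SL3Kernel

/-! ### A local section of the covering `SU(2) → SO(3)` -/

/-- Four times the square of the real part of a unit quaternion over `R`. -/
def secTr (R : Mat3) : ℝ := 1 + R 0 0 + R 1 1 + R 2 2

/-- The quaternion with positive real part over the rotation `R`, if `tr R > -1`. -/
def sec (R : Mat3) : ℍ[ℝ] :=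
  ⟨√(secTr R) / 2, (R 2 1 - R 1 2) / (2 * √(secTr R)), (R 0 2 - R 2 0) / (2 * √(secTr R)),
    (R 1 0 - R 0 1) / (2 * √(secTr R))⟩

lemma secTr_rotMat (y : K) : secTr (rotMat (y : ℍ[ℝ])) = 4 * (y : ℍ[ℝ]).re ^ 2 := by
  have h := coords_sq y
  rw [rotMat_eq]
  simp [secTr]
  linear_combination -h

lemma sec_rotMat (y : K) (hy : 0 < (y : ℍ[ℝ]).re) : sec (rotMat (y : ℍ[ℝ])) = y := by
  have h1 : √(secTr (rotMat (y : ℍ[ℝ]))) = 2 * (y : ℍ[ℝ]).re := by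
    rw [secTr_rotMat, show 4 * (y : ℍ[ℝ]).re ^ 2 = (2 * (y : ℍ[ℝ]).re) ^ 2 by ring,
      Real.sqrt_sq (by positivity)]
  rw [sec, h1, rotMat_eq]
  apply QuaternionAlgebra.ext
  · simp
  all_goals
    simp
    field_simp
    ring

structure IsRot (R : Mat3) : Prop where
  tmul : R.transpose * R = 1
  det : R.det = 1

/-- The entries of a rotation equal its cofactors. These quadratic relations complement
orthogonality in the verifications of `sec_spec` and `gs_of_isRot`. -/
lemma IsRot.adj {R : Mat3} (h : IsRot R) : R.adjugate = R.transpose := by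
  have h1 := Matrix.adjugate_mul R
  calc R.adjugate = R.adjugate * (R * R.transpose) := by rw [mul_eq_one_comm.1 h.tmul, mul_one]
    _ = R.transpose := by rw [← mul_assoc, h1, h.det, one_smul, one_mul]

lemma isRot_rotMat (y : K) : IsRot (rotMat (y : ℍ[ℝ])) :=
  ⟨rotMat_transpose_mul_self y, det_rotMat y⟩

lemma IsRot.mul {R S : Mat3} (hR : IsRot R) (hS : IsRot S) : IsRot (R * S) := by
  refine ⟨?_, by rw [Matrix.det_mul, hR.det, hS.det, one_mul]⟩
  rw [Matrix.transpose_mul, mul_assoc, ← mul_assoc R.transpose, hR.tmul, one_mul, hS.tmul]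

lemma IsRot.transpose {R : Mat3} (hR : IsRot R) : IsRot R.transpose :=
  ⟨by rw [Matrix.transpose_transpose]; exact mul_eq_one_comm.1 hR.tmul,
    by rw [Matrix.det_transpose, hR.det]⟩

lemma sec_spec {R : Mat3} (h : IsRot R) (ht : 0 < secTr R) :
    Quaternion.normSq (sec R) = 1 ∧ rotMat (sec R) = R := by
  have hadj := h.adj
  have ho := h.tmul
  have ho' := mul_eq_one_comm.1 h.tmul
  have hs : 0 < √(secTr R) := Real.sqrt_pos.2 ht
  have hs2 : √(secTr R) ^ 2 = secTr R := Real.sq_sqrt ht.le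
  rw [Matrix.adjugate_fin_three] at hadj
  have A := fun i j => congrFun (congrFun hadj i) j
  have O := fun i j => congrFun (congrFun ho i) j
  have O' := fun i j => congrFun (congrFun ho' i) j
  simp only [Matrix.mul_apply, Matrix.transpose_apply, Fin.sum_univ_three] at O O'
  have a00 := A 0 0
  have a01 := A 0 1
  have a02 := A 0 2
  have a10 := A 1 0
  have a11 := A 1 1
  have a12 := A 1 2
  have a20 := A 2 0
  have a21 := A 2 1
  have a22 := A 2 2
  simp at a00 a01 a02 a10 a11 a12 a20 a21 a22
  have o01 := O 0 1
  have o02 := O 0 2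
  have o12 := O 1 2
  have o00 := O 0 0
  have o11 := O 1 1
  have o22 := O 2 2
  have p01 := O' 0 1
  have p02 := O' 0 2
  have p12 := O' 1 2
  have p00 := O' 0 0
  have p11 := O' 1 1
  have p22 := O' 2 2
  simp at o01 o02 o12 o00 o11 o22 p01 p02 p12 p00 p11 p22
  clear A O O' hadj ho ho'
  -- For a rotation the antisymmetric part has squared length `(3 - tr R)(1 + tr R)`, which is what
  -- makes `sec R` a unit quaternion.
  have hn : (R 2 1 - R 1 2) ^ 2 + (R 0 2 - R 2 0) ^ 2 + (R 1 0 - R 0 1) ^ 2 =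
      (4 - secTr R) * secTr R := by
    rw [secTr]
    linear_combination o00 + o11 + o22 + 2 * a00 + 2 * a11 + 2 * a22
  have hN : Quaternion.normSq (sec R) = 1 := by
    rw [Quaternion.normSq_def']
    simp only [sec]
    set s := √(secTr R)
    field_simp
    have e : s ^ 4 = (secTr R) ^ 2 := by rw [← hs2]; ring
    linear_combination hn + e - 4 * hs2
  refine ⟨hN, ?_⟩
  -- The quaternion is read off from the antisymmetric part; the following six identities recover
  -- the symmetric part of `R` from products of its coordinates.
  have q01 : (R 2 1 - R 1 2) * (R 0 2 - R 2 0) = (R 1 0 + R 0 1) * secTr R := by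
    rw [secTr]; linear_combination a01 + a10 - o01 - p01
  have q02 : (R 2 1 - R 1 2) * (R 1 0 - R 0 1) = (R 2 0 + R 0 2) * secTr R := by
    rw [secTr]; linear_combination a20 + a02 - o02 - p02
  have q12 : (R 0 2 - R 2 0) * (R 1 0 - R 0 1) = (R 2 1 + R 1 2) * secTr R := by
    rw [secTr]; linear_combination a12 + a21 - o12 - p12
  have q00 : (secTr R) ^ 2 + (R 2 1 - R 1 2) ^ 2 - (R 0 2 - R 2 0) ^ 2 - (R 1 0 - R 0 1) ^ 2
      = 4 * R 0 0 * secTr R := by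
    rw [secTr]; linear_combination o11 + o22 - o00 - 2 * p00 + 2 * a00 - 2 * a11 - 2 * a22
  have q11 : (secTr R) ^ 2 - (R 2 1 - R 1 2) ^ 2 + (R 0 2 - R 2 0) ^ 2 - (R 1 0 - R 0 1) ^ 2
      = 4 * R 1 1 * secTr R := by
    rw [secTr]; linear_combination o00 + o22 - o11 - 2 * p11 - 2 * a00 + 2 * a11 - 2 * a22
  have q22 : (secTr R) ^ 2 - (R 2 1 - R 1 2) ^ 2 - (R 0 2 - R 2 0) ^ 2 + (R 1 0 - R 0 1) ^ 2
      = 4 * R 2 2 * secTr R := by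
    rw [secTr]; linear_combination o00 + o11 - o22 - 2 * p22 - 2 * a00 - 2 * a11 + 2 * a22
  clear a00 a01 a02 a10 a11 a12 a20 a21 a22 o00 o01 o02 o11 o12 o22 p00 p01 p02 p11 p12 p22
  have e4 : √(secTr R) ^ 4 = (secTr R) ^ 2 := by
    linear_combination (√(secTr R) ^ 2 + secTr R) * hs2
  rw [rotMat_eq]
  simp only [sec]
  generalize √(secTr R) = s at *
  generalize secTr R = τ at *
  ext i j
  fin_cases i <;> fin_cases j <;> simp only [Matrix.of_apply, Matrix.cons_val', Matrix.cons_val, Fin.zero_eta, Fin.mk_one, Fin.reduceFinMk, Matrix.cons_val_zero, Matrix.cons_val_one]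
  all_goals
    field_simp
  · linear_combination e4 + q00 - 4 * R 0 0 * hs2
  · linear_combination q01 - (R 1 0 + R 0 1) * hs2
  · linear_combination q02 - (R 2 0 + R 0 2) * hs2
  · linear_combination q01 - (R 1 0 + R 0 1) * hs2
  · linear_combination e4 + q11 - 4 * R 1 1 * hs2
  · linear_combination q12 - (R 2 1 + R 1 2) * hs2
  · linear_combination q02 - (R 2 0 + R 0 2) * hs2
  · linear_combination q12 - (R 2 1 + R 1 2) * hs2
  · linear_combination e4 + q22 - 4 * R 2 2 * hs2

/-! ### The Gram–Schmidt process -/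

/-- The cross product of the first two columns. -/
def crossCol (A : Mat3) : Fin 3 → ℝ :=
  ![A 1 0 * A 2 1 - A 2 0 * A 1 1, A 2 0 * A 0 1 - A 0 0 * A 2 1, A 0 0 * A 1 1 - A 1 0 * A 0 1]

def gsN (A : Mat3) : ℝ := A 0 0 ^ 2 + A 1 0 ^ 2 + A 2 0 ^ 2

def gsM (A : Mat3) : ℝ := crossCol A 0 ^ 2 + crossCol A 1 ^ 2 + crossCol A 2 ^ 2

/-- The orthogonal factor of the Gram–Schmidt decomposition of a matrix of positive determinant. -/
def gs (A : Mat3) : Mat3 :=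
  let p := √(gsN A)
  let r := √(gsM A)
  let c := crossCol A
  !![A 0 0 / p, (c 1 * A 2 0 - c 2 * A 1 0) / (p * r), c 0 / r;
    A 1 0 / p, (c 2 * A 0 0 - c 0 * A 2 0) / (p * r), c 1 / r;
    A 2 0 / p, (c 0 * A 1 0 - c 1 * A 0 0) / (p * r), c 2 / r]

lemma det_eq_crossCol (A : Mat3) :
    A.det = crossCol A 0 * A 0 2 + crossCol A 1 * A 1 2 + crossCol A 2 * A 2 2 := by
  rw [Matrix.det_fin_three]
  simp [crossCol]
  ring

lemma gsM_pos {A : Mat3} (h : A.det = 1) : 0 < gsM A := by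
  rw [det_eq_crossCol] at h
  by_contra hn
  rw [gsM] at hn
  have h0 : crossCol A 0 = 0 := by nlinarith [sq_nonneg (crossCol A 0), sq_nonneg (crossCol A 1), sq_nonneg (crossCol A 2)]
  have h1 : crossCol A 1 = 0 := by nlinarith [sq_nonneg (crossCol A 0), sq_nonneg (crossCol A 1), sq_nonneg (crossCol A 2)]
  have h2 : crossCol A 2 = 0 := by nlinarith [sq_nonneg (crossCol A 0), sq_nonneg (crossCol A 1), sq_nonneg (crossCol A 2)]
  simp [h0, h1, h2] at h

lemma gsN_pos {A : Mat3} (h : A.det = 1) : 0 < gsN A := by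
  rw [Matrix.det_fin_three] at h
  by_contra hn
  rw [gsN] at hn
  have h0 : A 0 0 = 0 := by nlinarith [sq_nonneg (A 0 0), sq_nonneg (A 1 0), sq_nonneg (A 2 0)]
  have h1 : A 1 0 = 0 := by nlinarith [sq_nonneg (A 0 0), sq_nonneg (A 1 0), sq_nonneg (A 2 0)]
  have h2 : A 2 0 = 0 := by nlinarith [sq_nonneg (A 0 0), sq_nonneg (A 1 0), sq_nonneg (A 2 0)]
  simp [h0, h1, h2] at h

/-- The columns of `gs A` are the normalizations of the first column `u` of `A`, of `c × u` and of
`c`, where `c` is the cross product of the first two columns. As `c` is orthogonal to both of these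
and `c` times the third column is `det A = 1`, the product with `A` is triangular with positive
diagonal. -/
lemma gs_spec {A : Mat3} (h : A.det = 1) :
    IsRot (gs A) ∧ (∀ i j, j < i → ((gs A).transpose * A) i j = 0) ∧
      ∀ i, 0 < ((gs A).transpose * A) i i := by
  have hp : 0 < √(gsN A) := Real.sqrt_pos.2 (gsN_pos h)
  have hr : 0 < √(gsM A) := Real.sqrt_pos.2 (gsM_pos h)
  have hp2 : √(gsN A) ^ 2 = gsN A := Real.sq_sqrt (gsN_pos h).le
  have hr2 : √(gsM A) ^ 2 = gsM A := Real.sq_sqrt (gsM_pos h).le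
  have hd := h
  rw [det_eq_crossCol] at hd
  have o1 : crossCol A 0 * A 0 0 + crossCol A 1 * A 1 0 + crossCol A 2 * A 2 0 = 0 := by
    simp [crossCol]; ring
  have o2 : crossCol A 0 * A 0 1 + crossCol A 1 * A 1 1 + crossCol A 2 * A 2 1 = 0 := by
    simp [crossCol]; ring
  -- The scalar triple product: with `w` the second column, `(c × u) · w = c · (u × w) = c · c`.
  have o3 : (crossCol A 1 * A 2 0 - crossCol A 2 * A 1 0) * A 0 1 +
    (crossCol A 2 * A 0 0 - crossCol A 0 * A 2 0) * A 1 1 +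
    (crossCol A 0 * A 1 0 - crossCol A 1 * A 0 0) * A 2 1 = gsM A := by
    simp [crossCol, gsM]; ring
  have hp3 : √(gsN A) ^ 2 = A 0 0 ^ 2 + A 1 0 ^ 2 + A 2 0 ^ 2 := hp2
  have hr3 : √(gsM A) ^ 2 = crossCol A 0 ^ 2 + crossCol A 1 ^ 2 + crossCol A 2 ^ 2 := hr2
  clear hp2
  simp only [gs]
  generalize √(gsN A) = p at *
  generalize √(gsM A) = r at *
  generalize crossCol A = c at *
  have key : ∀ i j, (!![A 0 0 / p, (c 1 * A 2 0 - c 2 * A 1 0) / (p * r), c 0 / r;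
    A 1 0 / p, (c 2 * A 0 0 - c 0 * A 2 0) / (p * r), c 1 / r;
    A 2 0 / p, (c 0 * A 1 0 - c 1 * A 0 0) / (p * r), c 2 / r].transpose * A) i j =
    ![(A 0 0 * A 0 j + A 1 0 * A 1 j + A 2 0 * A 2 j) / p,
      ((c 1 * A 2 0 - c 2 * A 1 0) * A 0 j + (c 2 * A 0 0 - c 0 * A 2 0) * A 1 j +
        (c 0 * A 1 0 - c 1 * A 0 0) * A 2 j) / (p * r),
      (c 0 * A 0 j + c 1 * A 1 j + c 2 * A 2 j) / r] i := by
    intro i j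
    rw [Matrix.mul_apply, Fin.sum_univ_three]
    fin_cases i <;> simp <;> ring
  refine ⟨⟨?_, ?_⟩, ?_, ?_⟩
  · ext i j
    rw [Matrix.mul_apply, Fin.sum_univ_three]
    fin_cases i <;> fin_cases j <;> simp <;> field_simp
    · linear_combination -hp3
    · ring
    · linear_combination o1
    · ring
    · linear_combination (-(c 0 * A 0 0 + c 1 * A 1 0 + c 2 * A 2 0)) * o1 - r ^ 2 * hp3 -
      (A 0 0 ^ 2 + A 1 0 ^ 2 + A 2 0 ^ 2) * hr3
    · ring
    · linear_combination o1
    · ring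
    · linear_combination -hr3
  · rw [Matrix.det_fin_three]
    simp
    field_simp
    linear_combination (-(c 0 * A 0 0 + c 1 * A 1 0 + c 2 * A 2 0)) * o1 - r ^ 2 * hp3 -
      (A 0 0 ^ 2 + A 1 0 ^ 2 + A 2 0 ^ 2) * hr3
  · intro i j hij
    rw [key]
    fin_cases i <;> fin_cases j <;> simp at hij ⊢
    · left; ring
    · left; linear_combination o1
    · left; linear_combination o2
  · intro i
    rw [key]
    fin_cases i <;> simp
    · apply div_pos _ hp
      nlinarith [pow_pos hp 2]
    · rw [o3, ← hr2]
      positivity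
    · rw [hd]
      positivity

lemma IsRot.gs_mul_rot {A : Mat3} (h : A.det = 1) (y : K) :
    IsRot (gs A * (rotMat (y : ℍ[ℝ])).transpose) :=
  (gs_spec h).1.mul (isRot_rotMat y).transpose

/-! ### Lifts of elements near the identity -/

/-- The rotation by which `g` moves `y`. -/
def moveRot (g : Mat3) (y : K) : Mat3 :=
  gs (g * rotMat (y : ℍ[ℝ])) * (rotMat (y : ℍ[ℝ])).transpose

/-- The matrix `g` moves every point of `SO(3)` by a rotation of small angle. -/
def Near (g : SL3) : Prop := ∀ y : K, 13 / 4 < secTr (moveRot g.1 y)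

lemma det_mul_rot (g : SL3) (y : K) : (g.1 * rotMat (y : ℍ[ℝ])).det = 1 := by
  rw [Matrix.det_mul, g.2, det_rotMat, one_mul]

lemma isRot_moveRot (g : SL3) (y : K) : IsRot (moveRot g.1 y) :=
  IsRot.gs_mul_rot (det_mul_rot g y) y

lemma sec_moveRot {g : SL3} (hg : Near g) (y : K) :
    Quaternion.normSq (sec (moveRot g.1 y)) = 1 ∧ rotMat (sec (moveRot g.1 y)) = moveRot g.1 y :=
  sec_spec (isRot_moveRot g y) (lt_trans (by norm_num) (hg y))

/-- The unit quaternion close to `1` which moves `y` to its image under `g`. -/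
def mover (g : SL3) (hg : Near g) (y : K) : K := mkK (sec (moveRot g.1 y)) (sec_moveRot hg y).1

lemma rot_mover {g : SL3} (hg : Near g) (y : K) :
    (rot (mover g hg y)).1 = moveRot g.1 y := (sec_moveRot hg y).2

/-- For a unit quaternion `secTr` is `4 re²`, and `13/4 > (9/5)²`. The bound `9/10` is what
`mul_ne_neg` needs to rule out the wrong sign. -/
lemma mover_re {g : SL3} (hg : Near g) (y : K) : 9 / 10 < (mover g hg y : ℍ[ℝ]).re := by
  change 9 / 10 < √(secTr (moveRot g.1 y)) / 2
  have : (9 / 5 : ℝ) < √(secTr (moveRot g.1 y)) := by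
    apply Real.lt_sqrt_of_sq_lt
    have := hg y
    linarith
  linarith

lemma mover_spec {g : SL3} (hg : Near g) (y : K) :
    (rot (mover g hg y * y))⁻¹ * g * rot y ∈ AN := by
  have h := gs_spec (det_mul_rot g y)
  have e : ((rot (mover g hg y * y))⁻¹ * g * rot y).1 =
      (gs (g.1 * rotMat (y : ℍ[ℝ]))).transpose * (g.1 * rotMat (y : ℍ[ℝ])) := by
    rw [Matrix.SpecialLinearGroup.coe_mul, Matrix.SpecialLinearGroup.coe_mul, rot_inv_coe,
      ← rot_coe, map_mul, Matrix.SpecialLinearGroup.coe_mul, rot_mover, moveRot, rot_coe,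
      mul_assoc (gs _), rotMat_transpose_mul_self, mul_one, mul_assoc]
  refine ⟨fun i j hij => ?_, fun i => ?_⟩
  · rw [e]; exact h.2.1 i j hij
  · rw [e]; exact h.2.2 i
end SL3Kernel

/-! ### Continuity of the lifts and the exponential of matrices -/

namespace SL3Kernel

open scoped Matrix.Norms.Operator Topology
open Filter

/-! ### Regularity of the Gram–Schmidt process -/

lemma contDiffAt_gs {E : Type*} [NormedAddCommGroup E] [NormedSpace ℝ E] {n : WithTop ℕ∞}
    {A : E → Mat3} {x : E} (hA : ∀ i j, ContDiffAt ℝ n (fun e => A e i j) x)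
    (hdet : (A x).det = 1) (i j : Fin 3) : ContDiffAt ℝ n (fun e => gs (A e) i j) x := by
  have hN := gsN_pos hdet
  have hM := gsM_pos hdet
  have hc : ∀ k, ContDiffAt ℝ n (fun e => crossCol (A e) k) x := by
    intro k
    fin_cases k <;> exact ((hA _ _).mul (hA _ _)).sub ((hA _ _).mul (hA _ _))
  have hp : ContDiffAt ℝ n (fun e => √(gsN (A e))) x :=
    ((((hA _ _).pow 2).add ((hA _ _).pow 2)).add ((hA _ _).pow 2)).sqrt hN.ne'
  have hr : ContDiffAt ℝ n (fun e => √(gsM (A e))) x :=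
    ((((hc _).pow 2).add ((hc _).pow 2)).add ((hc _).pow 2)).sqrt hM.ne'
  have hp0 : √(gsN (A x)) ≠ 0 := (Real.sqrt_pos.2 hN).ne'
  have hr0 : √(gsM (A x)) ≠ 0 := (Real.sqrt_pos.2 hM).ne'
  fin_cases i <;> fin_cases j
  all_goals first
    | exact (hA _ _).div hp hp0
    | exact (hc _).div hr hr0
    | exact (((hc _).mul (hA _ _)).sub ((hc _).mul (hA _ _))).div (hp.mul hr) (mul_ne_zero hp0 hr0)

lemma continuousAt_gs {A : Mat3} (hdet : A.det = 1) : ContinuousAt gs A := by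
  refine continuousAt_pi.2 fun i => continuousAt_pi.2 fun j => ?_
  refine (contDiffAt_gs (n := 0) (A := fun e : Fin 3 → Fin 3 → ℝ => e) (x := A) (fun i j => ?_)
    hdet i j).continuousAt
  exact (contDiff_apply_apply ℝ ℝ i j).contDiffAt

lemma continuous_rotMat : Continuous rotMat := by
  have h : rotMat = fun y : ℍ[ℝ] => _ := funext rotMat_eq
  rw [h]
  have h0 := Quaternion.continuous_re
  have h1 := Quaternion.continuous_imI
  have h2 := Quaternion.continuous_imJ
  have h3 := Quaternion.continuous_imK
  refine continuous_matrix fun i j => ?_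
  fin_cases i <;> fin_cases j <;> simp <;> fun_prop

lemma gs_of_isRot {R : Mat3} (h : IsRot R) : gs R = R := by
  have hadj := h.adj
  rw [Matrix.adjugate_fin_three] at hadj
  have A := fun i j => congrFun (congrFun hadj i) j
  have O := fun i j => congrFun (congrFun h.tmul i) j
  simp only [Matrix.mul_apply, Matrix.transpose_apply, Fin.sum_univ_three] at O
  have a20 := A 2 0
  have a21 := A 2 1
  have a22 := A 2 2
  have a10 := A 1 0
  have a11 := A 1 1
  have a12 := A 1 2
  have o00 := O 0 0
  have o22 := O 2 2
  simp at a20 a21 a22 a10 a11 a12 o00 o22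
  have c0 : crossCol R 0 = R 0 2 := by simp [crossCol]; linear_combination a20
  have c1 : crossCol R 1 = R 1 2 := by simp [crossCol]; linear_combination a21
  have c2 : crossCol R 2 = R 2 2 := by simp [crossCol]; linear_combination a22
  have hN : gsN R = 1 := by rw [gsN]; linear_combination o00
  have hM : gsM R = 1 := by rw [gsM, c0, c1, c2]; linear_combination o22
  simp only [gs, hN, hM, c0, c1, c2]
  ext i j
  fin_cases i <;> fin_cases j <;> simp
  · linear_combination a10
  · linear_combination a11
  · linear_combination a12

lemma moveRot_one (y : K) : moveRot 1 y = 1 := by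
  rw [moveRot, one_mul, gs_of_isRot (isRot_rotMat y), rotMat_mul_transpose_self]

lemma near_one : Near 1 := fun y => by
  rw [Matrix.SpecialLinearGroup.coe_one, moveRot_one]
  norm_num [secTr]

lemma continuousAt_moveRot {A : Mat3} (hA : A.det = 1) (y : K) :
    ContinuousAt (fun p : Mat3 × K => moveRot p.1 p.2) (A, y) := by
  have hd : (A * rotMat (y : ℍ[ℝ])).det = 1 := by rw [Matrix.det_mul, hA, det_rotMat, one_mul]
  have hr : Continuous fun p : Mat3 × K => rotMat (p.2 : ℍ[ℝ]) :=
    continuous_rotMat.comp (continuous_subtype_val.comp continuous_snd)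
  have h1 : ContinuousAt (fun p : Mat3 × K => gs (p.1 * rotMat (p.2 : ℍ[ℝ]))) (A, y) :=
    ContinuousAt.comp' (f := fun p : Mat3 × K => p.1 * rotMat (p.2 : ℍ[ℝ])) (continuousAt_gs hd)
      (continuous_fst.mul hr).continuousAt
  exact h1.mul hr.matrix_transpose.continuousAt

def qI : ℍ[ℝ] := ⟨0, 1, 0, 0⟩
def qJ : ℍ[ℝ] := ⟨0, 0, 1, 0⟩
def qK : ℍ[ℝ] := ⟨0, 0, 0, 1⟩

lemma continuous_secTr : Continuous secTr := by
  unfold secTr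
  fun_prop

lemma continuousAt_sec {R : Mat3} (h : 0 < secTr R) : ContinuousAt sec R := by
  have hs := continuous_secTr.sqrt
  have h0 : √(secTr R) ≠ 0 := (Real.sqrt_pos.2 h).ne'
  have e : ∀ i j, Continuous fun R : Mat3 => R i j := fun i j => by fun_prop
  have key : sec = fun R : Mat3 => (√(secTr R) / 2) • (1 : ℍ[ℝ])
      + ((R 2 1 - R 1 2) / (2 * √(secTr R))) • qI
      + ((R 0 2 - R 2 0) / (2 * √(secTr R))) • qJ
      + ((R 1 0 - R 0 1) / (2 * √(secTr R))) • qK := by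
    funext R
    apply QuaternionAlgebra.ext
    · change _ = _ * (1 : ℝ) + _ * (0 : ℝ) + _ * (0 : ℝ) + _ * (0 : ℝ); simp [sec]
    · change _ = _ * (0 : ℝ) + _ * (1 : ℝ) + _ * (0 : ℝ) + _ * (0 : ℝ); simp [sec]
    · change _ = _ * (0 : ℝ) + _ * (0 : ℝ) + _ * (1 : ℝ) + _ * (0 : ℝ); simp [sec]
    · change _ = _ * (0 : ℝ) + _ * (0 : ℝ) + _ * (0 : ℝ) + _ * (1 : ℝ); simp [sec]
  have d : ∀ i j k l, ContinuousAt (fun R : Mat3 => (R i j - R k l) / (2 * √(secTr R))) R :=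
    fun i j k l => ((e i j).sub (e k l)).continuousAt.div
      (continuous_const.mul hs).continuousAt (by simpa using h0)
  rw [key]
  exact ((((hs.div_const 2).continuousAt.smul continuousAt_const).add
    ((d _ _ _ _).smul continuousAt_const)).add ((d _ _ _ _).smul continuousAt_const)).add
    ((d _ _ _ _).smul continuousAt_const)

/-! ### The exponential map of `SL(3,ℝ)` -/

lemma hasDerivAt_exp_apply (X : Mat3) (t : ℝ) (i j : Fin 3) :
    HasDerivAt (fun t : ℝ => NormedSpace.exp (t • X) i j) ((NormedSpace.exp (t • X) * X) i j) t := by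
  have h := hasDerivAt_exp_smul_const (𝕂 := ℝ) X t
  exact (LinearMap.toContinuousLinearMap
    (Matrix.entryLinearMap ℝ ℝ i j : Mat3 →ₗ[ℝ] ℝ)).hasFDerivAt.comp_hasDerivAt t h

lemma exp_add_smul (X : Mat3) (s t : ℝ) :
    NormedSpace.exp ((s + t) • X) = NormedSpace.exp (s • X) * NormedSpace.exp (t • X) := by
  rw [add_smul, Matrix.exp_add_of_commute]
  exact ((Commute.refl X).smul_left _).smul_right _

/-- The function `d` is multiplicative in `t` with `d'(0) = tr X = 0`, so its derivative vanishes
everywhere. -/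
lemma det_exp_smul {X : Mat3} (hX : X.trace = 0) (t : ℝ) : (NormedSpace.exp (t • X)).det = 1 := by
  let d : ℝ → ℝ := fun t => (NormedSpace.exp (t • X)).det
  have hd0 : HasDerivAt d 0 0 := by
    have e := fun i j => hasDerivAt_exp_apply X 0 i j
    simp only [zero_smul, NormedSpace.exp_zero, one_mul] at e
    have h : d = fun t => _ := funext fun t => Matrix.det_fin_three _
    rw [h]
    have := ((((((((e 0 0).mul (e 1 1)).mul (e 2 2)).sub (((e 0 0).mul (e 1 2)).mul (e 2 1))).sub
      (((e 0 1).mul (e 1 0)).mul (e 2 2))).add (((e 0 1).mul (e 1 2)).mul (e 2 0))).add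
      (((e 0 2).mul (e 1 0)).mul (e 2 1))).sub (((e 0 2).mul (e 1 1)).mul (e 2 0)))
    refine this.congr_deriv ?_
    rw [Matrix.trace_fin_three] at hX
    simp
    linarith
  have hd : ∀ t, HasDerivAt d 0 t := by
    intro t
    have h1 : HasDerivAt (fun s => d t * d (s - t)) (d t * 0) t := by
      refine HasDerivAt.const_mul _ ?_
      have := HasDerivAt.comp_sub_const t t (f := d) (f' := 0) (by simpa using hd0)
      exact this
    rw [mul_zero] at h1
    convert h1 using 1
    funext s
    simp only [d]
    rw [← Matrix.det_mul, ← exp_add_smul]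
    congr 3
    ring
  have := is_const_of_deriv_eq_zero (fun t => (hd t).differentiableAt) (fun t => (hd t).deriv) t 0
  change d t = 1
  rw [this]
  simp [d]

lemma det_exp {X : Mat3} (hX : X.trace = 0) : (NormedSpace.exp X).det = 1 := by
  simpa using det_exp_smul hX 1

/-- The exponential map of `SL(3,ℝ)`. -/
def expSL (X : Mat3) : SL3 :=
  if h : X.trace = 0 then ⟨NormedSpace.exp X, det_exp h⟩ else 1

lemma expSL_coe {X : Mat3} (h : X.trace = 0) : (expSL X).1 = NormedSpace.exp X := by
  have e : expSL X = ⟨NormedSpace.exp X, det_exp h⟩ := dif_pos h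
  rw [e]

lemma trace_smul_eq {X : Mat3} (h : X.trace = 0) (t : ℝ) : (t • X).trace = 0 := by
  rw [Matrix.trace_smul, h, smul_zero]

lemma expSL_add {X : Mat3} (h : X.trace = 0) (s t : ℝ) :
    expSL ((s + t) • X) = expSL (s • X) * expSL (t • X) := by
  apply Subtype.ext
  rw [Matrix.SpecialLinearGroup.coe_mul, expSL_coe (trace_smul_eq h _),
    expSL_coe (trace_smul_eq h _), expSL_coe (trace_smul_eq h _), exp_add_smul]

/-- The condition is open in `(X, y)` and holds for `X = 0`, where nothing moves; since `K` is
compact, a neighbourhood of `0` works for all `y` at once. -/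
lemma exists_near_radius : ∃ ε > 0, ∀ X : Mat3, X.trace = 0 → ‖X‖ < ε → Near (expSL X) := by
  have hexp : Continuous (NormedSpace.exp : Mat3 → Mat3) := by
    let _ : NormedAlgebra ℚ Mat3 := .restrictScalars ℚ ℝ Mat3
    exact NormedSpace.exp_continuous
  have h : ∀ᶠ X in 𝓝 (0 : Mat3), ∀ y ∈ (Set.univ : Set K),
      13 / 4 < secTr (moveRot (NormedSpace.exp X) y) := by
    refine isCompact_univ.eventually_forall_of_forall_eventually fun y _ => ?_
    have h1 : ContinuousAt (fun p : Mat3 × K => secTr (moveRot (NormedSpace.exp p.1) p.2)) (0, y) := by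
      refine continuous_secTr.continuousAt.comp ?_
      refine ContinuousAt.comp' (f := fun p : Mat3 × K => (NormedSpace.exp p.1, p.2))
        (continuousAt_moveRot (by simp) _) ?_
      exact ((hexp.comp continuous_fst).prodMk continuous_snd).continuousAt
    refine h1.eventually (lt_mem_nhds ?_)
    simp only [NormedSpace.exp_zero, moveRot_one]
    norm_num [secTr]
  obtain ⟨ε, hε, H⟩ := Metric.eventually_nhds_iff.1 h
  refine ⟨ε, hε, fun X hX hn y => ?_⟩
  rw [expSL_coe hX]
  exact H (by simpa using hn) y trivial

end SL3Kernel

/-! ### The exponential map of `G` and smoothness of the Iwasawa projection -/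

namespace SL3Kernel

open scoped Matrix.Norms.Operator Topology
open Filter

/-! ### The action of `G` on `SU(2)` -/

/-- The action of `G` on `K`. -/
def act (u : G) (y : K) : K := u.1.2 y

@[simp] lemma act_one (y : K) : act 1 y = y := rfl
lemma act_mul (u v : G) (y : K) : act (u * v) y = act u (act v y) := rfl
@[simp] lemma act_embK (z y : K) : act (embK z) y = z * y := rfl
lemma kPart_eq (u : G) : kPart u = act u 1 := rfl
lemma continuous_act (u : G) : Continuous (act u) := u.1.2.continuous
lemma act_spec (u : G) (y : K) : (rot (act u y))⁻¹ * proj u * rot y ∈ AN := u.2 y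
lemma act_injective (u : G) : Function.Injective (act u) := u.1.2.injective
@[simp] lemma proj_embK (y : K) : proj (embK y) = rot y := rfl

lemma act_inv_act (u : G) (y : K) : act u⁻¹ (act u y) = y := by
  rw [← act_mul, inv_mul_cancel, act_one]

lemma G_ext {u v : G} (h1 : proj u = proj v) (h2 : ∀ y, act u y = act v y) : u = v :=
  Subtype.ext (Prod.ext h1 (Homeomorph.ext h2))

lemma act_eq_or_neg {u v : G} (h : proj u = proj v) (y : K) : act u y = act v y ∨ act u y = -act v y := by
  apply eq_or_neg_of_rot_eq
  have h1 := act_spec u y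
  have h2 := act_spec v y
  rw [h] at h1
  have := AN.mul_mem h2 (AN.inv_mem h1)
  convert this using 1
  group

/-- Both points lie over the same rotation, so they agree up to sign, and injectivity of the action
excludes equality. -/
lemma act_neg (u : G) (y : K) : act u (-y) = -act u y := by
  have h : act u (-y) = act u y ∨ act u (-y) = -act u y := by
    apply eq_or_neg_of_rot_eq
    have h1 := act_spec u y
    have h2 := act_spec u (-y)
    rw [rot_neg] at h2
    have := AN.mul_mem h1 (AN.inv_mem h2)
    convert this using 1
    group
  refine h.resolve_left fun h => ?_
  have h0 := act_injective u h
  have hn := coords_sq y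
  have r0 : -(y : ℍ[ℝ]).re = (y : ℍ[ℝ]).re := congrArg (fun w : K => (w : ℍ[ℝ]).re) h0
  have r1 : -(y : ℍ[ℝ]).imI = (y : ℍ[ℝ]).imI := congrArg (fun w : K => (w : ℍ[ℝ]).imI) h0
  have r2 : -(y : ℍ[ℝ]).imJ = (y : ℍ[ℝ]).imJ := congrArg (fun w : K => (w : ℍ[ℝ]).imJ) h0
  have r3 : -(y : ℍ[ℝ]).imK = (y : ℍ[ℝ]).imK := congrArg (fun w : K => (w : ℍ[ℝ]).imK) h0
  rw [show (y : ℍ[ℝ]).re = 0 by linarith, show (y : ℍ[ℝ]).imI = 0 by linarith,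
    show (y : ℍ[ℝ]).imJ = 0 by linarith, show (y : ℍ[ℝ]).imK = 0 by linarith] at hn
  norm_num at hn

/-- Two lifts of one matrix differ by a continuous sign on the connected space `K`, so one value
decides. -/
lemma G_ext_one {u v : G} (h1 : proj u = proj v) (h2 : act u 1 = act v 1) : u = v :=
  G_ext h1 (sign_const (continuous_act u) (continuous_act v) (act_eq_or_neg h1) h2)

lemma eq_or_eq_mul {u v : G} (h : proj u = proj v) : u = v ∨ u = embK (-1) * v := by
  rcases act_eq_or_neg h 1 with h1 | h1
  · exact Or.inl (G_ext_one h h1)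
  · refine Or.inr (G_ext_one ?_ ?_)
    · rw [map_mul, proj_embK, rot_neg, map_one, one_mul, h]
    · rw [h1, act_mul, act_embK, neg_one_mul]

lemma embK_neg_one_comm (u : G) : embK (-1) * u = u * embK (-1) := by
  refine G_ext_one ?_ ?_
  · rw [map_mul, map_mul, proj_embK, rot_neg, map_one, one_mul, mul_one]
  · rw [act_mul, act_mul, act_embK, act_embK, mul_one, neg_one_mul, act_neg]

/-- Two lifts differ at most by `embK (-1)`, which is central and of order two, so it disappears on
squaring. -/
lemma sq_eq_of_proj_eq {u v : G} (h : proj u = proj v) : u * u = v * v := by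
  rcases eq_or_eq_mul h with rfl | rfl
  · rfl
  · rw [mul_assoc, ← mul_assoc v, ← embK_neg_one_comm, mul_assoc, ← mul_assoc, ← map_mul]
    simp

/-- One-parameter subgroups of `G` are determined by their images in `SL(3,ℝ)`. -/
lemma oneParam_unique {γ δ : Multiplicative ℝ →* G} (h : ∀ t, proj (γ t) = proj (δ t)) : γ = δ := by
  refine MonoidHom.ext fun t => ?_
  -- Every value of a one-parameter subgroup is a square, and squares do not see the ambiguity of
  -- the lift.
  have e : t = Multiplicative.ofAdd (t.toAdd / 2) * Multiplicative.ofAdd (t.toAdd / 2) := by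
    rw [← ofAdd_add, add_halves, ofAdd_toAdd]
  rw [e, map_mul, map_mul]
  exact sq_eq_of_proj_eq (h _)

/-! ### Lifting small elements -/

/-- The imaginary parts have squared length below `0.19`, so the real part of `a * b` exceeds `0.81
- 0.19 > 0`, while that of `-c` is negative. -/
lemma mul_ne_neg {a b c : K} (ha : 9 / 10 < (a : ℍ[ℝ]).re) (hb : 9 / 10 < (b : ℍ[ℝ]).re)
    (hc : 9 / 10 < (c : ℍ[ℝ]).re) : a * b ≠ -c := by
  intro h
  have h0 := congrArg (fun w : K => (w : ℍ[ℝ]).re) h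
  have e : ((a * b : K) : ℍ[ℝ]).re = (a : ℍ[ℝ]).re * (b : ℍ[ℝ]).re - (a : ℍ[ℝ]).imI * (b : ℍ[ℝ]).imI
    - (a : ℍ[ℝ]).imJ * (b : ℍ[ℝ]).imJ - (a : ℍ[ℝ]).imK * (b : ℍ[ℝ]).imK :=
    Quaternion.re_mul _ _
  simp only [K_neg_re] at h0
  rw [e] at h0
  have h1 := coords_sq a
  have h2 := coords_sq b
  nlinarith [sq_nonneg ((a : ℍ[ℝ]).imI - (b : ℍ[ℝ]).imI), sq_nonneg ((a : ℍ[ℝ]).imJ - (b : ℍ[ℝ]).imJ),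
    sq_nonneg ((a : ℍ[ℝ]).imK - (b : ℍ[ℝ]).imK)]

/-- Both sides move `y` to points over the same rotation, so they agree up to sign, and all three
movers are too close to `1` for the sign to be negative. Thus lifting near the identity is
multiplicative. -/
lemma mover_mul {g h : SL3} (hg : Near g) (hh : Near h) (hgh : Near (g * h)) (y : K) :
    mover g hg (mover h hh y * y) * mover h hh y = mover (g * h) hgh y := by
  have h1 := mover_spec hg (mover h hh y * y)
  have h2 := mover_spec hh y
  have h3 := mover_spec hgh y
  have h4 : mover g hg (mover h hh y * y) * (mover h hh y * y) = mover (g * h) hgh y * y ∨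
      mover g hg (mover h hh y * y) * (mover h hh y * y) = -(mover (g * h) hgh y * y) := by
    apply eq_or_neg_of_rot_eq
    have := AN.mul_mem h3 (AN.inv_mem (AN.mul_mem h1 h2))
    convert this using 1
    group
  rw [← mul_assoc, ← neg_mul] at h4
  rcases h4 with h4 | h4
  · exact mul_right_cancel h4
  · exact absurd (mul_right_cancel h4) (mul_ne_neg (mover_re hg _) (mover_re hh _) (mover_re hgh _))

lemma mover_one (y : K) : mover 1 near_one y = 1 := by
  have h := rot_mover near_one y
  rw [Matrix.SpecialLinearGroup.coe_one, moveRot_one] at h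
  have h2 : rot (mover 1 near_one y) ∈ AN := by
    have : rot (mover 1 near_one y) = 1 := Subtype.ext h
    rw [this]; exact AN.one_mem
  refine (eq_or_neg_of_rot_mem_AN h2).resolve_right fun h3 => ?_
  have h4 := mover_re near_one y
  rw [h3] at h4
  have : (((-1 : K) : ℍ[ℝ])).re = -1 := rfl
  rw [this] at h4
  norm_num at h4

lemma mover_cancel {g h : SL3} (hg : Near g) (hh : Near h) (e : g * h = 1) (y : K) :
    mover g hg (mover h hh y * y) * (mover h hh y * y) = y := by
  have hn : Near (g * h) := by rw [e]; exact near_one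
  rw [← mul_assoc, mover_mul hg hh hn]
  have : mover (g * h) hn y = mover 1 near_one y := by congr 1
  rw [this, mover_one, one_mul]

lemma continuousAt_mover_aux {A : Mat3} (hA : A.det = 1) (y : K) (h : 0 < secTr (moveRot A y)) :
    ContinuousAt (fun p : Mat3 × K => sec (moveRot p.1 p.2) * (p.2 : ℍ[ℝ])) (A, y) := by
  have h1 : ContinuousAt (fun p : Mat3 × K => sec (moveRot p.1 p.2)) (A, y) :=
    ContinuousAt.comp' (f := fun p : Mat3 × K => moveRot p.1 p.2) (continuousAt_sec h)
      (continuousAt_moveRot hA y)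
  exact h1.mul (continuous_subtype_val.comp continuous_snd).continuousAt

lemma continuous_mover {g : SL3} (hg : Near g) : Continuous fun y => mover g hg y * y := by
  refine Continuous.subtype_mk ?_ _
  refine continuous_iff_continuousAt.2 fun y => ?_
  have h := continuousAt_mover_aux g.2 y (lt_trans (by norm_num) (hg y))
  exact ContinuousAt.comp' (f := fun y : K => (g.1, y)) h (by fun_prop)

/-- The lift of an element near the identity. -/
def lift (g : SL3) (hg : Near g) (hg' : Near g⁻¹) : G :=
  ⟨(g, { toFun := fun y => mover g hg y * y
         invFun := fun y => mover g⁻¹ hg' y * y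
         left_inv := mover_cancel hg' hg (inv_mul_cancel g)
         right_inv := mover_cancel hg hg' (mul_inv_cancel g)
         continuous_toFun := continuous_mover hg
         continuous_invFun := continuous_mover hg' }), mover_spec hg⟩

lemma act_lift {g : SL3} (hg : Near g) (hg' : Near g⁻¹) (y : K) :
    act (lift g hg hg') y = mover g hg y * y := rfl

lemma proj_lift {g : SL3} (hg : Near g) (hg' : Near g⁻¹) : proj (lift g hg hg') = g := rfl

def nearRadius : ℝ := exists_near_radius.choose

lemma nearRadius_pos : 0 < nearRadius := exists_near_radius.choose_spec.1

lemma near_expSL {X : Mat3} (h : X.trace = 0) (hn : ‖X‖ < nearRadius) : Near (expSL X) :=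
  exists_near_radius.choose_spec.2 X h hn

lemma expSL_neg {X : Mat3} (h : X.trace = 0) : expSL (-X) = (expSL X)⁻¹ := by
  have e := expSL_add h (-1) 1
  rw [neg_add_cancel, zero_smul, neg_smul, one_smul] at e
  refine eq_inv_of_mul_eq_one_left ?_
  rw [← e]
  apply Subtype.ext
  rw [expSL_coe (by simp)]
  simp

lemma near_expSL_inv {X : Mat3} (h : X.trace = 0) (hn : ‖X‖ < nearRadius) : Near (expSL X)⁻¹ := by
  rw [← expSL_neg h]
  exact near_expSL (by rw [Matrix.trace_neg, h, neg_zero]) (by rwa [norm_neg])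

/-- The lift of `exp X`, if `X` is small. -/
def smallLift (X : Mat3) : G :=
  if h : X.trace = 0 ∧ ‖X‖ < nearRadius then
    lift (expSL X) (near_expSL h.1 h.2) (near_expSL_inv h.1 h.2) else 1

lemma smallLift_eq {X : Mat3} (h : X.trace = 0) (hn : ‖X‖ < nearRadius) :
    smallLift X = lift (expSL X) (near_expSL h hn) (near_expSL_inv h hn) := dif_pos ⟨h, hn⟩

lemma smallLift_add {X : Mat3} (h : X.trace = 0) {s t : ℝ} (hs : ‖s • X‖ < nearRadius)
    (ht : ‖t • X‖ < nearRadius) (hst : ‖(s + t) • X‖ < nearRadius) :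
    smallLift ((s + t) • X) = smallLift (s • X) * smallLift (t • X) := by
  rw [smallLift_eq (trace_smul_eq h _) hs, smallLift_eq (trace_smul_eq h _) ht,
    smallLift_eq (trace_smul_eq h _) hst]
  have hn : Near (expSL (s • X) * expSL (t • X)) := by
    rw [← expSL_add h]; exact near_expSL (trace_smul_eq h _) hst
  refine G_ext ?_ fun y => ?_
  · rw [map_mul, proj_lift, proj_lift, proj_lift, expSL_add h]
  · rw [act_mul, act_lift, act_lift, act_lift, ← mul_assoc,
      mover_mul (near_expSL (trace_smul_eq h _) hs) (near_expSL (trace_smul_eq h _) ht) hn]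
    congr 2
    exact expSL_add h s t

lemma smallLift_pow {X : Mat3} (h : X.trace = 0) (n : ℕ) (hn : ‖(n : ℝ) • X‖ < nearRadius) :
    smallLift ((n : ℝ) • X) = smallLift X ^ n := by
  induction n with
  | zero =>
    have hz := smallLift_add h (s := 0) (t := 0) (by simpa using nearRadius_pos)
      (by simpa using nearRadius_pos) (by simpa using nearRadius_pos)
    simp only [add_zero] at hz
    simpa using hz
  | succ n ih =>
    have h1 : ‖(n : ℝ) • X‖ < nearRadius := by
      refine lt_of_le_of_lt ?_ hn
      rw [norm_smul, norm_smul]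
      gcongr
      simp only [Real.norm_natCast]
      push_cast
      linarith
    have h2 : ‖(1 : ℝ) • X‖ < nearRadius := by
      refine lt_of_le_of_lt ?_ hn
      rw [norm_smul, norm_smul]
      gcongr
      simp only [Real.norm_natCast, norm_one]
      push_cast
      linarith [(Nat.cast_nonneg n : (0 : ℝ) ≤ n)]
    push_cast at hn ⊢
    rw [smallLift_add h h1 h2 hn, ih h1, one_smul, pow_succ]

/-- The exponential map of `G`. -/
def expLift (X : Mat3) : G :=
  smallLift ((1 / (⌊‖X‖ / nearRadius⌋₊ + 1 : ℕ) : ℝ) • X) ^ (⌊‖X‖ / nearRadius⌋₊ + 1)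

lemma norm_div_lt {X : Mat3} {n : ℕ} (hn : 0 < n) (h : ‖X‖ < n * nearRadius) :
    ‖(1 / (n : ℝ)) • X‖ < nearRadius := by
  have : (0 : ℝ) < n := Nat.cast_pos.2 hn
  rw [norm_smul, Real.norm_of_nonneg (by positivity), one_div_mul_eq_div, div_lt_iff₀ this, mul_comm]
  exact h

/-- Subdividing further does not change the result. Any two admissible subdivisions have a common
refinement, so the particular integer in `expLift` is immaterial. -/
lemma smallLift_pow_eq {X : Mat3} (hX : X.trace = 0) {n m : ℕ} (hn : 0 < n)
    (h : ‖X‖ < n * nearRadius) (hm : 0 < m) :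
    smallLift ((1 / (n : ℝ)) • X) ^ n = smallLift ((1 / ((n * m : ℕ) : ℝ)) • X) ^ (n * m) := by
  have hm' : (m : ℝ) ≠ 0 := by positivity
  have e : (1 / (n : ℝ)) • X = (m : ℝ) • ((1 / ((n * m : ℕ) : ℝ)) • X) := by
    rw [smul_smul]
    congr 1
    push_cast
    field_simp
  rw [mul_comm n m, pow_mul, mul_comm m n, ← smallLift_pow (trace_smul_eq hX _) m, ← e]
  rw [← e]
  exact norm_div_lt hn h

lemma expLift_eq {X : Mat3} (hX : X.trace = 0) {n : ℕ} (hn : 0 < n) (h : ‖X‖ < n * nearRadius) :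
    expLift X = smallLift ((1 / (n : ℝ)) • X) ^ n := by
  have h0 : ‖X‖ < (⌊‖X‖ / nearRadius⌋₊ + 1 : ℕ) * nearRadius := by
    rw [← div_lt_iff₀ nearRadius_pos]
    push_cast
    exact Nat.lt_floor_add_one _
  rw [expLift, smallLift_pow_eq hX (Nat.succ_pos _) h0 hn, smallLift_pow_eq hX hn h (Nat.succ_pos _),
    mul_comm n]

lemma exists_pos_nat_bound (r : ℝ) : ∃ n : ℕ, 0 < n ∧ r < n * nearRadius := by
  obtain ⟨n, hn⟩ := exists_nat_gt (r / nearRadius)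
  refine ⟨n + 1, Nat.succ_pos _, ?_⟩
  rw [← div_lt_iff₀ nearRadius_pos]
  push_cast
  linarith

lemma expLift_add {X : Mat3} (hX : X.trace = 0) (s t : ℝ) :
    expLift ((s + t) • X) = expLift (s • X) * expLift (t • X) := by
  obtain ⟨n, hn, h⟩ := exists_pos_nat_bound (‖s • X‖ + ‖t • X‖)
  have h1 : ‖s • X‖ < n * nearRadius := by linarith [norm_nonneg (t • X)]
  have h2 : ‖t • X‖ < n * nearRadius := by linarith [norm_nonneg (s • X)]
  have h3 : ‖(s + t) • X‖ < n * nearRadius := by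
    rw [add_smul]; exact (norm_add_le _ _).trans_lt h
  rw [expLift_eq (trace_smul_eq hX _) hn h1, expLift_eq (trace_smul_eq hX _) hn h2,
    expLift_eq (trace_smul_eq hX _) hn h3]
  have g1 := norm_div_lt hn h1
  have g2 := norm_div_lt hn h2
  have g3 := norm_div_lt hn h3
  rw [smul_smul] at g1 g2 g3
  rw [smul_smul, smul_smul, smul_smul, mul_add]
  rw [mul_add] at g3
  -- Both orders of multiplication give the lift of the same matrix, so the two factors commute and
  -- the `n`th power of the product splits.
  have c1 := smallLift_add hX g1 g2 g3
  have c2 := smallLift_add hX g2 g1 (by rwa [add_comm])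
  rw [c1, Commute.mul_pow]
  rw [add_comm] at c2
  exact c1.symm.trans c2

lemma proj_smallLift {X : Mat3} (hX : X.trace = 0) (hn : ‖X‖ < nearRadius) :
    proj (smallLift X) = expSL X := by
  rw [smallLift_eq hX hn, proj_lift]

lemma proj_expLift {X : Mat3} (hX : X.trace = 0) : (proj (expLift X)).1 = NormedSpace.exp X := by
  obtain ⟨n, hn, h⟩ := exists_pos_nat_bound ‖X‖
  rw [expLift_eq hX hn h, map_pow, proj_smallLift (trace_smul_eq hX _) (norm_div_lt hn h),
    Matrix.SpecialLinearGroup.coe_pow, expSL_coe (trace_smul_eq hX _), ← Matrix.exp_nsmul,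
    ← Nat.cast_smul_eq_nsmul ℝ, smul_smul]
  have : (n : ℝ) ≠ 0 := by positivity
  rw [mul_one_div_cancel this, one_smul]

/-- The one-parameter subgroup of `G` with derivative `X`. -/
def oneParam (X : Mat3) (hX : X.trace = 0) : Multiplicative ℝ →* G where
  toFun t := expLift (t.toAdd • X)
  map_one' := by
    have h := expLift_add hX 0 0
    rw [add_zero] at h
    exact left_eq_mul.1 h
  map_mul' s t := expLift_add hX _ _

/-- `expG` is defined by choice; `oneParam` shows that a one-parameter subgroup of the required kind
exists, and `oneParam_unique` that the chosen one is the same. -/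
lemma expG_eq {X : Mat3} (hX : X.trace = 0) : expG X = expLift X := by
  have hex : ∃ h, ∃ γ : Multiplicative ℝ →* G,
    (∀ t : ℝ, (proj (γ (Multiplicative.ofAdd t))).1 = NormedSpace.exp (t • X)) ∧
      γ (Multiplicative.ofAdd 1) = h :=
    ⟨_, oneParam X hX, fun t => proj_expLift (trace_smul_eq hX _), rfl⟩
  obtain ⟨γ, hγ, h1⟩ := Classical.epsilon_spec hex
  have : γ = oneParam X hX := oneParam_unique fun t => Subtype.ext
    ((hγ t.toAdd).trans (proj_expLift (trace_smul_eq hX _)).symm)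
  change Classical.epsilon _ = _
  rw [← h1, this]
  change expLift ((1 : ℝ) • X) = _
  rw [one_smul]

lemma proj_expG {X : Mat3} (hX : X.trace = 0) : (proj (expG X)).1 = NormedSpace.exp X := by
  rw [expG_eq hX, proj_expLift hX]

lemma expG_add {X : Mat3} (hX : X.trace = 0) (s t : ℝ) :
    expG ((s + t) • X) = expG (s • X) * expG (t • X) := by
  rw [expG_eq (trace_smul_eq hX _), expG_eq (trace_smul_eq hX _), expG_eq (trace_smul_eq hX _),
    expLift_add hX]

lemma expG_zero : expG 0 = 1 := by
  have h := expG_add (X := 0) (by simp) 0 0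
  simp only [smul_zero] at h
  exact left_eq_mul.1 h

lemma expG_unique {X : Mat3} (hX : X.trace = 0) (γ : Multiplicative ℝ →* G)
    (hγ : ∀ t : ℝ, (proj (γ (Multiplicative.ofAdd t))).1 = NormedSpace.exp (t • X)) (t : ℝ) :
    γ (Multiplicative.ofAdd t) = expG (t • X) := by
  have : γ = oneParam X hX := oneParam_unique fun t => Subtype.ext
    ((hγ t.toAdd).trans (proj_expLift (trace_smul_eq hX _)).symm)
  rw [this, expG_eq (trace_smul_eq hX _)]
  rfl

lemma continuousAt_smallLift {P : Type*} [TopologicalSpace P] {X : P → Mat3} {y : P → K} {p : P}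
    (hX : Continuous X) (htr : ∀ p, (X p).trace = 0) (hn : ‖X p‖ < nearRadius)
    (hy : ContinuousAt y p) : ContinuousAt (fun p => act (smallLift (X p)) (y p)) p := by
  have hexp : Continuous (NormedSpace.exp : Mat3 → Mat3) := by
    let _ : NormedAlgebra ℚ Mat3 := .restrictScalars ℚ ℝ Mat3
    exact NormedSpace.exp_continuous
  rw [Topology.IsInducing.subtypeVal.continuousAt_iff]
  have hd : (NormedSpace.exp (X p)).det = 1 := det_exp (htr p)
  have hs : 0 < secTr (moveRot (NormedSpace.exp (X p)) (y p)) := by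
    have := near_expSL (htr p) hn (y p)
    rw [expSL_coe (htr p)] at this
    linarith
  have h1 : ContinuousAt (fun p => sec (moveRot (NormedSpace.exp (X p)) (y p)) * (y p : ℍ[ℝ])) p :=
    ContinuousAt.comp' (f := fun p => (NormedSpace.exp (X p), y p)) (continuousAt_mover_aux hd _ hs)
      ((hexp.comp hX).continuousAt.prodMk hy)
  refine h1.congr ?_
  have hev : ∀ᶠ q in 𝓝 p, ‖X q‖ < nearRadius :=
    hX.norm.continuousAt.eventually (gt_mem_nhds hn)
  filter_upwards [hev] with q hq
  rw [Function.comp_apply, smallLift_eq (htr q) hq, act_lift]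
  change _ = sec (moveRot (expSL (X q)).1 (y q)) * (y q : ℍ[ℝ])
  rw [expSL_coe (htr q)]

/-- Near a given parameter one integer `n` works, and `expG` is the `n`th power of a small lift.
Joint continuity of a small lift in the matrix and in the point is applied `n` times. -/
lemma continuous_act_expG {P : Type*} [TopologicalSpace P] {X : P → Mat3} {y : P → K}
    (hX : Continuous X) (htr : ∀ p, (X p).trace = 0) (hy : Continuous y) :
    Continuous fun p => act (expG (X p)) (y p) := by
  refine continuous_iff_continuousAt.2 fun p => ?_
  obtain ⟨n, hn, h⟩ := exists_pos_nat_bound ‖X p‖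
  have hev : ∀ᶠ q in 𝓝 p, ‖X q‖ < n * nearRadius := hX.norm.continuousAt.eventually (gt_mem_nhds h)
  have key : ∀ k : ℕ, ContinuousAt (fun q => act (smallLift ((1 / (n : ℝ)) • X q) ^ k) (y q)) p := by
    intro k
    induction k with
    | zero => simpa using hy.continuousAt
    | succ k ih =>
      simp_rw [pow_succ', act_mul]
      exact continuousAt_smallLift (X := fun q => (1 / (n : ℝ)) • X q)
        (hX.const_smul (1 / (n : ℝ)))
        (fun q => trace_smul_eq (htr q) _) (norm_div_lt hn h) ih
  refine (key n).congr ?_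
  filter_upwards [hev] with q hq
  rw [expG_eq (htr q), expLift_eq (htr q) hn hq]

/-! ### Smoothness of lifts -/

lemma sec_eq (R : Mat3) : sec R = (√(secTr R) / 2) • (1 : ℍ[ℝ])
      + ((R 2 1 - R 1 2) / (2 * √(secTr R))) • qI + ((R 0 2 - R 2 0) / (2 * √(secTr R))) • qJ
      + ((R 1 0 - R 0 1) / (2 * √(secTr R))) • qK := by
  apply QuaternionAlgebra.ext
  · change _ = _ * (1 : ℝ) + _ * (0 : ℝ) + _ * (0 : ℝ) + _ * (0 : ℝ); simp [sec]
  · change _ = _ * (0 : ℝ) + _ * (1 : ℝ) + _ * (0 : ℝ) + _ * (0 : ℝ); simp [sec]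
  · change _ = _ * (0 : ℝ) + _ * (0 : ℝ) + _ * (1 : ℝ) + _ * (0 : ℝ); simp [sec]
  · change _ = _ * (0 : ℝ) + _ * (0 : ℝ) + _ * (0 : ℝ) + _ * (1 : ℝ); simp [sec]

lemma contDiffAt_sec {E : Type*} [NormedAddCommGroup E] [NormedSpace ℝ E] {n : WithTop ℕ∞}
    {R : E → Mat3} {x : E} (hR : ∀ i j, ContDiffAt ℝ n (fun e => R e i j) x)
    (h : 0 < secTr (R x)) : ContDiffAt ℝ n (fun e => sec (R e)) x := by
  have hs : ContDiffAt ℝ n (fun e => √(secTr (R e))) x :=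
    (((contDiffAt_const.add (hR _ _)).add (hR _ _)).add (hR _ _)).sqrt h.ne'
  have h0 : √(secTr (R x)) ≠ 0 := (Real.sqrt_pos.2 h).ne'
  have d : ∀ i j k l, ContDiffAt ℝ n (fun e => (R e i j - R e k l) / (2 * √(secTr (R e)))) x :=
    fun i j k l => ((hR i j).sub (hR k l)).div (contDiffAt_const.mul hs) (by simpa using h0)
  simp_rw [sec_eq]
  exact ((((hs.div_const 2).smul contDiffAt_const).add ((d _ _ _ _).smul contDiffAt_const)).add
    ((d _ _ _ _).smul contDiffAt_const)).add ((d _ _ _ _).smul contDiffAt_const)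

/-- A continuous lift of a smooth map to `SO(3)` is smooth. -/
lemma contDiff_of_rotMat {E : Type*} [NormedAddCommGroup E] [NormedSpace ℝ E] {n : WithTop ℕ∞}
    {h : E → K} (hc : Continuous h)
    (hr : ∀ i j, ContDiff ℝ n fun e => rotMat (h e : ℍ[ℝ]) i j) :
    ContDiff ℝ n fun e => (h e : ℍ[ℝ]) := by
  refine contDiff_iff_contDiffAt.2 fun x => ?_
  -- After translation the value at `x` is `1`, where the section `sec` is smooth and, by continuity
  -- of `h`, inverts `rotMat` along nearby values.
  let R : E → Mat3 := fun e => rotMat ((h e * (h x)⁻¹ : K) : ℍ[ℝ])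
  have hR : ∀ i j, ContDiffAt ℝ n (fun e => R e i j) x := by
    intro i j
    have e1 : ∀ e, R e i j = ∑ k, rotMat (h e : ℍ[ℝ]) i k * rotMat (((h x)⁻¹ : K) : ℍ[ℝ]) k j := by
      intro e
      change rotMat ((h e : ℍ[ℝ]) * (((h x)⁻¹ : K) : ℍ[ℝ])) i j = _
      rw [rotMat_mul, Matrix.mul_apply]
    simp_rw [e1]
    exact ContDiffAt.sum fun k _ => (hr i k).contDiffAt.mul contDiffAt_const
  have hx1 : (((h x * (h x)⁻¹ : K)) : ℍ[ℝ]).re = 1 := by rw [mul_inv_cancel]; rfl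
  have hpos : 0 < secTr (R x) := by
    rw [secTr_rotMat, hx1]; norm_num
  have hsm := (contDiffAt_sec hR hpos).mul (contDiffAt_const (c := (h x : ℍ[ℝ])))
  refine hsm.congr_of_eventuallyEq ?_
  have hcont : Continuous fun e => (((h e * (h x)⁻¹ : K)) : ℍ[ℝ]).re :=
    continuous_re_K.comp (hc.mul continuous_const)
  have hev : ∀ᶠ e in 𝓝 x, 0 < (((h e * (h x)⁻¹ : K)) : ℍ[ℝ]).re :=
    hcont.continuousAt.eventually (lt_mem_nhds (lt_of_lt_of_eq one_pos hx1.symm))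
  filter_upwards [hev] with e he
  rw [sec_rotMat _ he]
  change (h e : ℍ[ℝ]) = ((h e * (h x)⁻¹ * h x : K) : ℍ[ℝ])
  rw [inv_mul_cancel_right]

lemma eq_one_of_isRot {S : Mat3} (hS : IsRot S) (h1 : ∀ i j, j < i → S i j = 0)
    (h2 : ∀ i, 0 < S i i) : S = 1 := by
  have O := fun i j => congrFun (congrFun hS.tmul i) j
  simp only [Matrix.mul_apply, Matrix.transpose_apply, Fin.sum_univ_three] at O
  have e10 := h1 1 0 (by decide)
  have e20 := h1 2 0 (by decide)
  have e21 := h1 2 1 (by decide)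
  have o00 := O 0 0
  have o01 := O 0 1
  have o02 := O 0 2
  have o11 := O 1 1
  have o12 := O 1 2
  have o22 := O 2 2
  simp [e10, e20, e21] at o00 o01 o02 o11 o12 o22
  have s00 : S 0 0 = 1 := by nlinarith [h2 0]
  have s01 : S 0 1 = 0 := o01.resolve_left (h2 0).ne'
  have s02 : S 0 2 = 0 := o02.resolve_left (h2 0).ne'
  simp [s01, s02] at o11 o12 o22
  have s11 : S 1 1 = 1 := by nlinarith [h2 1]
  have s12 : S 1 2 = 0 := o12.resolve_left (h2 1).ne'
  simp [s12] at o22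
  have s22 : S 2 2 = 1 := by nlinarith [h2 2]
  ext i j
  fin_cases i <;> fin_cases j <;> simp [*]

/-- By uniqueness of the Iwasawa decomposition of a matrix, the rotation under `kPart u` is the
Gram–Schmidt factor, an explicit smooth function. -/
lemma rotMat_kPart (u : G) : rotMat (kPart u : ℍ[ℝ]) = gs (proj u).1 := by
  set A := (proj u).1
  have hg := gs_spec (A := A) (proj u).2
  have h1 : (rot (kPart u))⁻¹ * proj u ∈ AN := by
    have := act_spec u 1
    rwa [map_one, mul_one] at this
  let S : SL3 := ⟨gs A, hg.1.det⟩
  have hS : (S⁻¹).1 = (gs A).transpose := by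
    rw [Matrix.SpecialLinearGroup.coe_inv]; exact hg.1.adj
  have h2 : S⁻¹ * proj u ∈ AN := by
    refine ⟨fun i j hij => ?_, fun i => ?_⟩
    · rw [Matrix.SpecialLinearGroup.coe_mul, hS]; exact hg.2.1 i j hij
    · rw [Matrix.SpecialLinearGroup.coe_mul, hS]; exact hg.2.2 i
  have h3 : S⁻¹ * rot (kPart u) ∈ AN := by
    have := AN.mul_mem h2 (AN.inv_mem h1)
    convert this using 1
    group
  have h4 : S⁻¹ * rot (kPart u) = 1 := Subtype.ext <| eq_one_of_isRot
    (by rw [Matrix.SpecialLinearGroup.coe_mul, hS]; exact hg.1.transpose.mul (isRot_rotMat _))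
    h3.1 h3.2
  exact congrArg Subtype.val (inv_mul_eq_one.1 h4).symm

lemma slMat_apply (c : Fin 3 → Fin 3 → ℝ) : slMat c =
    Matrix.of c - (((c 0 0 + c 1 1 + c 2 2) / 3 : ℝ) • (1 : Mat3)) := by
  ext i j
  simp only [slMat, T, Fin.sum_univ_three]
  fin_cases i <;> fin_cases j <;> simp [Matrix.single] <;> ring

lemma trace_slMat (c : Fin 3 → Fin 3 → ℝ) : (slMat c).trace = 0 := by
  rw [slMat_apply, Matrix.trace_fin_three]
  simp
  ring

lemma slMat_of_trace {X : Mat3} (h : X.trace = 0) : slMat (fun i j => X i j) = X := by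
  rw [Matrix.trace_fin_three] at h
  rw [slMat_apply, h]
  simp only [zero_div, zero_smul, sub_zero]
  rfl

lemma slMat_smul (t : ℝ) (c : Fin 3 → Fin 3 → ℝ) : slMat (t • c) = t • slMat c := by
  simp only [slMat, Pi.smul_apply, smul_assoc, Finset.smul_sum]

lemma contDiff_exp {n : WithTop ℕ∞} : ContDiff ℝ n (NormedSpace.exp : Mat3 → Mat3) :=
  contDiff_iff_contDiffAt.2 fun x => (NormedSpace.exp_analytic (𝕂 := ℝ) x).contDiffAt

lemma contDiff_slMat {n : WithTop ℕ∞} : ContDiff ℝ n (slMat : (Fin 3 → Fin 3 → ℝ) → Mat3) := by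
  refine ContDiff.sum fun i _ => ContDiff.sum fun j _ => ?_
  exact (contDiff_apply_apply ℝ ℝ i j).smul contDiff_const

lemma contDiff_proj_prod {n : WithTop ℕ∞} (m : ℕ) :
    ContDiff ℝ n fun c : Fin m → Fin 3 → Fin 3 → ℝ =>
      ((proj (List.ofFn fun i => expG (slMat (c i))).prod).1 : Mat3) := by
  induction m with
  | zero => simpa using contDiff_const
  | succ m ih =>
    simp only [List.ofFn_succ, List.prod_cons, map_mul, Matrix.SpecialLinearGroup.coe_mul,
      proj_expG (trace_slMat _)]
    refine ContDiff.mul ?_ ?_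
    · exact contDiff_exp.comp (contDiff_slMat.comp (contDiff_apply _ _ _))
    · exact ih.comp (f := fun (c : Fin (m + 1) → Fin 3 → Fin 3 → ℝ) (i : Fin m) => c i.succ)
        (contDiff_pi.2 fun i => contDiff_apply _ _ _)

lemma continuous_slMat : Continuous slMat := (contDiff_slMat (n := 0)).continuous

lemma continuous_act_prod (m : ℕ) (y : K) :
    Continuous fun c : Fin m → Fin 3 → Fin 3 → ℝ =>
      act (List.ofFn fun i => expG (slMat (c i))).prod y := by
  induction m with
  | zero => simpa using continuous_const
  | succ m ih =>
    simp only [List.ofFn_succ, List.prod_cons, act_mul]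
    refine continuous_act_expG (continuous_slMat.comp (continuous_apply _))
      (fun c => trace_slMat _) ?_
    exact ih.comp (f := fun (c : Fin (m + 1) → Fin 3 → Fin 3 → ℝ) (i : Fin m) => c i.succ)
      (continuous_pi fun i => continuous_apply _)

lemma contDiff_proj_apply {n : WithTop ℕ∞} (m : ℕ) (g : G) (i j : Fin 3) :
    ContDiff ℝ n fun c : Fin m → Fin 3 → Fin 3 → ℝ =>
      (proj (g * (List.ofFn fun i => expG (slMat (c i))).prod)).1 i j := by
  have h := (contDiff_const (c := (proj g).1)).mul (contDiff_proj_prod (n := n) m)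
  simp only [map_mul, Matrix.SpecialLinearGroup.coe_mul]
  exact (LinearMap.toContinuousLinearMap
    (Matrix.entryLinearMap ℝ ℝ i j : Mat3 →ₗ[ℝ] ℝ)).contDiff.comp h

/-- The image in `SO(3)` is smooth by Gram–Schmidt, and the action of `G` supplies the continuity of
the lift; together they give smoothness upstairs. -/
lemma contDiff_kPart {n : WithTop ℕ∞} (m : ℕ) (g : G) :
    ContDiff ℝ n fun c : Fin m → Fin 3 → Fin 3 → ℝ =>
      (kPart (g * (List.ofFn fun i => expG (slMat (c i))).prod) : ℍ[ℝ]) := by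
  refine contDiff_of_rotMat ?_ fun i j => ?_
  · simp only [kPart_eq, act_mul]
    exact (continuous_act g).comp (continuous_act_prod m 1)
  · simp only [rotMat_kPart]
    exact contDiff_iff_contDiffAt.2 fun c => contDiffAt_gs
      (fun i j => (contDiff_proj_apply m g i j).contDiffAt) (proj _).2 i j

end SL3Kernel

/-! ### The subgroups `K`, `AN` and `M` of `G` -/

namespace SL3Kernel

open scoped Matrix.Norms.Operator Topology
open Filter

/-! ### Identities for the exponential map of `G` -/

/-- The adjoint action of `G` on matrices. -/
def Ad (g : G) (X : Mat3) : Mat3 := (proj g).1 * X * ((proj g)⁻¹).1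

lemma proj_mul_inv (g : G) : (proj g).1 * ((proj g)⁻¹).1 = 1 := by
  rw [← Matrix.SpecialLinearGroup.coe_mul, mul_inv_cancel]; rfl

lemma proj_inv_mul (g : G) : ((proj g)⁻¹).1 * (proj g).1 = 1 := by
  rw [← Matrix.SpecialLinearGroup.coe_mul, inv_mul_cancel]; rfl

lemma trace_Ad (g : G) {X : Mat3} (hX : X.trace = 0) : (Ad g X).trace = 0 := by
  rw [Ad, Matrix.trace_mul_comm, ← mul_assoc, proj_inv_mul, one_mul, hX]

lemma Ad_smul (g : G) (t : ℝ) (X : Mat3) : Ad g (t • X) = t • Ad g X := by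
  simp [Ad]

lemma Ad_add (g : G) (X Y : Mat3) : Ad g (X + Y) = Ad g X + Ad g Y := by
  simp [Ad, mul_add, add_mul]

/-- Conjugating a one-parameter subgroup of `G` gives one whose matrices are `exp (t Ad(g) X)`, and
such a subgroup is unique. -/
lemma conj_expG (g : G) {X : Mat3} (hX : X.trace = 0) : g * expG X * g⁻¹ = expG (Ad g X) := by
  have h := expG_unique (trace_Ad g hX) ((MulAut.conj g).toMonoidHom.comp (oneParam X hX))
    (fun t => ?_) 1
  · rw [one_smul] at h
    rw [← h, expG_eq hX]
    change _ = g * expLift ((1 : ℝ) • X) * g⁻¹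
    rw [one_smul]
  · change (proj (g * expLift (t • X) * g⁻¹)).1 = _
    rw [map_mul, map_mul, map_inv, Matrix.SpecialLinearGroup.coe_mul,
      Matrix.SpecialLinearGroup.coe_mul, proj_expLift (trace_smul_eq hX _), ← Ad_smul]
    let U : Mat3ˣ := ⟨(proj g).1, ((proj g)⁻¹).1, proj_mul_inv g, proj_inv_mul g⟩
    exact (Matrix.exp_units_conj U (t • X)).symm

lemma mul_expG (g : G) {X : Mat3} (hX : X.trace = 0) : g * expG X = expG (Ad g X) * g := by
  rw [← conj_expG g hX, inv_mul_cancel_right]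

lemma expG_neg {X : Mat3} (hX : X.trace = 0) : expG (-X) = (expG X)⁻¹ := by
  have h := expG_add hX (-1) 1
  simp only [neg_add_cancel, zero_smul, one_smul, neg_smul, expG_zero] at h
  exact eq_inv_of_mul_eq_one_left h.symm

lemma eq_exp_of_hasDerivAt {M : ℝ → Mat3} {X : Mat3} (h : ∀ t, HasDerivAt M (M t * X) t)
    (h0 : M 0 = 1) (t : ℝ) : M t = NormedSpace.exp (t • X) := by
  have hN : ∀ t, HasDerivAt (fun t => M t * NormedSpace.exp (t • (-X))) 0 t := by
    intro t
    refine ((h t).mul (hasDerivAt_exp_smul_const' (𝕂 := ℝ) (-X) t)).congr_deriv ?_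
    simp [mul_assoc]
  have hc := is_const_of_deriv_eq_zero (fun t => (hN t).differentiableAt) (fun t => (hN t).deriv) t 0
  simp only [h0, zero_smul, NormedSpace.exp_zero, mul_one] at hc
  have e : NormedSpace.exp (t • (-X)) * NormedSpace.exp (t • X) = 1 := by
    rw [← Matrix.exp_add_of_commute]
    · simp
    · exact ((Commute.refl X).neg_left.smul_left _).smul_right _
  calc M t = M t * (NormedSpace.exp (t • (-X)) * NormedSpace.exp (t • X)) := by rw [e, mul_one]
    _ = _ := by rw [← mul_assoc, hc, one_mul]

/-- The differential of `rot`. -/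
def rhoMat (z : Fin 3 → ℝ) : Mat3 :=
  !![0, -2 * z 2, 2 * z 1; 2 * z 2, 0, -2 * z 0; -2 * z 1, 2 * z 0, 0]

lemma trace_rhoMat (z : Fin 3 → ℝ) : (rhoMat z).trace = 0 := by
  rw [Matrix.trace_fin_three]; simp [rhoMat]

def reCLM : ℍ[ℝ] →L[ℝ] ℝ := LinearMap.toContinuousLinearMap
  { toFun := fun q => q.re, map_add' := fun _ _ => rfl, map_smul' := fun _ _ => rfl }

def imICLM : ℍ[ℝ] →L[ℝ] ℝ := LinearMap.toContinuousLinearMap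
  { toFun := fun q => q.imI, map_add' := fun _ _ => rfl, map_smul' := fun _ _ => rfl }

def imJCLM : ℍ[ℝ] →L[ℝ] ℝ := LinearMap.toContinuousLinearMap
  { toFun := fun q => q.imJ, map_add' := fun _ _ => rfl, map_smul' := fun _ _ => rfl }

def imKCLM : ℍ[ℝ] →L[ℝ] ℝ := LinearMap.toContinuousLinearMap
  { toFun := fun q => q.imK, map_add' := fun _ _ => rfl, map_smul' := fun _ _ => rfl }

lemma rotMat_expK_hasDerivAt_zero (z : Fin 3 → ℝ) :
    HasDerivAt (fun t : ℝ => rotMat (expK (t • z) : ℍ[ℝ])) (rhoMat z) 0 := by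
  have h := hasDerivAt_expK z
  have h0 : HasDerivAt (fun t : ℝ => (expK (t • z) : ℍ[ℝ]).re) 0 0 :=
    reCLM.hasFDerivAt.comp_hasDerivAt 0 h
  have h1 : HasDerivAt (fun t : ℝ => (expK (t • z) : ℍ[ℝ]).imI) (z 0) 0 :=
    imICLM.hasFDerivAt.comp_hasDerivAt 0 h
  have h2 : HasDerivAt (fun t : ℝ => (expK (t • z) : ℍ[ℝ]).imJ) (z 1) 0 :=
    imJCLM.hasFDerivAt.comp_hasDerivAt 0 h
  have h3 : HasDerivAt (fun t : ℝ => (expK (t • z) : ℍ[ℝ]).imK) (z 2) 0 :=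
    imKCLM.hasFDerivAt.comp_hasDerivAt 0 h
  have e0 : (expK 0 : ℍ[ℝ]).re = 1 := by rw [expK_zero]; rfl
  have e1 : (expK 0 : ℍ[ℝ]).imI = 0 := by rw [expK_zero]; rfl
  have e2 : (expK 0 : ℍ[ℝ]).imJ = 0 := by rw [expK_zero]; rfl
  have e3 : (expK 0 : ℍ[ℝ]).imK = 0 := by rw [expK_zero]; rfl
  simp_rw [rotMat_eq]
  refine hasDerivAt_pi.2 fun i => hasDerivAt_pi.2 fun j => ?_
  fin_cases i <;> fin_cases j
  · refine ((((h0.pow 2).add (h1.pow 2)).sub (h2.pow 2)).sub (h3.pow 2)).congr_deriv ?_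
    simp [rhoMat, e0, e1, e2, e3]
  · refine (((h1.mul h2).sub (h0.mul h3)).const_mul 2).congr_deriv ?_
    simp [rhoMat, e0, e1, e2, e3]
  · refine (((h1.mul h3).add (h0.mul h2)).const_mul 2).congr_deriv ?_
    simp [rhoMat, e0, e1, e2, e3]
  · refine (((h1.mul h2).add (h0.mul h3)).const_mul 2).congr_deriv ?_
    simp [rhoMat, e0, e1, e2, e3]
  · refine ((((h0.pow 2).sub (h1.pow 2)).add (h2.pow 2)).sub (h3.pow 2)).congr_deriv ?_
    simp [rhoMat, e0, e1, e2, e3]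
  · refine (((h2.mul h3).sub (h0.mul h1)).const_mul 2).congr_deriv ?_
    simp [rhoMat, e0, e1, e2, e3]
  · refine (((h1.mul h3).sub (h0.mul h2)).const_mul 2).congr_deriv ?_
    simp [rhoMat, e0, e1, e2, e3]
  · refine (((h2.mul h3).add (h0.mul h1)).const_mul 2).congr_deriv ?_
    simp [rhoMat, e0, e1, e2, e3]
  · refine ((((h0.pow 2).sub (h1.pow 2)).sub (h2.pow 2)).add (h3.pow 2)).congr_deriv ?_
    simp [rhoMat, e0, e1, e2, e3]

lemma rotMat_expK (z : Fin 3 → ℝ) (t : ℝ) :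
    rotMat (expK (t • z) : ℍ[ℝ]) = NormedSpace.exp (t • rhoMat z) := by
  refine eq_exp_of_hasDerivAt (M := fun t => rotMat (expK (t • z) : ℍ[ℝ])) (fun t => ?_) ?_ t
  · have h0 := rotMat_expK_hasDerivAt_zero z
    have h1 : HasDerivAt (fun s : ℝ => rotMat (expK ((s - t) • z) : ℍ[ℝ])) (rhoMat z) t :=
      HasDerivAt.comp_sub_const t t (f := fun s : ℝ => rotMat (expK (s • z) : ℍ[ℝ])) (by rw [sub_self]; exact h0)
    refine (h1.const_mul (rotMat (expK (t • z) : ℍ[ℝ]))).congr_of_eventuallyEq ?_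
    refine Eventually.of_forall fun s => ?_
    change _ = rotMat (expK (t • z) : ℍ[ℝ]) * rotMat (expK ((s - t) • z) : ℍ[ℝ])
    rw [← rotMat_mul]
    have := expK_add t (s - t) z
    rw [add_sub_cancel] at this
    simp only [this]; rfl
  · simp only [zero_smul, expK_zero]
    exact rotMat_one

/-- Through this identity right derivatives along `𝔨₀` at points of `K` can be computed inside `K`.
-/
lemma embK_expK (z : Fin 3 → ℝ) : embK (expK z) = expG (rhoMat z) := by
  let γ : Multiplicative ℝ →* G := embK.comp
    { toFun := fun t => expK (t.toAdd • z)
      map_one' := by simp [expK_zero]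
      map_mul' := fun s t => expK_add _ _ z }
  have h := expG_unique (trace_rhoMat z) γ (fun t => rotMat_expK z t) 1
  rw [one_smul] at h
  rw [← h]
  change _ = embK (expK ((1 : ℝ) • z))
  rw [one_smul]

lemma rhoMat_smul (t : ℝ) (z : Fin 3 → ℝ) : rhoMat (t • z) = t • rhoMat z := by
  ext i j
  fin_cases i <;> fin_cases j <;> simp [rhoMat] <;> ring

lemma rhoMat_add (z w : Fin 3 → ℝ) : rhoMat (z + w) = rhoMat z + rhoMat w := by
  ext i j
  fin_cases i <;> fin_cases j <;> simp [rhoMat] <;> ring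

/-! ### Upper triangular matrices -/

/-- Upper triangular traceless matrices. -/
structure IsUpper (X : Mat3) : Prop where
  low : ∀ i j, j < i → X i j = 0
  tr : X.trace = 0

lemma IsUpper.smul {X : Mat3} (h : IsUpper X) (t : ℝ) : IsUpper (t • X) :=
  ⟨fun i j hij => by simp [h.low i j hij], trace_smul_eq h.tr t⟩

lemma IsUpper.exp_low {X : Mat3} (h : IsUpper X) (i j : Fin 3) (hij : j < i) :
    NormedSpace.exp X i j = 0 := by
  have h1 : Matrix.BlockTriangular X (id : Fin 3 → Fin 3) := fun i j hij => h.low i j hij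
  exact Matrix.BlockTriangular.exp h1 hij

lemma IsUpper.exp_diag {X : Mat3} (h : IsUpper X) (t : ℝ) (i : Fin 3) :
    NormedSpace.exp (t • X) i i = Real.exp (t * X i i) := by
  have hd : ∀ t, HasDerivAt (fun t : ℝ => NormedSpace.exp (t • X) i i)
      (NormedSpace.exp (t • X) i i * X i i) t := by
    intro t
    refine (hasDerivAt_exp_apply X t i i).congr_deriv ?_
    rw [Matrix.mul_apply, Finset.sum_eq_single i]
    · intro k _ hk
      rcases lt_or_gt_of_ne hk with hk | hk
      · rw [(h.smul t).exp_low i k hk, zero_mul]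
      · rw [h.low k i hk, mul_zero]
    · simp
  have hN : ∀ t, HasDerivAt (fun t : ℝ => NormedSpace.exp (t • X) i i * Real.exp (-(t * X i i))) 0 t := by
    intro t
    have h2 : HasDerivAt (fun t : ℝ => Real.exp (-(t * X i i)))
        (Real.exp (-(t * X i i)) * (-(1 * X i i))) t :=
      (((hasDerivAt_id t).mul_const (X i i)).neg).exp
    refine ((hd t).mul h2).congr_deriv ?_
    ring
  have hc := is_const_of_deriv_eq_zero (fun t => (hN t).differentiableAt) (fun t => (hN t).deriv) t 0
  simp only [zero_smul, NormedSpace.exp_zero, zero_mul, neg_zero, Real.exp_zero, mul_one,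
    Matrix.one_apply_eq] at hc
  rw [Real.exp_neg, mul_inv_eq_one₀ (Real.exp_ne_zero _)] at hc
  exact hc

lemma IsUpper.expG_mem_AN {X : Mat3} (h : IsUpper X) : proj (expG X) ∈ AN := by
  refine ⟨fun i j hij => ?_, fun i => ?_⟩
  · rw [proj_expG h.tr]; exact h.exp_low i j hij
  · rw [proj_expG h.tr]
    have := h.exp_diag 1 i
    rw [one_smul] at this
    rw [this]
    exact Real.exp_pos _

lemma IsUpper.expG_mem_B {X : Mat3} (h : IsUpper X) : expG X ∈ B := h.expG_mem_AN.1

lemma kPart_eq_or_neg {u : G} (h : proj u ∈ AN) : kPart u = 1 ∨ kPart u = -1 := by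
  apply eq_or_neg_of_rot_mem_AN
  have h1 := act_spec u 1
  rw [map_one, mul_one] at h1
  have h2 := AN.mul_mem h (AN.inv_mem h1)
  convert h2 using 1
  change rot (act u 1) = _
  group

/-- The `K`-component lies over `1`, so it is `±1`; writing the element as the square of `expG` of
half of `X` makes the sign positive. -/
lemma IsUpper.kPart_expG {X : Mat3} (h : IsUpper X) : kPart (expG X) = 1 := by
  have e := expG_add h.tr (1 / 2) (1 / 2)
  norm_num at e
  rw [e, kPart_eq, act_mul]
  rcases kPart_eq_or_neg (h.smul (1 / 2)).expG_mem_AN with h1 | h1 <;> rw [kPart_eq] at h1 <;>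
    norm_num at h1
  · rw [h1, h1]
  · rw [h1, act_neg, h1, neg_neg]

/-! ### The group `M` -/

def kI : K := mkK qI (by rw [Quaternion.normSq_def']; simp [qI])
def kK : K := mkK qK (by rw [Quaternion.normSq_def']; simp [qK])

@[simp] lemma kI_re : (kI : ℍ[ℝ]).re = 0 := rfl
@[simp] lemma kI_imI : (kI : ℍ[ℝ]).imI = 1 := rfl
@[simp] lemma kI_imJ : (kI : ℍ[ℝ]).imJ = 0 := rfl
@[simp] lemma kI_imK : (kI : ℍ[ℝ]).imK = 0 := rfl
@[simp] lemma kK_re : (kK : ℍ[ℝ]).re = 0 := rfl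
@[simp] lemma kK_imI : (kK : ℍ[ℝ]).imI = 0 := rfl
@[simp] lemma kK_imJ : (kK : ℍ[ℝ]).imJ = 0 := rfl
@[simp] lemma kK_imK : (kK : ℍ[ℝ]).imK = 1 := rfl

lemma K_mul_re (y z : K) : ((y * z : K) : ℍ[ℝ]).re = (y : ℍ[ℝ]).re * (z : ℍ[ℝ]).re -
    (y : ℍ[ℝ]).imI * (z : ℍ[ℝ]).imI - (y : ℍ[ℝ]).imJ * (z : ℍ[ℝ]).imJ -
    (y : ℍ[ℝ]).imK * (z : ℍ[ℝ]).imK := Quaternion.re_mul _ _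
lemma K_mul_imI (y z : K) : ((y * z : K) : ℍ[ℝ]).imI = (y : ℍ[ℝ]).re * (z : ℍ[ℝ]).imI +
    (y : ℍ[ℝ]).imI * (z : ℍ[ℝ]).re + (y : ℍ[ℝ]).imJ * (z : ℍ[ℝ]).imK -
    (y : ℍ[ℝ]).imK * (z : ℍ[ℝ]).imJ := Quaternion.imI_mul _ _
lemma K_mul_imJ (y z : K) : ((y * z : K) : ℍ[ℝ]).imJ = (y : ℍ[ℝ]).re * (z : ℍ[ℝ]).imJ -
    (y : ℍ[ℝ]).imI * (z : ℍ[ℝ]).imK + (y : ℍ[ℝ]).imJ * (z : ℍ[ℝ]).re +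
    (y : ℍ[ℝ]).imK * (z : ℍ[ℝ]).imI := Quaternion.imJ_mul _ _
lemma K_mul_imK (y z : K) : ((y * z : K) : ℍ[ℝ]).imK = (y : ℍ[ℝ]).re * (z : ℍ[ℝ]).imK +
    (y : ℍ[ℝ]).imI * (z : ℍ[ℝ]).imJ - (y : ℍ[ℝ]).imJ * (z : ℍ[ℝ]).imI +
    (y : ℍ[ℝ]).imK * (z : ℍ[ℝ]).re := Quaternion.imK_mul _ _
@[simp] lemma K_one_re : ((1 : K) : ℍ[ℝ]).re = 1 := rfl
@[simp] lemma K_one_imI : ((1 : K) : ℍ[ℝ]).imI = 0 := rfl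
@[simp] lemma K_one_imJ : ((1 : K) : ℍ[ℝ]).imJ = 0 := rfl
@[simp] lemma K_one_imK : ((1 : K) : ℍ[ℝ]).imK = 0 := rfl

/-- As `α β` is positive inside the interval, `α` has no zero there and stays positive; then `β` is
positive too, and `β 1 ≥ 0` in the limit. This fixes the sign of the endpoint of a lifted path. -/
lemma sign_path {α β : ℝ → ℝ} (hα : Continuous α) (hβ : Continuous β)
    (h0 : α 0 = 1) (hpos : ∀ t ∈ Set.Ioo 0 1, 0 < α t * β t) (h1 : α 1 * β 1 = 0)
    (hend : α 1 ^ 2 < β 1 ^ 2) (hn : α 1 ^ 2 + β 1 ^ 2 = 1) : α 1 = 0 ∧ β 1 = 1 := by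
  have ha : ∀ t ∈ Set.Ioo (0 : ℝ) 1, 0 < α t := by
    intro t ht
    by_contra hneg
    obtain ⟨s, hs, hs0⟩ := intermediate_value_Icc' ht.1.le hα.continuousOn
      (show (0 : ℝ) ∈ Set.Icc (α t) (α 0) from ⟨not_lt.1 hneg, by rw [h0]; norm_num⟩)
    have hs' : 0 < s := lt_of_le_of_ne hs.1 (by rintro rfl; rw [h0] at hs0; norm_num at hs0)
    have := hpos s ⟨hs', hs.2.trans_lt ht.2⟩
    rw [hs0, zero_mul] at this
    exact lt_irrefl _ this
  have hb : 0 ≤ β 1 := by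
    refine ge_of_tendsto (hβ.continuousAt.tendsto.mono_left (nhdsWithin_le_nhds (s := Set.Iio 1))) ?_
    filter_upwards [Ioo_mem_nhdsLT (zero_lt_one' ℝ)] with t ht
    exact (pos_of_mul_pos_right (hpos t ht) (ha t ht).le).le
  have hb1 : β 1 ≠ 0 := by
    intro h
    rw [h] at hend
    nlinarith [sq_nonneg (α 1)]
  have ha1 : α 1 = 0 := (mul_eq_zero.1 h1).resolve_right hb1
  refine ⟨ha1, ?_⟩
  rw [ha1] at hn
  nlinarith

def qArcI (t : ℝ) : ℍ[ℝ] :=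
  ⟨Real.cos (Real.pi / 2 * t), Real.sin (Real.pi / 2 * t), 0, 0⟩

def arcI (t : ℝ) : K := mkK (qArcI t) (by rw [Quaternion.normSq_def']; simp [qArcI])

@[simp] lemma arcI_re (t : ℝ) : (arcI t : ℍ[ℝ]).re = Real.cos (Real.pi / 2 * t) := rfl
@[simp] lemma arcI_imI (t : ℝ) : (arcI t : ℍ[ℝ]).imI = Real.sin (Real.pi / 2 * t) := rfl
@[simp] lemma arcI_imJ (t : ℝ) : (arcI t : ℍ[ℝ]).imJ = 0 := rfl
@[simp] lemma arcI_imK (t : ℝ) : (arcI t : ℍ[ℝ]).imK = 0 := rfl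

def qArcK (t : ℝ) : ℍ[ℝ] :=
  ⟨Real.cos (Real.pi / 2 * t), 0, 0, Real.sin (Real.pi / 2 * t)⟩

def arcK (t : ℝ) : K := mkK (qArcK t) (by rw [Quaternion.normSq_def']; simp [qArcK])

@[simp] lemma arcK_re (t : ℝ) : (arcK t : ℍ[ℝ]).re = Real.cos (Real.pi / 2 * t) := rfl
@[simp] lemma arcK_imI (t : ℝ) : (arcK t : ℍ[ℝ]).imI = 0 := rfl
@[simp] lemma arcK_imJ (t : ℝ) : (arcK t : ℍ[ℝ]).imJ = 0 := rfl
@[simp] lemma arcK_imK (t : ℝ) : (arcK t : ℍ[ℝ]).imK = Real.sin (Real.pi / 2 * t) := rfl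

lemma continuous_arcI : Continuous arcI := by
  refine Continuous.subtype_mk ?_ _
  have e : qArcI =
      fun t => Real.cos (Real.pi / 2 * t) • (1 : ℍ[ℝ]) + Real.sin (Real.pi / 2 * t) • qI := by
    funext t
    apply QuaternionAlgebra.ext
    · change _ = _ * (1 : ℝ) + _ * (0 : ℝ); simp; rfl
    · change _ = _ * (0 : ℝ) + _ * (1 : ℝ); simp; rfl
    · change _ = _ * (0 : ℝ) + _ * (0 : ℝ); simp; rfl
    · change _ = _ * (0 : ℝ) + _ * (0 : ℝ); simp; rfl
  change Continuous qArcI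
  rw [e]
  fun_prop

lemma continuous_arcK : Continuous arcK := by
  refine Continuous.subtype_mk ?_ _
  have e : qArcK =
      fun t => Real.cos (Real.pi / 2 * t) • (1 : ℍ[ℝ]) + Real.sin (Real.pi / 2 * t) • qK := by
    funext t
    apply QuaternionAlgebra.ext
    · change _ = _ * (1 : ℝ) + _ * (0 : ℝ); simp; rfl
    · change _ = _ * (0 : ℝ) + _ * (0 : ℝ); simp; rfl
    · change _ = _ * (0 : ℝ) + _ * (0 : ℝ); simp; rfl
    · change _ = _ * (0 : ℝ) + _ * (1 : ℝ); simp; rfl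
  change Continuous qArcK
  rw [e]
  fun_prop

lemma arcI_zero : arcI 0 = 1 := by
  apply K_ext <;> simp only [arcI_re, arcI_imI, arcI_imJ, arcI_imK, mul_zero, Real.cos_zero,
    Real.sin_zero] <;> rfl

lemma arcK_zero : arcK 0 = 1 := by
  apply K_ext <;> simp only [arcK_re, arcK_imI, arcK_imJ, arcK_imK, mul_zero, Real.cos_zero,
    Real.sin_zero] <;> rfl

lemma arcI_one : arcI 1 = kI := by
  apply K_ext <;> simp only [arcI_re, arcI_imI, arcI_imJ, arcI_imK, mul_one, Real.cos_pi_div_two,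
    Real.sin_pi_div_two] <;> rfl

lemma arcK_one : arcK 1 = kK := by
  apply K_ext <;> simp only [arcK_re, arcK_imI, arcK_imJ, arcK_imK, mul_one, Real.cos_pi_div_two,
    Real.sin_pi_div_two] <;> rfl

lemma cos_sin_pos {t : ℝ} (ht : t ∈ Set.Ioo (0 : ℝ) 1) :
    0 < Real.cos (Real.pi / 2 * t) * Real.sin (Real.pi / 2 * t) := by
  have hp := Real.pi_pos
  have h1 : Real.pi / 2 * t < Real.pi / 2 := by nlinarith [ht.2]
  have h2 : 0 < Real.pi / 2 * t := by have := ht.1; positivity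
  exact mul_pos (Real.cos_pos_of_mem_Ioo ⟨by linarith, h1⟩) (Real.sin_pos_of_pos_of_lt_pi h2 (by linarith))

lemma mem_AN_of_act_one {v : G} (h1 : act v 1 = 1) : proj v ∈ AN := by
  have h := act_spec v 1
  rwa [h1, map_one, inv_one, one_mul, mul_one] at h

/-- The matrix `b'` with `b rot y = rot z b'`, where `z` is the image of `y` under `b`. -/
lemma exists_AN_mul (v : G) (y : K) : ∃ b ∈ AN,
    (proj v).1 * rotMat (y : ℍ[ℝ]) = rotMat (act v y : ℍ[ℝ]) * b.1 := by
  refine ⟨_, act_spec v y, ?_⟩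
  rw [← rot_coe, ← rot_coe, ← Matrix.SpecialLinearGroup.coe_mul,
    ← Matrix.SpecialLinearGroup.coe_mul]
  congr 1
  rw [mul_assoc (rot _)⁻¹, mul_inv_cancel_left]

/-- The matrix of `v` is in `AN`, so it preserves the line of the first basis vector. The arc from
`1` to `𝐢` consists of lifts of rotations about this axis, and so does its image, which can only end
at `±𝐢`. The matrix entry `(2, 1)` shows that `re · imI` stays positive on the way, so `sign_path`
yields `+𝐢`. -/
lemma act_kI_of_act_one {v : G} (h1 : act v 1 = 1) : act v kI = kI := by
  obtain ⟨hb1, hb2⟩ := mem_AN_of_act_one h1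
  have key : ∀ t, (act v (arcI t) : ℍ[ℝ]).imJ = 0 ∧ (act v (arcI t) : ℍ[ℝ]).imK = 0 ∧
      (∃ p > 0, (act v (arcI t) : ℍ[ℝ]).re * (act v (arcI t) : ℍ[ℝ]).imI =
        p * (Real.cos (Real.pi / 2 * t) * Real.sin (Real.pi / 2 * t))) ∧
      (Real.cos (Real.pi / 2 * t) = 0 →
        (act v (arcI t) : ℍ[ℝ]).re ^ 2 < (act v (arcI t) : ℍ[ℝ]).imI ^ 2) := by
    intro t
    obtain ⟨b', ⟨hb1', hb2'⟩, h⟩ := exists_AN_mul v (arcI t)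
    have E := fun i j => congrFun (congrFun h i) j
    rw [rotMat_eq, rotMat_eq] at E
    simp only [Matrix.mul_apply, Fin.sum_univ_three] at E
    generalize act v (arcI t) = z at *
    have hcs := Real.cos_sq_add_sin_sq (Real.pi / 2 * t)
    have l10 := hb1 1 0 (by decide)
    have l20 := hb1 2 0 (by decide)
    have l21 := hb1 2 1 (by decide)
    have m10 := hb1' 1 0 (by decide)
    have m20 := hb1' 2 0 (by decide)
    have m21 := hb1' 2 1 (by decide)
    have E00 := E 0 0
    have E10 := E 1 0
    have E20 := E 2 0
    have E21 := E 2 1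
    have E11 := E 1 1
    have p0 := hb2 0
    have p1 := hb2 1
    have p2 := hb2 2
    have q0 := hb2' 0
    have q1 := hb2' 1
    simp [l10, l20, l21, m10, m20, m21] at E00 E10 E20 E21 E11
    have hn := coords_sq z
    generalize (z : ℍ[ℝ]).re = a at *
    generalize (z : ℍ[ℝ]).imI = b at *
    generalize (z : ℍ[ℝ]).imJ = c at *
    generalize (z : ℍ[ℝ]).imK = d at *
    generalize Real.cos (Real.pi / 2 * t) = C at *
    generalize Real.sin (Real.pi / 2 * t) = S at *
    have e10 : b * c + a * d = 0 := E10.resolve_right q0.ne'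
    have e20 : b * d - a * c = 0 := E20.resolve_right q0.ne'
    have hpos : a ^ 2 + b ^ 2 ≠ 0 := by
      intro h0
      have h3 : a ^ 2 + b ^ 2 - c ^ 2 - d ^ 2 ≤ 0 := by nlinarith [sq_nonneg d, sq_nonneg c]
      nlinarith [mul_nonneg (neg_nonneg.2 h3) q0.le]
    have hc : c = 0 := by
      have : c * (a ^ 2 + b ^ 2) = 0 := by linear_combination b * e10 - a * e20
      exact (mul_eq_zero.1 this).resolve_right hpos
    have hd : d = 0 := by
      have : d * (a ^ 2 + b ^ 2) = 0 := by linear_combination a * e10 + b * e20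
      exact (mul_eq_zero.1 this).resolve_right hpos
    subst hc hd
    refine ⟨rfl, rfl, ⟨(proj v).1 2 2 / b'.1 1 1, div_pos p2 q1, ?_⟩, fun hC => ?_⟩
    · field_simp
      linarith
    · subst hC
      by_contra hneg
      have h3 : 0 ≤ a ^ 2 - b ^ 2 := by linarith
      nlinarith [mul_nonneg h3 q1.le]
  obtain ⟨hJ, hK, ⟨p, hp, hab⟩, hlt⟩ := key 1
  have hc1 : Real.cos (Real.pi / 2 * 1) = 0 := by simp
  rw [hc1, zero_mul, mul_zero] at hab
  have hcont := (continuous_act v).comp continuous_arcI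
  have hn := coords_sq (act v (arcI 1))
  rw [hJ, hK] at hn
  have hs := sign_path (α := fun t => (act v (arcI t) : ℍ[ℝ]).re)
    (β := fun t => (act v (arcI t) : ℍ[ℝ]).imI) (continuous_re_K.comp hcont)
    (Quaternion.continuous_imI.comp (continuous_subtype_val.comp hcont))
    (by simp only [arcI_zero, h1]; rfl)
    (fun t ht => by
      obtain ⟨-, -, ⟨p, hp, h⟩, -⟩ := key t
      simp only [h]
      exact mul_pos hp (cos_sin_pos ht)) hab (hlt hc1) (by linarith)
  rw [← arcI_one]
  apply K_ext
  · rw [hs.1]; simp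
  · rw [hs.2]; simp
  · rw [hJ]; simp
  · rw [hK]; simp

/-- The same argument for the plane of the first two basis vectors and rotations about the third
axis; the entry `(1, 0)` controls the sign. -/
lemma act_kK_of_act_one {v : G} (h1 : act v 1 = 1) : act v kK = kK := by
  obtain ⟨hb1, hb2⟩ := mem_AN_of_act_one h1
  have key : ∀ t, (act v (arcK t) : ℍ[ℝ]).imI = 0 ∧ (act v (arcK t) : ℍ[ℝ]).imJ = 0 ∧
      (∃ p > 0, (act v (arcK t) : ℍ[ℝ]).re * (act v (arcK t) : ℍ[ℝ]).imK =
        p * (Real.cos (Real.pi / 2 * t) * Real.sin (Real.pi / 2 * t))) ∧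
      (Real.cos (Real.pi / 2 * t) = 0 →
        (act v (arcK t) : ℍ[ℝ]).re ^ 2 < (act v (arcK t) : ℍ[ℝ]).imK ^ 2) := by
    intro t
    obtain ⟨b', ⟨hb1', hb2'⟩, h⟩ := exists_AN_mul v (arcK t)
    have E := fun i j => congrFun (congrFun h i) j
    rw [rotMat_eq, rotMat_eq] at E
    simp only [Matrix.mul_apply, Fin.sum_univ_three] at E
    generalize act v (arcK t) = z at *
    have hcs := Real.cos_sq_add_sin_sq (Real.pi / 2 * t)
    have l10 := hb1 1 0 (by decide)
    have l20 := hb1 2 0 (by decide)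
    have l21 := hb1 2 1 (by decide)
    have m10 := hb1' 1 0 (by decide)
    have m20 := hb1' 2 0 (by decide)
    have m21 := hb1' 2 1 (by decide)
    have E00 := E 0 0
    have E10 := E 1 0
    have E20 := E 2 0
    have E21 := E 2 1
    have E22 := E 2 2
    have p0 := hb2 0
    have p1 := hb2 1
    have p2 := hb2 2
    have q0 := hb2' 0
    have q1 := hb2' 1
    have q2 := hb2' 2
    simp [l10, l20, l21, m10, m20, m21] at E00 E10 E20 E21 E22
    have hn := coords_sq z
    generalize (z : ℍ[ℝ]).re = a at *
    generalize (z : ℍ[ℝ]).imI = b at *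
    generalize (z : ℍ[ℝ]).imJ = c at *
    generalize (z : ℍ[ℝ]).imK = d at *
    generalize Real.cos (Real.pi / 2 * t) = C at *
    generalize Real.sin (Real.pi / 2 * t) = S at *
    have e20 : b * d - a * c = 0 := E20.resolve_right q0.ne'
    have e21 : c * d + a * b = 0 := by
      rw [e20] at E21
      have : (c * d + a * b) * b'.1 1 1 = 0 := by linarith
      exact (mul_eq_zero.1 this).resolve_right q1.ne'
    have hpos : a ^ 2 + d ^ 2 ≠ 0 := by
      intro h0
      rw [e20, e21] at E22
      have h3 : (a ^ 2 - b ^ 2 - c ^ 2 + d ^ 2) ≤ 0 := by nlinarith [sq_nonneg b, sq_nonneg c]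
      nlinarith [mul_nonneg (neg_nonneg.2 h3) q2.le]
    have hb : b = 0 := by
      have : b * (a ^ 2 + d ^ 2) = 0 := by linear_combination a * e21 + d * e20
      exact (mul_eq_zero.1 this).resolve_right hpos
    have hc : c = 0 := by
      have : c * (a ^ 2 + d ^ 2) = 0 := by linear_combination d * e21 - a * e20
      exact (mul_eq_zero.1 this).resolve_right hpos
    subst hb hc
    refine ⟨rfl, rfl, ⟨(proj v).1 1 1 / b'.1 0 0, div_pos p1 q0, ?_⟩, fun hC => ?_⟩
    · field_simp
      linarith
    · subst hC
      by_contra hneg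
      have h3 : 0 ≤ a ^ 2 - d ^ 2 := by linarith
      nlinarith [mul_nonneg h3 q0.le]
  obtain ⟨hI, hJ, ⟨p, hp, hab⟩, hlt⟩ := key 1
  have hc1 : Real.cos (Real.pi / 2 * 1) = 0 := by simp
  rw [hc1, zero_mul, mul_zero] at hab
  have hcont := (continuous_act v).comp continuous_arcK
  have hn := coords_sq (act v (arcK 1))
  rw [hI, hJ] at hn
  have hs := sign_path (α := fun t => (act v (arcK t) : ℍ[ℝ]).re)
    (β := fun t => (act v (arcK t) : ℍ[ℝ]).imK) (continuous_re_K.comp hcont)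
    (Quaternion.continuous_imK.comp (continuous_subtype_val.comp hcont))
    (by simp only [arcK_zero, h1]; rfl)
    (fun t ht => by
      obtain ⟨-, -, ⟨p, hp, h⟩, -⟩ := key t
      simp only [h]
      exact mul_pos hp (cos_sin_pos ht)) hab (hlt hc1) (by linarith)
  rw [← arcK_one]
  apply K_ext
  · rw [hs.1]; simp
  · rw [hI]; simp
  · rw [hJ]; simp
  · rw [hs.2]; simp

/-- Composing `u` with embedded elements of `K` gives an element of `G` that fixes `1`, so it
suffices that all such elements fix `z`. -/
lemma act_eq_mul_act (u : G) (y z : K)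
    (h : ∀ v : G, act v 1 = 1 → act v z = z) : act u (y * z) = act u y * z := by
  have e : u * embK y = embK (act u y) * (embK (act u y)⁻¹ * (u * embK y)) := by
    rw [map_inv, mul_inv_cancel_left]
  have hv : act (embK (act u y)⁻¹ * (u * embK y)) 1 = 1 := by
    rw [act_mul, act_mul, act_embK, act_embK, mul_one, inv_mul_cancel]
  calc act u (y * z) = act (u * embK y) z := by rw [act_mul, act_embK]
    _ = _ := by rw [e, act_mul, h _ hv, act_embK]

lemma act_mul_kI (u : G) (y : K) : act u (y * kI) = act u y * kI :=
  act_eq_mul_act u y kI fun _ => act_kI_of_act_one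

lemma act_mul_kK (u : G) (y : K) : act u (y * kK) = act u y * kK :=
  act_eq_mul_act u y kK fun _ => act_kK_of_act_one

/-- The unit quaternions over diagonal matrices are products of `𝐢` and `𝐤`. -/
lemma diag_induction {P : K → Prop} (hI : P kI) (hK : P kK) (hm : ∀ y z, P y → P z → P (y * z))
    {y : K} (hy : ∀ i j, j < i → rotMat (y : ℍ[ℝ]) i j = 0) : P y := by
  have hneg1 : P (-1) := by
    have : (-1 : K) = kI * kI := by
      apply K_ext <;> simp [K_mul_re, K_mul_imI, K_mul_imJ, K_mul_imK]
    rw [this]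
    exact hm _ _ hI hI
  have h1 : P 1 := by
    have : (1 : K) = (-1) * (-1) := by simp
    rw [this]
    exact hm _ _ hneg1 hneg1
  have hneg : ∀ y, P y → P (-y) := fun y h => by
    rw [← neg_one_mul]
    exact hm _ _ hneg1 h
  have hJ := hm _ _ hK hI
  have e10 := hy 1 0 (by decide)
  have e20 := hy 2 0 (by decide)
  have e21 := hy 2 1 (by decide)
  have hn := coords_sq y
  rw [rotMat_eq] at e10 e20 e21
  simp at e10 e20 e21
  have key : ∀ x : ℝ, x ^ 2 = 1 → x = 1 ∨ x = -1 := fun x hx => by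
    rcases mul_eq_zero.1 (show (x - 1) * (x + 1) = 0 by linarith) with h | h
    · left; linarith
    · right; linarith
  generalize ha : (y : ℍ[ℝ]).re = a at *
  generalize hb : (y : ℍ[ℝ]).imI = b at *
  generalize hc : (y : ℍ[ℝ]).imJ = c at *
  generalize hd : (y : ℍ[ℝ]).imK = d at *
  have fin : ∀ z : K, P z → (y = z ∨ y = -z) → P y := by
    rintro z hz (rfl | rfl)
    · exact hz
    · exact hneg _ hz
  by_cases a0 : a = 0
  · subst a0
    by_cases b0 : b = 0
    · subst b0
      by_cases c0 : c = 0
      · subst c0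
        refine fin kK hK ((key d (by linarith)).imp (fun h => ?_) fun h => ?_) <;>
          apply K_ext <;> simp [*]
      · have d0 : d = 0 := by simpa [c0] using e21
        subst d0
        refine fin _ hJ ((key c (by linarith)).imp (fun h => ?_) fun h => ?_) <;>
          apply K_ext <;> simp [K_mul_re, K_mul_imI, K_mul_imJ, K_mul_imK, *]
    · have c0 : c = 0 := by simpa [b0] using e10
      have d0 : d = 0 := by simpa [b0] using e20
      subst c0 d0
      refine fin kI hI ((key b (by linarith)).imp (fun h => ?_) fun h => ?_) <;>
        apply K_ext <;> simp [*]
  · have hpos : a ^ 2 + b ^ 2 ≠ 0 := by positivity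
    have hpos' : a ^ 2 + d ^ 2 ≠ 0 := by positivity
    have hc0 : c = 0 := by
      have : c * (a ^ 2 + b ^ 2) = 0 := by linear_combination b * e10 - a * e20
      exact (mul_eq_zero.1 this).resolve_right hpos
    have hd0 : d = 0 := by
      have : d * (a ^ 2 + b ^ 2) = 0 := by linear_combination a * e10 + b * e20
      exact (mul_eq_zero.1 this).resolve_right hpos
    have hb0 : b = 0 := by
      have : b * (a ^ 2 + d ^ 2) = 0 := by linear_combination a * e21 + d * e20
      exact (mul_eq_zero.1 this).resolve_right hpos'
    subst hc0 hd0 hb0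
    refine fin 1 h1 ((key a (by linarith)).imp (fun h => ?_) fun h => ?_) <;>
      apply K_ext <;> simp [*]

/-- The rotation differs from the triangular matrix of `q` by a factor in `AN`, so it is triangular
as well; by `diag_induction` the `K`-component of `q` then lies in `M`. -/
lemma rotMat_kPart_low {q : G} (hq : q ∈ B) (i j : Fin 3) (hij : j < i) :
    rotMat (kPart q : ℍ[ℝ]) i j = 0 := by
  have h := act_spec q 1
  rw [map_one, mul_one] at h
  have h2 := AN.inv_mem h
  have e : rotMat (kPart q : ℍ[ℝ]) = (proj q).1 * (((rot (act q 1))⁻¹ * proj q)⁻¹).1 := by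
    rw [← Matrix.SpecialLinearGroup.coe_mul, mul_inv_rev, inv_inv, mul_inv_cancel_left]
    rfl
  have h1 : Matrix.BlockTriangular (proj q).1 (id : Fin 3 → Fin 3) := fun i j hij => hq i j hij
  have h3 : Matrix.BlockTriangular (((rot (act q 1))⁻¹ * proj q)⁻¹).1 (id : Fin 3 → Fin 3) :=
    fun i j hij => h2.1 i j hij
  rw [e]
  exact h1.mul h3 hij

/-- The action of `G` on `K` commutes with right multiplication by `M`, since it does so for the
generators `𝐢` and `𝐤`. This makes the `K`-component multiplicative under right multiplication by
`B`. -/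
lemma act_mul_kPart {q : G} (hq : q ∈ B) (u : G) (y : K) : act u (y * kPart q) = act u y * kPart q := by
  refine diag_induction (P := fun m => ∀ y, act u (y * m) = act u y * m) (act_mul_kI u)
    (act_mul_kK u) (fun m n hm hn y => ?_) (rotMat_kPart_low hq) y
  rw [← mul_assoc, hn, hm, mul_assoc]

end SL3Kernel

/-! ### Second-order differential calculus on `G` -/

namespace SL3Kernel

open scoped Topology
open Filter

/-! ### Right differentiation of smooth functions -/

section
open scoped Matrix.Norms.Operator

lemma hasDerivAt_Ad_expG {X Y : Mat3} (hX : X.trace = 0) (i j : Fin 3) :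
    HasDerivAt (fun t : ℝ => Ad (expG (t • X)) Y i j) ((X * Y - Y * X) i j) 0 := by
  have h1 := hasDerivAt_exp_smul_const (𝕂 := ℝ) X (0 : ℝ)
  have h2 := hasDerivAt_exp_smul_const (𝕂 := ℝ) (-X) (0 : ℝ)
  have h := (h1.mul_const Y).mul h2
  have e : ∀ t : ℝ, Ad (expG (t • X)) Y =
      NormedSpace.exp (t • X) * Y * NormedSpace.exp (t • (-X)) := by
    intro t
    rw [Ad, ← map_inv, ← expG_neg (trace_smul_eq hX _), proj_expG (trace_smul_eq hX _),
      ← smul_neg, proj_expG (trace_smul_eq (by rw [Matrix.trace_neg, hX, neg_zero]) _)]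
  simp_rw [e]
  have h3 := (LinearMap.toContinuousLinearMap
    (Matrix.entryLinearMap ℝ ℝ i j : Mat3 →ₗ[ℝ] ℝ)).hasFDerivAt.comp_hasDerivAt 0 h
  refine h3.congr_deriv ?_
  simp [sub_eq_add_neg]
  rfl

end

/-- The space of coordinates of `𝔰𝔩(3,ℝ)`. -/
abbrev E9 : Type := Fin 3 → Fin 3 → ℝ

/-- The coordinates of a matrix. -/
def coordE (X : Mat3) : E9 := fun i j => X i j

lemma coordE_add (X Y : Mat3) : coordE (X + Y) = coordE X + coordE Y := rfl
lemma coordE_smul (t : ℝ) (X : Mat3) : coordE (t • X) = t • coordE X := rfl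

lemma slMat_smul_coordE {X : Mat3} (h : X.trace = 0) (t : ℝ) : slMat (t • coordE X) = t • X := by
  rw [slMat_smul]
  congr 1
  exact slMat_of_trace h

/-- `f` in the exponential chart at `g`. -/
def chart1 (f : G → V) (g : G) : E9 → V := fun c => f (g * expG (slMat c))

def chart2 (f : G → V) (g : G) : E9 × E9 → V := fun p => f (g * expG (slMat p.1) * expG (slMat p.2))

lemma Smooth.chart1 {f : G → V} (hf : Smooth f) (g : G) : ContDiff ℝ ∞ (chart1 f g) := by
  have h := (hf 1 g).comp (contDiff_pi.2 fun _ => contDiff_id :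
    ContDiff ℝ ∞ fun (c : E9) (_ : Fin 1) => c)
  have e : SL3Kernel.chart1 f g = _ := funext fun c => (by
    simp [SL3Kernel.chart1, List.ofFn_succ] : SL3Kernel.chart1 f g c =
      f (g * (List.ofFn fun _ : Fin 1 => expG (slMat c)).prod))
  rw [e]
  exact h

lemma Smooth.chart2 {f : G → V} (hf : Smooth f) (g : G) : ContDiff ℝ ∞ (chart2 f g) := by
  have h0 : ContDiff ℝ ∞ fun (p : E9 × E9) => (![p.1, p.2] : Fin 2 → E9) := by
    refine contDiff_pi.2 fun i => ?_
    fin_cases i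
    · exact contDiff_fst
    · exact contDiff_snd
  have h := (hf 2 g).comp h0
  have e : SL3Kernel.chart2 f g = _ := funext fun p => (by
    simp [SL3Kernel.chart2, List.ofFn_succ, mul_assoc] : SL3Kernel.chart2 f g p =
      f (g * (List.ofFn fun i : Fin 2 => expG (slMat ((![p.1, p.2] : Fin 2 → E9) i))).prod))
  rw [e]
  exact h

lemma Smooth.hasDerivAt {f : G → V} (hf : Smooth f) (g : G) {X : Mat3} (hX : X.trace = 0) :
    HasDerivAt (fun t : ℝ => f (g * expG (t • X))) (fderiv ℝ (SL3Kernel.chart1 f g) 0 (coordE X)) 0 := by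
  have h1 : HasFDerivAt (SL3Kernel.chart1 f g) (fderiv ℝ (SL3Kernel.chart1 f g) 0) ((0 : ℝ) • coordE X) := by
    rw [zero_smul]
    exact ((hf.chart1 g).differentiable (by simp) 0).hasFDerivAt
  have h2 : HasDerivAt (fun t : ℝ => t • coordE X) (coordE X) 0 := by
    simpa using (hasDerivAt_id (0 : ℝ)).smul_const (coordE X)
  refine (h1.comp_hasDerivAt 0 h2).congr_of_eventuallyEq (Eventually.of_forall fun t => ?_)
  simp only [Function.comp_apply, SL3Kernel.chart1, slMat_smul_coordE hX]

lemma Smooth.rDeriv_eq {f : G → V} (hf : Smooth f) (g : G) {X : Mat3} (hX : X.trace = 0) :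
    rDeriv X f g = fderiv ℝ (SL3Kernel.chart1 f g) 0 (coordE X) := (hf.hasDerivAt g hX).deriv

lemma Smooth.hasDerivAt_rDeriv_self {f : G → V} (hf : Smooth f) (g : G) {X : Mat3} (hX : X.trace = 0) :
    HasDerivAt (fun t : ℝ => f (g * expG (t • X))) (rDeriv X f g) 0 := by
  rw [hf.rDeriv_eq g hX]; exact hf.hasDerivAt g hX

/-- The second derivative of `f` along `g exp X exp Y`. -/
def snd (f : G → V) (g : G) (X Y : Mat3) : V :=
  fderiv ℝ (fderiv ℝ (chart2 f g)) 0 (coordE X, 0) (0, coordE Y)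

lemma Smooth.rDeriv_mul_expG {f : G → V} (hf : Smooth f) (g : G) {X Y : Mat3} (hX : X.trace = 0)
    (hY : Y.trace = 0) (t : ℝ) : rDeriv Y f (g * expG (t • X)) =
      fderiv ℝ (SL3Kernel.chart2 f g) (t • coordE X, 0) (0, coordE Y) := by
  have h1 : HasFDerivAt (SL3Kernel.chart2 f g) (fderiv ℝ (SL3Kernel.chart2 f g) (t • coordE X, 0))
      (t • coordE X, (0 : ℝ) • coordE Y) := by
    rw [zero_smul]
    exact ((hf.chart2 g).differentiable (by simp) _).hasFDerivAt
  have h2 : HasDerivAt (fun s : ℝ => (t • coordE X, s • coordE Y)) (0, coordE Y) 0 := by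
    refine (hasDerivAt_const _ _).prodMk ?_
    simpa using (hasDerivAt_id (0 : ℝ)).smul_const (coordE Y)
  refine HasDerivAt.deriv ((h1.comp_hasDerivAt 0 h2).congr_of_eventuallyEq
    (Eventually.of_forall fun s => ?_))
  simp only [Function.comp_apply, SL3Kernel.chart2, slMat_smul_coordE hX, slMat_smul_coordE hY]

lemma hasDerivAt_fderiv_apply {E F : Type*} [NormedAddCommGroup E] [NormedSpace ℝ E]
    [NormedAddCommGroup F] [NormedSpace ℝ F] {H : E → F} (hH : ContDiff ℝ 2 H) {p v : ℝ → E}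
    {p' v' p₀ v₀ : E} {t : ℝ} (hp : HasDerivAt p p' t) (hv : HasDerivAt v v' t) (hp₀ : p t = p₀)
    (hv₀ : v t = v₀) :
    HasDerivAt (fun t => fderiv ℝ H (p t) (v t))
      (fderiv ℝ (fderiv ℝ H) p₀ p' v₀ + fderiv ℝ H p₀ v') t := by
  subst hp₀ hv₀
  have h1 : HasFDerivAt (fderiv ℝ H) (fderiv ℝ (fderiv ℝ H) (p t)) (p t) :=
    ((hH.fderiv_right (m := 1) (by norm_num)).differentiable (by simp) _).hasFDerivAt
  exact (h1.comp_hasDerivAt t hp).clm_apply hv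

lemma Smooth.hasDerivAt_rDeriv {f : G → V} (hf : Smooth f) (g : G) {X Y : Mat3} (hX : X.trace = 0)
    (hY : Y.trace = 0) :
    HasDerivAt (fun t : ℝ => rDeriv Y f (g * expG (t • X))) (snd f g X Y) 0 := by
  simp_rw [hf.rDeriv_mul_expG g hX hY]
  have h2 : HasDerivAt (fun t : ℝ => ((t • coordE X, 0) : E9 × E9)) (coordE X, 0) 0 := by
    refine HasDerivAt.prodMk ?_ (hasDerivAt_const _ _)
    simpa using (hasDerivAt_id (0 : ℝ)).smul_const (coordE X)
  have h3 := hasDerivAt_fderiv_apply (contDiff_infty.1 (hf.chart2 g) 2) h2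
    (hasDerivAt_const (0 : ℝ) ((0, coordE Y) : E9 × E9))
    (p₀ := 0) (by rw [zero_smul]; rfl) rfl
  rw [map_zero, add_zero] at h3
  exact h3

lemma Smooth.rDeriv_rDeriv {f : G → V} (hf : Smooth f) (g : G) {X Y : Mat3} (hX : X.trace = 0)
    (hY : Y.trace = 0) : rDeriv X (rDeriv Y f) g = snd f g X Y :=
  (hf.hasDerivAt_rDeriv g hX hY).deriv

lemma snd_add_left (f : G → V) (g : G) (X X' Y : Mat3) :
    snd f g (X + X') Y = snd f g X Y + snd f g X' Y := by
  have : ((coordE (X + X'), 0) : E9 × E9) = (coordE X, 0) + (coordE X', 0) := by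
    rw [coordE_add, Prod.mk_add_mk, add_zero]
  rw [snd, this, map_add]
  rfl

lemma snd_smul_left (f : G → V) (g : G) (t : ℝ) (X Y : Mat3) :
    snd f g (t • X) Y = t • snd f g X Y := by
  have : ((coordE (t • X), 0) : E9 × E9) = t • (coordE X, 0) := by
    rw [coordE_smul, Prod.smul_mk, smul_zero]
  rw [snd, this, map_smul]
  rfl

lemma snd_add_right (f : G → V) (g : G) (X Y Y' : Mat3) :
    snd f g X (Y + Y') = snd f g X Y + snd f g X Y' := by
  have : ((0, coordE (Y + Y')) : E9 × E9) = (0, coordE Y) + (0, coordE Y') := by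
    rw [coordE_add, Prod.mk_add_mk, add_zero]
  rw [snd, this, map_add]
  rfl

lemma snd_smul_right (f : G → V) (g : G) (t : ℝ) (X Y : Mat3) :
    snd f g X (t • Y) = t • snd f g X Y := by
  have : ((0, coordE (t • Y)) : E9 × E9) = t • (0, coordE Y) := by
    rw [coordE_smul, Prod.smul_mk, smul_zero]
  rw [snd, this, map_smul]
  rfl

/-- Right differentiation is a representation of the Lie algebra: `XY - YX` acts as the bracket. The
derivative of `Y f` along `g exp(tX)` is computed a second time after `exp(tX)` has been moved to
the right of `exp(sY)`; the product rule then adds the derivative of `Ad(exp tX) Y`, the bracket, to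
the mixed second derivative in the other order. -/
lemma Smooth.snd_comm {f : G → V} (hf : Smooth f) (g : G) {X Y : Mat3} (hX : X.trace = 0)
    (hY : Y.trace = 0) : snd f g X Y = snd f g Y X + rDeriv (X * Y - Y * X) f g := by
  have hXY : (X * Y - Y * X).trace = 0 := by
    rw [Matrix.trace_sub, Matrix.trace_mul_comm, sub_self]
  have hd : HasDerivAt (fun t : ℝ => rDeriv Y f (g * expG (t • X)))
      (snd f g Y X + rDeriv (X * Y - Y * X) f g) 0 := by
    -- Uses `exp(tX) exp(sY) = exp(s Ad(exp tX) Y) exp(tX)`.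
    have e1 : ∀ t : ℝ, rDeriv Y f (g * expG (t • X)) =
        fderiv ℝ (SL3Kernel.chart2 f g) (0, t • coordE X) (coordE (Ad (expG (t • X)) Y), 0) := by
      intro t
      have hA := trace_Ad (expG (t • X)) hY
      have h1 : HasFDerivAt (SL3Kernel.chart2 f g) (fderiv ℝ (SL3Kernel.chart2 f g) (0, t • coordE X))
          ((0 : ℝ) • coordE (Ad (expG (t • X)) Y), t • coordE X) := by
        rw [zero_smul]
        exact ((hf.chart2 g).differentiable (by simp) _).hasFDerivAt
      have h2 : HasDerivAt (fun s : ℝ => (s • coordE (Ad (expG (t • X)) Y), t • coordE X))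
          (coordE (Ad (expG (t • X)) Y), 0) 0 := by
        refine HasDerivAt.prodMk ?_ (hasDerivAt_const _ _)
        simpa using (hasDerivAt_id (0 : ℝ)).smul_const (coordE (Ad (expG (t • X)) Y))
      refine HasDerivAt.deriv ((h1.comp_hasDerivAt 0 h2).congr_of_eventuallyEq
        (Eventually.of_forall fun s => ?_))
      simp only [Function.comp_apply, SL3Kernel.chart2, slMat_smul_coordE hX, slMat_smul_coordE hA]
      rw [mul_assoc, mul_assoc, mul_expG _ (trace_smul_eq hY s), Ad_smul]
    simp_rw [e1]
    have h2 : HasDerivAt (fun t : ℝ => ((0, t • coordE X) : E9 × E9)) (0, coordE X) 0 := by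
      refine (hasDerivAt_const _ _).prodMk ?_
      simpa using (hasDerivAt_id (0 : ℝ)).smul_const (coordE X)
    have h3 : HasDerivAt (fun t : ℝ => ((coordE (Ad (expG (t • X)) Y), 0) : E9 × E9))
        (coordE (X * Y - Y * X), 0) 0 := by
      refine HasDerivAt.prodMk ?_ (hasDerivAt_const _ _)
      exact hasDerivAt_pi.2 fun i => hasDerivAt_pi.2 fun j => hasDerivAt_Ad_expG hX i j
    have e0 : Ad (expG ((0 : ℝ) • X)) Y = Y := by
      rw [zero_smul, expG_zero, Ad]
      simp
    have h3' := hasDerivAt_fderiv_apply (contDiff_infty.1 (hf.chart2 g) 2) h2 h3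
      (p₀ := 0) (by rw [zero_smul]; rfl) (by rw [e0])
    refine h3'.congr_deriv ?_
    have hsym : IsSymmSndFDerivAt ℝ (SL3Kernel.chart2 f g) 0 :=
      (contDiff_infty.1 (hf.chart2 g) 2).contDiffAt.isSymmSndFDerivAt (by simp)
    rw [hsym.eq]
    refine congrArg₂ (· + ·) rfl ?_
    have h5 : HasFDerivAt (SL3Kernel.chart2 f g) (fderiv ℝ (SL3Kernel.chart2 f g) 0)
        ((0 : ℝ) • coordE (X * Y - Y * X), 0) := by
      rw [zero_smul]
      exact ((hf.chart2 g).differentiable (by simp) _).hasFDerivAt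
    have h6 : HasDerivAt (fun s : ℝ => ((s • coordE (X * Y - Y * X), 0) : E9 × E9))
        (coordE (X * Y - Y * X), 0) 0 := by
      refine HasDerivAt.prodMk ?_ (hasDerivAt_const _ _)
      simpa using (hasDerivAt_id (0 : ℝ)).smul_const (coordE (X * Y - Y * X))
    have e4 : ∀ s : ℝ, f (g * expG (s • (X * Y - Y * X))) =
        SL3Kernel.chart2 f g (s • coordE (X * Y - Y * X), 0) := by
      intro s
      have e0 : slMat 0 = 0 := by simpa using slMat_smul 0 0
      simp only [SL3Kernel.chart2, slMat_smul_coordE hXY, e0, expG_zero, mul_one]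
    have h7 := h5.comp_hasDerivAt 0 h6
    rw [rDeriv]
    simp_rw [e4]
    exact h7.deriv.symm
  exact (hf.hasDerivAt_rDeriv g hX hY).unique hd

end SL3Kernel

/-! ### Reduction of `D` to a single entry -/

namespace SL3Kernel

open scoped Topology
open Filter

/-! ### Right differentiation on the induced representation -/

/-- `X ↦ Ψ(X, f)(g)`, on traceless matrices. -/
def drv (f : G → V) (g : G) : Mat3 →ₗ[ℝ] V where
  toFun X := fderiv ℝ (chart1 f g) 0 (coordE X)
  map_add' X Y := by rw [coordE_add, map_add]
  map_smul' t X := by rw [coordE_smul, map_smul]; rfl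

lemma Smooth.rDeriv_eq_drv {f : G → V} (hf : Smooth f) (g : G) {X : Mat3} (hX : X.trace = 0) :
    rDeriv X f g = drv f g X := hf.rDeriv_eq g hX

/-- `snd` as a bilinear map. -/
def sndL (f : G → V) (g : G) : Mat3 →ₗ[ℝ] Mat3 →ₗ[ℝ] V :=
  LinearMap.mk₂ ℝ (snd f g) (snd_add_left f g) (snd_smul_left f g) (snd_add_right f g)
    (fun t X Y => snd_smul_right f g t X Y)

lemma sndL_apply (f : G → V) (g : G) (X Y : Mat3) : sndL f g X Y = snd f g X Y := rfl

lemma trace_T (i j : Fin 3) : (T i j).trace = 0 := by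
  rw [T, Matrix.trace_sub, Matrix.trace_smul, Matrix.trace_one]
  by_cases h : i = j
  · subst h; simp
  · rw [Matrix.trace_single_eq_of_ne _ _ _ h]; simp [h]

lemma trace_comm (X Y : Mat3) : (X * Y - Y * X).trace = 0 := by
  rw [Matrix.trace_sub, Matrix.trace_mul_comm, sub_self]

lemma isUpper_T {i j : Fin 3} (h : i ≤ j) : IsUpper (T i j) := by
  refine ⟨fun k l hkl => ?_, trace_T i j⟩
  have h1 : k ≠ l := hkl.ne'
  simp only [T, Matrix.sub_apply, Matrix.smul_apply, Matrix.one_apply_ne h1, smul_zero, sub_zero]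
  rw [Matrix.single_apply_of_ne]
  rintro ⟨rfl, rfl⟩
  exact absurd h (not_le.2 hkl)

/-- The scalar corrections are central, so these are the relations of the matrix units; for `i = l`,
`j = k` the corrections of the two diagonal terms cancel. -/
lemma T_commutator (i j k l : Fin 3) : T i j * T k l - T k l * T i j =
    (if j = k then T i l else 0) - (if l = i then T k j else 0) := by
  have h0 : T i j * T k l - T k l * T i j = Matrix.single i j 1 * Matrix.single k l 1 -
      Matrix.single k l 1 * Matrix.single i j (1 : ℝ) := by
    simp only [T, mul_sub, sub_mul, mul_smul_comm, smul_mul_assoc, mul_one, one_mul]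
    simp only [smul_sub, smul_smul, mul_comm]
    abel
  rw [h0]
  by_cases h1 : j = k
  · subst h1
    by_cases h2 : l = i
    · subst h2
      simp [T]
    · rw [Matrix.single_mul_single_of_ne _ _ _ _ h2]
      simp [T, h2, Ne.symm h2]
  · rw [Matrix.single_mul_single_of_ne _ _ _ _ h1]
    by_cases h2 : l = i
    · subst h2
      simp [T, h1, Ne.symm h1]
    · rw [Matrix.single_mul_single_of_ne _ _ _ _ h2]
      simp [h1, h2]

/-- The coefficient of `∑ A i j T i k T k j - (a/3) A` at `A i j` in the operator `D`. -/
def Dcoeff (a : ℂ) (f : G → V) (g : G) (i j : Fin 3) : V :=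
  (∑ k, rDerivSym (T i k) (T k j) f g) + (a / 3) • rDeriv (T i j) f g

lemma Smooth.rDerivSym_eq {f : G → V} (hf : Smooth f) (g : G) {X Y : Mat3} (hX : X.trace = 0)
    (hY : Y.trace = 0) :
    rDerivSym X Y f g = snd f g X Y - (1 / 2 : ℂ) • drv f g (X * Y - Y * X) := by
  rw [rDerivSym, hf.rDeriv_rDeriv g hX hY, hf.rDeriv_rDeriv g hY hX, hf.snd_comm g hX hY,
    hf.rDeriv_eq_drv g (trace_comm X Y)]
  module

lemma sum_T_diag : ∑ k, T k k = 0 := by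
  rw [Fin.sum_univ_three]
  ext i j
  fin_cases i <;> fin_cases j <;> simp [T, Matrix.single_apply] <;> norm_num

/-- Undoing the symmetrization subtracts half of `∑ [T i k, T k j] = 3 T i j`, which explains the
shift by `3/2`. -/
lemma Smooth.Dcoeff_eq {f : G → V} (hf : Smooth f) (a : ℂ) (g : G) (i j : Fin 3) :
    Dcoeff a f g i j =
      (∑ k, sndL f g (T i k) (T k j)) + (a / 3 - 3 / 2) • drv f g (T i j) := by
  have h1 : ∑ k, drv f g (T i k * T k j - T k j * T i k) = (3 : ℂ) • drv f g (T i j) := by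
    rw [← map_sum]
    have : ∑ k, (T i k * T k j - T k j * T i k) = (3 : ℝ) • T i j := by
      simp only [T_commutator, if_true]
      rw [Finset.sum_sub_distrib]
      have h2 : ∑ k, (if j = i then T k k else 0) = 0 := by
        split_ifs
        · exact sum_T_diag
        · simp
      rw [h2, sub_zero]
      rw [Finset.sum_const, Finset.card_univ, Fintype.card_fin]
      module
    rw [this, map_smul]
    ext c
    simp
  rw [Dcoeff, Finset.sum_congr rfl fun k _ => hf.rDerivSym_eq g (trace_T i k) (trace_T k j),
    Finset.sum_sub_distrib, ← Finset.smul_sum, h1, hf.rDeriv_eq_drv g (trace_T i j)]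
  simp only [sndL_apply]
  module

/-! ### Upper triangular directions -/

/-- The character of `𝔟` that gives the right derivatives of functions in `Ind ν`. -/
def chi (ν : Fin 3 → ℂ) (X : Mat3) : ℂ := -∑ i, (X i i : ℂ) * ν i

lemma quatMat_one : quatMat 1 = 1 := by
  ext i j
  fin_cases i <;> fin_cases j <;> simp [quatMat, Complex.ext_iff]

lemma IsUpper.sigma_expG {X : Mat3} (h : IsUpper X) (ν : Fin 3 → ℂ) (t : ℝ) :
    sigma ν (expG (t • X))⁻¹ = Complex.exp (t * chi ν X) • (1 : Matrix (Fin 2) (Fin 2) ℂ) := by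
  rw [← expG_neg (h.smul t).tr, ← neg_smul, sigma, (h.smul (-t)).kPart_expG]
  congr 1
  · have h1 : ∀ i, (((|(proj (expG (-t • X))).1 i i| : ℝ) : ℂ)) ^ ν i =
        Complex.exp (-t * X i i * ν i) := by
      intro i
      rw [proj_expG (h.smul (-t)).tr, h.exp_diag, abs_of_pos (Real.exp_pos _),
        Complex.cpow_def_of_ne_zero (by exact_mod_cast (Real.exp_pos _).ne'), ← Complex.ofReal_log
        (Real.exp_pos _).le, Real.log_exp]
      push_cast
      rfl
    rw [aChar, Finset.prod_congr rfl fun i _ => h1 i, ← Complex.exp_sum, chi]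
    congr 1
    rw [mul_neg, Finset.mul_sum, ← Finset.sum_neg_distrib]
    exact Finset.sum_congr rfl fun i _ => by ring
  · exact quatMat_one

lemma Ind.expG_upper {ν : Fin 3 → ℂ} {f : G → V} (hf : f ∈ Ind ν) {X : Mat3} (h : IsUpper X)
    (g : G) (t : ℝ) : f (g * expG (t • X)) = Complex.exp (t * chi ν X) • f g := by
  rw [hf.2 g _ (h.smul t).expG_mem_B, h.sigma_expG, Matrix.smul_mulVec, Matrix.one_mulVec]

lemma Ind.rDeriv_upper {ν : Fin 3 → ℂ} {f : G → V} (hf : f ∈ Ind ν) {X : Mat3} (h : IsUpper X) :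
    rDeriv X f = chi ν X • f := by
  funext g
  rw [rDeriv]
  simp_rw [Ind.expG_upper hf h g]
  have h1 : HasDerivAt (fun t : ℝ => Complex.exp (t * chi ν X)) (chi ν X) 0 := by
    have h2 : HasDerivAt (fun t : ℝ => (t : ℂ) * chi ν X) (chi ν X) 0 := by
      simpa using (Complex.ofRealCLM.hasDerivAt (x := (0 : ℝ))).mul_const (chi ν X)
    simpa using h2.cexp
  exact (h1.smul_const (f g)).deriv

/-- In `Ψ(YX, f)` the right factor `X` acts first, and `f` is an eigenfunction of it. The reductions
below therefore move upper triangular factors to the right. -/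
lemma Ind.snd_upper {ν : Fin 3 → ℂ} {f : G → V} (hf : f ∈ Ind ν) {X Y : Mat3} (h : IsUpper X)
    (hY : Y.trace = 0) (g : G) : snd f g Y X = chi ν X • drv f g Y := by
  rw [← hf.1.rDeriv_rDeriv g hY h.tr, Ind.rDeriv_upper hf h, ← hf.1.rDeriv_eq_drv g hY]
  exact ((hf.1.hasDerivAt_rDeriv_self g hY).const_smul (chi ν X)).deriv

lemma chi_T_lt (ν : Fin 3 → ℂ) {i j : Fin 3} (h : i < j) : chi ν (T i j) = 0 := by
  rw [chi, neg_eq_zero]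
  refine Finset.sum_eq_zero fun k _ => ?_
  have : T i j k k = 0 := by
    simp only [T, Matrix.sub_apply, if_neg h.ne, zero_smul, Matrix.zero_apply, sub_zero]
    rw [Matrix.single_apply_of_ne]
    rintro ⟨rfl, rfl⟩
    exact h.ne rfl
  simp [this]

/-- The entries of `lam2 (-a)` add up to zero, so the trace correction in `T i i` contributes
nothing. -/
lemma chi_T_diag (a : ℂ) (i : Fin 3) : chi (-lam2 (-a)) (T i i) = lam2 (-a) i := by
  rw [chi, Fin.sum_univ_three]
  fin_cases i <;> simp [T, lam2, Matrix.single_apply] <;> ring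

section Operator

variable {a : ℂ} {f : G → V}

lemma Ind.drv_lt (hf : f ∈ Ind (-lam2 (-a))) (g : G) {i j : Fin 3} (h : i < j) :
    drv f g (T i j) = 0 := by
  rw [← hf.1.rDeriv_eq_drv g (trace_T i j), Ind.rDeriv_upper hf (isUpper_T h.le), chi_T_lt _ h,
    zero_smul]
  rfl

lemma Ind.drv_diag (hf : f ∈ Ind (-lam2 (-a))) (g : G) (i : Fin 3) :
    drv f g (T i i) = lam2 (-a) i • f g := by
  rw [← hf.1.rDeriv_eq_drv g (trace_T i i), Ind.rDeriv_upper hf (isUpper_T le_rfl), chi_T_diag]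
  rfl

lemma Ind.snd_lt (hf : f ∈ Ind (-lam2 (-a))) (g : G) {i j : Fin 3} (h : i < j) (k l : Fin 3) :
    sndL f g (T k l) (T i j) = 0 := by
  rw [sndL_apply, Ind.snd_upper hf (isUpper_T h.le) (trace_T k l), chi_T_lt _ h, zero_smul]

lemma Ind.snd_diag (hf : f ∈ Ind (-lam2 (-a))) (g : G) (i k l : Fin 3) :
    sndL f g (T k l) (T i i) = lam2 (-a) i • drv f g (T k l) := by
  rw [sndL_apply, Ind.snd_upper hf (isUpper_T le_rfl) (trace_T k l), chi_T_diag]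

lemma Smooth.snd_T_comm (hf : Smooth f) (g : G) (i j k l : Fin 3) :
    sndL f g (T i j) (T k l) = sndL f g (T k l) (T i j) +
      ((if j = k then drv f g (T i l) else 0) - (if l = i then drv f g (T k j) else 0)) := by
  rw [sndL_apply, sndL_apply, hf.snd_comm g (trace_T i j) (trace_T k l),
    hf.rDeriv_eq_drv g (trace_comm _ _), T_commutator, map_sub]
  congr 2 <;> split_ifs <;> simp

lemma Ind.snd_lt_left (hf : f ∈ Ind (-lam2 (-a))) (g : G) {i j : Fin 3} (h : i < j) (k l : Fin 3) :
    sndL f g (T i j) (T k l) =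
      (if j = k then drv f g (T i l) else 0) - (if l = i then drv f g (T k j) else 0) := by
  rw [hf.1.snd_T_comm, Ind.snd_lt hf g h, zero_add]

lemma Ind.snd_diag_left (hf : f ∈ Ind (-lam2 (-a))) (g : G) (i k l : Fin 3) :
    sndL f g (T i i) (T k l) = lam2 (-a) i • drv f g (T k l) +
      ((if i = k then drv f g (T i l) else 0) - (if l = i then drv f g (T k i) else 0)) := by
  rw [hf.1.snd_T_comm, Ind.snd_diag hf]

/-- All three diagonal entries are the same scalar multiple of `f`: this is where the special form
of `λ(2,-a)` enters, and it lets them cancel against a traceless `A`. -/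
lemma Ind.Dcoeff_diag (hf : f ∈ Ind (-lam2 (-a))) (g : G) (i : Fin 3) :
    Dcoeff a f g i i = (2 * a ^ 2 / 9 - 1 / 2) • f g := by
  have l01 : (0 : Fin 3) < 1 := by decide
  have l02 : (0 : Fin 3) < 2 := by decide
  have l12 : (1 : Fin 3) < 2 := by decide
  rw [hf.1.Dcoeff_eq, Fin.sum_univ_three]
  fin_cases i
  all_goals
    simp only [Fin.zero_eta, Fin.mk_one, Fin.reduceFinMk, Ind.snd_diag hf, Ind.drv_diag hf,
      Ind.snd_lt hf g l01, Ind.snd_lt hf g l02, Ind.snd_lt hf g l12, Ind.snd_lt_left hf g l01,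
      Ind.snd_lt_left hf g l02, Ind.snd_lt_left hf g l12, if_true]
    simp only [lam2, Matrix.cons_val]
    module

/-- Above the diagonal everything is a derivative along `N`. At `(1, 0)` and `(2, 1)` what remains
is a multiple of one first derivative; its coefficient, made up of two entries of `λ`, the
commutators and `a/3 - 3/2`, is zero. -/
lemma Ind.Dcoeff_eq_zero (hf : f ∈ Ind (-lam2 (-a))) (g : G) {i j : Fin 3} (hij : i ≠ j)
    (h : ¬ (i = 2 ∧ j = 0)) : Dcoeff a f g i j = 0 := by
  have l01 : (0 : Fin 3) < 1 := by decide
  have l02 : (0 : Fin 3) < 2 := by decide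
  have l12 : (1 : Fin 3) < 2 := by decide
  rw [hf.1.Dcoeff_eq, Fin.sum_univ_three]
  fin_cases i <;> fin_cases j
  all_goals first | exact absurd rfl hij | exact absurd ⟨rfl, rfl⟩ h | skip
  all_goals
    simp only [Fin.zero_eta, Fin.mk_one, Fin.reduceFinMk, Ind.snd_diag hf, Ind.drv_diag hf,
      Ind.snd_diag_left hf, Ind.drv_lt hf g l01, Ind.drv_lt hf g l02, Ind.drv_lt hf g l12,
      Ind.snd_lt hf g l01, Ind.snd_lt hf g l02, Ind.snd_lt hf g l12, Ind.snd_lt_left hf g l01,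
      Ind.snd_lt_left hf g l02, Ind.snd_lt_left hf g l12, if_true, smul_zero, add_zero]
    simp
    try simp only [lam2, Matrix.cons_val]
    try module

lemma Ind.D_apply (hf : f ∈ Ind (-lam2 (-a))) (g : G)
    (A : {A : Matrix (Fin 3) (Fin 3) ℂ // A.trace = 0}) :
    D a f g A = A.1 2 0 • Dcoeff a f g 2 0 := by
  have hA := A.2
  rw [Matrix.trace_fin_three] at hA
  have h0 : D a f g A = ∑ i, ∑ j, A.1 i j • Dcoeff a f g i j := rfl
  rw [h0]
  simp only [Fin.sum_univ_three, Ind.Dcoeff_diag hf]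
  rw [Ind.Dcoeff_eq_zero hf g (i := 0) (j := 1) (by decide) (by decide),
    Ind.Dcoeff_eq_zero hf g (i := 0) (j := 2) (by decide) (by decide),
    Ind.Dcoeff_eq_zero hf g (i := 1) (j := 0) (by decide) (by decide),
    Ind.Dcoeff_eq_zero hf g (i := 1) (j := 2) (by decide) (by decide),
    Ind.Dcoeff_eq_zero hf g (i := 2) (j := 1) (by decide) (by decide)]
  have h2 : A.1 2 2 = -A.1 0 0 - A.1 1 1 := by linear_combination hA
  rw [h2]
  module

lemma Ind.D_eq_zero_iff (hf : f ∈ Ind (-lam2 (-a))) :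
    D a f = 0 ↔ ∀ g, Dcoeff a f g 2 0 = 0 := by
  constructor
  · intro h g
    have h1 := congrFun (congrFun h g) ⟨Matrix.single 2 0 1,
      Matrix.trace_single_eq_of_ne _ _ _ (by decide)⟩
    rw [Ind.D_apply hf] at h1
    simpa using h1
  · intro h
    funext g A
    rw [Ind.D_apply hf, h, smul_zero]
    rfl

/-- Modulo derivatives along `N`, the lower triangular directions are directions in `𝔨₀`. -/
lemma T20_eq : T 2 0 = T 0 2 - rhoMat ![0, 1 / 2, 0] := by
  ext i j
  fin_cases i <;> fin_cases j <;> simp [T, rhoMat, Matrix.single_apply]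

lemma T10_eq : T 1 0 = T 0 1 + rhoMat ![0, 0, 1 / 2] := by
  ext i j
  fin_cases i <;> fin_cases j <;> simp [T, rhoMat, Matrix.single_apply]

lemma T21_eq : T 2 1 = T 1 2 + rhoMat ![1 / 2, 0, 0] := by
  ext i j
  fin_cases i <;> fin_cases j <;> simp [T, rhoMat, Matrix.single_apply]

/-- At `(2, 0)` the terms with a diagonal factor add up to `(a - 1/2) T 2 0`, and `T 2 1 T 1 0`
remains. Replacing the lower triangular matrices by elements of `𝔨₀` gives an operator that
differentiates only along `K`. -/
lemma Ind.Dcoeff_two_zero (hf : f ∈ Ind (-lam2 (-a))) (g : G) :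
    Dcoeff a f g 2 0 = sndL f g (rhoMat ![1 / 2, 0, 0]) (rhoMat ![0, 0, 1 / 2]) -
      (a - 1 / 2) • drv f g (rhoMat ![0, 1 / 2, 0]) := by
  have l01 : (0 : Fin 3) < 1 := by decide
  have l02 : (0 : Fin 3) < 2 := by decide
  have l12 : (1 : Fin 3) < 2 := by decide
  have h1 : sndL f g (rhoMat ![1 / 2, 0, 0]) (rhoMat ![0, 0, 1 / 2]) =
      sndL f g (T 2 1) (T 1 0) := by
    have e1 : rhoMat ![0, 0, 1 / 2] = T 1 0 - T 0 1 := by rw [T10_eq]; abel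
    have e2 : rhoMat ![1 / 2, 0, 0] = T 2 1 - T 1 2 := by rw [T21_eq]; abel
    rw [e1, e2]
    -- The correction `T 0 1` acts first and kills `f`; the correction `T 1 2` commutes with `T 1
    -- 0`, so it too can be moved to the right, where it kills `f`.
    simp only [map_sub, LinearMap.sub_apply, Ind.snd_lt hf g l01, Ind.snd_lt_left hf g l12]
    simp
  have h2 : drv f g (rhoMat ![0, 1 / 2, 0]) = - drv f g (T 2 0) := by
    have e1 : rhoMat ![0, 1 / 2, 0] = T 0 2 - T 2 0 := by rw [T20_eq]; abel
    rw [e1, map_sub, Ind.drv_lt hf g l02, zero_sub]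
  rw [h1, h2, hf.1.Dcoeff_eq, Fin.sum_univ_three, Ind.snd_diag hf, Ind.snd_diag_left hf]
  simp only [if_true]
  simp
  simp only [lam2, Matrix.cons_val]
  module

end Operator

end SL3Kernel

/-! ### Covariance under `B` and translation under `G` -/

namespace SL3Kernel

open scoped Topology
open Filter

/-! ### Covariance of the operator under `B` -/

section Covariance

variable {f : G → V} {ν : Fin 3 → ℂ}

lemma Ind.rDeriv_mul (hf : f ∈ Ind ν) {b : G} (hb : b ∈ B) (g : G) {X : Mat3} (hX : X.trace = 0) :
    rDeriv X f (g * b) = (sigma ν b⁻¹).mulVecLin (rDeriv (Ad b X) f g) := by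
  have h1 : ∀ t : ℝ, f (g * b * expG (t • X)) =
      (sigma ν b⁻¹).mulVecLin (f (g * expG (t • Ad b X))) := by
    intro t
    rw [mul_assoc, mul_expG b (trace_smul_eq hX t), ← mul_assoc, hf.2 _ b hb, Ad_smul]
    rfl
  rw [rDeriv]
  simp_rw [h1]
  have h2 := hf.1.hasDerivAt_rDeriv_self g (trace_Ad b hX)
  exact ((LinearMap.toContinuousLinearMap
    ((sigma ν b⁻¹).mulVecLin.restrictScalars ℝ)).hasFDerivAt.comp_hasDerivAt 0 h2).deriv

lemma Ind.snd_mul (hf : f ∈ Ind ν) {b : G} (hb : b ∈ B) (g : G) {X Y : Mat3} (hX : X.trace = 0)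
    (hY : Y.trace = 0) :
    snd f (g * b) X Y = (sigma ν b⁻¹).mulVecLin (snd f g (Ad b X) (Ad b Y)) := by
  have h1 : ∀ t : ℝ, rDeriv Y f (g * b * expG (t • X)) =
      (sigma ν b⁻¹).mulVecLin (rDeriv (Ad b Y) f (g * expG (t • Ad b X))) := by
    intro t
    rw [mul_assoc, mul_expG b (trace_smul_eq hX t), ← mul_assoc, Ind.rDeriv_mul hf hb _ hY, Ad_smul]
  rw [← hf.1.rDeriv_rDeriv _ hX hY, rDeriv]
  simp_rw [h1]
  have h2 := hf.1.hasDerivAt_rDeriv g (trace_Ad b hX) (trace_Ad b hY)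
  exact ((LinearMap.toContinuousLinearMap
    ((sigma ν b⁻¹).mulVecLin.restrictScalars ℝ)).hasFDerivAt.comp_hasDerivAt 0 h2).deriv

lemma Ad_T (b : G) (i j : Fin 3) :
    Ad b (T i j) = ∑ p, ∑ q, ((proj b).1 p i * ((proj b)⁻¹).1 j q) • T p q := by
  have h := slMat_of_trace (trace_Ad b (trace_T i j))
  have hc : ∀ p q, Ad b (T i j) p q = (proj b).1 p i * ((proj b)⁻¹).1 j q -
      (if i = j then (1 / 3 : ℝ) else 0) * (if p = q then 1 else 0) := by
    intro p q
    rw [Ad, T, mul_sub, sub_mul, mul_smul_comm, smul_mul_assoc, mul_one, proj_mul_inv,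
      Matrix.sub_apply, Matrix.smul_apply, Matrix.one_apply]
    congr 1
    rw [Matrix.mul_apply, Finset.sum_eq_single j]
    · rw [Matrix.mul_single_apply_same, mul_one]
    · intro k _ hk
      rw [Matrix.mul_single_apply_of_ne _ _ _ _ _ hk, zero_mul]
    · simp
  rw [← h, slMat]
  simp_rw [hc, sub_smul, Finset.sum_sub_distrib]
  rw [sub_eq_self]
  simp_rw [mul_smul, ← Finset.smul_sum, ite_smul, one_smul, zero_smul, Finset.sum_ite_eq,
    Finset.mem_univ, if_true]
  rw [sum_T_diag, smul_zero, ite_self]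

/-- Under conjugation the inner indices of `∑ T i k T k j` carry `b` and `b⁻¹`, which contract to
the identity; so this quadratic expression transforms as `T i j` does. -/
lemma sum_bilin_contract {M N : Type*} [AddCommGroup M] [Module ℝ M] [AddCommGroup N] [Module ℝ N]
    (S : M →ₗ[ℝ] M →ₗ[ℝ] N) (t : Fin 3 → Fin 3 → M) (β γ : Fin 3 → ℝ) (b c : Mat3)
    (hbc : b * c = 1) :
    ∑ k, S (∑ p, ∑ q, (β p * c k q) • t p q) (∑ p, ∑ q, (b p k * γ q) • t p q) =
      ∑ p, ∑ q, (β p * γ q) • ∑ k, S (t p k) (t k q) := by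
  have h1 : ∀ k, ∑ p, ∑ q, (β p * c k q) • t p q = ∑ q, c k q • ∑ p, β p • t p q := by
    intro k
    rw [Finset.sum_comm]
    refine Finset.sum_congr rfl fun q _ => ?_
    rw [Finset.smul_sum]
    exact Finset.sum_congr rfl fun p _ => by rw [smul_smul, mul_comm]
  have h2 : ∀ k, ∑ p, ∑ q, (b p k * γ q) • t p q = ∑ p, b p k • ∑ q, γ q • t p q := by
    intro k
    refine Finset.sum_congr rfl fun q _ => ?_
    rw [Finset.smul_sum]
    exact Finset.sum_congr rfl fun p _ => by rw [smul_smul]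
  simp_rw [h1, h2]
  set R : Fin 3 → M := fun q => ∑ p, β p • t p q with hR
  set C : Fin 3 → M := fun p => ∑ q, γ q • t p q with hC
  have h3 : ∀ k, S (∑ q, c k q • R q) (∑ p, b p k • C p) =
      ∑ q, ∑ p, (b p k * c k q) • S (R q) (C p) := by
    intro k
    rw [LinearMap.map_sum₂]
    refine Finset.sum_congr rfl fun q _ => ?_
    rw [map_sum]
    refine Finset.sum_congr rfl fun p _ => ?_
    rw [LinearMap.map_smul₂, map_smul, smul_smul, mul_comm]
  rw [Finset.sum_congr rfl fun k _ => h3 k, Finset.sum_comm]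
  have h4 : ∀ q, ∑ k, ∑ p, (b p k * c k q) • S (R q) (C p) = S (R q) (C q) := by
    intro q
    rw [Finset.sum_comm]
    simp_rw [← Finset.sum_smul, ← Matrix.mul_apply, hbc, Matrix.one_apply, ite_smul, one_smul,
      zero_smul]
    simp
  rw [Finset.sum_congr rfl fun q _ => h4 q]
  have h5 : ∀ q, S (R q) (C q) = ∑ p, ∑ r, (β p * γ r) • S (t p q) (t q r) := by
    intro q
    change S (∑ p, β p • t p q) (∑ r, γ r • t q r) = _
    rw [LinearMap.map_sum₂]
    refine Finset.sum_congr rfl fun p _ => ?_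
    rw [map_sum]
    refine Finset.sum_congr rfl fun r _ => ?_
    rw [LinearMap.map_smul₂, map_smul, smul_smul]
  simp_rw [h5, Finset.smul_sum]
  rw [Finset.sum_comm]
  exact Finset.sum_congr rfl fun p _ => Finset.sum_comm

/-- The element `x_A` depends on `A` equivariantly, so translation by `b` conjugates the matrix of
coefficients and applies the inducing representation. -/
lemma Ind.Dcoeff_mul (hf : f ∈ Ind ν) {b : G} (hb : b ∈ B) (a : ℂ) (g : G) (i j : Fin 3) :
    Dcoeff a f (g * b) i j = (sigma ν b⁻¹).mulVecLin
      (∑ p, ∑ q, ((proj b).1 p i * ((proj b)⁻¹).1 j q) • Dcoeff a f g p q) := by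
  have h1 : ∀ X : Mat3, X.trace = 0 →
      drv f (g * b) X = (sigma ν b⁻¹).mulVecLin (drv f g (Ad b X)) := by
    intro X hX
    rw [← hf.1.rDeriv_eq_drv _ hX, Ind.rDeriv_mul hf hb g hX, hf.1.rDeriv_eq_drv _ (trace_Ad b hX)]
  rw [hf.1.Dcoeff_eq]
  simp_rw [sndL_apply]
  rw [Finset.sum_congr rfl fun k _ => Ind.snd_mul hf hb g (trace_T i k) (trace_T k j),
    h1 _ (trace_T i j), ← map_sum, ← map_smul, ← map_add]
  congr 1
  simp_rw [← sndL_apply, Ad_T]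
  rw [sum_bilin_contract (sndL f g) T (fun p => (proj b).1 p i) (fun q => ((proj b)⁻¹).1 j q)
    (proj b).1 ((proj b)⁻¹).1 (proj_mul_inv b)]
  simp_rw [hf.1.Dcoeff_eq, smul_add, Finset.sum_add_distrib, map_sum, map_smul]
  congr 1
  rw [Finset.smul_sum]
  refine Finset.sum_congr rfl fun p _ => ?_
  rw [Finset.smul_sum]
  exact Finset.sum_congr rfl fun q _ => smul_comm _ _ _

end Covariance

lemma mem_B_of_embK (g : G) : (embK (kPart g))⁻¹ * g ∈ B := by
  have h := act_spec g 1
  rw [map_one, mul_one] at h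
  intro i j hij
  have e : proj ((embK (kPart g))⁻¹ * g) = (rot (act g 1))⁻¹ * proj g := by
    rw [map_mul, map_inv, proj_embK, kPart_eq]
  rw [e]
  exact h.1 i j hij

/-- Only the diagonal entries, all equal, could contribute, and the sum of their weights is the
entry `(0, 2)` of `b⁻¹ b = 1`, which is zero. -/
lemma Ind.Dcoeff_mul_eq_zero {a : ℂ} {f : G → V} (hf : f ∈ Ind (-lam2 (-a))) {g b : G} (hb : b ∈ B)
    (h : Dcoeff a f g 2 0 = 0) : Dcoeff a f (g * b) 2 0 = 0 := by
  rw [Ind.Dcoeff_mul hf hb]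
  simp only [Fin.sum_univ_three, Ind.Dcoeff_diag hf]
  rw [Ind.Dcoeff_eq_zero hf g (i := 0) (j := 1) (by decide) (by decide),
    Ind.Dcoeff_eq_zero hf g (i := 0) (j := 2) (by decide) (by decide),
    Ind.Dcoeff_eq_zero hf g (i := 1) (j := 0) (by decide) (by decide),
    Ind.Dcoeff_eq_zero hf g (i := 1) (j := 2) (by decide) (by decide),
    Ind.Dcoeff_eq_zero hf g (i := 2) (j := 1) (by decide) (by decide), h]
  have e := congrFun (congrFun (proj_inv_mul b) 0) 2
  rw [Matrix.mul_apply, Fin.sum_univ_three, Matrix.one_apply_ne (by decide)] at e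
  set x := (2 * a ^ 2 / 9 - 1 / 2) • f g
  have e2 : ((proj b).1 0 2 * ((proj b)⁻¹).1 0 0) • x + ((proj b).1 1 2 * ((proj b)⁻¹).1 0 1) • x +
      ((proj b).1 2 2 * ((proj b)⁻¹).1 0 2) • x = 0 := by
    rw [← add_smul, ← add_smul]
    convert zero_smul ℝ x
    linarith
  rw [← map_zero (sigma (-lam2 (-a)) b⁻¹).mulVecLin]
  congr 1
  simpa using e2

lemma Ind.D_eq_zero_iff_embK {a : ℂ} {f : G → V} (hf : f ∈ Ind (-lam2 (-a))) :
    D a f = 0 ↔ ∀ y, Dcoeff a f (embK y) 2 0 = 0 := by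
  rw [Ind.D_eq_zero_iff hf]
  refine ⟨fun h y => h _, fun h g => ?_⟩
  have := Ind.Dcoeff_mul_eq_zero hf (mem_B_of_embK g) (h (kPart g))
  rwa [mul_inv_cancel_left] at this

/-! ### Left translation -/

/-- Left translation `L(u) f (g) = f (u⁻¹ g)`. -/
def leftTr (u : G) : (G → V) →ₗ[ℂ] (G → V) := LinearMap.funLeft ℂ V fun g => u⁻¹ * g

lemma leftTr_apply (u : G) (f : G → V) (g : G) : leftTr u f g = f (u⁻¹ * g) := rfl

lemma leftTr_mul (u v : G) (f : G → V) : leftTr (u * v) f = leftTr u (leftTr v f) := by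
  funext g
  simp only [leftTr_apply, mul_inv_rev, mul_assoc]

lemma leftTr_one (f : G → V) : leftTr 1 f = f := by
  funext g
  simp only [leftTr_apply, inv_one, one_mul]

lemma Smooth.leftTr {f : G → V} (hf : Smooth f) (u : G) : Smooth (leftTr u f) := by
  intro n g
  have := hf n (u⁻¹ * g)
  simpa only [leftTr_apply, mul_assoc] using this

lemma Ind.leftTr {ν : Fin 3 → ℂ} {f : G → V} (hf : f ∈ Ind ν) (u : G) : leftTr u f ∈ Ind ν :=
  ⟨hf.1.leftTr u, fun g q hq => by
    rw [leftTr_apply, leftTr_apply, ← mul_assoc, hf.2 _ q hq]⟩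

lemma rDeriv_leftTr (X : Mat3) (u : G) (f : G → V) :
    rDeriv X (leftTr u f) = leftTr u (rDeriv X f) := by
  funext g
  simp only [rDeriv, leftTr_apply, mul_assoc]

lemma D_leftTr (a : ℂ) (u : G) (f : G → V) (g : G) : D a (leftTr u f) g = D a f (u⁻¹ * g) := by
  funext A
  simp only [D, rDerivSym, rDeriv_leftTr]
  rfl

/-! ### Functions in the induced representation and their restrictions to `K` -/

lemma Smooth.add {f f' : G → V} (hf : Smooth f) (hf' : Smooth f') : Smooth (f + f') :=
  fun n g => (hf n g).add (hf' n g)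

lemma Smooth.smul {f : G → V} (hf : Smooth f) (c : ℂ) : Smooth (c • f) :=
  fun n g => (hf n g).const_smul c

lemma Smooth.zero : Smooth (0 : G → V) := fun _ _ => contDiff_const

/-- `Ind ν` as a subspace. -/
def indSub (ν : Fin 3 → ℂ) : Submodule ℂ (G → V) where
  carrier := Ind ν
  add_mem' hf hf' := ⟨hf.1.add hf'.1, fun g q hq => by
    rw [Pi.add_apply, Pi.add_apply, hf.2 g q hq, hf'.2 g q hq, Matrix.mulVec_add]⟩
  zero_mem' := ⟨Smooth.zero, fun g q _ => by simp⟩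
  smul_mem' c f hf := ⟨hf.1.smul c, fun g q hq => by
    rw [Pi.smul_apply, Pi.smul_apply, hf.2 g q hq, Matrix.mulVec_smul]⟩

end SL3Kernel

/-! ### The induced representation as a space of functions on `K` -/

namespace SL3Kernel

open scoped Topology
open Filter

/-! ### Upper triangular matrices and characters of `A` -/

/-- Upper triangular matrices in `SL(3,ℝ)`. -/
def IsTri (x : SL3) : Prop := ∀ i j, j < i → x.1 i j = 0

lemma IsTri.mul_diag {x y : SL3} (hx : IsTri x) (hy : IsTri y) (i : Fin 3) :
    (x * y).1 i i = x.1 i i * y.1 i i := by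
  have x10 := hx 1 0 (by decide)
  have x20 := hx 2 0 (by decide)
  have x21 := hx 2 1 (by decide)
  have y10 := hy 1 0 (by decide)
  have y20 := hy 2 0 (by decide)
  have y21 := hy 2 1 (by decide)
  rw [Matrix.SpecialLinearGroup.coe_mul, Matrix.mul_apply, Fin.sum_univ_three]
  fin_cases i <;> simp_all

lemma IsTri.mul {x y : SL3} (hx : IsTri x) (hy : IsTri y) : IsTri (x * y) := by
  have x10 := hx 1 0 (by decide)
  have x20 := hx 2 0 (by decide)
  have x21 := hx 2 1 (by decide)
  have y10 := hy 1 0 (by decide)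
  have y20 := hy 2 0 (by decide)
  have y21 := hy 2 1 (by decide)
  intro i j h
  rw [Matrix.SpecialLinearGroup.coe_mul, Matrix.mul_apply, Fin.sum_univ_three]
  fin_cases i <;> fin_cases j <;> simp_all

lemma IsTri.inv {x : SL3} (hx : IsTri x) : IsTri x⁻¹ := by
  have x10 := hx 1 0 (by decide)
  have x20 := hx 2 0 (by decide)
  have x21 := hx 2 1 (by decide)
  intro i j h
  rw [Matrix.SpecialLinearGroup.coe_inv]
  fin_cases i <;> fin_cases j <;> simp_all [Matrix.adjugate_fin_three]

lemma aChar_mul (ν : Fin 3 → ℂ) {x y : SL3} (hx : IsTri x) (hy : IsTri y) :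
    aChar ν (x * y) = aChar ν x * aChar ν y := by
  rw [aChar, aChar, aChar, ← Finset.prod_mul_distrib]
  refine Finset.prod_congr rfl fun i _ => ?_
  rw [hx.mul_diag hy, abs_mul, Complex.ofReal_mul,
    Complex.mul_cpow_ofReal_nonneg (abs_nonneg _) (abs_nonneg _)]

lemma aChar_one (ν : Fin 3 → ℂ) : aChar ν 1 = 1 := by
  simp [aChar]

lemma aChar_inv (ν : Fin 3 → ℂ) {x : SL3} (hx : IsTri x) : aChar ν x⁻¹ = (aChar ν x)⁻¹ := by
  refine eq_inv_of_mul_eq_one_left ?_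
  rw [← aChar_mul ν hx.inv hx, inv_mul_cancel, aChar_one]

lemma aChar_ne_zero (ν : Fin 3 → ℂ) {x : SL3} (hx : IsTri x) : aChar ν x ≠ 0 := by
  intro h
  have := aChar_mul ν hx.inv hx
  rw [inv_mul_cancel, aChar_one, h, mul_zero] at this
  exact one_ne_zero this

/-- Elements of `M` lie over diagonal matrices with entries `±1`, whose signs `aChar` ignores. -/
lemma aChar_rot (ν : Fin 3 → ℂ) {m : K} (hm : IsTri (rot m)) : aChar ν (rot m) = 1 := by
  have h : ∀ i, |rotMat (m : ℍ[ℝ]) i i| = 1 ∧ IsTri (rot m) := by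
    refine diag_induction (P := fun m => ∀ i, |rotMat (m : ℍ[ℝ]) i i| = 1 ∧ IsTri (rot m))
      ?_ ?_ ?_ hm
    · intro i
      constructor
      · rw [rotMat_eq]; fin_cases i <;> simp
      · intro i j h
        rw [rot_coe, rotMat_eq]; fin_cases i <;> fin_cases j <;> simp_all
    · intro i
      constructor
      · rw [rotMat_eq]; fin_cases i <;> simp
      · intro i j h
        rw [rot_coe, rotMat_eq]; fin_cases i <;> fin_cases j <;> simp_all
    · intro y z hy hz i
      have h1 := (hy 0).2.mul_diag (hz 0).2 i
      rw [← map_mul, rot_coe, rot_coe, rot_coe] at h1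
      exact ⟨by rw [h1, abs_mul, (hy i).1, (hz i).1, one_mul], by
        rw [map_mul]; exact (hy 0).2.mul (hz 0).2⟩
  rw [aChar]
  refine Finset.prod_eq_one fun i _ => ?_
  rw [rot_coe, (h i).1, Complex.ofReal_one, Complex.one_cpow]

lemma kPart_inv_of_mem_B {q : G} (hq : q ∈ B) : kPart q⁻¹ = (kPart q)⁻¹ := by
  have h := act_mul_kPart hq q⁻¹ 1
  rw [one_mul, kPart_eq q, act_inv_act] at h
  rw [kPart_eq q⁻¹, kPart_eq q]
  exact eq_inv_of_mul_eq_one_left h.symm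

lemma anPart_isTri (g : G) : IsTri (anPart g) := by
  have h := act_spec g 1
  rw [map_one, mul_one] at h
  exact h.1

lemma anPart_diag_pos (g : G) (i : Fin 3) : 0 < (anPart g).1 i i := by
  have h := act_spec g 1
  rw [map_one, mul_one] at h
  exact h.2 i

/-! ### Restriction to `K` -/

lemma quatMat_mul (y z : ℍ[ℝ]) : quatMat (y * z) = quatMat y * quatMat z := by
  ext i j
  rw [Matrix.mul_apply, Fin.sum_univ_two]
  fin_cases i <;> fin_cases j <;>
    simp [quatMat, Complex.ext_iff] <;> constructor <;> ring

/-- `G = KAN` and the equivariance under `AN` determine a function by its restriction to `K`. -/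
lemma Ind.eq_extend {ν : Fin 3 → ℂ} {f : G → V} (hf : f ∈ Ind ν) :
    f = extend ν fun y => f (embK y) := by
  funext g
  have hb := mem_B_of_embK g
  have h1 := hf.2 (embK (kPart g)) _ hb
  rw [mul_inv_cancel_left] at h1
  have h2 : kPart ((embK (kPart g))⁻¹ * g) = 1 := by
    rw [kPart_eq, act_mul, ← map_inv, act_embK, kPart_eq, inv_mul_cancel]
  have h3 : proj ((embK (kPart g))⁻¹ * g) = anPart g := by
    rw [map_mul, map_inv, proj_embK, anPart]
  rw [h1, sigma, kPart_inv_of_mem_B hb, h2, map_inv, h3, aChar_inv ν (anPart_isTri g), inv_one]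
  have : quatMat ((1 : K) : ℍ[ℝ]) = 1 := quatMat_one
  rw [this, Matrix.smul_mulVec, Matrix.one_mulVec]
  rfl

lemma Ind.mul_of_isTri {ν : Fin 3 → ℂ} {f : G → V} (hf : f ∈ Ind ν) {m : K} (hm : IsTri (rot m))
    (y : K) : f (embK (y * m)) = (quatMat ((m⁻¹ : K) : ℍ[ℝ])).mulVec (f (embK y)) := by
  have hb : embK m ∈ B := hm
  rw [map_mul, hf.2 _ _ hb, sigma, kPart_inv_of_mem_B hb, map_inv, proj_embK,
    aChar_inv ν hm, aChar_rot ν hm, inv_one, one_smul, kPart_eq, act_embK, mul_one]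

lemma isTri_rot_kI : IsTri (rot kI) := by
  intro i j h
  rw [rot_coe, rotMat_eq]; fin_cases i <;> fin_cases j <;> simp_all

lemma isTri_rot_kK : IsTri (rot kK) := by
  intro i j h
  rw [rot_coe, rotMat_eq]; fin_cases i <;> fin_cases j <;> simp_all

lemma extend_embK (ν : Fin 3 → ℂ) (F : K → V) (y : K) : extend ν F (embK y) = F y := by
  have h1 : anPart (embK y) = 1 := by
    rw [anPart, kPart_eq, act_embK, mul_one, proj_embK, inv_mul_cancel]
  change (aChar ν (anPart (embK y)))⁻¹ • F (kPart (embK y)) = F y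
  rw [h1, aChar_one, inv_one, one_smul, kPart_eq, act_embK, mul_one]

lemma anPart_embK_mul (y : K) (g : G) : anPart (embK y * g) = anPart g := by
  rw [anPart, anPart, kPart_eq, act_mul, act_embK, map_mul, map_mul, proj_embK, mul_inv_rev,
    mul_assoc, inv_mul_cancel_left, kPart_eq]

lemma leftTr_extend (ν : Fin 3 → ℂ) (F : K → V) (y : K) :
    leftTr (embK y) (extend ν F) = extend ν fun z => F (y⁻¹ * z) := by
  funext g
  rw [leftTr_apply, ← map_inv]
  change (aChar ν (anPart (embK y⁻¹ * g)))⁻¹ • F (kPart (embK y⁻¹ * g)) =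
    (aChar ν (anPart g))⁻¹ • F (y⁻¹ * kPart g)
  rw [anPart_embK_mul]
  rfl

/-- Equivariance need only be checked for `𝐢` and `𝐤`, which generate `M`. Smoothness comes from
that of the `K`-component, together with a smooth extension of the function from `K` to all
quaternions. -/
lemma extend_mem_Ind (ν : Fin 3 → ℂ) {F : K → V} {F' : ℍ[ℝ] → V} (hF' : ContDiff ℝ ∞ F')
    (hF : ∀ y : K, F y = F' y)
    (hI : ∀ y, F (y * kI) = (quatMat ((kI⁻¹ : K) : ℍ[ℝ])).mulVec (F y))
    (hK : ∀ y, F (y * kK) = (quatMat ((kK⁻¹ : K) : ℍ[ℝ])).mulVec (F y)) :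
    extend ν F ∈ Ind ν := by
  constructor
  · intro n g
    have hk := contDiff_kPart (n := ∞) n g
    have hp := fun i j => contDiff_proj_apply (n := ∞) n g i j
    set u : (Fin n → Fin 3 → Fin 3 → ℝ) → G :=
      fun c => g * (List.ofFn fun i => expG (slMat (c i))).prod with hu
    change ContDiff ℝ ∞ fun c => (aChar ν (anPart (u c)))⁻¹ • F (kPart (u c))
    have hd : ∀ i, ContDiff ℝ ∞ fun c => (anPart (u c)).1 i i := by
      intro i
      have e : ∀ c, (anPart (u c)).1 i i =
          ∑ k, rotMat (kPart (u c) : ℍ[ℝ]) k i * (proj (u c)).1 k i := by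
        intro c
        rw [anPart, Matrix.SpecialLinearGroup.coe_mul, rot_inv_coe, Matrix.mul_apply]
        rfl
      simp_rw [e]
      refine ContDiff.sum fun k _ => ContDiff.mul ?_ (hp k i)
      have h0 := reCLM.contDiff.comp hk
      have h1 := imICLM.contDiff.comp hk
      have h2 := imJCLM.contDiff.comp hk
      have h3 := imKCLM.contDiff.comp hk
      change ContDiff ℝ ∞ fun c => (kPart (u c) : ℍ[ℝ]).re at h0
      change ContDiff ℝ ∞ fun c => (kPart (u c) : ℍ[ℝ]).imI at h1
      change ContDiff ℝ ∞ fun c => (kPart (u c) : ℍ[ℝ]).imJ at h2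
      change ContDiff ℝ ∞ fun c => (kPart (u c) : ℍ[ℝ]).imK at h3
      simp_rw [rotMat_eq]
      fin_cases k <;> fin_cases i <;> simp <;> fun_prop
    have hpow : ∀ i, ContDiff ℝ ∞ fun c => (((|(anPart (u c)).1 i i| : ℝ) : ℂ)) ^ ν i := by
      intro i
      -- The diagonal of the `AN`-part is positive, so the complex power is the exponential of a
      -- real logarithm, which is smooth.
      have e : ∀ c, (((|(anPart (u c)).1 i i| : ℝ) : ℂ)) ^ ν i =
          Complex.exp ((Real.log ((anPart (u c)).1 i i) : ℂ) * ν i) := by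
        intro c
        have hpos := anPart_diag_pos (u c) i
        rw [abs_of_pos hpos, Complex.cpow_def_of_ne_zero (by exact_mod_cast hpos.ne'),
          ← Complex.ofReal_log hpos.le]
      simp_rw [e]
      refine ContDiff.cexp (ContDiff.mul ?_ contDiff_const)
      exact Complex.ofRealCLM.contDiff.comp ((hd i).log fun c => (anPart_diag_pos (u c) i).ne')
    refine ContDiff.smul (ContDiff.inv ?_ fun c => aChar_ne_zero ν (anPart_isTri _)) ?_
    · exact contDiff_prod fun i _ => hpow i
    · simp_rw [hF]
      exact hF'.comp hk
  · intro g q hq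
    have hm : ∀ y, F (y * kPart q) = (quatMat (((kPart q)⁻¹ : K) : ℍ[ℝ])).mulVec (F y) := by
      refine diag_induction (P := fun m => ∀ y, F (y * m) =
        (quatMat ((m⁻¹ : K) : ℍ[ℝ])).mulVec (F y)) hI hK (fun m n hm hn y => ?_)
        (rotMat_kPart_low hq)
      rw [← mul_assoc, hn, hm, Matrix.mulVec_mulVec, ← quatMat_mul, mul_inv_rev]
      rfl
    have hr : IsTri (rot (kPart q)) := fun i j hij => rotMat_kPart_low hq i j hij
    have hq' : IsTri (proj q) := hq
    have h1 : kPart (g * q) = kPart g * kPart q := by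
      have := act_mul_kPart hq g 1
      rw [one_mul] at this
      rw [kPart_eq, act_mul, kPart_eq g, ← this]
      rfl
    have h2 : anPart (g * q) = (rot (kPart q))⁻¹ * anPart g * proj q := by
      rw [anPart, h1, map_mul, map_mul, anPart]
      group
    change (aChar ν (anPart (g * q)))⁻¹ • F (kPart (g * q)) =
      (sigma ν q⁻¹).mulVec ((aChar ν (anPart g))⁻¹ • F (kPart g))
    rw [h2, h1, hm, aChar_mul ν (hr.inv.mul (anPart_isTri g)) hq',
      aChar_mul ν hr.inv (anPart_isTri g), aChar_inv ν hr, aChar_rot ν hr, inv_one, one_mul,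
      sigma, map_inv, aChar_inv ν hq', kPart_inv_of_mem_B hq, Matrix.smul_mulVec,
      Matrix.mulVec_smul, smul_smul, mul_inv, mul_comm]

end SL3Kernel

/-! ### The duality between `S^m ℂ²` and polynomials of degree at most `m` -/

namespace SL3Kernel

/-! ### Coordinates on `S^m ℂ²` and the invariant pairing -/

/-- The monomial `e₀^i e₁^(m-i)`, for `i ≤ m`. -/
def mono (m i : ℕ) : SymPow m :=
  -- The minimum keeps the degree equal to `m` for every index. Later `mono m (m + 1)` occurs,
  -- always with coefficient zero.
  ⟨MvPolynomial.X 0 ^ min i m * MvPolynomial.X 1 ^ (m - i), by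
    have h := (MvPolynomial.isHomogeneous_X_pow (R := ℂ) (0 : Fin 2) (min i m)).mul
      (MvPolynomial.isHomogeneous_X_pow (R := ℂ) (1 : Fin 2) (m - i))
    rwa [show min i m + (m - i) = m by omega] at h⟩

lemma coe_mono {m i : ℕ} (h : i ≤ m) : (mono m i : MvPolynomial (Fin 2) ℂ) =
    MvPolynomial.X 0 ^ i * MvPolynomial.X 1 ^ (m - i) := by
  change MvPolynomial.X 0 ^ min i m * MvPolynomial.X 1 ^ (m - i) = _
  rw [min_eq_left h]

lemma coe_mono_monomial {m i : ℕ} (h : i ≤ m) : (mono m i : MvPolynomial (Fin 2) ℂ) =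
    MvPolynomial.monomial (Finsupp.single 0 i + Finsupp.single 1 (m - i)) 1 := by
  rw [coe_mono h, MvPolynomial.X_pow_eq_monomial, MvPolynomial.X_pow_eq_monomial,
    MvPolynomial.monomial_mul, one_mul]

/-- The coefficient at `e₀^i e₁^(m-i)`. -/
def cf (m i : ℕ) : SymPow m →ₗ[ℂ] ℂ :=
  (MvPolynomial.lcoeff ℂ (Finsupp.single 0 i + Finsupp.single 1 (m - i))).comp (SymPow m).subtype

lemma cf_apply (m i : ℕ) (v : SymPow m) :
    cf m i v = MvPolynomial.coeff (Finsupp.single 0 i + Finsupp.single 1 (m - i)) v.1 := rfl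

lemma cf_mono {m i j : ℕ} (hj : j ≤ m) : cf m i (mono m j) = if i = j then 1 else 0 := by
  rw [cf_apply, coe_mono_monomial hj, MvPolynomial.coeff_monomial]
  by_cases h : i = j
  · subst h; simp
  · rw [if_neg h, if_neg]
    intro e
    have := DFunLike.congr_fun e 0
    simp at this
    exact h this.symm

lemma eq_sum_mono (m : ℕ) (v : SymPow m) :
    v = ∑ i ∈ Finset.range (m + 1), cf m i v • mono m i := by
  apply Subtype.ext
  ext s
  rw [AddSubmonoidClass.coe_finset_sum, MvPolynomial.coeff_sum]
  have h1 : ∀ i ∈ Finset.range (m + 1), MvPolynomial.coeff s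
      ((cf m i v • mono m i : SymPow m) : MvPolynomial (Fin 2) ℂ) =
      if Finsupp.single 0 i + Finsupp.single 1 (m - i) = s then MvPolynomial.coeff s v.1 else 0 := by
    intro i hi
    rw [Finset.mem_range] at hi
    rw [Submodule.coe_smul, MvPolynomial.coeff_smul, coe_mono_monomial (by omega),
      MvPolynomial.coeff_monomial, cf_apply]
    split_ifs with h
    · rw [h]; simp
    · simp
  rw [Finset.sum_congr rfl h1]
  by_cases hs : s 0 + s 1 = m
  · rw [Finset.sum_eq_single (s 0)]
    · rw [if_pos]
      ext k
      fin_cases k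
      · simp
      · simp; omega
    · intro i _ hi
      rw [if_neg]
      intro e
      have := DFunLike.congr_fun e 0
      simp at this
      exact hi this
    · intro h
      rw [Finset.mem_range] at h
      omega
  · have hv : v.1.IsHomogeneous m := v.2
    have h0 : MvPolynomial.coeff s v.1 = 0 := by
      refine hv.coeff_eq_zero ?_
      rw [Finsupp.degree_eq_sum, Fin.sum_univ_two]
      exact hs
    rw [h0]
    simp

lemma symPow_hom_ext {m : ℕ} {E : Type*} [AddCommGroup E] [Module ℂ E]
    {φ ψ : SymPow m →ₗ[ℂ] E} (h : ∀ i ≤ m, φ (mono m i) = ψ (mono m i)) : φ = ψ := by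
  ext1 v
  rw [eq_sum_mono m v, map_sum, map_sum]
  refine Finset.sum_congr rfl fun i hi => ?_
  rw [map_smul, map_smul, h i (by rw [Finset.mem_range] at hi; omega)]

instance (m : ℕ) : FiniteDimensional ℂ (SymPow m) := by
  refine ⟨⟨(Finset.range (m + 1)).image (mono m), ?_⟩⟩
  rw [eq_top_iff]
  intro v _
  rw [eq_sum_mono m v]
  refine Submodule.sum_mem _ fun i hi => Submodule.smul_mem _ _ (Submodule.subset_span ?_)
  exact Finset.mem_coe.2 (Finset.mem_image_of_mem _ hi)

/-- `⟨e₀^i e₁^(m-i), t^i⟩`. -/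
def wt (m i : ℕ) : ℂ := ((i.factorial * (m - i).factorial : ℕ) : ℂ) / (m.factorial : ℂ)

lemma wt_ne_zero (m i : ℕ) : wt m i ≠ 0 :=
  div_ne_zero (by exact_mod_cast (Nat.mul_pos i.factorial_pos (m - i).factorial_pos).ne')
    (by exact_mod_cast m.factorial_pos.ne')

lemma wt_succ {m i : ℕ} (h : i < m) : ((m - i : ℕ) : ℂ) * wt m (i + 1) = (i + 1) * wt m i := by
  obtain ⟨k, rfl⟩ := Nat.exists_eq_add_of_lt h
  have e1 : i + k + 1 - i = k + 1 := by omega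
  have e2 : i + k + 1 - (i + 1) = k := by omega
  rw [wt, wt, e1, e2, Nat.factorial_succ i, Nat.factorial_succ k]
  push_cast
  ring

lemma wt_choose {m i : ℕ} (h : i ≤ m) : wt m i * (m.choose i : ℂ) = 1 := by
  have h1 := Nat.choose_mul_factorial_mul_factorial h
  rw [wt, div_mul_eq_mul_div, div_eq_one_iff_eq (by exact_mod_cast m.factorial_pos.ne')]
  exact_mod_cast by rw [← h1]; ring

lemma pairing_eq (m : ℕ) (q : Polynomial ℂ) (v : SymPow m) :
    pairing m q v = ∑ i ∈ Finset.range (m + 1), wt m i * q.coeff i * cf m i v := by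
  rw [pairing, LinearMap.sum_apply]
  rfl

lemma pairing_mono {m i : ℕ} (h : i ≤ m) (q : Polynomial ℂ) :
    pairing m q (mono m i) = wt m i * q.coeff i := by
  rw [pairing_eq, Finset.sum_eq_single i]
  · rw [cf_mono h, if_pos rfl, mul_one]
  · intro j _ hj
    rw [cf_mono h, if_neg hj, mul_zero]
  · intro hi
    rw [Finset.mem_range] at hi
    omega

lemma pairing_add (m : ℕ) (p q : Polynomial ℂ) : pairing m (p + q) = pairing m p + pairing m q := by
  refine symPow_hom_ext fun i hi => ?_
  rw [LinearMap.add_apply, pairing_mono hi, pairing_mono hi, pairing_mono hi, Polynomial.coeff_add,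
    mul_add]

lemma pairing_smul (m : ℕ) (c : ℂ) (q : Polynomial ℂ) : pairing m (c • q) = c • pairing m q := by
  refine symPow_hom_ext fun i hi => ?_
  rw [LinearMap.smul_apply, pairing_mono hi, pairing_mono hi, Polynomial.coeff_smul, smul_eq_mul,
    smul_eq_mul, mul_left_comm]

lemma pairing_injective {m : ℕ} {p q : Polynomial ℂ} (hp : p.natDegree ≤ m) (hq : q.natDegree ≤ m)
    (h : ∀ v, pairing m p v = pairing m q v) : p = q := by
  ext i
  by_cases hi : i ≤ m
  · have := h (mono m i)
    rw [pairing_mono hi, pairing_mono hi] at this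
    exact mul_left_cancel₀ (wt_ne_zero m i) this
  · rw [Polynomial.coeff_eq_zero_of_natDegree_lt (by omega),
      Polynomial.coeff_eq_zero_of_natDegree_lt (by omega)]

lemma exists_pairing_eq {m : ℕ} (φ : SymPow m →ₗ[ℂ] ℂ) :
    ∃ q : Polynomial ℂ, q.natDegree ≤ m ∧ pairing m q = φ := by
  refine ⟨∑ i ∈ Finset.range (m + 1), Polynomial.monomial i ((wt m i)⁻¹ * φ (mono m i)), ?_, ?_⟩
  · refine Polynomial.natDegree_sum_le_of_forall_le _ _ fun i hi => ?_
    refine (Polynomial.natDegree_monomial_le _).trans ?_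
    rw [Finset.mem_range] at hi
    omega
  · refine symPow_hom_ext fun i hi => ?_
    rw [pairing_mono hi, Polynomial.finset_sum_coeff]
    simp_rw [Polynomial.coeff_monomial]
    rw [Finset.sum_ite_eq' , if_pos (by rw [Finset.mem_range]; omega),
      mul_inv_cancel_left₀ (wt_ne_zero m i)]

/-! ### The group action on `S^m ℂ²` -/

/-- The linear form `x e₀ + y e₁`. -/
def lin (x y : ℂ) : MvPolynomial (Fin 2) ℂ :=
  MvPolynomial.C x * MvPolynomial.X 0 + MvPolynomial.C y * MvPolynomial.X 1

lemma lin_isHomogeneous (x y : ℂ) : (lin x y).IsHomogeneous 1 := by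
  refine MvPolynomial.IsHomogeneous.add ?_ ?_
  · simpa using (MvPolynomial.isHomogeneous_C (Fin 2) x).mul (MvPolynomial.isHomogeneous_X ℂ 0)
  · simpa using (MvPolynomial.isHomogeneous_C (Fin 2) y).mul (MvPolynomial.isHomogeneous_X ℂ 1)

/-- The power `(x e₀ + y e₁)^m`. -/
def pw (m : ℕ) (x y : ℂ) : SymPow m :=
  ⟨lin x y ^ m, by simpa using (lin_isHomogeneous x y).pow m⟩

lemma pw_eq (m : ℕ) (x y : ℂ) : pw m x y =
    ∑ i ∈ Finset.range (m + 1), (x ^ i * y ^ (m - i) * (m.choose i : ℂ)) • mono m i := by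
  apply Subtype.ext
  rw [AddSubmonoidClass.coe_finset_sum]
  change lin x y ^ m = _
  rw [lin, add_pow]
  refine Finset.sum_congr rfl fun i hi => ?_
  rw [Finset.mem_range] at hi
  rw [Submodule.coe_smul, coe_mono (by omega), MvPolynomial.smul_eq_C_mul]
  simp only [map_mul, map_pow, map_natCast, mul_pow]
  ring

lemma pairing_pw (m : ℕ) (q : Polynomial ℂ) (x y : ℂ) : pairing m q (pw m x y) =
    ∑ i ∈ Finset.range (m + 1), q.coeff i * (x ^ i * y ^ (m - i)) := by
  rw [pw_eq, map_sum]
  refine Finset.sum_congr rfl fun i hi => ?_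
  rw [Finset.mem_range] at hi
  rw [map_smul, pairing_mono (by omega), smul_eq_mul]
  linear_combination (x ^ i * y ^ (m - i) * q.coeff i) * wt_choose (m := m) (i := i) (by omega)

/-- Pairing with the power of a linear form is evaluation at a point, and these powers span.
Identities about the pairing thus reduce to evaluating polynomials. -/
lemma pairing_pw_one {m : ℕ} {q : Polynomial ℂ} (hq : q.natDegree ≤ m) (c : ℂ) :
    pairing m q (pw m c 1) = q.eval c := by
  rw [pairing_pw, Polynomial.eval_eq_sum_range' (n := m + 1) (by omega)]
  simp

/-- A functional that vanishes on all these powers is the pairing with a polynomial that vanishes at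
every point. -/
lemma span_pw (m : ℕ) : Submodule.span ℂ (Set.range fun c => pw m c 1) = ⊤ := by
  by_contra h
  obtain ⟨φ, hφ, hle⟩ := Submodule.exists_le_ker_of_lt_top _ (lt_top_iff_ne_top.2 h)
  obtain ⟨q, hq, rfl⟩ := exists_pairing_eq φ
  have h0 : q = 0 := by
    refine Polynomial.funext fun c => ?_
    rw [← pairing_pw_one hq, Polynomial.eval_zero]
    exact hle (Submodule.subset_span ⟨c, rfl⟩)
  apply hφ
  refine symPow_hom_ext fun i hi => ?_
  rw [pairing_mono hi, h0]
  simp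

lemma symPow_hom_ext_pw {m : ℕ} {E : Type*} [AddCommGroup E] [Module ℂ E]
    {φ ψ : SymPow m →ₗ[ℂ] E} (h : ∀ c, φ (pw m c 1) = ψ (pw m c 1)) : φ = ψ :=
  LinearMap.ext_on_range (span_pw m) h

/-- The substitution `e_j ↦ ∑ g i j e_i`. -/
def substHom (g : Matrix (Fin 2) (Fin 2) ℂ) : MvPolynomial (Fin 2) ℂ →ₐ[ℂ] MvPolynomial (Fin 2) ℂ :=
  MvPolynomial.aeval fun j => lin (g 0 j) (g 1 j)

lemma substHom_lin (g : Matrix (Fin 2) (Fin 2) ℂ) (x y : ℂ) :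
    substHom g (lin x y) = lin (g 0 0 * x + g 0 1 * y) (g 1 0 * x + g 1 1 * y) := by
  simp only [substHom, lin, map_add, map_mul, MvPolynomial.aeval_X, MvPolynomial.algHom_C,
    MvPolynomial.algebraMap_eq]
  ring

lemma substHom_mem (g : Matrix (Fin 2) (Fin 2) ℂ) (m : ℕ) (v : MvPolynomial (Fin 2) ℂ)
    (hv : v ∈ SymPow m) : substHom g v ∈ SymPow m := by
  have h := eq_sum_mono m ⟨v, hv⟩
  have h' := congrArg Subtype.val h
  rw [AddSubmonoidClass.coe_finset_sum] at h'
  change v = _ at h'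
  rw [h', map_sum]
  refine Submodule.sum_mem _ fun i hi => ?_
  rw [Finset.mem_range] at hi
  rw [Submodule.coe_smul, map_smul, coe_mono (by omega), map_mul, map_pow, map_pow]
  refine Submodule.smul_mem _ _ ?_
  have := ((lin_isHomogeneous (g 0 0) (g 1 0)).pow i).mul
    ((lin_isHomogeneous (g 0 1) (g 1 1)).pow (m - i))
  rw [show 1 * i + 1 * (m - i) = m by omega] at this
  simpa [substHom] using this

/-- The action of a matrix on `S^m ℂ²`. -/
def symRep (m : ℕ) (g : Matrix (Fin 2) (Fin 2) ℂ) : SymPow m →ₗ[ℂ] SymPow m :=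
  (substHom g).toLinearMap.restrict (substHom_mem g m)

lemma symRep_pw (m : ℕ) (g : Matrix (Fin 2) (Fin 2) ℂ) (x y : ℂ) :
    symRep m g (pw m x y) = pw m (g 0 0 * x + g 0 1 * y) (g 1 0 * x + g 1 1 * y) := by
  apply Subtype.ext
  change substHom g (lin x y ^ m) = lin _ _ ^ m
  rw [map_pow, substHom_lin]

lemma symRep_mul (m : ℕ) (g h : Matrix (Fin 2) (Fin 2) ℂ) (v : SymPow m) :
    symRep m (g * h) v = symRep m g (symRep m h v) := by
  have : symRep m (g * h) = (symRep m g).comp (symRep m h) := by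
    refine symPow_hom_ext_pw fun c => ?_
    rw [LinearMap.comp_apply, symRep_pw, symRep_pw, symRep_pw, Matrix.mul_apply, Matrix.mul_apply,
      Matrix.mul_apply, Matrix.mul_apply]
    simp only [Fin.sum_univ_two]
    congr 1 <;> ring
  rw [this]; rfl

lemma natDegree_polyAct (m : ℕ) (y : K) (q : Polynomial ℂ) : (polyAct m y q).natDegree ≤ m := by
  refine Polynomial.natDegree_sum_le_of_forall_le _ _ fun j hj => ?_
  rw [Finset.mem_range] at hj
  have h1 : ∀ a b : ℂ, (Polynomial.C a * Polynomial.X + Polynomial.C b).natDegree ≤ 1 :=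
    fun a b => Polynomial.natDegree_linear_le
  have h2 := Polynomial.natDegree_pow_le_of_le j
    (h1 (quatMat ((y⁻¹ : K) : ℍ[ℝ]) 0 0) (quatMat ((y⁻¹ : K) : ℍ[ℝ]) 0 1))
  have h3 := Polynomial.natDegree_pow_le_of_le (m - j)
    (h1 (quatMat ((y⁻¹ : K) : ℍ[ℝ]) 1 0) (quatMat ((y⁻¹ : K) : ℍ[ℝ]) 1 1))
  have h4 := Polynomial.natDegree_mul_le_of_le (Polynomial.natDegree_mul_le_of_le
    (Polynomial.natDegree_C (q.coeff j)).le h2) h3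
  refine h4.trans ?_
  omega

lemma eval_polyAct (m : ℕ) (y : K) (q : Polynomial ℂ) (c : ℂ) : (polyAct m y q).eval c =
    ∑ j ∈ Finset.range (m + 1), q.coeff j *
      ((quatMat ((y⁻¹ : K) : ℍ[ℝ]) 0 0 * c + quatMat ((y⁻¹ : K) : ℍ[ℝ]) 0 1) ^ j *
      (quatMat ((y⁻¹ : K) : ℍ[ℝ]) 1 0 * c + quatMat ((y⁻¹ : K) : ℍ[ℝ]) 1 1) ^ (m - j)) := by
  rw [polyAct, Polynomial.eval_finset_sum]
  refine Finset.sum_congr rfl fun j _ => ?_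
  simp only [Polynomial.eval_mul, Polynomial.eval_pow, Polynomial.eval_add, Polynomial.eval_C,
    Polynomial.eval_X]
  ring

/-- The pairing is invariant. -/
lemma pairing_polyAct (m : ℕ) (y : K) (q : Polynomial ℂ) (v : SymPow m) :
    pairing m (polyAct m y q) v = pairing m q (symRep m (quatMat ((y⁻¹ : K) : ℍ[ℝ])) v) := by
  have : pairing m (polyAct m y q) =
      (pairing m q).comp (symRep m (quatMat ((y⁻¹ : K) : ℍ[ℝ]))) := by
    refine symPow_hom_ext_pw fun c => ?_
    rw [LinearMap.comp_apply, pairing_pw_one (natDegree_polyAct m y q), eval_polyAct, symRep_pw,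
      pairing_pw]
    simp only [mul_one]
  rw [this]; rfl

lemma quatMat_coe_mul (y z : K) : quatMat ((y * z : K) : ℍ[ℝ]) = quatMat y * quatMat z :=
  quatMat_mul _ _

/-- Follows by duality from multiplicativity on `S^m ℂ²`, since the pairing is nondegenerate and
invariant. -/
lemma polyAct_mul (m : ℕ) (y z : K) (q : Polynomial ℂ) :
    polyAct m (y * z) q = polyAct m y (polyAct m z q) := by
  refine pairing_injective (natDegree_polyAct _ _ _) (natDegree_polyAct _ _ _) fun v => ?_
  rw [pairing_polyAct, pairing_polyAct, pairing_polyAct, mul_inv_rev, quatMat_coe_mul, symRep_mul]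

lemma PhiK_apply (m : ℕ) (q : Fin 2 → Polynomial ℂ) (v : SymPow m) (y : K) (c : Fin 2) :
    PhiK m q v y c = pairing m (polyAct m y (q c)) v := rfl

lemma PhiK_mul_left (m : ℕ) (q : Fin 2 → Polynomial ℂ) (v : SymPow m) (y z : K) :
    PhiK m q v (y⁻¹ * z) = PhiK m q (symRep m (quatMat y) v) z := by
  funext c
  rw [PhiK_apply, PhiK_apply, polyAct_mul, pairing_polyAct, inv_inv]

lemma PhiK_mul_right (m : ℕ) (q : Fin 2 → Polynomial ℂ) (v : SymPow m) (y z : K) :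
    PhiK m q v (y * z) = PhiK m (fun c => polyAct m z (q c)) v y := by
  funext c
  rw [PhiK_apply, PhiK_apply, polyAct_mul]

end SL3Kernel

/-! ### Differentiation of `Φ_m` and the operator on polynomials -/

namespace SL3Kernel

open scoped Topology

/-! ### The Lie algebra action on polynomials -/

/-- The derivative of `t ↦ exp(-tZ) p` at `t = 0`, for `p` of degree at most `m`. -/
def dAct (m : ℕ) (Z : ℍ[ℝ]) (p : Polynomial ℂ) : Polynomial ℂ :=
  (Polynomial.C (quatMat Z 0 0) * Polynomial.X + Polynomial.C (quatMat Z 0 1)) *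
      Polynomial.derivative p +
    (Polynomial.C (quatMat Z 1 0) * Polynomial.X + Polynomial.C (quatMat Z 1 1)) *
      (Polynomial.C (m : ℂ) * p - Polynomial.X * Polynomial.derivative p)

lemma coeff_X_mul_derivative (p : Polynomial ℂ) (n : ℕ) :
    (Polynomial.X * Polynomial.derivative p).coeff n = n * p.coeff n := by
  cases n with
  | zero => simp
  | succ n => rw [Polynomial.coeff_X_mul, Polynomial.coeff_derivative]; push_cast; ring

lemma coeff_dAct_zero (m : ℕ) (Z : ℍ[ℝ]) (p : Polynomial ℂ) : (dAct m Z p).coeff 0 =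
    m * quatMat Z 1 1 * p.coeff 0 + quatMat Z 0 1 * p.coeff 1 := by
  simp only [dAct, add_mul, Polynomial.coeff_add, mul_assoc, Polynomial.coeff_C_mul,
    Polynomial.coeff_sub, coeff_X_mul_derivative, Polynomial.coeff_derivative,
    Polynomial.mul_coeff_zero, Polynomial.coeff_X_zero, Polynomial.coeff_C_zero]
  push_cast
  ring

lemma coeff_dAct_succ (m : ℕ) (Z : ℍ[ℝ]) (p : Polynomial ℂ) (n : ℕ) : (dAct m Z p).coeff (n + 1) =
    ((n + 1) * quatMat Z 0 0 + (m - (n + 1)) * quatMat Z 1 1) * p.coeff (n + 1) +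
      (n + 2) * quatMat Z 0 1 * p.coeff (n + 2) + (m - n) * quatMat Z 1 0 * p.coeff n := by
  simp only [dAct, add_mul, Polynomial.coeff_add, mul_assoc, Polynomial.coeff_C_mul,
    Polynomial.coeff_X_mul _ n, Polynomial.coeff_sub, coeff_X_mul_derivative,
    Polynomial.coeff_derivative]
  push_cast
  ring

lemma natDegree_dAct {m : ℕ} (Z : ℍ[ℝ]) {p : Polynomial ℂ} (hp : p.natDegree ≤ m) :
    (dAct m Z p).natDegree ≤ m := by
  rw [Polynomial.natDegree_le_iff_coeff_eq_zero] at hp ⊢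
  intro N hN
  obtain ⟨n, rfl⟩ := Nat.exists_eq_succ_of_ne_zero (by omega : N ≠ 0)
  rw [Nat.succ_eq_add_one, coeff_dAct_succ, hp (n + 1) hN, hp (n + 2) (by omega)]
  rcases eq_or_lt_of_le (by omega : m ≤ n) with h | h
  · rw [h]; ring
  · rw [hp n h]; ring

lemma symAct_mono {m i : ℕ} (hi : i ≤ m) (Z : ℍ[ℝ]) : symAct m Z (mono m i) =
    (i * quatMat Z 0 0 + (m - i) * quatMat Z 1 1) • mono m i + (i * quatMat Z 1 0) • mono m (i - 1) +
      ((m - i) * quatMat Z 0 1) • mono m (i + 1) := by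
  apply Subtype.ext
  obtain ⟨l, rfl⟩ := Nat.exists_eq_add_of_le hi
  have h0 : (symAct (i + l) Z (mono (i + l) i)).1 =
      MvPolynomial.mkDerivation ℂ (fun j : Fin 2 =>
        ∑ i, MvPolynomial.C (quatMat Z i j) * MvPolynomial.X i)
        (MvPolynomial.X 0 ^ i * MvPolynomial.X 1 ^ l) := by
    change symDer Z (mono (i + l) i).1 = _
    rw [coe_mono hi, Nat.add_sub_cancel_left]
    rfl
  rw [h0]
  simp only [Submodule.coe_add, Submodule.coe_smul, Derivation.leibniz, Derivation.leibniz_pow,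
    MvPolynomial.mkDerivation_X, Fin.sum_univ_two, smul_eq_mul, nsmul_eq_mul]
  rw [coe_mono hi, coe_mono (by omega : i - 1 ≤ i + l), Nat.add_sub_cancel_left]
  simp only [MvPolynomial.smul_eq_C_mul, map_mul, map_add, map_sub, map_natCast, Nat.cast_add]
  rcases Nat.eq_zero_or_pos i with rfl | hi0
  · rcases Nat.eq_zero_or_pos l with rfl | hl0
    · simp
    · obtain ⟨l, rfl⟩ := Nat.exists_eq_succ_of_ne_zero hl0.ne'
      rw [coe_mono (by omega), show 0 + l.succ - (0 + 1) = l by omega]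
      simp only [Nat.succ_eq_add_one, Nat.add_sub_cancel]
      push_cast
      ring
  · obtain ⟨i, rfl⟩ := Nat.exists_eq_succ_of_ne_zero hi0.ne'
    simp only [Nat.succ_eq_add_one, Nat.add_sub_cancel]
    rw [show i + 1 + l - i = l + 1 by omega]
    rcases Nat.eq_zero_or_pos l with rfl | hl0
    · simp
      ring
    · obtain ⟨l, rfl⟩ := Nat.exists_eq_succ_of_ne_zero hl0.ne'
      rw [coe_mono (by omega), show i + 1 + l.succ - (i + 1 + 1) = l by omega]
      simp only [Nat.succ_eq_add_one, Nat.add_sub_cancel]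
      push_cast
      ring

/-- The operators are dual to each other: the factors by which they shift indices correspond through
the ratio of consecutive weights, `wt_succ`. -/
lemma pairing_symAct {m : ℕ} (Z : ℍ[ℝ]) {p : Polynomial ℂ} (hp : p.natDegree ≤ m) (v : SymPow m) :
    pairing m p (symAct m Z v) = pairing m (dAct m Z p) v := by
  have : (pairing m p).comp (symAct m Z) = pairing m (dAct m Z p) := by
    refine symPow_hom_ext fun i hi => ?_
    -- For `i = m` the left side has coefficient zero, and the right side vanishes by the bound on
    -- the degree of `p`.
    have hs : (m - i : ℂ) * quatMat Z 0 1 * pairing m p (mono m (i + 1)) =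
        wt m i * ((i + 1) * quatMat Z 0 1 * p.coeff (i + 1)) := by
      rcases eq_or_lt_of_le hi with rfl | h
      · rw [Polynomial.coeff_eq_zero_of_natDegree_lt (by omega)]
        ring
      · rw [pairing_mono h]
        have := wt_succ h
        rw [Nat.cast_sub hi] at this
        linear_combination (quatMat Z 0 1 * p.coeff (i + 1)) * this
    rw [LinearMap.comp_apply, symAct_mono hi, map_add, map_add, map_smul, map_smul, map_smul,
      smul_eq_mul, smul_eq_mul, smul_eq_mul, hs, pairing_mono hi, pairing_mono hi]
    cases i with
    | zero =>
      rw [coeff_dAct_zero]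
      push_cast
      ring
    | succ n =>
      rw [coeff_dAct_succ, Nat.add_sub_cancel, pairing_mono (by omega)]
      have := wt_succ (m := m) (i := n) hi
      rw [Nat.cast_sub (by omega)] at this
      push_cast
      linear_combination (-quatMat Z 1 0 * p.coeff n) * this
  rw [← this]; rfl

/-- The entries of `quatMat` as linear maps. -/
def quatMatL (i j : Fin 2) : ℍ[ℝ] →L[ℝ] ℂ := LinearMap.toContinuousLinearMap
  { toFun := fun q => quatMat q i j
    map_add' := fun p q => by
      fin_cases i <;> fin_cases j <;> simp [quatMat, Complex.ext_iff] <;>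
        first | ring1 | exact ⟨by ring, by ring⟩
    map_smul' := fun t q => by
      fin_cases i <;> fin_cases j <;> simp [quatMat, Complex.ext_iff] }

lemma hasDerivAt_quatMat_expK (z : Fin 3 → ℝ) (i j : Fin 2) :
    HasDerivAt (fun t : ℝ => quatMat (expK (t • z) : ℍ[ℝ]) i j) (quatMat (imQuat z) i j) 0 :=
  (quatMatL i j).hasFDerivAt.comp_hasDerivAt 0 (hasDerivAt_expK z)

lemma hasDerivAt_eval_polyAct {m : ℕ} {p : Polynomial ℂ} (hp : p.natDegree ≤ m) (z : Fin 3 → ℝ)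
    (c : ℂ) : HasDerivAt (fun t : ℝ => (polyAct m (expK (t • z))⁻¹ p).eval c)
      ((dAct m (imQuat z) p).eval c) 0 := by
  have e0 : ∀ i j, quatMat (expK ((0 : ℝ) • z) : ℍ[ℝ]) i j = (1 : Matrix (Fin 2) (Fin 2) ℂ) i j := by
    intro i j
    rw [zero_smul, expK_zero]
    exact congrFun (congrFun quatMat_one i) j
  have hA : HasDerivAt (fun t : ℝ => quatMat (expK (t • z) : ℍ[ℝ]) 0 0 * c +
      quatMat (expK (t • z) : ℍ[ℝ]) 0 1) (quatMat (imQuat z) 0 0 * c + quatMat (imQuat z) 0 1) 0 :=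
    ((hasDerivAt_quatMat_expK z 0 0).mul_const c).add (hasDerivAt_quatMat_expK z 0 1)
  have hB : HasDerivAt (fun t : ℝ => quatMat (expK (t • z) : ℍ[ℝ]) 1 0 * c +
      quatMat (expK (t • z) : ℍ[ℝ]) 1 1) (quatMat (imQuat z) 1 0 * c + quatMat (imQuat z) 1 1) 0 :=
    ((hasDerivAt_quatMat_expK z 1 0).mul_const c).add (hasDerivAt_quatMat_expK z 1 1)
  have h : HasDerivAt (fun t : ℝ => ∑ j ∈ Finset.range (m + 1), p.coeff j *
      ((quatMat (expK (t • z) : ℍ[ℝ]) 0 0 * c + quatMat (expK (t • z) : ℍ[ℝ]) 0 1) ^ j *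
      (quatMat (expK (t • z) : ℍ[ℝ]) 1 0 * c + quatMat (expK (t • z) : ℍ[ℝ]) 1 1) ^ (m - j))) _ 0 :=
    HasDerivAt.fun_sum fun j _ => ((hA.pow j).mul (hB.pow (m - j))).const_mul (p.coeff j)
  simp_rw [eval_polyAct, inv_inv]
  refine h.congr_deriv ?_
  simp only [Pi.pow_apply, e0, Matrix.one_apply_eq, Matrix.one_apply_ne (zero_ne_one),
    Matrix.one_apply_ne (one_ne_zero), zero_mul, one_mul, add_zero, zero_add, one_pow, mul_one]
  simp only [dAct, Polynomial.eval_add, Polynomial.eval_mul, Polynomial.eval_sub, Polynomial.eval_C,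
    Polynomial.eval_X]
  have hd : (Polynomial.derivative p).eval c =
      ∑ j ∈ Finset.range (m + 1), p.coeff j * j * c ^ (j - 1) := by
    rw [Polynomial.derivative_eval]
    exact Polynomial.sum_over_range' p (by simp) (m + 1) (by omega)
  rw [hd, Polynomial.eval_eq_sum_range' (n := m + 1) (by omega)]
  simp only [Finset.mul_sum, ← Finset.sum_sub_distrib, ← Finset.sum_add_distrib]
  refine Finset.sum_congr rfl fun j hj => ?_
  rw [Finset.mem_range] at hj
  rw [Nat.cast_sub (by omega)]
  cases j with
  | zero => simp; ring
  | succ j => rw [Nat.add_sub_cancel]; push_cast; ring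

lemma hasDerivAt_pairing_polyAct {m : ℕ} {p : Polynomial ℂ} (hp : p.natDegree ≤ m) (z : Fin 3 → ℝ)
    (v : SymPow m) : HasDerivAt (fun t : ℝ => pairing m (polyAct m (expK (t • z))⁻¹ p) v)
      (pairing m (dAct m (imQuat z) p) v) 0 := by
  have hv : v ∈ Submodule.span ℂ (Set.range fun c => pw m c 1) := by rw [span_pw]; trivial
  induction hv using Submodule.span_induction with
  | mem v hv =>
    obtain ⟨c, rfl⟩ := hv
    simp_rw [pairing_pw_one (natDegree_polyAct _ _ _), pairing_pw_one (natDegree_dAct _ hp)]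
    exact hasDerivAt_eval_polyAct hp z c
  | zero => simpa using hasDerivAt_const (0 : ℝ) (0 : ℂ)
  | add v w _ _ hv hw => simp_rw [map_add]; exact hv.add hw
  | smul c v _ hv => simp_rw [map_smul]; exact hv.const_smul c

/-! ### Derivatives of `Φ_m` -/

lemma Phi_embK (ν : Fin 3 → ℂ) (m : ℕ) (q : Fin 2 → Polynomial ℂ) (v : SymPow m) (y : K) :
    Phi ν m q v (embK y) = PhiK m q v y := extend_embK ν _ y

lemma leftTr_Phi (ν : Fin 3 → ℂ) (m : ℕ) (q : Fin 2 → Polynomial ℂ) (v : SymPow m) (y : K) :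
    leftTr (embK y) (Phi ν m q v) = Phi ν m q (symRep m (quatMat y) v) := by
  change leftTr (embK y) (extend ν (PhiK m q v)) = extend ν (PhiK m q (symRep m (quatMat y) v))
  rw [leftTr_extend]
  simp_rw [PhiK_mul_left]

lemma kFinite_Phi (ν : Fin 3 → ℂ) (m : ℕ) (q : Fin 2 → Polynomial ℂ) (v : SymPow m) :
    KFinite (Phi ν m q v) := by
  refine Submodule.finiteDimensional_of_le (S₂ := LinearMap.range (Phi ν m q)) ?_
  rw [Submodule.span_le]
  rintro _ ⟨y, rfl⟩
  exact ⟨_, (leftTr_Phi ν m q v y).symm⟩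

lemma hasDerivAt_PhiK_left (m : ℕ) (q : Fin 2 → Polynomial ℂ) (v : SymPow m) (z : Fin 3 → ℝ) (y : K) :
    HasDerivAt (fun t : ℝ => PhiK m q v ((expK (t • z))⁻¹ * y))
      (PhiK m q (symAct m (imQuat z) v) y) 0 := by
  refine hasDerivAt_pi.2 fun c => ?_
  simp_rw [PhiK_apply, polyAct_mul]
  rw [pairing_symAct _ (natDegree_polyAct _ _ _)]
  exact hasDerivAt_pairing_polyAct (natDegree_polyAct _ _ _) z v

lemma hasDerivAt_Phi_left (ν : Fin 3 → ℂ) (m : ℕ) (q : Fin 2 → Polynomial ℂ) (v : SymPow m)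
    (z : Fin 3 → ℝ) (g : G) :
    HasDerivAt (fun t : ℝ => Phi ν m q v ((embK (expK (t • z)))⁻¹ * g))
      (Phi ν m q (symAct m (imQuat z) v) g) 0 := by
  have h := (hasDerivAt_PhiK_left m q v z (kPart g)).const_smul (aChar ν (anPart g))⁻¹
  have e : ∀ t : ℝ, Phi ν m q v ((embK (expK (t • z)))⁻¹ * g) =
      (aChar ν (anPart g))⁻¹ • PhiK m q v ((expK (t • z))⁻¹ * kPart g) := by
    intro t
    have h1 := congrFun (leftTr_extend ν (PhiK m q v) (expK (t • z))) g
    exact h1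
  simp_rw [e]
  exact h

/-- Right translation acts on the polynomials, not on `v`. The sign in `-z` appears because `dAct`
differentiates the action of `exp(-tZ)`. -/
lemma hasDerivAt_PhiK_right (m : ℕ) {q : Fin 2 → Polynomial ℂ} (hq : ∀ c, (q c).natDegree ≤ m)
    (v : SymPow m) (z : Fin 3 → ℝ) (y : K) :
    HasDerivAt (fun t : ℝ => PhiK m q v (y * expK (t • z)))
      (PhiK m (fun c => dAct m (imQuat (-z)) (q c)) v y) 0 := by
  refine hasDerivAt_pi.2 fun c => ?_
  have e : ∀ t : ℝ, expK (t • z) = (expK (t • (-z)))⁻¹ := by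
    intro t
    rw [smul_neg, expK_neg, inv_inv]
  simp_rw [PhiK_apply, polyAct_mul, pairing_polyAct m y, e]
  exact hasDerivAt_pairing_polyAct (hq c) (-z) _

lemma rDeriv_Phi (ν : Fin 3 → ℂ) (m : ℕ) {q : Fin 2 → Polynomial ℂ} (hq : ∀ c, (q c).natDegree ≤ m)
    (v : SymPow m) (z : Fin 3 → ℝ) (y : K) :
    rDeriv (rhoMat z) (Phi ν m q v) (embK y) =
      Phi ν m (fun c => dAct m (imQuat (-z)) (q c)) v (embK y) := by
  have e : ∀ t : ℝ, Phi ν m q v (embK y * expG (t • rhoMat z)) = PhiK m q v (y * expK (t • z)) := by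
    intro t
    rw [← rhoMat_smul, ← embK_expK, ← map_mul, Phi_embK]
  rw [rDeriv]
  simp_rw [e]
  rw [Phi_embK]
  exact (hasDerivAt_PhiK_right m hq v z y).deriv

lemma rDeriv_rDeriv_Phi (ν : Fin 3 → ℂ) (m : ℕ) {q : Fin 2 → Polynomial ℂ}
    (hq : ∀ c, (q c).natDegree ≤ m) (v : SymPow m) (z w : Fin 3 → ℝ) (y : K) :
    rDeriv (rhoMat z) (rDeriv (rhoMat w) (Phi ν m q v)) (embK y) =
      Phi ν m (fun c => dAct m (imQuat (-z)) (dAct m (imQuat (-w)) (q c))) v (embK y) := by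
  rw [← rDeriv_Phi ν m (fun c => natDegree_dAct _ (hq c)) v z y]
  have e : ∀ t : ℝ, rDeriv (rhoMat w) (Phi ν m q v) (embK y * expG (t • rhoMat z)) =
      Phi ν m (fun c => dAct m (imQuat (-w)) (q c)) v (embK y * expG (t • rhoMat z)) := by
    intro t
    rw [← rhoMat_smul, ← embK_expK, ← map_mul, rDeriv_Phi ν m hq]
  rw [rDeriv, rDeriv]
  simp_rw [e]

/-- The operator on polynomials that corresponds to the entry of `D` that survives. -/
def recOp (a : ℂ) (m : ℕ) (p : Polynomial ℂ) : Polynomial ℂ :=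
  dAct m (imQuat (-![1 / 2, 0, 0])) (dAct m (imQuat (-![0, 0, 1 / 2])) p) -
    (a - 1 / 2) • dAct m (imQuat (-![0, 1 / 2, 0])) p

lemma natDegree_recOp (a : ℂ) {m : ℕ} {p : Polynomial ℂ} (hp : p.natDegree ≤ m) :
    (recOp a m p).natDegree ≤ m :=
  (Polynomial.natDegree_sub_le_of_le (natDegree_dAct _ (natDegree_dAct _ hp))
    ((Polynomial.natDegree_smul_le _ _).trans (natDegree_dAct _ hp))).trans (by simp)

lemma Dcoeff_Phi {a : ℂ} {m : ℕ} {q : Fin 2 → Polynomial ℂ} (hq : ∀ c, (q c).natDegree ≤ m)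
    {v : SymPow m} (h : Phi (-lam2 (-a)) m q v ∈ Ind (-lam2 (-a))) (y : K) :
    Dcoeff a (Phi (-lam2 (-a)) m q v) (embK y) 2 0 = PhiK m (fun c => recOp a m (q c)) v y := by
  rw [Ind.Dcoeff_two_zero h, sndL_apply, ← h.1.rDeriv_rDeriv _ (trace_rhoMat _) (trace_rhoMat _),
    ← h.1.rDeriv_eq_drv _ (trace_rhoMat _), rDeriv_rDeriv_Phi _ _ hq, rDeriv_Phi _ _ hq,
    Phi_embK, Phi_embK]
  funext c
  rw [Pi.sub_apply, Pi.smul_apply, PhiK_apply, PhiK_apply, PhiK_apply, pairing_polyAct,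
    pairing_polyAct, pairing_polyAct, recOp, sub_eq_add_neg (dAct _ _ _), ← neg_smul, pairing_add,
    pairing_smul, LinearMap.add_apply, LinearMap.smul_apply]
  module

lemma quatMat_half_i : quatMat (imQuat (-![1 / 2, 0, 0])) =
    !![-Complex.I / 2, 0; 0, Complex.I / 2] := by
  ext i j
  fin_cases i <;> fin_cases j <;> simp [quatMat, imQuat, Complex.ext_iff] <;> norm_num

lemma quatMat_half_j : quatMat (imQuat (-![0, 1 / 2, 0])) = !![0, 1 / 2; -1 / 2, 0] := by
  ext i j
  fin_cases i <;> fin_cases j <;> simp [quatMat, imQuat, Complex.ext_iff] <;> norm_num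

lemma quatMat_half_k : quatMat (imQuat (-![0, 0, 1 / 2])) =
    !![0, Complex.I / 2; Complex.I / 2, 0] := by
  ext i j
  fin_cases i <;> fin_cases j <;> simp [quatMat, imQuat, Complex.ext_iff] <;> norm_num

lemma coeff_recOp_zero (a : ℂ) (m : ℕ) (p : Polynomial ℂ) :
    (recOp a m p).coeff 0 = -(1 / 4) * ((m + 2 * a - 1) * p.coeff 1) := by
  simp only [recOp, Polynomial.coeff_sub, Polynomial.coeff_smul, coeff_dAct_zero, quatMat_half_i,
    quatMat_half_j, quatMat_half_k, Matrix.of_apply, Matrix.cons_val', Matrix.cons_val_zero,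
    Matrix.cons_val_one, Matrix.cons_val_fin_one, smul_eq_mul]
  linear_combination (m / 4 * p.coeff 1) * Complex.I_sq

/-- The half of `𝐢` acts diagonally on monomials, while those of `𝐣` and `𝐤` shift the degree by
one. So `recOp` changes parity, and each of its coefficients involves only two coefficients of `p`.
-/
lemma coeff_recOp_succ (a : ℂ) (m : ℕ) (p : Polynomial ℂ) (n : ℕ) :
    (recOp a m p).coeff (n + 1) = -(1 / 4) * ((n + 2) * (m - 2 * (n + 1) + 2 * a - 1) *
      p.coeff (n + 2) + (m - n) * (m - 2 * (n + 1) - 2 * a + 1) * p.coeff n) := by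
  simp only [recOp, Polynomial.coeff_sub, Polynomial.coeff_smul, coeff_dAct_succ, quatMat_half_i,
    quatMat_half_j, quatMat_half_k, Matrix.of_apply, Matrix.cons_val', Matrix.cons_val_zero,
    Matrix.cons_val_one, Matrix.cons_val_fin_one, smul_eq_mul]
  linear_combination ((m - 2 * (n + 1)) / 4 * ((n + 2) * p.coeff (n + 2) + (m - n) * p.coeff n)) *
    Complex.I_sq

end SL3Kernel

/-! ### Solution of the recursion by hypergeometric polynomials -/

namespace SL3Kernel

/-! ### The recursion -/

lemma coeff_recOp_eq (a : ℂ) (m : ℕ) (p : Polynomial ℂ) (n : ℕ) :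
    (recOp a m p).coeff n = -(1 / 4) * ((n + 1) * (m - 2 * n + 2 * a - 1) * p.coeff (n + 1) +
      (m - n + 1) * (m - 2 * n - 2 * a + 1) * (if n = 0 then 0 else p.coeff (n - 1))) := by
  cases n with
  | zero => rw [coeff_recOp_zero]; simp
  | succ n =>
    rw [coeff_recOp_succ, if_neg (Nat.succ_ne_zero n), Nat.add_sub_cancel]
    push_cast
    ring

/-- Reversing the order of the coefficients interchanges the two terms of the recursion, up to an
overall sign. -/
lemma recOp_reflect {a : ℂ} {m : ℕ} {p r : Polynomial ℂ} (hp : p.natDegree ≤ m)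
    (hr : r.natDegree ≤ m) (h : ∀ n ≤ m, r.coeff n = p.coeff (m - n)) (h0 : recOp a m p = 0) :
    recOp a m r = 0 := by
  ext n
  rw [Polynomial.coeff_zero]
  by_cases hn : n ≤ m
  · have h1 := congrArg (fun q => Polynomial.coeff q (m - n)) h0
    simp only [Polynomial.coeff_zero] at h1
    rw [coeff_recOp_eq] at h1 ⊢
    have e1 : r.coeff (n + 1) = if m - n = 0 then 0 else p.coeff (m - n - 1) := by
      split_ifs with hmn
      · exact Polynomial.coeff_eq_zero_of_natDegree_lt (by omega)
      · rw [h (n + 1) (by omega)]; congr 1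
    have e2 : (if n = 0 then 0 else r.coeff (n - 1)) = p.coeff (m - n + 1) := by
      split_ifs with hn0
      · exact (Polynomial.coeff_eq_zero_of_natDegree_lt (by omega)).symm
      · rw [h (n - 1) (by omega)]; congr 1; omega
    rw [e1, e2]
    rw [Nat.cast_sub hn] at h1
    linear_combination -h1
  · exact Polynomial.coeff_eq_zero_of_natDegree_lt (by have := natDegree_recOp a hr; omega)

lemma recOp_even_step {a : ℂ} {m M : ℕ} (hm : m = 2 * M + 1) {p : Polynomial ℂ}
    (h0 : recOp a m p = 0) (j : ℕ) :
    (2 * j + 2) * (M + a - 2 * j - 1) * p.coeff (2 * (j + 1)) +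
      (2 * M + 1 - 2 * j) * (M - a - 2 * j) * p.coeff (2 * j) = 0 := by
  have h1 := congrArg (fun q => Polynomial.coeff q (2 * j + 1)) h0
  simp only [Polynomial.coeff_zero] at h1
  rw [coeff_recOp_succ, hm] at h1
  push_cast at h1
  rw [show 2 * (j + 1) = 2 * j + 2 by ring]
  linear_combination -2 * h1

/-- Let `2j` be the degree of `p`. The recursion at the top has only the term with `p_{2j} ≠ 0`,
whose factor `2M + 1 - 2j` is odd; hence `M - a - 2j = 0`. -/
lemma exists_int_of_recOp {a : ℂ} {m M : ℕ} (hm : m = 2 * M + 1) {p : Polynomial ℂ}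
    (hp : p.natDegree ≤ m) (heven : ∀ n, ¬ Even n → p.coeff n = 0) (hp0 : p ≠ 0)
    (h0 : recOp a m p = 0) : ∃ (n : ℤ) (k : ℕ), a = n ∧ m = mInd n k := by
  have hlc : p.coeff p.natDegree ≠ 0 := Polynomial.leadingCoeff_ne_zero.2 hp0
  have hev : Even p.natDegree := by
    by_contra h
    exact hlc (heven _ h)
  obtain ⟨j, hj⟩ := hev
  have h1 := recOp_even_step hm h0 j
  rw [← two_mul] at hj
  rw [Polynomial.coeff_eq_zero_of_natDegree_lt (by omega : p.natDegree < 2 * (j + 1)), mul_zero,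
    zero_add, ← hj] at h1
  have h2 : (2 * M + 1 - 2 * j : ℂ) ≠ 0 := by
    intro h
    have : ((2 * M + 1 - 2 * j : ℤ) : ℂ) = 0 := by push_cast; exact h
    rw [Int.cast_eq_zero] at this
    omega
  rw [mul_eq_zero, mul_eq_zero] at h1
  have h3 : (M - a - 2 * j : ℂ) = 0 := by tauto
  -- Since `2j ≤ 2M + 1`, we have `0 ≤ j ≤ M` and `|M - 2j| ≤ M` with the same parity as `M`; so the
  -- division by two is exact.
  refine ⟨(M : ℤ) - 2 * j, (M - ((M : ℤ) - 2 * j).natAbs) / 2, ?_, ?_⟩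
  · push_cast
    linear_combination -h3
  · rw [mInd]
    omega

lemma poch_succ (x : ℂ) (l : ℕ) : poch x (l + 1) = poch x l * (x + l) :=
  Finset.prod_range_succ _ _

lemma poch_ne_zero {x : ℂ} (h : ∀ i : ℕ, x + i ≠ 0) (l : ℕ) : poch x l ≠ 0 :=
  Finset.prod_ne_zero_iff.2 fun i _ => h i

/-- Twice this number is odd, because `a + |a|` is even. So no denominator of the series vanishes,
and neither does the leading factor of the recursion. -/
lemma hyp_denominator_ne_zero (a : ℤ) (k i : ℕ) :
    (-(a : ℂ) / 2 - ((|a| : ℤ) : ℂ) / 2 + 1 / 2 - k + i) ≠ 0 := by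
  intro h
  have : ((-a - |a| + 1 - 2 * k + 2 * i : ℤ) : ℂ) = 0 := by
    push_cast
    linear_combination 2 * h
  rw [Int.cast_eq_zero] at this
  rcases abs_choice a with h | h <;> rw [h] at this <;> omega

lemma hypCoeff_zero (a : ℤ) (k : ℕ) : hypCoeff a k 0 = 1 := by
  simp [hypCoeff, poch]

/-- The ratio of consecutive hypergeometric terms is that prescribed by the recursion of `recOp` for
`M = |a| + 2k`. -/
lemma hypCoeff_succ (a : ℤ) (k l : ℕ) :
    (2 * l + 2) * ((|a| : ℤ) + 2 * k + a - 2 * l - 1) * hypCoeff a k (l + 1) +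
      (2 * ((|a| : ℤ) + 2 * k) + 1 - 2 * l) * ((|a| : ℤ) + 2 * k - a - 2 * l) * hypCoeff a k l = 0 := by
  have h1 := hyp_denominator_ne_zero a k l
  have h2 := poch_ne_zero (hyp_denominator_ne_zero a k) l
  have h3 : (l.factorial : ℂ) ≠ 0 := by exact_mod_cast l.factorial_ne_zero
  have h4 : (l + 1 : ℂ) ≠ 0 := by exact_mod_cast l.succ_ne_zero
  simp only [hypCoeff, poch_succ, Nat.factorial_succ]
  push_cast
  generalize (((|a| : ℤ) : ℂ)) = A at *
  generalize poch (-(a : ℂ) / 2 - A / 2 + 1 / 2 - k) l = P at *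
  have h5 : (2 * l + 2) * (A + 2 * k + a - 2 * l - 1) =
      -4 * (l + 1) * (-(a : ℂ) / 2 - A / 2 + 1 / 2 - k + l) := by ring
  rw [h5]
  have e : ∀ P₁ P₂ x₁ x₂ D F : ℂ, D ≠ 0 → F ≠ 0 →
      (l + 1) * D * (P₁ * x₁ * (P₂ * x₂) / ((l + 1) * F * (P * D))) =
        x₁ * x₂ * (P₁ * P₂ / (F * P)) := by
    intro P₁ P₂ x₁ x₂ D F hD hF
    field_simp
  linear_combination (-4) * e (poch (-A - 1 / 2 - 2 * k) l) (poch ((a : ℂ) / 2 - A / 2 - k) l)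
    (-A - 1 / 2 - 2 * k + l) ((a : ℂ) / 2 - A / 2 - k + l) _ _ h1 h3

/-- The second upper parameter is `-hypDeg a k`, so its Pochhammer symbol acquires a zero factor.
Formulas for the coefficients therefore hold without restriction on the index. -/
lemma hypCoeff_eq_zero (a : ℤ) (k l : ℕ) (h : hypDeg a k < l) : hypCoeff a k l = 0 := by
  have h1 : poch ((a : ℂ) / 2 - ((|a| : ℤ) : ℂ) / 2 - k) l = 0 := by
    refine Finset.prod_eq_zero (i := hypDeg a k) (Finset.mem_range.2 h) ?_
    have h2 : ((2 * hypDeg a k : ℕ) : ℤ) = |a| - a + 2 * k := by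
      rw [hypDeg, Int.abs_eq_natAbs]
      omega
    have h3 : (2 * hypDeg a k : ℂ) = ((|a| : ℤ) : ℂ) - a + 2 * k := by exact_mod_cast h2
    linear_combination h3 / 2
  rw [hypCoeff]
  simp only [h1, mul_zero, zero_div]

lemma two_hypDeg_le (a : ℤ) (k : ℕ) : 2 * hypDeg a k ≤ mInd a k := by
  rw [hypDeg, mInd, Int.abs_eq_natAbs]
  omega

lemma coeff_qPoly (a : ℤ) (k n : ℕ) : (qPoly a k).coeff n =
    if Even n then hypCoeff a k (n / 2) else 0 := by
  rw [qPoly, Polynomial.finset_sum_coeff]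
  simp_rw [Polynomial.coeff_C_mul_X_pow]
  split_ifs with h
  · obtain ⟨l, hl⟩ := h
    have e : n / 2 = l := by omega
    rw [e]
    by_cases hle : l ≤ hypDeg a k
    · rw [Finset.sum_eq_single l]
      · rw [if_pos (by omega)]
      · intro i _ hi
        rw [if_neg (by omega)]
      · intro hi
        rw [Finset.mem_range] at hi
        omega
    · rw [hypCoeff_eq_zero a k l (by omega)]
      refine Finset.sum_eq_zero fun i hi => ?_
      rw [Finset.mem_range] at hi
      rw [if_neg (by omega)]
  · refine Finset.sum_eq_zero fun i hi => ?_
    rw [if_neg]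
    rintro rfl
    exact h (even_two_mul i)

lemma natDegree_qPoly (a : ℤ) (k : ℕ) : (qPoly a k).natDegree ≤ mInd a k := by
  refine Polynomial.natDegree_sum_le_of_forall_le _ _ fun i hi => ?_
  rw [Finset.mem_range] at hi
  refine (Polynomial.natDegree_C_mul_X_pow_le _ _).trans ?_
  have := two_hypDeg_le a k
  omega

lemma natDegree_qRev (a : ℤ) (k : ℕ) : (qRev a k).natDegree ≤ mInd a k := by
  refine Polynomial.natDegree_sum_le_of_forall_le _ _ fun i hi => ?_
  exact (Polynomial.natDegree_C_mul_X_pow_le _ _).trans (Nat.sub_le _ _)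

lemma coeff_qRev (a : ℤ) (k n : ℕ) (hn : n ≤ mInd a k) :
    (qRev a k).coeff n = (qPoly a k).coeff (mInd a k - n) := by
  rw [qRev, qPoly, Polynomial.finset_sum_coeff, Polynomial.finset_sum_coeff]
  refine Finset.sum_congr rfl fun i hi => ?_
  rw [Finset.mem_range] at hi
  rw [Polynomial.coeff_C_mul_X_pow, Polynomial.coeff_C_mul_X_pow]
  have := two_hypDeg_le a k
  congr 1
  rw [eq_iff_iff]
  omega

lemma mInd_eq (a : ℤ) (k : ℕ) : mInd a k = 2 * (a.natAbs + 2 * k) + 1 := by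
  rw [mInd]; ring

lemma recOp_qPoly (a : ℤ) (k : ℕ) : recOp (a : ℂ) (mInd a k) (qPoly a k) = 0 := by
  ext n
  rw [Polynomial.coeff_zero]
  have hA : ((a.natAbs : ℕ) : ℂ) = ((|a| : ℤ) : ℂ) := by
    rw [Int.abs_eq_natAbs]; rfl
  have hM : (mInd a k : ℂ) = 2 * (((|a| : ℤ) : ℂ) + 2 * k) + 1 := by
    rw [mInd_eq]; push_cast; rw [← hA]
  rcases Nat.even_or_odd n with hn | ⟨l, rfl⟩
  · rw [coeff_recOp_eq, coeff_qPoly, if_neg (by rw [Nat.not_even_iff_odd]; exact hn.add_one)]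
    split_ifs with h0
    · simp
    · rw [coeff_qPoly, if_neg]
      · simp
      · rw [Nat.even_iff] at hn ⊢
        omega
  · rw [coeff_recOp_succ, coeff_qPoly, coeff_qPoly, if_pos (by simp [parity_simps]), if_pos (by simp),
      show (2 * l + 2) / 2 = l + 1 by omega, show 2 * l / 2 = l by omega, hM]
    have := hypCoeff_succ a k l
    push_cast
    linear_combination (-1 / 2) * this

lemma recOp_qRev (a : ℤ) (k : ℕ) : recOp (a : ℂ) (mInd a k) (qRev a k) = 0 :=
  recOp_reflect (natDegree_qPoly a k) (natDegree_qRev a k) (fun n hn => coeff_qRev a k n hn)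
    (recOp_qPoly a k)

/-- The factor of `p_{2l+2}` never vanishes, so an even solution is determined by its constant term.
-/
lemma eq_smul_qPoly {a : ℤ} {k : ℕ} {p : Polynomial ℂ} (heven : ∀ n, ¬ Even n → p.coeff n = 0)
    (h0 : recOp (a : ℂ) (mInd a k) p = 0) : p = p.coeff 0 • qPoly a k := by
  have hA : ((a.natAbs : ℕ) : ℂ) = ((|a| : ℤ) : ℂ) := by
    rw [Int.abs_eq_natAbs]; rfl
  have key : ∀ l, p.coeff (2 * l) = p.coeff 0 * hypCoeff a k l := by
    intro l
    induction l with
    | zero => rw [hypCoeff_zero]; simp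
    | succ l ih =>
      have h1 := recOp_even_step (mInd_eq a k) h0 l
      have h2 := hypCoeff_succ a k l
      have h3 : (2 * l + 2 : ℂ) * (((|a| : ℤ) : ℂ) + 2 * k + a - 2 * l - 1) ≠ 0 := by
        refine mul_ne_zero (by exact_mod_cast (by omega : 2 * l + 2 ≠ 0)) ?_
        have := hyp_denominator_ne_zero a k l
        intro h
        apply this
        linear_combination (-1 / 2) * h
      apply mul_left_cancel₀ h3
      rw [ih] at h1
      push_cast at h1
      rw [hA] at h1
      linear_combination h1 - p.coeff 0 * h2
  ext n
  rw [Polynomial.coeff_smul, coeff_qPoly, smul_eq_mul]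
  split_ifs with h
  · obtain ⟨l, rfl⟩ := h
    rw [← two_mul, key, show 2 * l / 2 = l by omega]
  · rw [heven n h, mul_zero]

/-! ### Invariance under `M` -/

lemma quatMat_kI_inv : quatMat ((kI⁻¹ : K) : ℍ[ℝ]) = !![-Complex.I, 0; 0, Complex.I] := by
  have h : ((kI⁻¹ : K) : ℍ[ℝ]) = star (kI : ℍ[ℝ]) := rfl
  ext i j
  rw [h]
  fin_cases i <;> fin_cases j <;> simp [quatMat, Complex.ext_iff]

lemma quatMat_kK_inv : quatMat ((kK⁻¹ : K) : ℍ[ℝ]) = !![0, Complex.I; Complex.I, 0] := by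
  have h : ((kK⁻¹ : K) : ℍ[ℝ]) = star (kK : ℍ[ℝ]) := rfl
  ext i j
  rw [h]
  fin_cases i <;> fin_cases j <;> simp [quatMat, Complex.ext_iff]

/-- The element `𝐢` acts by a diagonal matrix, so monomials are eigenvectors. -/
lemma coeff_polyAct_kI {m n : ℕ} (hn : n ≤ m) (q : Polynomial ℂ) :
    (polyAct m kI q).coeff n = Complex.I ^ m * (-1) ^ n * q.coeff n := by
  have h : ∀ j ∈ Finset.range (m + 1), (Polynomial.C (q.coeff j) *
      (Polynomial.C (-Complex.I) * Polynomial.X + Polynomial.C 0) ^ j *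
      (Polynomial.C 0 * Polynomial.X + Polynomial.C Complex.I) ^ (m - j)).coeff n =
      if n = j then Complex.I ^ m * (-1) ^ n * q.coeff n else 0 := by
    intro j hj
    rw [Finset.mem_range] at hj
    have e : Polynomial.C (q.coeff j) *
      (Polynomial.C (-Complex.I) * Polynomial.X + Polynomial.C 0) ^ j *
      (Polynomial.C 0 * Polynomial.X + Polynomial.C Complex.I) ^ (m - j) =
      Polynomial.C (Complex.I ^ m * (-1) ^ j * q.coeff j) * Polynomial.X ^ j := by
      have e1 : Complex.I ^ m = Complex.I ^ j * Complex.I ^ (m - j) := by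
        rw [← pow_add]; congr 1; omega
      rw [e1, neg_eq_neg_one_mul Complex.I]
      simp only [map_zero, zero_mul, zero_add, add_zero, mul_pow, map_mul, map_pow]
      ring
    rw [e, Polynomial.coeff_C_mul_X_pow]
    split_ifs with hnj
    · rw [hnj]
    · rfl
  rw [polyAct, Polynomial.finset_sum_coeff]
  simp only [quatMat_kI_inv, Matrix.of_apply, Matrix.cons_val', Matrix.cons_val_zero,
    Matrix.cons_val_one, Matrix.cons_val_fin_one]
  rw [Finset.sum_congr rfl h, Finset.sum_ite_eq, if_pos (by rw [Finset.mem_range]; omega)]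

/-- The element `𝐤` interchanges the two homogeneous coordinates up to the scalar `I`, which
reverses the coefficients. -/
lemma coeff_polyAct_kK {m n : ℕ} (hn : n ≤ m) (q : Polynomial ℂ) :
    (polyAct m kK q).coeff n = Complex.I ^ m * q.coeff (m - n) := by
  have h : ∀ j ∈ Finset.range (m + 1), (Polynomial.C (q.coeff j) *
      (Polynomial.C 0 * Polynomial.X + Polynomial.C Complex.I) ^ j *
      (Polynomial.C Complex.I * Polynomial.X + Polynomial.C 0) ^ (m - j)).coeff n =
      if m - n = j then Complex.I ^ m * q.coeff (m - n) else 0 := by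
    intro j hj
    rw [Finset.mem_range] at hj
    have e : Polynomial.C (q.coeff j) *
      (Polynomial.C 0 * Polynomial.X + Polynomial.C Complex.I) ^ j *
      (Polynomial.C Complex.I * Polynomial.X + Polynomial.C 0) ^ (m - j) =
      Polynomial.C (Complex.I ^ m * q.coeff j) * Polynomial.X ^ (m - j) := by
      have e1 : Complex.I ^ m = Complex.I ^ j * Complex.I ^ (m - j) := by
        rw [← pow_add]; congr 1; omega
      rw [e1]
      simp only [map_zero, zero_mul, zero_add, add_zero, mul_pow, map_mul, map_pow]
      ring
    rw [e, Polynomial.coeff_C_mul_X_pow]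
    by_cases hnj : m - n = j
    · rw [if_pos hnj, if_pos (by omega), hnj]
    · rw [if_neg hnj, if_neg (by omega)]
  rw [polyAct, Polynomial.finset_sum_coeff]
  simp only [quatMat_kK_inv, Matrix.of_apply, Matrix.cons_val', Matrix.cons_val_zero,
    Matrix.cons_val_one, Matrix.cons_val_fin_one]
  rw [Finset.sum_congr rfl h, Finset.sum_ite_eq, if_pos (by rw [Finset.mem_range]; omega)]

end SL3Kernel

/-! ### Invariant pairs that solve the recursion -/

namespace SL3Kernel

/-- The pair `(q 0, q 1)` is an `M`-invariant element of `𝒫_m[t] ⊗ σ⁰`. -/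
structure MInv (m : ℕ) (q : Fin 2 → Polynomial ℂ) : Prop where
  deg : ∀ c, (q c).natDegree ≤ m
  kI0 : polyAct m kI (q 0) = (-Complex.I) • q 0
  kI1 : polyAct m kI (q 1) = Complex.I • q 1
  kK0 : polyAct m kK (q 0) = Complex.I • q 1
  kK1 : polyAct m kK (q 1) = Complex.I • q 0

lemma symRep_one (m : ℕ) (v : SymPow m) : symRep m 1 v = v := by
  have : symRep m 1 = LinearMap.id := by
    refine symPow_hom_ext_pw fun c => ?_
    rw [symRep_pw]
    simp
  rw [this]; rfl

lemma PhiK_one (m : ℕ) (q : Fin 2 → Polynomial ℂ) (v : SymPow m) (c : Fin 2) :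
    PhiK m q v 1 c = pairing m (q c) v := by
  rw [PhiK_apply, pairing_polyAct, inv_one]
  have : quatMat ((1 : K) : ℍ[ℝ]) = 1 := quatMat_one
  rw [this, symRep_one]

/-- Evaluation at `1` is the pairing itself, which is nondegenerate, so equivariance at that one
point determines the action on the polynomials. -/
lemma mInv_of_PhiK {m : ℕ} {q : Fin 2 → Polynomial ℂ} (hq : ∀ c, (q c).natDegree ≤ m)
    (hI : ∀ v, PhiK m q v kI = (quatMat ((kI⁻¹ : K) : ℍ[ℝ])).mulVec (PhiK m q v 1))
    (hK : ∀ v, PhiK m q v kK = (quatMat ((kK⁻¹ : K) : ℍ[ℝ])).mulVec (PhiK m q v 1)) :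
    MInv m q := by
  have hd : ∀ (x : ℂ) (c : Fin 2), (x • q c).natDegree ≤ m :=
    fun x c => (Polynomial.natDegree_smul_le _ _).trans (hq c)
  refine ⟨hq, ?_, ?_, ?_, ?_⟩
  · refine pairing_injective (natDegree_polyAct _ _ _) (hd _ _) fun v => ?_
    have h := congrFun (hI v) 0
    rw [quatMat_kI_inv, Matrix.mulVec, dotProduct, Fin.sum_univ_two, PhiK_one, PhiK_one] at h
    rw [pairing_smul]
    simpa [PhiK_apply] using h
  · refine pairing_injective (natDegree_polyAct _ _ _) (hd _ _) fun v => ?_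
    have h := congrFun (hI v) 1
    rw [quatMat_kI_inv, Matrix.mulVec, dotProduct, Fin.sum_univ_two, PhiK_one, PhiK_one] at h
    rw [pairing_smul]
    simpa [PhiK_apply] using h
  · refine pairing_injective (natDegree_polyAct _ _ _) (hd _ _) fun v => ?_
    have h := congrFun (hK v) 0
    rw [quatMat_kK_inv, Matrix.mulVec, dotProduct, Fin.sum_univ_two, PhiK_one, PhiK_one] at h
    rw [pairing_smul]
    simpa [PhiK_apply] using h
  · refine pairing_injective (natDegree_polyAct _ _ _) (hd _ _) fun v => ?_
    have h := congrFun (hK v) 1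
    rw [quatMat_kK_inv, Matrix.mulVec, dotProduct, Fin.sum_univ_two, PhiK_one, PhiK_one] at h
    rw [pairing_smul]
    simpa [PhiK_apply] using h

lemma pairing_polyAct_smul (m : ℕ) (y : K) (c : ℂ) (q : Polynomial ℂ) (v : SymPow m) :
    pairing m (polyAct m y (c • q)) v = c * pairing m (polyAct m y q) v := by
  rw [pairing_polyAct, pairing_smul, pairing_polyAct]
  rfl

lemma MInv.PhiK_mul_kI {m : ℕ} {q : Fin 2 → Polynomial ℂ} (h : MInv m q) (v : SymPow m) (y : K) :
    PhiK m q v (y * kI) = (quatMat ((kI⁻¹ : K) : ℍ[ℝ])).mulVec (PhiK m q v y) := by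
  rw [PhiK_mul_right, quatMat_kI_inv]
  funext c
  rw [Matrix.mulVec, dotProduct, Fin.sum_univ_two]
  fin_cases c
  · simp [PhiK_apply, h.kI0, pairing_polyAct_smul, -neg_smul]
  · simp [PhiK_apply, h.kI1, pairing_polyAct_smul]

lemma MInv.PhiK_mul_kK {m : ℕ} {q : Fin 2 → Polynomial ℂ} (h : MInv m q) (v : SymPow m) (y : K) :
    PhiK m q v (y * kK) = (quatMat ((kK⁻¹ : K) : ℍ[ℝ])).mulVec (PhiK m q v y) := by
  rw [PhiK_mul_right, quatMat_kK_inv]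
  funext c
  rw [Matrix.mulVec, dotProduct, Fin.sum_univ_two]
  fin_cases c
  · simp [PhiK_apply, h.kK0, pairing_polyAct_smul]
  · simp [PhiK_apply, h.kK1, pairing_polyAct_smul]

lemma I_pow_of_mod_one {m : ℕ} (h : m % 4 = 1) : Complex.I ^ m = Complex.I := by
  rw [Complex.I_pow_eq_pow_mod, h, pow_one]

lemma I_pow_of_mod_three {m : ℕ} (h : m % 4 = 3) : Complex.I ^ m = -Complex.I := by
  rw [Complex.I_pow_eq_pow_mod, h, Complex.I_pow_three]

lemma ext_of_natDegree_le {m : ℕ} {p q : Polynomial ℂ} (hp : p.natDegree ≤ m) (hq : q.natDegree ≤ m)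
    (h : ∀ n ≤ m, p.coeff n = q.coeff n) : p = q := by
  ext n
  by_cases hn : n ≤ m
  · exact h n hn
  · rw [Polynomial.coeff_eq_zero_of_natDegree_lt (by omega),
      Polynomial.coeff_eq_zero_of_natDegree_lt (by omega)]

lemma coeff_qPoly_odd {a : ℤ} {k n : ℕ} (h : ¬ Even n) : (qPoly a k).coeff n = 0 := by
  rw [coeff_qPoly, if_neg h]

lemma mInv_of_coeff {m : ℕ} {q : Fin 2 → Polynomial ℂ} (hd : ∀ c, (q c).natDegree ≤ m)
    (h : ∀ n ≤ m, (Complex.I ^ m * (-1) ^ n * (q 0).coeff n = -Complex.I * (q 0).coeff n ∧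
      Complex.I ^ m * (-1) ^ n * (q 1).coeff n = Complex.I * (q 1).coeff n) ∧
      Complex.I ^ m * (q 0).coeff (m - n) = Complex.I * (q 1).coeff n ∧
      Complex.I ^ m * (q 1).coeff (m - n) = Complex.I * (q 0).coeff n) : MInv m q := by
  have ds : ∀ (x : ℂ) (c : Fin 2), (x • q c).natDegree ≤ m :=
    fun x c => (Polynomial.natDegree_smul_le _ _).trans (hd c)
  refine ⟨hd, ?_, ?_, ?_, ?_⟩ <;>
    refine ext_of_natDegree_le (natDegree_polyAct _ _ _) (ds _ _) fun n hn => ?_ <;>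
    rw [Polynomial.coeff_smul, smul_eq_mul]
  · rw [coeff_polyAct_kI hn, (h n hn).1.1]
  · rw [coeff_polyAct_kI hn, (h n hn).1.2]
  · rw [coeff_polyAct_kK hn, (h n hn).2.1]
  · rw [coeff_polyAct_kK hn, (h n hn).2.2]

/-- Modulo 4 the index `mInd a k` is `1` for even `a` and `3` for odd `a`, so `I^m` is `I` or `-I`.
This sign decides which component is even, and with what sign the other is its reversal. -/
lemma mInv_qPair (a : ℤ) (k : ℕ) : MInv (mInd a k) (qPair a k) := by
  have d0 := natDegree_qPoly a k
  have d1 := natDegree_qRev a k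
  have hodd : mInd a k % 2 = 1 := by rw [mInd_eq]; omega
  have dn : (-qRev a k).natDegree ≤ mInd a k := by rw [Polynomial.natDegree_neg]; exact d1
  have hrev : ∀ n ≤ mInd a k, (qRev a k).coeff (mInd a k - n) = (qPoly a k).coeff n := by
    intro n hn
    rw [coeff_qRev a k _ (Nat.sub_le _ _), Nat.sub_sub_self hn]
  have c0 : ∀ n : ℕ, (-1 : ℂ) ^ n * (qPoly a k).coeff n = (qPoly a k).coeff n := by
    intro n
    by_cases h : Even n
    · rw [h.neg_one_pow, one_mul]
    · rw [coeff_qPoly_odd h, mul_zero]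
  have c1 : ∀ n ≤ mInd a k, (-1 : ℂ) ^ n * (qRev a k).coeff n = -(qRev a k).coeff n := by
    intro n hn
    rw [coeff_qRev a k n hn]
    by_cases h : Even n
    · rw [coeff_qPoly_odd, mul_zero, neg_zero]
      rw [Nat.even_iff] at h ⊢
      omega
    · rw [(Nat.not_even_iff_odd.1 h).neg_one_pow, neg_one_mul]
  by_cases ha : Even a
  · have hI : Complex.I ^ mInd a k = Complex.I := I_pow_of_mod_one (by
      rw [mInd]; rw [← Int.natAbs_even, Nat.even_iff] at ha; omega)
    have e : qPair a k = ![qRev a k, qPoly a k] := if_pos ha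
    rw [e]
    refine mInv_of_coeff (fun c => by fin_cases c <;> assumption) fun n hn => ?_
    change (_ * (qRev a k).coeff n = _ * (qRev a k).coeff n ∧
      _ * (qPoly a k).coeff n = _ * (qPoly a k).coeff n) ∧
      _ * (qRev a k).coeff (mInd a k - n) = _ * (qPoly a k).coeff n ∧
      _ * (qPoly a k).coeff (mInd a k - n) = _ * (qRev a k).coeff n
    rw [hI, hrev n hn, ← coeff_qRev a k n hn]
    exact ⟨⟨by linear_combination Complex.I * c1 n hn, by linear_combination Complex.I * c0 n⟩,
      rfl, rfl⟩
  · have hI : Complex.I ^ mInd a k = -Complex.I := I_pow_of_mod_three (by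
      rw [mInd]; rw [← Int.natAbs_even, Nat.even_iff] at ha; omega)
    have e : qPair a k = ![qPoly a k, -qRev a k] := if_neg ha
    rw [e]
    refine mInv_of_coeff (fun c => by fin_cases c <;> assumption) fun n hn => ?_
    change (_ * (qPoly a k).coeff n = _ * (qPoly a k).coeff n ∧
      _ * (-qRev a k).coeff n = _ * (-qRev a k).coeff n) ∧
      _ * (qPoly a k).coeff (mInd a k - n) = _ * (-qRev a k).coeff n ∧
      _ * (-qRev a k).coeff (mInd a k - n) = _ * (qPoly a k).coeff n
    rw [hI, Polynomial.coeff_neg, Polynomial.coeff_neg, hrev n hn, ← coeff_qRev a k n hn]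
    exact ⟨⟨by linear_combination -Complex.I * c0 n, by linear_combination Complex.I * c1 n hn⟩,
      by ring, by ring⟩

lemma recOp_neg (a : ℂ) (m : ℕ) (p : Polynomial ℂ) : recOp a m (-p) = -recOp a m p := by
  ext n
  rw [Polynomial.coeff_neg, coeff_recOp_eq, coeff_recOp_eq]
  simp only [Polynomial.coeff_neg]
  split_ifs <;> ring

lemma recOp_qPair (a : ℤ) (k : ℕ) (c : Fin 2) : recOp (a : ℂ) (mInd a k) (qPair a k c) = 0 := by
  rw [qPair]
  split_ifs
  · fin_cases c
    · exact recOp_qRev a k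
    · exact recOp_qPoly a k
  · fin_cases c
    · exact recOp_qPoly a k
    · change recOp (a : ℂ) (mInd a k) (-qRev a k) = 0
      rw [recOp_neg, recOp_qRev, neg_zero]

lemma qPair_ne_zero (a : ℤ) (k : ℕ) : ∃ c, qPair a k c ≠ 0 := by
  have h : qPoly a k ≠ 0 := by
    intro h
    have h1 := coeff_qPoly a k 0
    rw [h, if_pos (by simp), Nat.zero_div, hypCoeff_zero] at h1
    simp at h1
  rw [qPair]
  split_ifs
  · exact ⟨1, h⟩
  · exact ⟨0, h⟩

/-- Invariance under `𝐢` excludes even `m` and forces one component to be even; invariance under `𝐤`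
makes the other its reversal up to sign. The recursion for the even component then determines `a`,
`m` and the pair. -/
lemma MInv.eq_smul_qPair {a : ℂ} {m : ℕ} {q : Fin 2 → Polynomial ℂ} (h : MInv m q)
    (hrec : ∀ c, recOp a m (q c) = 0) (hq : q ≠ 0) :
    ∃ (n : ℤ) (k : ℕ) (x : ℂ), a = n ∧ m = mInd n k ∧ ∀ c, q c = x • qPair n k c := by
  have hI0 : ∀ n ≤ m, Complex.I ^ m * (-1) ^ n * (q 0).coeff n = -Complex.I * (q 0).coeff n :=
    fun n hn => by rw [← coeff_polyAct_kI hn, h.kI0, Polynomial.coeff_smul, smul_eq_mul]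
  have hI1 : ∀ n ≤ m, Complex.I ^ m * (-1) ^ n * (q 1).coeff n = Complex.I * (q 1).coeff n :=
    fun n hn => by rw [← coeff_polyAct_kI hn, h.kI1, Polynomial.coeff_smul, smul_eq_mul]
  have hK0 : ∀ n ≤ m, Complex.I ^ m * (q 0).coeff (m - n) = Complex.I * (q 1).coeff n :=
    fun n hn => by rw [← coeff_polyAct_kK hn, h.kK0, Polynomial.coeff_smul, smul_eq_mul]
  have hK1 : ∀ n ≤ m, Complex.I ^ m * (q 1).coeff (m - n) = Complex.I * (q 0).coeff n :=
    fun n hn => by rw [← coeff_polyAct_kK hn, h.kK1, Polynomial.coeff_smul, smul_eq_mul]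
  have hz : ∀ c n, ¬ n ≤ m → (q c).coeff n = 0 := fun c n hn =>
    Polynomial.coeff_eq_zero_of_natDegree_lt (by have := h.deg c; omega)
  have hI := Complex.I_ne_zero
  have h2I : ∀ x : ℂ, Complex.I * x = -Complex.I * x → x = 0 := fun x hx => by
    have : (2 * Complex.I) * x = 0 := by linear_combination hx
    simpa using this
  have hcase : m % 4 = 0 ∨ m % 4 = 1 ∨ m % 4 = 2 ∨ m % 4 = 3 := by omega
  -- If `I^m = ±1`, the eigenvalues of `𝐢` on monomials are `±1`, while invariance requires `±I`.
  have heven : Complex.I ^ m = 1 ∨ Complex.I ^ m = -1 → False := by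
    intro hm
    have hu : ∀ (n : ℕ) (x : ℂ), x = Complex.I ∨ x = -Complex.I →
        Complex.I ^ m * (-1) ^ n ≠ x := by
      intro n x hx e
      have h1 : (Complex.I ^ m * (-1) ^ n) ^ 2 = 1 := by
        rcases hm with hm | hm <;> rw [hm] <;> rcases Nat.even_or_odd n with hn | hn <;>
          rw [hn.neg_one_pow] <;> norm_num
      rw [e] at h1
      rcases hx with rfl | rfl
      · rw [Complex.I_sq] at h1; norm_num at h1
      · rw [neg_sq, Complex.I_sq] at h1; norm_num at h1
    apply hq
    funext c
    ext n
    by_cases hn : n ≤ m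
    · fin_cases c
      · by_contra hne
        exact hu n _ (Or.inr rfl) (mul_right_cancel₀ hne (hI0 n hn))
      · by_contra hne
        exact hu n _ (Or.inl rfl) (mul_right_cancel₀ hne (hI1 n hn))
    · rw [hz c n hn]; simp
  rcases hcase with hm | hm | hm | hm
  · exact (heven (Or.inl (by rw [Complex.I_pow_eq_pow_mod, hm, pow_zero]))).elim
  · have hIm := I_pow_of_mod_one hm
    rw [hIm] at hI0 hI1 hK0 hK1
    have hp : ∀ n, ¬ Even n → (q 1).coeff n = 0 := by
      intro n hn
      by_cases hnm : n ≤ m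
      · have := hI1 n hnm
        rw [(Nat.not_even_iff_odd.1 hn).neg_one_pow] at this
        exact h2I _ (by linear_combination -this)
      · exact hz 1 n hnm
    have hr : ∀ n ≤ m, (q 0).coeff n = (q 1).coeff (m - n) := fun n hn =>
      (mul_left_cancel₀ hI (hK1 n hn)).symm
    have h10 : q 1 ≠ 0 := by
      intro h0
      apply hq
      funext c
      fin_cases c
      · ext n
        by_cases hn : n ≤ m
        · change (q 0).coeff n = 0
          rw [hr n hn, h0, Polynomial.coeff_zero]
        · exact hz 0 n hn
      · exact h0
    obtain ⟨a', k, rfl, hmk⟩ := exists_int_of_recOp (M := m / 2) (by omega) (h.deg 1) hp h10 (hrec 1)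
    subst hmk
    have e1 := eq_smul_qPoly hp (hrec 1)
    have ha : Even a' := by
      rw [← Int.natAbs_even, Nat.even_iff]; rw [mInd] at hm; omega
    refine ⟨a', k, (q 1).coeff 0, rfl, rfl, fun c => ?_⟩
    rw [qPair, if_pos ha]
    fin_cases c
    · refine ext_of_natDegree_le (h.deg 0)
        ((Polynomial.natDegree_smul_le _ _).trans (natDegree_qRev a' k)) fun n hn => ?_
      change (q 0).coeff n = ((q 1).coeff 0 • qRev a' k).coeff n
      rw [hr n hn, Polynomial.coeff_smul, coeff_qRev a' k n hn, ← Polynomial.coeff_smul, ← e1]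
    · exact e1
  · exact (heven (Or.inr (by rw [Complex.I_pow_eq_pow_mod, hm, Complex.I_sq]))).elim
  · have hIm := I_pow_of_mod_three hm
    rw [hIm] at hI0 hI1 hK0 hK1
    have hp : ∀ n, ¬ Even n → (q 0).coeff n = 0 := by
      intro n hn
      by_cases hnm : n ≤ m
      · have := hI0 n hnm
        rw [(Nat.not_even_iff_odd.1 hn).neg_one_pow] at this
        exact h2I _ (by linear_combination this)
      · exact hz 0 n hnm
    have hr : ∀ n ≤ m, (q 1).coeff n = -(q 0).coeff (m - n) := fun n hn =>
      mul_left_cancel₀ hI (by linear_combination -(hK0 n hn))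
    have h10 : q 0 ≠ 0 := by
      intro h0
      apply hq
      funext c
      fin_cases c
      · exact h0
      · ext n
        by_cases hn : n ≤ m
        · change (q 1).coeff n = 0
          rw [hr n hn, h0, Polynomial.coeff_zero, neg_zero]
        · exact hz 1 n hn
    obtain ⟨a', k, rfl, hmk⟩ := exists_int_of_recOp (M := m / 2) (by omega) (h.deg 0) hp h10 (hrec 0)
    subst hmk
    have e1 := eq_smul_qPoly hp (hrec 0)
    have ha : ¬ Even a' := by
      rw [← Int.natAbs_even, Nat.even_iff]; rw [mInd] at hm; omega
    refine ⟨a', k, (q 0).coeff 0, rfl, rfl, fun c => ?_⟩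
    rw [qPair, if_neg ha]
    fin_cases c
    · exact e1
    · refine ext_of_natDegree_le (h.deg 1) ((Polynomial.natDegree_smul_le _ _).trans
        ((Polynomial.natDegree_neg (qRev a' k)).trans_le (natDegree_qRev a' k))) fun n hn => ?_
      change (q 1).coeff n = ((q 0).coeff 0 • -qRev a' k).coeff n
      rw [hr n hn, Polynomial.coeff_smul, Polynomial.coeff_neg, coeff_qRev a' k n hn, smul_neg,
        ← Polynomial.coeff_smul, ← e1]

/-! ### Smoothness of `Φ_m` -/

/-- On unit quaternions `star y` is the inverse of `y`; written with `star`, the function is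
polynomial in the coordinates of all quaternions. -/
lemma contDiff_pairing_symRep (m : ℕ) (p : Polynomial ℂ) (v : SymPow m) :
    ContDiff ℝ ∞ fun y : ℍ[ℝ] => pairing m p (symRep m (quatMat (star y)) v) := by
  have hv : v ∈ Submodule.span ℂ (Set.range fun c => pw m c 1) := by rw [span_pw]; trivial
  have hq : ∀ i j, ContDiff ℝ ∞ fun y : ℍ[ℝ] => quatMat (star y) i j := fun i j =>
    (LinearMap.toContinuousLinearMap
      { toFun := fun y : ℍ[ℝ] => quatMat (star y) i j
        map_add' := fun y z => by
          rw [star_add]; exact map_add (quatMatL i j) _ _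
        map_smul' := fun t y => by
          rw [Quaternion.star_smul]; exact map_smul (quatMatL i j) _ _ }).contDiff
  induction hv using Submodule.span_induction with
  | mem v hv =>
    obtain ⟨c, rfl⟩ := hv
    simp_rw [symRep_pw, pairing_pw]
    refine ContDiff.sum fun i _ => contDiff_const.mul (ContDiff.mul (ContDiff.pow ?_ _)
      (ContDiff.pow ?_ _))
    · exact ((hq 0 0).mul contDiff_const).add ((hq 0 1).mul contDiff_const)
    · exact ((hq 1 0).mul contDiff_const).add ((hq 1 1).mul contDiff_const)
  | zero => simp_rw [map_zero]; exact contDiff_const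
  | add v w _ _ hv hw => simp_rw [map_add]; exact hv.add hw
  | smul c v _ hv => simp_rw [map_smul]; exact hv.const_smul c

lemma MInv.Phi_mem_Ind {m : ℕ} {q : Fin 2 → Polynomial ℂ} (h : MInv m q) (ν : Fin 3 → ℂ)
    (v : SymPow m) : Phi ν m q v ∈ Ind ν := by
  refine extend_mem_Ind ν (F' := fun y c => pairing m (q c) (symRep m (quatMat (star y)) v))
    (contDiff_pi.2 fun c => contDiff_pairing_symRep m (q c) v) (fun y => ?_)
    (h.PhiK_mul_kI v) (h.PhiK_mul_kK v)
  funext c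
  rw [PhiK_apply, pairing_polyAct]
  rfl

lemma Phi_mem_kerDK (a : ℤ) (k : ℕ) (v : SymPow (mInd a k)) :
    Phi (-lam2 (-(a : ℂ))) (mInd a k) (qPair a k) v ∈ kerDK (a : ℂ) := by
  have hI := (mInv_qPair a k).Phi_mem_Ind (-lam2 (-(a : ℂ))) v
  refine ⟨hI, (Ind.D_eq_zero_iff_embK hI).2 fun y => ?_, kFinite_Phi _ _ _ _⟩
  rw [Dcoeff_Phi (mInv_qPair a k).deg hI]
  funext c
  rw [PhiK_apply, recOp_qPair, pairing_polyAct, pairing_eq]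
  simp

end SL3Kernel

/-! ### Highest weight theory for `𝔰𝔩(2,ℂ)` -/

namespace SL3Kernel

/-! ### Finite-dimensional representations of `𝔰𝔩(2,ℂ)` -/

section Sl2

variable {W : Type*} [AddCommGroup W] [Module ℂ W]

/-- The commutation relations of `𝔰𝔩(2,ℂ)`. -/
structure Sl2 (H E F : W →ₗ[ℂ] W) : Prop where
  hE : ∀ w, H (E w) = E (H w) + (2 : ℂ) • E w
  hF : ∀ w, H (F w) = F (H w) - (2 : ℂ) • F w
  eF : ∀ w, E (F w) = F (E w) + H w

variable {H E F : W →ₗ[ℂ] W}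

/-- The Weyl reflection; every statement about `F` also gives one about `E`. -/
lemma Sl2.symm (s : Sl2 H E F) : Sl2 (-H) F E where
  hE w := by simp only [LinearMap.neg_apply, s.hF, map_neg]; module
  hF w := by simp only [LinearMap.neg_apply, s.hE, map_neg]; module
  eF w := by simp only [LinearMap.neg_apply, s.eF]; module

lemma Sl2.H_pow (s : Sl2 H E F) (n : ℕ) (w : W) :
    H ((F ^ n) w) = (F ^ n) (H w) - (2 * n : ℂ) • (F ^ n) w := by
  induction n with
  | zero => simp
  | succ n ih =>
    rw [pow_succ', Module.End.mul_apply, Module.End.mul_apply, s.hF, ih, map_sub, map_smul]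
    push_cast
    module

/-- The vector `u` is not assumed to be an eigenvector of `H`, because diagonalizability of `H` on
the kernel of `E` is deduced from this formula in `Sl2.mem_hwSpan_of_pow`. -/
lemma Sl2.E_pow (s : Sl2 H E F) (n : ℕ) {u : W} (hu : E u = 0) :
    E ((F ^ (n + 1)) u) = (n + 1 : ℂ) • (F ^ n) (H u - (n : ℂ) • u) := by
  induction n with
  | zero => simp [s.eF, hu]
  | succ n ih =>
    rw [pow_succ', Module.End.mul_apply, s.eF, ih, s.H_pow, map_sub, map_sub, map_smul, map_smul,
      pow_succ' F n, Module.End.mul_apply, Module.End.mul_apply, map_smul, map_sub, map_smul]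
    push_cast
    module

lemma Sl2.kerE_stable (s : Sl2 H E F) {u : W} (hu : E u = 0) : E (H u) = 0 := by
  have := s.hE u
  rw [hu, map_zero, smul_zero, add_zero] at this
  exact this.symm

variable [FiniteDimensional ℂ W]

/-- Otherwise `H` would have the infinitely many eigenvalues `μ - 2n`. -/
lemma Sl2.exists_pow_eq_zero (s : Sl2 H E F) {w : W} {μ : ℂ} (h : H w = μ • w) :
    ∃ n, (F ^ n) w = 0 := by
  by_contra! hne
  have h1 : ∀ n : ℕ, Module.End.HasEigenvalue H (μ - 2 * n) := by
    intro n
    refine Module.End.hasEigenvalue_of_hasEigenvector (x := (F ^ n) w) ⟨?_, hne n⟩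
    rw [Module.End.mem_eigenspace_iff, s.H_pow, h, map_smul, sub_smul]
  have hfin := Module.End.finite_hasEigenvalue H
  have hinj : Function.Injective fun n : ℕ => μ - 2 * n := fun a b hab => by
    have : (a : ℂ) = b := by linear_combination (-1 / 2) * hab
    exact_mod_cast this
  exact (Set.infinite_range_of_injective hinj) (hfin.subset (by rintro _ ⟨n, rfl⟩; exact h1 n))

lemma exists_eigenvector_mem {p : Submodule ℂ W} (hp : p ≠ ⊥) (hH : ∀ w ∈ p, H w ∈ p) :
    ∃ w ∈ p, w ≠ 0 ∧ ∃ μ : ℂ, H w = μ • w := by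
  have : Nontrivial p := Submodule.nontrivial_iff_ne_bot.2 hp
  obtain ⟨μ, hμ⟩ := Module.End.exists_eigenvalue (H.restrict hH)
  obtain ⟨w, hw⟩ := hμ.exists_hasEigenvector
  refine ⟨w, w.2, fun h => hw.2 (Subtype.ext h), μ, ?_⟩
  exact congrArg Subtype.val hw.apply_eq_smul

/-- The kernels of the powers of `F` stabilize at some `F ^ n`. If the range of `F ^ n`, which is
`H`-stable, were nonzero, it would contain an eigenvector `F ^ n x` of `H`; a further power of `F`
kills it, so `x` already lies in the stable kernel, a contradiction. -/
lemma Sl2.nilpotent (s : Sl2 H E F) : ∃ n, ∀ w, (F ^ n) w = 0 := by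
  obtain ⟨n, hn⟩ := monotone_stabilizes_iff_noetherian.2 (inferInstance : IsNoetherian ℂ W)
    F.iterateKer
  by_cases hr : LinearMap.range (F ^ n) = ⊥
  · exact ⟨n, fun w => by
      have : (F ^ n) w ∈ LinearMap.range (F ^ n) := ⟨w, rfl⟩
      rw [hr] at this
      exact this⟩
  exfalso
  obtain ⟨w, ⟨x, hx⟩, hw0, μ, hμ⟩ := exists_eigenvector_mem (H := H) hr (by
    rintro _ ⟨x, rfl⟩
    exact ⟨H x - (2 * n : ℂ) • x, by rw [s.H_pow, map_sub, map_smul]⟩)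
  obtain ⟨k, hk⟩ := s.exists_pow_eq_zero hμ
  have h2 : x ∈ F.iterateKer (n + k) := by
    change x ∈ LinearMap.ker (F ^ (n + k))
    rw [LinearMap.mem_ker, add_comm, pow_add, Module.End.mul_apply, hx, hk]
  rw [← hn (n + k) (by omega)] at h2
  change x ∈ LinearMap.ker (F ^ n) at h2
  rw [LinearMap.mem_ker, hx] at h2
  exact hw0 h2

/-- If `F ^ (n + 1) u` is the first power that vanishes, then applying `E` to it gives `(n + 1)(μ -
n) F ^ n u = 0`. -/
lemma Sl2.exists_nat (s : Sl2 H E F) {u : W} (hu : E u = 0) (h0 : u ≠ 0) {μ : ℂ} (h : H u = μ • u) :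
    ∃ n : ℕ, μ = n := by
  have h1 : ∃ n, (F ^ n) u = 0 := s.exists_pow_eq_zero h
  obtain ⟨n, hn1, hn2⟩ := Nat.exists_not_and_succ_of_not_zero_of_exists
    (p := fun n => (F ^ n) u = 0) h0 h1
  refine ⟨n, ?_⟩
  have h2 := s.E_pow n hu
  rw [hn2, map_zero, h, ← sub_smul, map_smul, smul_smul] at h2
  rcases smul_eq_zero.1 h2.symm with h3 | h3
  · rcases mul_eq_zero.1 h3 with h4 | h4
    · exact absurd h4 (by exact_mod_cast n.succ_ne_zero)
    · exact sub_eq_zero.1 h4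
  · exact absurd h3 hn1

/-- The span of the highest weight vectors of natural weight. -/
def hwSpan (H E : W →ₗ[ℂ] W) : Submodule ℂ W :=
  Submodule.span ℂ {u | E u = 0 ∧ ∃ j : ℕ, H u = (j : ℂ) • u}

/-- From `F ^ (n + 1) u = 0` one gets `F ^ n (H - n) u = 0`. By induction `(H - n) u` is a sum of
eigenvectors with weights below `n`, where `H - n` is invertible; subtracting the preimage corrects
`u` to an eigenvector of weight `n`. -/
lemma Sl2.mem_hwSpan_of_pow (s : Sl2 H E F) (n : ℕ) : ∀ u, E u = 0 → (F ^ n) u = 0 →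
    u ∈ Submodule.span ℂ {u | E u = 0 ∧ ∃ j : ℕ, j < n ∧ H u = (j : ℂ) • u} := by
  induction n with
  | zero => intro u _ h; rw [pow_zero, Module.End.one_apply] at h; rw [h]; exact Submodule.zero_mem _
  | succ n ih =>
    intro u hu h
    have h1 := s.E_pow n hu
    rw [h, map_zero] at h1
    have h2 : (F ^ n) (H u - (n : ℂ) • u) = 0 :=
      (smul_eq_zero.1 h1.symm).resolve_left (by exact_mod_cast n.succ_ne_zero)
    have h3 := ih (H u - (n : ℂ) • u) (by rw [map_sub, map_smul, s.kerE_stable hu, hu]; simp) h2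
    have key : ∀ v ∈ Submodule.span ℂ {u | E u = 0 ∧ ∃ j : ℕ, j < n ∧ H u = (j : ℂ) • u},
        ∃ v' ∈ Submodule.span ℂ {u | E u = 0 ∧ ∃ j : ℕ, j < n ∧ H u = (j : ℂ) • u},
          H v' - (n : ℂ) • v' = v := by
      intro v hv
      induction hv using Submodule.span_induction with
      | mem v hv =>
        obtain ⟨hv, j, hj, hH⟩ := hv
        have hne : (j - n : ℂ) ≠ 0 := by
          rw [sub_ne_zero]
          exact_mod_cast hj.ne
        refine ⟨(j - n : ℂ)⁻¹ • v, Submodule.smul_mem _ _ (Submodule.subset_span ⟨hv, j, hj, hH⟩), ?_⟩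
        rw [map_smul, hH, smul_comm (n : ℂ), ← smul_sub, ← sub_smul, smul_smul,
          inv_mul_cancel₀ hne, one_smul]
      | zero => exact ⟨0, Submodule.zero_mem _, by simp⟩
      | add v w _ _ hv hw =>
        obtain ⟨v', hv', rfl⟩ := hv
        obtain ⟨w', hw', rfl⟩ := hw
        exact ⟨v' + w', Submodule.add_mem _ hv' hw', by rw [map_add]; module⟩
      | smul c v _ hv =>
        obtain ⟨v', hv', rfl⟩ := hv
        exact ⟨c • v', Submodule.smul_mem _ _ hv', by rw [map_smul]; module⟩
    obtain ⟨v', hv', hv⟩ := key _ h3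
    have hle : Submodule.span ℂ {u | E u = 0 ∧ ∃ j : ℕ, j < n ∧ H u = (j : ℂ) • u} ≤
        Submodule.span ℂ {u | E u = 0 ∧ ∃ j : ℕ, j < n + 1 ∧ H u = (j : ℂ) • u} :=
      Submodule.span_mono fun x hx => ⟨hx.1, hx.2.imp fun j hj => ⟨hj.1.trans n.lt_succ_self, hj.2⟩⟩
    have hE : ∀ x ∈ Submodule.span ℂ {u | E u = 0 ∧ ∃ j : ℕ, j < n ∧ H u = (j : ℂ) • u}, E x = 0 :=
      fun x hx => (Submodule.span_le (p := LinearMap.ker E)).2 (fun y hy => hy.1) hx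
    have hu' : u = (u - v') + v' := by abel
    rw [hu']
    refine Submodule.add_mem _ (Submodule.subset_span ⟨?_, n, n.lt_succ_self, ?_⟩) (hle hv')
    · rw [map_sub, hu, hE v' hv', sub_zero]
    · rw [map_sub]
      have : H u - H v' = (n : ℂ) • u - (n : ℂ) • v' := by
        rw [sub_eq_sub_iff_sub_eq_sub]
        exact hv.symm
      rw [this, smul_sub]

lemma Sl2.ker_le_hwSpan (s : Sl2 H E F) {u : W} (hu : E u = 0) : u ∈ hwSpan H E := by
  obtain ⟨n, hn⟩ := s.nilpotent
  have hle : Submodule.span ℂ {u | E u = 0 ∧ ∃ j : ℕ, j < n ∧ H u = (j : ℂ) • u} ≤ hwSpan H E :=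
    Submodule.span_mono fun x hx => ⟨hx.1, hx.2.imp fun j hj => hj.2⟩
  exact hle (s.mem_hwSpan_of_pow n u hu (hn u))

/-- Let `u = F w ≠ 0` be a highest weight vector of weight `n`. Then `(H - (n + 2)) w` is killed by
`F`, and `w` can be changed by an element of the kernel of `F` into an eigenvector `x` of weight `n
+ 2` with `F x = u`. All `E ^ j x` are then nonzero, which contradicts nilpotency of `E`. -/
lemma Sl2.ker_inf_range (s : Sl2 H E F) : LinearMap.ker E ⊓ LinearMap.range F = ⊥ := by
  by_contra hne
  obtain ⟨u, ⟨hu, w, hw⟩, hu0, μ, hμ⟩ := exists_eigenvector_mem (H := H) hne (by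
    rintro _ ⟨hu, x, rfl⟩
    exact ⟨s.kerE_stable hu, H x - (2 : ℂ) • x, by rw [s.hF, map_sub, map_smul]⟩)
  replace hu : E u = 0 := hu
  obtain ⟨n, rfl⟩ := s.exists_nat hu hu0 hμ
  have hst : ∀ v ∈ LinearMap.ker F, (H - (n + 2 : ℂ) • (LinearMap.id : W →ₗ[ℂ] W)) v ∈ LinearMap.ker F := by
    intro v hv
    rw [LinearMap.mem_ker] at hv ⊢
    have := s.symm.kerE_stable hv
    rw [LinearMap.neg_apply, map_neg, neg_eq_zero] at this
    simp [this, hv]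
  -- On the kernel of `F` the eigenvalues of `H` are nonpositive integers, so `H - (n + 2)` is
  -- injective there, and bijective by finite dimension.
  have hinj : Function.Injective ((H - (n + 2 : ℂ) • (LinearMap.id : W →ₗ[ℂ] W)).restrict hst) := by
    rw [← LinearMap.ker_eq_bot, LinearMap.ker_eq_bot']
    intro v hv
    by_contra hv0
    have h1 : H v.1 = (n + 2 : ℂ) • v.1 := by
      have := congrArg Subtype.val hv
      exact sub_eq_zero.1 this
    obtain ⟨k, hk⟩ := s.symm.exists_nat v.2 (fun h => hv0 (Subtype.ext h)) (μ := -(n + 2 : ℂ))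
      (by rw [LinearMap.neg_apply, h1, neg_smul])
    have : ((n + 2 + k : ℕ) : ℂ) = 0 := by push_cast; linear_combination -hk
    rw [Nat.cast_eq_zero] at this
    omega
  have hsurj := LinearMap.injective_iff_surjective.1 hinj
  have hFw : F ((H - (n + 2 : ℂ) • (LinearMap.id : W →ₗ[ℂ] W)) w) = 0 := by
    have h1 := s.hF w
    rw [hw, hμ] at h1
    have h2 : F (H w) = (n : ℂ) • u + (2 : ℂ) • u := by rw [h1]; abel
    simp only [LinearMap.sub_apply, LinearMap.smul_apply, LinearMap.id_apply, map_sub, map_smul, hw,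
      h2]
    module
  obtain ⟨v, hv⟩ := hsurj ⟨_, hFw⟩
  have hv' : H v.1 - (n + 2 : ℂ) • v.1 = H w - (n + 2 : ℂ) • w := congrArg Subtype.val hv
  set x := w - v.1 with hx
  have hFx : F x = u := by
    rw [hx, map_sub, hw, LinearMap.mem_ker.1 v.2, sub_zero]
  have hHx : H x = (n + 2 : ℂ) • x := by
    rw [hx, map_sub, smul_sub]
    rw [sub_eq_sub_iff_sub_eq_sub, ← hv']
  have hHE : ∀ j : ℕ, H ((E ^ j) x) = (n + 2 + 2 * j : ℂ) • (E ^ j) x := by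
    intro j
    have := s.symm.H_pow j x
    simp only [LinearMap.neg_apply, map_neg, hHx, map_smul] at this
    rw [← neg_neg (H _), this]
    module
  -- The coefficient `(j + 1)(n + 2 + j)` is never zero, so applying `F` shows inductively that no
  -- `E ^ j x` vanishes.
  have hFE : ∀ j : ℕ, F ((E ^ (j + 1)) x) = -((j + 1) * (n + 2 + j) : ℂ) • (E ^ j) x := by
    intro j
    induction j with
    | zero =>
      have h1 := s.eF x
      rw [hFx, hu, hHx] at h1
      simp only [zero_add, pow_one, pow_zero, Module.End.one_apply]
      rw [eq_neg_of_add_eq_zero_left h1.symm]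
      push_cast
      module
    | succ j ih =>
      have h1 := s.eF ((E ^ (j + 1)) x)
      rw [ih, hHE, map_smul, ← Module.End.mul_apply E, ← Module.End.mul_apply E, ← pow_succ',
        ← pow_succ'] at h1
      have h2 := eq_sub_of_add_eq h1.symm
      rw [h2]
      push_cast
      module
  obtain ⟨N, hN⟩ := s.symm.nilpotent
  have hne : ∀ j, (E ^ j) x ≠ 0 := by
    intro j
    induction j with
    | zero =>
      intro h
      rw [pow_zero, Module.End.one_apply] at h
      rw [h, map_zero] at hFx
      exact hu0 hFx.symm
    | succ j ih =>
      intro h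
      have h1 := hFE j
      rw [h, map_zero] at h1
      rcases smul_eq_zero.1 h1.symm with h2 | h2
      · rw [neg_eq_zero] at h2
        have : (((j + 1) * (n + 2 + j) : ℕ) : ℂ) = 0 := by push_cast; exact h2
        rw [Nat.cast_eq_zero] at this
        simp at this
      · exact ih h2
  exact hne N (hN x)

/-- By `ker_inf_range` and its reflection both sums are direct. By rank–nullity their dimensions add
up to twice that of `W`, so each is everything. -/
lemma Sl2.ker_sup_range (s : Sl2 H E F) : LinearMap.ker E ⊔ LinearMap.range F = ⊤ := by
  have h1 := Submodule.finrank_sup_add_finrank_inf_eq (LinearMap.ker E) (LinearMap.range F)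
  have h2 := Submodule.finrank_sup_add_finrank_inf_eq (LinearMap.ker F) (LinearMap.range E)
  rw [s.ker_inf_range, finrank_bot] at h1
  rw [s.symm.ker_inf_range, finrank_bot] at h2
  have h3 := LinearMap.finrank_range_add_finrank_ker E
  have h4 := LinearMap.finrank_range_add_finrank_ker F
  have h5 := Submodule.finrank_le (LinearMap.ker E ⊔ LinearMap.range F)
  have h6 := Submodule.finrank_le (LinearMap.ker F ⊔ LinearMap.range E)
  exact Submodule.eq_top_of_finrank_eq (by omega)

/-- A finite-dimensional representation is spanned by the translates of highest weight vectors. -/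
lemma Sl2.span_eq_top (s : Sl2 H E F) :
    Submodule.span ℂ {w | ∃ u, E u = 0 ∧ (∃ m : ℕ, H u = (m : ℂ) • u) ∧ ∃ j : ℕ, w = (F ^ j) u} = ⊤ := by
  set T := Submodule.span ℂ {w | ∃ u, E u = 0 ∧ (∃ m : ℕ, H u = (m : ℂ) • u) ∧ ∃ j : ℕ, w = (F ^ j) u}
    with hT
  have hle : hwSpan H E ≤ T := Submodule.span_mono fun x hx => ⟨x, hx.1, hx.2, 0, rfl⟩
  have hker : LinearMap.ker E ≤ T := fun u hu => hle (s.ker_le_hwSpan hu)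
  have hF : ∀ w ∈ T, F w ∈ T := by
    intro w hw
    induction hw using Submodule.span_induction with
    | mem w hw =>
      obtain ⟨u, hu, hm, j, rfl⟩ := hw
      exact Submodule.subset_span ⟨u, hu, hm, j + 1, by rw [pow_succ', Module.End.mul_apply]⟩
    | zero => rw [map_zero]; exact T.zero_mem
    | add v w _ _ hv hw => rw [map_add]; exact T.add_mem hv hw
    | smul c v _ hv => rw [map_smul]; exact T.smul_mem c hv
  -- The decomposition `W = ker E + F W` is iterated until the power of `F` in the remainder
  -- vanishes.
  have key : ∀ n : ℕ, ∀ w, ∃ t ∈ T, ∃ x, w = t + (F ^ n) x := by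
    intro n
    induction n with
    | zero => exact fun w => ⟨0, T.zero_mem, w, by simp⟩
    | succ n ih =>
      intro w
      have hw : w ∈ LinearMap.ker E ⊔ LinearMap.range F := by rw [s.ker_sup_range]; trivial
      obtain ⟨k, hk, _, ⟨x, rfl⟩, rfl⟩ := Submodule.mem_sup.1 hw
      obtain ⟨t, ht, y, rfl⟩ := ih x
      refine ⟨k + F t, T.add_mem (hker hk) (hF t ht), y, ?_⟩
      rw [map_add, pow_succ', Module.End.mul_apply, add_assoc]
  obtain ⟨n, hn⟩ := s.nilpotent
  rw [eq_top_iff]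
  intro w _
  obtain ⟨t, ht, x, rfl⟩ := key n w
  rw [hn, add_zero]
  exact ht

/-- By `E_pow` this vector is killed by `E`, and it lies in the range of `F`. -/
lemma Sl2.pow_succ_eq_zero (s : Sl2 H E F) {u : W} (hu : E u = 0) {m : ℕ} (hm : H u = (m : ℂ) • u) :
    (F ^ (m + 1)) u = 0 := by
  have h1 := s.E_pow m hu
  rw [hm, sub_self, map_zero, smul_zero] at h1
  have h2 : (F ^ (m + 1)) u ∈ LinearMap.ker E ⊓ LinearMap.range F :=
    ⟨h1, (F ^ m) u, by rw [pow_succ', Module.End.mul_apply]⟩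
  rw [s.ker_inf_range] at h2
  exact h2

end Sl2

end SL3Kernel

/-! ### The action of `𝔨` on functions by left translation -/

namespace SL3Kernel

open scoped Topology
open Filter

/-! ### The differential of left translation -/

/-- The derivative of `f (exp(-tz) g)` at `t = 0`, for `z ∈ 𝔨₀`. -/
def lD (z : Fin 3 → ℝ) (f : G → V) : G → V := fun g => drv f g (Ad g⁻¹ (rhoMat (-z)))

lemma rhoMat_neg (z : Fin 3 → ℝ) : rhoMat (-z) = -rhoMat z := by
  rw [← neg_one_smul ℝ z, rhoMat_smul, neg_one_smul]

lemma inv_embK_expK_mul (z : Fin 3 → ℝ) (g : G) (t : ℝ) :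
    (embK (expK (t • z)))⁻¹ * g = g * expG (t • Ad g⁻¹ (rhoMat (-z))) := by
  have h := mul_expG g⁻¹ (X := rhoMat (t • -z)) (trace_rhoMat _)
  rw [← Ad_smul, ← rhoMat_smul, ← map_inv, ← expK_neg, ← smul_neg, embK_expK]
  rw [← mul_left_inj g⁻¹, mul_inv_cancel_right, mul_assoc, ← h, mul_inv_cancel_left]

lemma Smooth.hasDerivAt_left {f : G → V} (hf : Smooth f) (z : Fin 3 → ℝ) (g : G) :
    HasDerivAt (fun t : ℝ => f ((embK (expK (t • z)))⁻¹ * g)) (lD z f g) 0 := by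
  simp_rw [inv_embK_expK_mul]
  exact hf.hasDerivAt g (trace_Ad _ (trace_rhoMat _))

lemma lD_add (z w : Fin 3 → ℝ) (f : G → V) : lD (z + w) f = lD z f + lD w f := by
  funext g
  rw [lD, neg_add, rhoMat_add, Ad_add, map_add]
  rfl

lemma lD_smul (t : ℝ) (z : Fin 3 → ℝ) (f : G → V) : lD (t • z) f = (t : ℂ) • lD z f := by
  funext g
  rw [lD, ← smul_neg, rhoMat_smul, Ad_smul, map_smul]
  funext c
  simp [lD]

lemma Smooth.lD_add {f f' : G → V} (hf : Smooth f) (hf' : Smooth f') (z : Fin 3 → ℝ) :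
    lD z (f + f') = lD z f + lD z f' := by
  funext g
  exact ((hf.add hf').hasDerivAt_left z g).unique
    ((hf.hasDerivAt_left z g).add (hf'.hasDerivAt_left z g))

lemma Smooth.lD_smul {f : G → V} (hf : Smooth f) (c : ℂ) (z : Fin 3 → ℝ) :
    lD z (c • f) = c • lD z f := by
  funext g
  exact ((hf.smul c).hasDerivAt_left z g).unique ((hf.hasDerivAt_left z g).const_smul c)

lemma Smooth.hasDerivAt_mul_expG_mul_expG {f : G → V} (hf : Smooth f) (g : G) {X Y : Mat3}
    (hX : X.trace = 0) (hY : Y.trace = 0) (t : ℝ) :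
    HasDerivAt (fun s : ℝ => f (g * expG (s • Y) * expG (t • X)))
      (fderiv ℝ (SL3Kernel.chart2 f g) (0, t • coordE X) (coordE Y, 0)) 0 := by
  have h1 : HasFDerivAt (SL3Kernel.chart2 f g) (fderiv ℝ (SL3Kernel.chart2 f g) (0, t • coordE X))
      ((0 : ℝ) • coordE Y, t • coordE X) := by
    rw [zero_smul]
    exact ((hf.chart2 g).differentiable (by simp) _).hasFDerivAt
  have h2 : HasDerivAt (fun s : ℝ => (s • coordE Y, t • coordE X)) (coordE Y, 0) 0 := by
    refine HasDerivAt.prodMk ?_ (hasDerivAt_const _ _)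
    simpa using (hasDerivAt_id (0 : ℝ)).smul_const (coordE Y)
  refine (h1.comp_hasDerivAt 0 h2).congr_of_eventuallyEq (Eventually.of_forall fun s => ?_)
  simp only [Function.comp_apply, SL3Kernel.chart2, slMat_smul_coordE hX, slMat_smul_coordE hY]

/-- The left translation written last stands closest to `g` after both have been moved to the right,
so the order of the two directions is reversed. -/
lemma Smooth.lD_lD {f : G → V} (hf : Smooth f) (z w : Fin 3 → ℝ) (hw : Smooth (lD w f)) (g : G) :
    lD z (lD w f) g = snd f g (Ad g⁻¹ (rhoMat (-w))) (Ad g⁻¹ (rhoMat (-z))) := by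
  have hX := trace_Ad g⁻¹ (trace_rhoMat (-z))
  have hY := trace_Ad g⁻¹ (trace_rhoMat (-w))
  have h1 := hw.hasDerivAt_left z g
  refine h1.unique ?_
  have e : ∀ t : ℝ, lD w f ((embK (expK (t • z)))⁻¹ * g) =
      fderiv ℝ (SL3Kernel.chart2 f g) (0, t • coordE (Ad g⁻¹ (rhoMat (-z))))
        (coordE (Ad g⁻¹ (rhoMat (-w))), 0) := by
    intro t
    refine (hf.hasDerivAt_left w _).unique ?_
    have e1 : ∀ s : ℝ, (embK (expK (s • w)))⁻¹ * ((embK (expK (t • z)))⁻¹ * g) =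
        g * expG (s • Ad g⁻¹ (rhoMat (-w))) * expG (t • Ad g⁻¹ (rhoMat (-z))) := by
      intro s
      rw [inv_embK_expK_mul z, ← mul_assoc, inv_embK_expK_mul w]
    simp_rw [e1]
    exact hf.hasDerivAt_mul_expG_mul_expG g hX hY t
  simp_rw [e]
  have h2 : HasDerivAt (fun t : ℝ => ((0, t • coordE (Ad g⁻¹ (rhoMat (-z)))) : E9 × E9))
      (0, coordE (Ad g⁻¹ (rhoMat (-z)))) 0 := by
    refine (hasDerivAt_const _ _).prodMk ?_
    simpa using (hasDerivAt_id (0 : ℝ)).smul_const (coordE (Ad g⁻¹ (rhoMat (-z))))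
  have h3 := hasDerivAt_fderiv_apply (contDiff_infty.1 (hf.chart2 g) 2) h2
    (hasDerivAt_const (0 : ℝ) ((coordE (Ad g⁻¹ (rhoMat (-w))), 0) : E9 × E9))
    (p₀ := 0) (by rw [zero_smul]; rfl) rfl
  rw [map_zero, add_zero] at h3
  refine h3.congr_deriv ?_
  have hsym : IsSymmSndFDerivAt ℝ (SL3Kernel.chart2 f g) 0 :=
    (contDiff_infty.1 (hf.chart2 g) 2).contDiffAt.isSymmSndFDerivAt (by simp)
  exact hsym _ _

lemma Ad_mul (g : G) (X Y : Mat3) : Ad g (X * Y) = Ad g X * Ad g Y := by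
  simp only [Ad, mul_assoc]
  rw [← mul_assoc ((proj g)⁻¹).1 (proj g).1, proj_inv_mul, one_mul]

lemma Ad_sub (g : G) (X Y : Mat3) : Ad g (X - Y) = Ad g X - Ad g Y := by
  simp [Ad, mul_sub, sub_mul]

/-- The reversed order in `lD_lD` and the sign in the definition of `lD` compensate each other, so
`lD` respects brackets. -/
lemma Smooth.lD_comm {f : G → V} (hf : Smooth f) {z w u : Fin 3 → ℝ} (hz : Smooth (lD z f))
    (hw : Smooth (lD w f)) (hu : rhoMat z * rhoMat w - rhoMat w * rhoMat z = rhoMat u) :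
    lD z (lD w f) = lD w (lD z f) + lD u f := by
  funext g
  have hX := trace_Ad g⁻¹ (trace_rhoMat (-z))
  have hY := trace_Ad g⁻¹ (trace_rhoMat (-w))
  have e : Ad g⁻¹ (rhoMat (-w)) * Ad g⁻¹ (rhoMat (-z)) - Ad g⁻¹ (rhoMat (-z)) * Ad g⁻¹ (rhoMat (-w)) =
      Ad g⁻¹ (rhoMat (-u)) := by
    rw [← Ad_mul, ← Ad_mul, ← Ad_sub, rhoMat_neg u, ← hu, rhoMat_neg, rhoMat_neg]
    congr 1
    noncomm_ring
  rw [Pi.add_apply, hf.lD_lD z w hw, hf.lD_lD w z hz, hf.snd_comm g hY hX, e,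
    hf.rDeriv_eq_drv g (trace_Ad _ (trace_rhoMat _))]
  rfl

/-! ### Finite-dimensional spaces of functions that are stable under `K` -/

/-- `W` is a finite-dimensional space of smooth functions, stable under translation by `K`. -/
structure KStable (W : Submodule ℂ (G → V)) : Prop where
  fin : FiniteDimensional ℂ W
  smooth : ∀ f ∈ W, Smooth f
  stable : ∀ (y : K), ∀ f ∈ W, leftTr (embK y) f ∈ W

/-- The difference quotients lie in `W` and converge pointwise, and a finite-dimensional subspace is
closed in the topology of pointwise convergence. -/
lemma KStable.lD_mem {W : Submodule ℂ (G → V)} (h : KStable W) (z : Fin 3 → ℝ) {f : G → V}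
    (hf : f ∈ W) : lD z f ∈ W := by
  have := h.fin
  have hc : IsClosed (W : Set (G → V)) := W.closed_of_finiteDimensional
  have ht : Tendsto (fun t : ℝ => ((t⁻¹ : ℝ) : ℂ) • (leftTr (embK (expK (t • z))) f - f)) (𝓝[≠] 0)
      (𝓝 (lD z f)) := by
    refine tendsto_pi_nhds.2 fun g => ?_
    have h1 := ((h.smooth f hf).hasDerivAt_left z g).tendsto_slope_zero
    refine h1.congr fun t => ?_
    rw [zero_add, zero_smul, expK_zero, map_one, inv_one, one_mul]
    funext c
    simp [leftTr_apply]
  exact hc.mem_of_tendsto ht (Eventually.of_forall fun t =>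
    W.smul_mem _ (W.sub_mem (h.stable _ f hf) hf))

/-- `lD z` on `W`. -/
def KStable.op {W : Submodule ℂ (G → V)} (h : KStable W) (z : Fin 3 → ℝ) : W →ₗ[ℂ] W where
  toFun f := ⟨lD z f, h.lD_mem z f.2⟩
  map_add' f f' := Subtype.ext ((h.smooth _ f.2).lD_add (h.smooth _ f'.2) z)
  map_smul' c f := Subtype.ext ((h.smooth _ f.2).lD_smul c z)

section

variable {W : Submodule ℂ (G → V)} (h : KStable W)
include h

lemma KStable.op_comm {z w u : Fin 3 → ℝ}
    (hu : rhoMat z * rhoMat w - rhoMat w * rhoMat z = rhoMat u) (f : W) :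
    h.op z (h.op w f) = h.op w (h.op z f) + h.op u f :=
  Subtype.ext ((h.smooth _ f.2).lD_comm (h.smooth _ (h.lD_mem z f.2)) (h.smooth _ (h.lD_mem w f.2)) hu)

lemma KStable.op_add (z w : Fin 3 → ℝ) (f : W) : h.op (z + w) f = h.op z f + h.op w f :=
  Subtype.ext (SL3Kernel.lD_add z w f.1)

lemma KStable.op_smul (t : ℝ) (z : Fin 3 → ℝ) (f : W) : h.op (t • z) f = (t : ℂ) • h.op z f :=
  Subtype.ext (SL3Kernel.lD_smul t z f.1)

end

lemma rhoMat_comm_12 : rhoMat ![1 / 2, 0, 0] * rhoMat ![0, 1 / 2, 0] -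
    rhoMat ![0, 1 / 2, 0] * rhoMat ![1 / 2, 0, 0] = rhoMat ![0, 0, 1 / 2] := by
  ext i j
  fin_cases i <;> fin_cases j <;> simp [rhoMat]

lemma rhoMat_comm_23 : rhoMat ![0, 1 / 2, 0] * rhoMat ![0, 0, 1 / 2] -
    rhoMat ![0, 0, 1 / 2] * rhoMat ![0, 1 / 2, 0] = rhoMat ![1 / 2, 0, 0] := by
  ext i j
  fin_cases i <;> fin_cases j <;> simp [rhoMat]

lemma rhoMat_comm_31 : rhoMat ![0, 0, 1 / 2] * rhoMat ![1 / 2, 0, 0] -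
    rhoMat ![1 / 2, 0, 0] * rhoMat ![0, 0, 1 / 2] = rhoMat ![0, 1 / 2, 0] := by
  ext i j
  fin_cases i <;> fin_cases j <;> simp [rhoMat]

section

variable {W : Submodule ℂ (G → V)} (h : KStable W)

/-- The action of `diag(1,-1)`. -/
def KStable.opH : W →ₗ[ℂ] W := (-2 * Complex.I) • h.op ![1 / 2, 0, 0]

/-- The action of the raising operator. -/
def KStable.opE : W →ₗ[ℂ] W := Complex.I • h.op ![0, 0, 1 / 2] - h.op ![0, 1 / 2, 0]

/-- The action of the lowering operator. -/
def KStable.opF : W →ₗ[ℂ] W := Complex.I • h.op ![0, 0, 1 / 2] + h.op ![0, 1 / 2, 0]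

lemma KStable.sl2 : Sl2 h.opH h.opE h.opF := by
  have h12 := h.op_comm rhoMat_comm_12
  have h23 := h.op_comm rhoMat_comm_23
  have h31 := h.op_comm rhoMat_comm_31
  have I2 := Complex.I_sq
  constructor
  · intro w
    simp only [KStable.opH, KStable.opE, LinearMap.smul_apply, LinearMap.sub_apply, map_sub,
      map_smul, h12, h31]
    match_scalars <;> first | ring1 | linear_combination 2 * I2
  · intro w
    simp only [KStable.opH, KStable.opF, LinearMap.smul_apply, LinearMap.add_apply, map_add,
      map_smul, h12, h31]
    match_scalars <;> first | ring1 | linear_combination 2 * I2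
  · intro w
    simp only [KStable.opH, KStable.opE, KStable.opF, LinearMap.smul_apply, LinearMap.add_apply,
      LinearMap.sub_apply, map_add, map_sub, map_smul, h23]
    match_scalars <;> first | ring1

lemma KStable.op_eq (z : Fin 3 → ℝ) (w : W) : h.op z w =
    (Complex.I * z 0) • h.opH w + (z 1 - Complex.I * z 2 : ℂ) • h.opF w +
      (-z 1 - Complex.I * z 2 : ℂ) • h.opE w := by
  have e : z = (2 * z 0) • ![1 / 2, 0, 0] + (2 * z 1) • ![0, 1 / 2, 0] +
      (2 * z 2) • ![0, 0, 1 / 2] := by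
    ext i
    fin_cases i <;> simp <;> ring
  conv_lhs => rw [e, h.op_add, h.op_add, h.op_smul, h.op_smul, h.op_smul]
  simp only [KStable.opH, KStable.opE, KStable.opF, LinearMap.smul_apply, LinearMap.add_apply,
      LinearMap.sub_apply]
  push_cast
  have I2 := Complex.I_sq
  match_scalars <;> first
    | ring1
    | linear_combination (2 * z 0 : ℂ) * I2
    | linear_combination (2 * z 2 : ℂ) * I2

end

end SL3Kernel

/-! ### From highest weight vectors to pairs of polynomials -/

namespace SL3Kernel

open scoped Topology
open Filter

/-! ### The map from `S^m ℂ²` that is defined by a highest weight vector -/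

lemma quatMat_imQuat (z : Fin 3 → ℝ) : quatMat (imQuat z) =
    !![Complex.I * z 0, -z 1 - Complex.I * z 2; z 1 - Complex.I * z 2, -(Complex.I * z 0)] := by
  ext i j
  fin_cases i <;> fin_cases j <;> simp [quatMat, imQuat, Complex.ext_iff]

section

variable {W : Type*} [AddCommGroup W] [Module ℂ W]

/-- The linear map `e₀^i e₁^(m-i) ↦ i!/m! F^(m-i) u`. -/
def hwMap (F : W →ₗ[ℂ] W) (m : ℕ) (u : W) : SymPow m →ₗ[ℂ] W :=
  ∑ i ∈ Finset.range (m + 1),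
    (cf m i).smulRight (((i.factorial : ℂ) / m.factorial) • (F ^ (m - i)) u)

lemma hwMap_mono (F : W →ₗ[ℂ] W) {m i : ℕ} (hi : i ≤ m) (u : W) :
    hwMap F m u (mono m i) = ((i.factorial : ℂ) / m.factorial) • (F ^ (m - i)) u := by
  rw [hwMap, LinearMap.sum_apply, Finset.sum_eq_single i]
  · rw [LinearMap.smulRight_apply, cf_mono hi, if_pos rfl, one_smul]
  · intro j _ hj
    rw [LinearMap.smulRight_apply, cf_mono hi, if_neg hj, zero_smul]
  · intro h
    rw [Finset.mem_range] at h
    omega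

lemma exists_hwMap_eq (F : W →ₗ[ℂ] W) {m j : ℕ} (hj : j ≤ m) (u : W) :
    ∃ v, hwMap F m u v = (F ^ j) u := by
  have hne : (((m - j).factorial : ℂ) / m.factorial) ≠ 0 :=
    div_ne_zero (by exact_mod_cast (m - j).factorial_ne_zero) (by exact_mod_cast m.factorial_ne_zero)
  refine ⟨(((m - j).factorial : ℂ) / m.factorial)⁻¹ • mono m (m - j), ?_⟩
  rw [map_smul, hwMap_mono _ (Nat.sub_le _ _), Nat.sub_sub_self hj, smul_smul,
    inv_mul_cancel₀ hne, one_smul]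

variable {H E F : W →ₗ[ℂ] W} [FiniteDimensional ℂ W]

lemma Sl2.hwMap_H (s : Sl2 H E F) {m i : ℕ} (hi : i ≤ m) {u : W} (hm : H u = (m : ℂ) • u) :
    H (hwMap F m u (mono m i)) = (2 * i - m : ℂ) • hwMap F m u (mono m i) := by
  rw [hwMap_mono F hi, map_smul, s.H_pow, hm, map_smul, Nat.cast_sub hi]
  module

/-- The normalization `i!/m!` in `hwMap` is chosen to give the factor `i` here. For `i = 0` the
claim is that `F ^ (m + 1)` kills `u`. -/
lemma Sl2.hwMap_F (s : Sl2 H E F) {m i : ℕ} (hi : i ≤ m) {u : W} (hu : E u = 0)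
    (hm : H u = (m : ℂ) • u) :
    F (hwMap F m u (mono m i)) = (i : ℂ) • hwMap F m u (mono m (i - 1)) := by
  rw [hwMap_mono F hi, map_smul, ← Module.End.mul_apply, ← pow_succ']
  cases i with
  | zero => rw [Nat.sub_zero, s.pow_succ_eq_zero hu hm]; simp
  | succ i =>
    rw [Nat.add_sub_cancel, hwMap_mono F (by omega), show m - (i + 1) + 1 = m - i by omega,
      Nat.factorial_succ, smul_smul]
    congr 1
    push_cast
    ring

lemma Sl2.hwMap_E (s : Sl2 H E F) {m i : ℕ} (hi : i ≤ m) {u : W} (hu : E u = 0)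
    (hm : H u = (m : ℂ) • u) :
    E (hwMap F m u (mono m i)) = (m - i : ℂ) • hwMap F m u (mono m (i + 1)) := by
  rw [hwMap_mono F hi, map_smul]
  rcases eq_or_lt_of_le hi with rfl | h
  · simp [hu]
  · obtain ⟨k, rfl⟩ := Nat.exists_eq_add_of_lt h
    rw [hwMap_mono F h, show i + k + 1 - i = k + 1 by omega,
      show i + k + 1 - (i + 1) = k by omega, s.E_pow k hu, hm, ← sub_smul, map_smul, smul_smul,
      smul_smul, smul_smul, Nat.factorial_succ i]
    congr 1
    push_cast
    ring

lemma Sl2.hwMap_symAct (s : Sl2 H E F) {m : ℕ} {u : W} (hu : E u = 0) (hm : H u = (m : ℂ) • u)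
    (z : Fin 3 → ℝ) (v : SymPow m) :
    hwMap F m u (symAct m (imQuat z) v) = (Complex.I * z 0) • H (hwMap F m u v) +
      (z 1 - Complex.I * z 2) • F (hwMap F m u v) +
      (-z 1 - Complex.I * z 2) • E (hwMap F m u v) := by
  have e : (hwMap F m u).comp (symAct m (imQuat z)) =
      ((Complex.I * z 0) • H + (z 1 - Complex.I * z 2 : ℂ) • F +
        (-z 1 - Complex.I * z 2 : ℂ) • E).comp (hwMap F m u) := by
    refine symPow_hom_ext fun i hi => ?_
    simp only [LinearMap.comp_apply, LinearMap.add_apply, LinearMap.smul_apply]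
    rw [symAct_mono hi, s.hwMap_H hi hm, s.hwMap_F hi hu hm, s.hwMap_E hi hu hm, quatMat_imQuat,
      map_add, map_add, map_smul, map_smul, map_smul]
    generalize hwMap F m u (mono m i) = x
    generalize hwMap F m u (mono m (i - 1)) = y
    generalize hwMap F m u (mono m (i + 1)) = w
    simp only [Matrix.of_apply, Matrix.cons_val', Matrix.cons_val_zero,
      Matrix.cons_val_one, Matrix.cons_val_fin_one]
    module
  exact LinearMap.congr_fun e v

lemma Sl2.exists_hwMap_eq (s : Sl2 H E F) {m : ℕ} {u : W} (hu : E u = 0)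
    (hm : H u = (m : ℂ) • u) (j : ℕ) : ∃ v, hwMap F m u v = (F ^ j) u := by
  by_cases hj : j ≤ m
  · exact SL3Kernel.exists_hwMap_eq F hj u
  · obtain ⟨i, rfl⟩ : ∃ i, j = i + (m + 1) := ⟨j - (m + 1), by omega⟩
    exact ⟨0, by rw [map_zero, pow_add, Module.End.mul_apply, s.pow_succ_eq_zero hu hm, map_zero]⟩

end

/-! ### Uniqueness of intertwining maps into functions on `K` -/

/-- Along a one-parameter subgroup the values on the basis of `S^m ℂ²` solve a linear ODE with
constant coefficients, and they vanish at `1`. One-parameter subgroups reach every point of `K`. -/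
lemma eq_zero_of_intertwining {m : ℕ} (α : SymPow m →ₗ[ℂ] (K → V))
    (hα : ∀ (z : Fin 3 → ℝ) v y, HasDerivAt (fun t : ℝ => α v ((expK (t • z))⁻¹ * y))
      (α (symAct m (imQuat z) v) y) 0) (h1 : ∀ v, α v 1 = 0) (v : SymPow m) (y : K) : α v y = 0 := by
  obtain ⟨z, hz⟩ := exists_expK y⁻¹
  set L : (Fin (m + 1) → V) →ₗ[ℝ] (Fin (m + 1) → V) :=
    LinearMap.pi fun i => ∑ j : Fin (m + 1),
      ((LinearMap.lsmul ℂ V (cf m j (symAct m (imQuat z) (mono m i)))).comp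
        (LinearMap.proj j)).restrictScalars ℝ with hL
  set x : ℝ → Fin (m + 1) → V := fun t i => α (mono m i) (expK (t • z))⁻¹ with hx
  have hLx : ∀ t i, L (x t) i = α (symAct m (imQuat z) (mono m i)) (expK (t • z))⁻¹ := by
    intro t i
    conv_rhs => rw [eq_sum_mono m (symAct m (imQuat z) (mono m i)), map_sum]
    rw [Finset.sum_apply, Finset.sum_range]
    simp [hL, hx]
  have hd : ∀ t, HasDerivAt x (L (x t)) t := by
    intro t
    refine hasDerivAt_pi.2 fun i => ?_
    rw [hLx]
    -- The hypothesis gives derivatives only at time zero; the group law carries them to time `t`.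
    have h0 := hα z (mono m i) (expK (t • z))⁻¹
    have h2 := HasDerivAt.comp_sub_const t t (by rw [sub_self]; exact h0)
    refine h2.congr_of_eventuallyEq (Eventually.of_forall fun s => ?_)
    simp only [hx]
    rw [← mul_inv_rev, ← expK_add, add_sub_cancel]
  have hc := (LinearMap.toContinuousLinearMap L).lipschitz
  have key := ODE_solution_unique_univ (v := fun _ => L) (s := fun _ => Set.univ)
    (K := ‖LinearMap.toContinuousLinearMap L‖₊) (t₀ := 0) (f := x) (g := fun _ => 0)
    (fun _ => hc.lipschitzOnWith) (fun t => ⟨hd t, trivial⟩)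
    (fun t => ⟨by rw [map_zero]; exact hasDerivAt_const _ _, trivial⟩) (by
      funext i
      simp only [hx, zero_smul, expK_zero, inv_one, h1]
      rfl)
  have hy : ∀ i ≤ m, α (mono m i) y = 0 := by
    intro i hi
    have := congrFun (congrFun key 1) ⟨i, by omega⟩
    simp only [hx, one_smul, hz, inv_inv] at this
    exact this
  rw [eq_sum_mono m v, map_sum, Finset.sum_apply]
  refine Finset.sum_eq_zero fun i hi => ?_
  rw [Finset.mem_range] at hi
  rw [map_smul, Pi.smul_apply, hy i (by omega), smul_zero]

/-! ### Intertwining maps into the kernel of `D` -/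

/-- Frobenius reciprocity: evaluation at `1` is a pair of functionals on `S^m ℂ²`, hence a pair of
polynomials. The map and the corresponding `Φ_m` have the same intertwining property and agree at
`1`. -/
lemma exists_eq_Phi {ν : Fin 3 → ℂ} {m : ℕ} (ψ : SymPow m →ₗ[ℂ] (G → V))
    (hI : ∀ v, ψ v ∈ Ind ν) (hψ : ∀ z v, lD z (ψ v) = ψ (symAct m (imQuat z) v)) :
    ∃ q : Fin 2 → Polynomial ℂ, (∀ c, (q c).natDegree ≤ m) ∧ ∀ v, ψ v = Phi ν m q v := by
  have hev : ∀ c : Fin 2, ∃ q : Polynomial ℂ, q.natDegree ≤ m ∧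
      ∀ v, pairing m q v = ψ v 1 c := by
    intro c
    obtain ⟨q, hq, hp⟩ := exists_pairing_eq
      (((LinearMap.proj c).comp (LinearMap.proj (1 : G))).comp ψ)
    exact ⟨q, hq, fun v => by rw [hp]; rfl⟩
  choose q hq hqv using hev
  refine ⟨q, hq, fun v => ?_⟩
  rw [Ind.eq_extend (hI v)]
  change extend _ _ = extend _ (PhiK m q v)
  congr 1
  funext y
  rw [← sub_eq_zero]
  refine eq_zero_of_intertwining
    ((LinearMap.funLeft ℂ V (embK : K → G)).comp ψ - PhiK m q) ?_ ?_ v y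
  · intro z v y
    have h1 := (hI v).1.hasDerivAt_left z (embK y)
    have h3 := h1.sub (hasDerivAt_PhiK_left m q v z y)
    rw [hψ] at h3
    refine h3.congr_of_eventuallyEq (Eventually.of_forall fun t => ?_)
    change ψ v (embK ((expK (t • z))⁻¹ * y)) - _ = _
    rw [map_mul, map_inv]
    rfl
  · intro v
    funext c
    change ψ v (embK 1) c - PhiK m q v 1 c = 0
    rw [map_one, PhiK_one, hqv, sub_self]

lemma Phi_mem_range_of_smul (ν : Fin 3 → ℂ) {m : ℕ} {q r : Fin 2 → Polynomial ℂ} {x : ℂ}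
    (hx : ∀ c, q c = x • r c) (v : SymPow m) : Phi ν m q v ∈ LinearMap.range (Phi ν m r) := by
  refine ⟨x • v, ?_⟩
  have : PhiK m r (x • v) = PhiK m q v := by
    funext y c
    rw [PhiK_apply, PhiK_apply, hx, pairing_polyAct_smul, map_smul, smul_eq_mul]
  exact congrArg (extend ν) this

/-- Equivariance under `𝐢` and `𝐤`, and the equation `D = 0`, both taken at the point `1`, give
invariance of the pair of polynomials and the recursion for it. -/
lemma range_le_range_Phi {a : ℂ} {m : ℕ} (ψ : SymPow m →ₗ[ℂ] (G → V))
    (hI : ∀ v, ψ v ∈ Ind (-lam2 (-a))) (hψ : ∀ z v, lD z (ψ v) = ψ (symAct m (imQuat z) v))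
    (hD : ∀ v, D a (ψ v) = 0) (h0 : ψ ≠ 0) :
    ∃ (n : ℤ) (k : ℕ), a = n ∧
      LinearMap.range ψ ≤ LinearMap.range (Phi (-lam2 (-a)) (mInd n k) (qPair n k)) := by
  obtain ⟨q, hq, hPhi⟩ := exists_eq_Phi ψ hI hψ
  have hInd : ∀ v, Phi (-lam2 (-a)) m q v ∈ Ind (-lam2 (-a)) := fun v => by
    rw [← hPhi]; exact hI v
  have hM : MInv m q := by
    refine mInv_of_PhiK hq (fun v => ?_) fun v => ?_
    · have := Ind.mul_of_isTri (hInd v) isTri_rot_kI 1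
      rwa [one_mul, Phi_embK, Phi_embK] at this
    · have := Ind.mul_of_isTri (hInd v) isTri_rot_kK 1
      rwa [one_mul, Phi_embK, Phi_embK] at this
  have hrec : ∀ c, recOp a m (q c) = 0 := by
    intro c
    refine pairing_injective (natDegree_recOp a (hq c)) (Polynomial.natDegree_zero.trans_le m.zero_le)
      fun v => ?_
    have h1 := (Ind.D_eq_zero_iff_embK (hInd v)).1 (by rw [← hPhi]; exact hD v) 1
    rw [Dcoeff_Phi hq (hInd v)] at h1
    have h2 := congrFun h1 c
    rw [PhiK_one] at h2
    rw [h2, pairing_eq]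
    simp
  have hq0 : q ≠ 0 := by
    rintro rfl
    refine h0 (LinearMap.ext fun v => ?_)
    have : PhiK m 0 v = 0 := by
      funext y c
      rw [PhiK_apply, pairing_polyAct, Pi.zero_apply, pairing_eq]
      simp
    rw [hPhi]
    change extend _ (PhiK m 0 v) = 0
    rw [this, map_zero]
  obtain ⟨n, k, x, ha, hm, hx⟩ := hM.eq_smul_qPair hrec hq0
  subst hm
  refine ⟨n, k, ha, ?_⟩
  rintro _ ⟨v, rfl⟩
  rw [hPhi]
  exact Phi_mem_range_of_smul _ hx v

lemma KStable.lD_hwMap {W : Submodule ℂ (G → V)} (h : KStable W) {m : ℕ} {u : W}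
    (hu : h.opE u = 0) (hm : h.opH u = (m : ℂ) • u) (z : Fin 3 → ℝ) (v : SymPow m) :
    lD z (hwMap h.opF m u v).1 = (hwMap h.opF m u (symAct m (imQuat z) v)).1 := by
  have := h.fin
  have e := (h.op_eq z (hwMap h.opF m u v)).trans (h.sl2.hwMap_symAct hu hm z v).symm
  exact congrArg Subtype.val e

lemma KStable.hw_mem_range {W : Submodule ℂ (G → V)} (h : KStable W) {a : ℂ}
    (hI : ∀ f ∈ W, f ∈ Ind (-lam2 (-a))) (hD : ∀ f ∈ W, D a f = 0)
    {m : ℕ} {u : W} (hu : h.opE u = 0) (hm : h.opH u = (m : ℂ) • u) (hu0 : u ≠ 0) :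
    ∃ (n : ℤ) (k : ℕ), a = n ∧ ∀ j, ((h.opF ^ j) u).1 ∈
      LinearMap.range (Phi (-lam2 (-a)) (mInd n k) (qPair n k)) := by
  have := h.fin
  have hex := h.sl2.exists_hwMap_eq hu hm
  obtain ⟨n, k, ha, hle⟩ := range_le_range_Phi (W.subtype.comp (hwMap h.opF m u))
    (fun v => hI _ (hwMap h.opF m u v).2) (h.lD_hwMap hu hm)
    (fun v => hD _ (hwMap h.opF m u v).2) (by
      intro h0
      obtain ⟨v, hv⟩ := hex 0
      rw [pow_zero, Module.End.one_apply] at hv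
      exact hu0 (hv.symm.trans (Subtype.ext (LinearMap.congr_fun h0 v))))
  refine ⟨n, k, ha, fun j => hle ?_⟩
  obtain ⟨v, hv⟩ := hex j
  exact ⟨v, congrArg Subtype.val hv⟩

end SL3Kernel

/-! ### Determination of the `K`-finite kernel -/

namespace SL3Kernel

/-! ### The `K`-finite kernel of `D` -/

lemma Smooth.rDeriv_fun_add {f f' : G → V} (hf : Smooth f) (hf' : Smooth f') {X : Mat3}
    (hX : X.trace = 0) : rDeriv X (f + f') = rDeriv X f + rDeriv X f' := by
  funext g
  exact ((hf.hasDerivAt_rDeriv_self g hX).add (hf'.hasDerivAt_rDeriv_self g hX)).deriv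

lemma Smooth.rDeriv_fun_smul {f : G → V} (hf : Smooth f) (c : ℂ) {X : Mat3} (hX : X.trace = 0) :
    rDeriv X (c • f) = c • rDeriv X f := by
  funext g
  exact ((hf.hasDerivAt_rDeriv_self g hX).const_smul c).deriv

lemma Smooth.D_add {f f' : G → V} (hf : Smooth f) (hf' : Smooth f') (a : ℂ) :
    D a (f + f') = D a f + D a f' := by
  have h2 : ∀ (X Y : Mat3) (g : G), X.trace = 0 → Y.trace = 0 →
      rDeriv X (rDeriv Y (f + f')) g = rDeriv X (rDeriv Y f) g + rDeriv X (rDeriv Y f') g := by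
    intro X Y g hX hY
    rw [hf.rDeriv_fun_add hf' hY, hf.rDeriv_rDeriv g hX hY, hf'.rDeriv_rDeriv g hX hY]
    exact ((hf.hasDerivAt_rDeriv g hX hY).add (hf'.hasDerivAt_rDeriv g hX hY)).deriv
  have h3 : ∀ (X Y : Mat3) (g : G), X.trace = 0 → Y.trace = 0 →
      rDerivSym X Y (f + f') g = rDerivSym X Y f g + rDerivSym X Y f' g := by
    intro X Y g hX hY
    rw [rDerivSym, h2 X Y g hX hY, h2 Y X g hY hX, rDerivSym, rDerivSym]
    module
  funext g A
  simp only [D, h3 _ _ _ (trace_T _ _) (trace_T _ _), hf.rDeriv_fun_add hf' (trace_T _ _),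
    Pi.add_apply]
  rw [← Finset.sum_add_distrib]
  refine Finset.sum_congr rfl fun i _ => ?_
  rw [← Finset.sum_add_distrib]
  refine Finset.sum_congr rfl fun j _ => ?_
  rw [Finset.sum_add_distrib]
  module

lemma Smooth.D_smul {f : G → V} (hf : Smooth f) (c a : ℂ) : D a (c • f) = c • D a f := by
  have h2 : ∀ (X Y : Mat3) (g : G), X.trace = 0 → Y.trace = 0 →
      rDeriv X (rDeriv Y (c • f)) g = c • rDeriv X (rDeriv Y f) g := by
    intro X Y g hX hY
    rw [hf.rDeriv_fun_smul c hY, hf.rDeriv_rDeriv g hX hY]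
    exact ((hf.hasDerivAt_rDeriv g hX hY).const_smul c).deriv
  have h3 : ∀ (X Y : Mat3) (g : G), X.trace = 0 → Y.trace = 0 →
      rDerivSym X Y (c • f) g = c • rDerivSym X Y f g := by
    intro X Y g hX hY
    rw [rDerivSym, h2 X Y g hX hY, h2 Y X g hY hX, rDerivSym]
    module
  funext g A
  simp only [D, h3 _ _ _ (trace_T _ _) (trace_T _ _), hf.rDeriv_fun_smul c (trace_T _ _),
    Pi.smul_apply]
  rw [Finset.smul_sum]
  refine Finset.sum_congr rfl fun i _ => ?_
  rw [Finset.smul_sum]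
  refine Finset.sum_congr rfl fun j _ => ?_
  rw [← Finset.smul_sum]
  module

/-- The kernel of `D` in the induced representation. -/
def kerD (a : ℂ) : Submodule ℂ (G → V) where
  carrier := {f | f ∈ Ind (-lam2 (-a)) ∧ D a f = 0}
  add_mem' hf hf' := ⟨(indSub _).add_mem hf.1 hf'.1, by
    rw [hf.1.1.D_add hf'.1.1, hf.2, hf'.2, add_zero]⟩
  zero_mem' := ⟨(indSub _).zero_mem, by
    have := Smooth.zero.D_smul 0 a
    rwa [zero_smul, zero_smul] at this⟩
  smul_mem' c f hf := ⟨(indSub _).smul_mem c hf.1, by rw [hf.1.1.D_smul, hf.2, smul_zero]⟩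

lemma leftTr_mem_kerD {a : ℂ} {f : G → V} (hf : f ∈ kerD a) (u : G) : leftTr u f ∈ kerD a :=
  ⟨Ind.leftTr hf.1 u, by funext g; rw [D_leftTr, hf.2]; rfl⟩

/-- The span of the translates of `f` under `K`. -/
def orbit (f : G → V) : Submodule ℂ (G → V) :=
  Submodule.span ℂ (Set.range fun y : K => leftTr (embK y) f)

lemma kFinite_iff (f : G → V) : KFinite f ↔ FiniteDimensional ℂ (orbit f) := Iff.rfl

lemma leftTr_mem_orbit (f : G → V) (y : K) : leftTr (embK y) f ∈ orbit f :=
  Submodule.subset_span ⟨y, rfl⟩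

lemma self_mem_orbit (f : G → V) : f ∈ orbit f := by
  have := leftTr_mem_orbit f 1
  rwa [map_one, leftTr_one] at this

lemma orbit_stable (f : G → V) (y : K) {x : G → V} (hx : x ∈ orbit f) :
    leftTr (embK y) x ∈ orbit f := by
  have hle : orbit f ≤ (orbit f).comap (leftTr (embK y)) := by
    refine Submodule.span_le.2 ?_
    rintro _ ⟨z, rfl⟩
    rw [SetLike.mem_coe, Submodule.mem_comap, ← leftTr_mul, ← map_mul]
    exact leftTr_mem_orbit f _
  exact hle hx

lemma KFinite.of_mem {f : G → V} {S : Submodule ℂ (G → V)} [FiniteDimensional ℂ S]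
    (h : ∀ y : K, leftTr (embK y) f ∈ S) : KFinite f := by
  rw [kFinite_iff]
  refine Submodule.finiteDimensional_of_le (S₂ := S) (Submodule.span_le.2 ?_)
  rintro _ ⟨y, rfl⟩
  exact h y

lemma KFinite.add {f f' : G → V} (hf : KFinite f) (hf' : KFinite f') : KFinite (f + f') := by
  rw [kFinite_iff] at hf hf'
  refine KFinite.of_mem (S := orbit f ⊔ orbit f') fun y => ?_
  rw [map_add]
  exact Submodule.add_mem_sup (leftTr_mem_orbit f y) (leftTr_mem_orbit f' y)

lemma KFinite.smul {f : G → V} (hf : KFinite f) (c : ℂ) : KFinite (c • f) := by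
  rw [kFinite_iff] at hf
  refine KFinite.of_mem (S := orbit f) fun y => ?_
  rw [map_smul]
  exact Submodule.smul_mem _ c (leftTr_mem_orbit f y)

lemma KFinite.zero : KFinite (0 : G → V) :=
  KFinite.of_mem (S := ⊥) fun y => by rw [map_zero]; exact Submodule.zero_mem _

/-- The space `kerDK a` as a submodule. -/
def kerDKSub (a : ℂ) : Submodule ℂ (G → V) where
  carrier := kerDK a
  add_mem' hf hf' := ⟨((kerD a).add_mem ⟨hf.1, hf.2.1⟩ ⟨hf'.1, hf'.2.1⟩).1,
    ((kerD a).add_mem ⟨hf.1, hf.2.1⟩ ⟨hf'.1, hf'.2.1⟩).2, hf.2.2.add hf'.2.2⟩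
  zero_mem' := ⟨(kerD a).zero_mem.1, (kerD a).zero_mem.2, KFinite.zero⟩
  smul_mem' c _ hf := ⟨((kerD a).smul_mem c ⟨hf.1, hf.2.1⟩).1,
    ((kerD a).smul_mem c ⟨hf.1, hf.2.1⟩).2, hf.2.2.smul c⟩

lemma orbit_le_kerD {a : ℂ} {f : G → V} (hf : f ∈ kerDK a) : orbit f ≤ kerD a := by
  refine Submodule.span_le.2 ?_
  rintro _ ⟨y, rfl⟩
  exact leftTr_mem_kerD ⟨hf.1, hf.2.1⟩ _

lemma KStable.orbit {a : ℂ} {f : G → V} (hf : f ∈ kerDK a) : KStable (orbit f) where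
  fin := hf.2.2
  smooth _ hx := (orbit_le_kerD hf hx).1.1
  stable y _ hx := orbit_stable f y hx

lemma Sl2.le_of_hw {M W : Type*} [AddCommGroup M] [Module ℂ M] [AddCommGroup W] [Module ℂ W]
    [FiniteDimensional ℂ W] {H E F : W →ₗ[ℂ] W} (s : Sl2 H E F) (ι : W →ₗ[ℂ] M)
    (S : Submodule ℂ M) (hS : ∀ u, E u = 0 → ∀ m : ℕ, H u = (m : ℂ) • u → ∀ j : ℕ, ι ((F ^ j) u) ∈ S)
    (w : W) : ι w ∈ S := by
  have hle : (⊤ : Submodule ℂ W) ≤ S.comap ι := by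
    rw [← s.span_eq_top]
    refine Submodule.span_le.2 ?_
    rintro _ ⟨u, hu, ⟨m, hm⟩, j, rfl⟩
    exact hS u hu m hm j
  exact hle trivial

/-- The orbit of `f` is spanned by the `F`-translates of highest weight vectors, each of which lies
in the range of some `Φ`. With `S = ⊥` this gives the nonintegral case, with `S` the sum of the
ranges the integral one. -/
lemma mem_of_mem_kerDK {a : ℂ} {f : G → V} (hf : f ∈ kerDK a) (S : Submodule ℂ (G → V))
    (hS : ∀ (n : ℤ) (k : ℕ), a = n →
      LinearMap.range (Phi (-lam2 (-a)) (mInd n k) (qPair n k)) ≤ S) : f ∈ S := by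
  have h := KStable.orbit hf
  have := h.fin
  refine h.sl2.le_of_hw (SL3Kernel.orbit f).subtype S (fun u hu m hm j => ?_) ⟨f, self_mem_orbit f⟩
  by_cases hu0 : u = 0
  · rw [hu0, map_zero, map_zero]
    exact S.zero_mem
  · obtain ⟨n, k, ha, hk⟩ := h.hw_mem_range (fun x hx => (orbit_le_kerD hf hx).1)
      (fun x hx => (orbit_le_kerD hf hx).2) hu hm hu0
    exact hS n k ha (hk j)

lemma kerDK_eq_zero {a : ℂ} (ha : ¬ ∃ n : ℤ, a = (n : ℂ)) : kerDK a = {0} := by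
  ext f
  rw [Set.mem_singleton_iff]
  constructor
  · intro hf
    exact (Submodule.mem_bot ℂ).1 (mem_of_mem_kerDK hf ⊥ fun n k h => absurd ⟨n, h⟩ ha)
  · rintro rfl
    exact (kerDKSub a).zero_mem

lemma kerDKSub_eq (a : ℤ) : kerDKSub (a : ℂ) =
    ⨆ k : ℕ, LinearMap.range (Phi (-lam2 (-(a : ℂ))) (mInd a k) (qPair a k)) := by
  refine le_antisymm (fun f hf => ?_) (iSup_le fun k => ?_)
  · refine mem_of_mem_kerDK hf _ fun n k h => ?_
    obtain rfl : a = n := by exact_mod_cast h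
    exact le_iSup (fun k : ℕ => LinearMap.range (Phi (-lam2 (-(a : ℂ))) (mInd a k) (qPair a k))) k
  · rintro _ ⟨v, rfl⟩
    exact Phi_mem_kerDK a k v

end SL3Kernel

/-! ### Irreducibility and separation of components by the Casimir operator -/

namespace SL3Kernel

/-! ### Irreducibility of `S^m ℂ²` -/

/-- The raising operator of `S^m ℂ²`. -/
def symE (m : ℕ) : SymPow m →ₗ[ℂ] SymPow m :=
  (Complex.I / 2) • symAct m (imQuat ![0, 0, 1]) - (1 / 2 : ℂ) • symAct m (imQuat ![0, 1, 0])

/-- The lowering operator of `S^m ℂ²`. -/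
def symF (m : ℕ) : SymPow m →ₗ[ℂ] SymPow m :=
  (Complex.I / 2) • symAct m (imQuat ![0, 0, 1]) + (1 / 2 : ℂ) • symAct m (imQuat ![0, 1, 0])

/-- The action of `diag(1,-1)` on `S^m ℂ²`. -/
def symH (m : ℕ) : SymPow m →ₗ[ℂ] SymPow m := (-Complex.I) • symAct m (imQuat ![1, 0, 0])

lemma symE_mono {m i : ℕ} (hi : i ≤ m) : symE m (mono m i) = (m - i : ℂ) • mono m (i + 1) := by
  rw [symE, LinearMap.sub_apply, LinearMap.smul_apply, LinearMap.smul_apply, symAct_mono hi,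
    symAct_mono hi, quatMat_imQuat, quatMat_imQuat]
  generalize mono m i = x
  generalize mono m (i - 1) = y
  generalize mono m (i + 1) = w
  have I2 := Complex.I_sq
  simp
  match_scalars <;> first
    | ring1
    | linear_combination (-(m - i) / 2 : ℂ) * I2
    | linear_combination (-(i / 2) : ℂ) * I2

lemma symF_mono {m i : ℕ} (hi : i ≤ m) : symF m (mono m i) = (i : ℂ) • mono m (i - 1) := by
  rw [symF, LinearMap.add_apply, LinearMap.smul_apply, LinearMap.smul_apply, symAct_mono hi,
    symAct_mono hi, quatMat_imQuat, quatMat_imQuat]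
  generalize mono m i = x
  generalize mono m (i - 1) = y
  generalize mono m (i + 1) = w
  have I2 := Complex.I_sq
  simp
  match_scalars <;> first
    | ring1
    | linear_combination (-(m - i) / 2 : ℂ) * I2
    | linear_combination (-(i / 2) : ℂ) * I2

lemma symH_mono {m i : ℕ} (hi : i ≤ m) : symH m (mono m i) = (2 * i - m : ℂ) • mono m i := by
  rw [symH, LinearMap.smul_apply, symAct_mono hi, quatMat_imQuat]
  generalize mono m i = x
  generalize mono m (i - 1) = y
  generalize mono m (i + 1) = w
  have I2 := Complex.I_sq
  simp
  match_scalars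
  linear_combination (m - 2 * i : ℂ) * I2

/-- The Casimir operator acts on `S^m ℂ²` by the scalar `m (m + 2)`. -/
lemma casimir (m : ℕ) (v : SymPow m) :
    (4 : ℂ) • symF m (symE m v) + symH m (symH m v) + (2 : ℂ) • symH m v = (m * (m + 2) : ℂ) • v := by
  have e : (4 : ℂ) • (symF m).comp (symE m) + (symH m).comp (symH m) + (2 : ℂ) • symH m =
      (m * (m + 2) : ℂ) • LinearMap.id := by
    refine symPow_hom_ext fun i hi => ?_
    simp only [LinearMap.add_apply, LinearMap.smul_apply, LinearMap.comp_apply, LinearMap.id_apply]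
    rw [symE_mono hi, symH_mono hi, map_smul, map_smul, symH_mono hi]
    rcases eq_or_lt_of_le hi with rfl | h
    · generalize mono i i = x
      module
    · rw [symF_mono h, Nat.succ_sub_one]
      generalize mono m i = x
      push_cast
      module
  exact LinearMap.congr_fun e v

lemma symF_pow_mono {m i : ℕ} (hi : i ≤ m) (n : ℕ) :
    (symF m ^ n) (mono m i) = (i.descFactorial n : ℂ) • mono m (i - n) := by
  induction n with
  | zero => simp
  | succ n ih =>
    rw [pow_succ', Module.End.mul_apply, ih, map_smul, symF_mono (by omega), smul_smul,
      Nat.descFactorial_succ, Nat.sub_sub]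
    push_cast
    rw [mul_comm]

/-- `S^m ℂ²` is irreducible. -/
lemma eq_top_of_stable {m : ℕ} {N : Submodule ℂ (SymPow m)} (hE : ∀ v ∈ N, symE m v ∈ N)
    (hF : ∀ v ∈ N, symF m v ∈ N) (hN : N ≠ ⊥) : N = ⊤ := by
  obtain ⟨v, hv, hv0⟩ := Submodule.exists_mem_ne_zero_of_ne_bot hN
  have hFp : ∀ n, (symF m ^ n) v ∈ N := by
    intro n
    induction n with
    | zero => exact hv
    | succ n ih => rw [pow_succ', Module.End.mul_apply]; exact hF _ ih
  -- For the largest index `n` with nonzero coefficient, `F ^ n` kills all lower monomials and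
  -- leaves a nonzero multiple of `mono m 0`, from which `E` produces all the others.
  obtain ⟨n, hn, hmax⟩ : ∃ n ∈ (Finset.range (m + 1)).filter (fun i => cf m i v ≠ 0),
      ∀ i ∈ (Finset.range (m + 1)).filter (fun i => cf m i v ≠ 0), i ≤ n := by
    refine Finset.exists_max_image _ id ?_
    by_contra h
    rw [Finset.not_nonempty_iff_eq_empty, Finset.filter_eq_empty_iff] at h
    apply hv0
    rw [eq_sum_mono m v]
    refine Finset.sum_eq_zero fun i hi => ?_
    rw [not_not.1 (h hi), zero_smul]
  rw [Finset.mem_filter, Finset.mem_range] at hn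
  have h1 : (symF m ^ n) v = (cf m n v * n.factorial) • mono m 0 := by
    conv_lhs => rw [eq_sum_mono m v, map_sum]
    rw [Finset.sum_eq_single n]
    · rw [map_smul, symF_pow_mono (by omega), Nat.descFactorial_self, Nat.sub_self, smul_smul]
    · intro i hi hin
      rw [map_smul, symF_pow_mono (by rw [Finset.mem_range] at hi; omega)]
      by_cases hc : cf m i v = 0
      · rw [hc, zero_smul]
      · have := hmax i (Finset.mem_filter.2 ⟨hi, hc⟩)
        rw [Nat.descFactorial_eq_zero_iff_lt.2 (by omega), Nat.cast_zero, zero_smul, smul_zero]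
    · intro h
      exact absurd (Finset.mem_range.2 hn.1) h
  have h0 : mono m 0 ∈ N := by
    have := hFp n
    rw [h1] at this
    exact (N.smul_mem_iff (mul_ne_zero hn.2 (by exact_mod_cast n.factorial_ne_zero))).1 this
  have hall : ∀ i ≤ m, mono m i ∈ N := by
    intro i
    induction i with
    | zero => exact fun _ => h0
    | succ i ih =>
      intro hi
      have := hE _ (ih (by omega))
      rw [symE_mono (by omega)] at this
      refine (N.smul_mem_iff (sub_ne_zero.2 ?_)).1 this
      exact_mod_cast (show m ≠ i by omega)
  rw [eq_top_iff]
  intro w _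
  rw [eq_sum_mono m w]
  exact N.sum_mem fun i hi => N.smul_mem _ (hall i (by rw [Finset.mem_range] at hi; omega))

/-! ### Invariant subspaces of direct sums -/

/-- Lagrange interpolation: with `C` the operator that acts by `c i` on the `i`th summand, the
product of `C - c j` over the other indices `j` in the support of `x` kills all components but the
`k`th, which it multiplies by a nonzero number. -/
lemma lof_mem_of_lmap_smul_mem {ι : Type*} [DecidableEq ι] {M : ι → Type*}
    [∀ i, AddCommGroup (M i)] [∀ i, Module ℂ (M i)] (c : ι → ℂ) (hc : Function.Injective c)
    {p : Submodule ℂ (⨁ i, M i)}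
    (hp : ∀ x ∈ p, DirectSum.lmap (fun i => c i • (LinearMap.id : M i →ₗ[ℂ] M i)) x ∈ p)
    {x : ⨁ i, M i} (hx : x ∈ p) (k : ι) : DirectSum.lof ℂ ι M k (x k) ∈ p := by
  have key : ∀ s : Finset ι, DirectSum.lmap
      (fun i => (∏ j ∈ s, (c i - c j)) • (LinearMap.id : M i →ₗ[ℂ] M i)) x ∈ p := by
    intro s
    induction s using Finset.induction_on with
    | empty =>
      convert hx using 1
      refine DFinsupp.ext fun i => ?_
      rw [DirectSum.lmap_apply]
      simp
    | insert a s ha ih =>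
      convert p.sub_mem (hp _ ih) (p.smul_mem (c a) ih) using 1
      refine DFinsupp.ext fun i => ?_
      rw [DFinsupp.sub_apply, DFinsupp.smul_apply]
      erw [DirectSum.lmap_apply, DirectSum.lmap_apply, DirectSum.lmap_apply]
      rw [Finset.prod_insert ha]
      simp only [LinearMap.smul_apply, LinearMap.id_apply]
      module
  classical
  set s := (DFinsupp.support x).erase k with hs
  have hd : (∏ j ∈ s, (c k - c j)) ≠ 0 := by
    refine Finset.prod_ne_zero_iff.2 fun j hj => sub_ne_zero.2 fun h => ?_
    exact Finset.ne_of_mem_erase hj (hc h).symm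
  refine (p.smul_mem_iff hd).1 ?_
  convert key s using 1
  refine DFinsupp.ext fun i => ?_
  rw [← map_smul]
  erw [DirectSum.lmap_apply]
  simp only [LinearMap.smul_apply, LinearMap.id_apply]
  by_cases hi : i = k
  · subst hi
    exact DirectSum.of_eq_same i _
  · refine (DirectSum.of_eq_of_ne k i _ hi).trans ?_
    by_cases hx0 : x i = 0
    · rw [hx0, smul_zero]
    · rw [Finset.prod_eq_zero (i := i) (Finset.mem_erase.2 ⟨hi, DFinsupp.mem_support_iff.2 hx0⟩)
        (sub_self _), zero_smul]

end SL3Kernel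

/-! ### Independence of the summands -/

namespace SL3Kernel

/-! ### The direct sum decomposition -/

section Stable

variable {ι : Type*} {M : ι → Type*} [∀ i, AddCommGroup (M i)] [∀ i, Module ℂ (M i)]

/-- The subspace `p` of `⨁ M i` is stable under the family `φ` of endomorphisms of the `M i`. -/
def StableUnder (p : Submodule ℂ (⨁ i, M i)) (φ : ∀ i, M i →ₗ[ℂ] M i) : Prop :=
  ∀ x ∈ p, DirectSum.lmap φ x ∈ p

variable {p : Submodule ℂ (⨁ i, M i)} {φ ψ : ∀ i, M i →ₗ[ℂ] M i}

lemma StableUnder.add (h : StableUnder p φ) (h' : StableUnder p ψ) :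
    StableUnder p fun i => φ i + ψ i := fun x hx => by
  have e : DirectSum.lmap (fun i => φ i + ψ i) x = DirectSum.lmap φ x + DirectSum.lmap ψ x :=
    DFinsupp.ext fun i => rfl
  rw [e]
  exact p.add_mem (h x hx) (h' x hx)

lemma StableUnder.smul (h : StableUnder p φ) (c : ℂ) : StableUnder p fun i => c • φ i := fun x hx => by
  have e : DirectSum.lmap (fun i => c • φ i) x = c • DirectSum.lmap φ x := DFinsupp.ext fun i => rfl
  rw [e]
  exact p.smul_mem c (h x hx)

lemma StableUnder.comp (h : StableUnder p φ) (h' : StableUnder p ψ) :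
    StableUnder p fun i => (φ i).comp (ψ i) := fun x hx => by
  have e : DirectSum.lmap (fun i => (φ i).comp (ψ i)) x = DirectSum.lmap φ (DirectSum.lmap ψ x) :=
    DFinsupp.ext fun i => rfl
  rw [e]
  exact h _ (h' x hx)

variable [DecidableEq ι] {N : Type*} [AddCommGroup N] [Module ℂ N]

lemma range_toModule (φ : ∀ i, M i →ₗ[ℂ] N) :
    LinearMap.range (DirectSum.toModule ℂ ι N φ) = ⨆ i, LinearMap.range (φ i) := by
  refine le_antisymm ?_ (iSup_le fun i => ?_)
  · rintro _ ⟨x, rfl⟩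
    induction x using DirectSum.induction_on with
    | zero => rw [map_zero]; exact Submodule.zero_mem _
    | of i v =>
      rw [← DirectSum.lof_eq_of ℂ, DirectSum.toModule_lof]
      exact Submodule.mem_iSup_of_mem i ⟨v, rfl⟩
    | add x y hx hy => rw [map_add]; exact Submodule.add_mem _ hx hy
  · rintro _ ⟨v, rfl⟩
    exact ⟨_, DirectSum.toModule_lof ℂ i v⟩

/-- The sum map factors through the direct sum of the ranges by a surjection, so the second factor
is injective too. -/
lemma iSupIndep_range_of_toModule_injective (φ : ∀ i, M i →ₗ[ℂ] N)
    (h : Function.Injective (DirectSum.toModule ℂ ι N φ)) :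
    iSupIndep fun i => LinearMap.range (φ i) := by
  refine iSupIndep_of_dfinsupp_lsum_injective _ ((injective_iff_map_eq_zero _).2 fun y hy => ?_)
  have hs : Function.Surjective (DirectSum.lmap fun i => (φ i).rangeRestrict) :=
    (DirectSum.lmap_surjective _).2 fun i => (φ i).surjective_rangeRestrict
  obtain ⟨x, rfl⟩ := hs y
  have e : (DirectSum.coeLinearMap fun i => LinearMap.range (φ i)).comp
      (DirectSum.lmap fun i => (φ i).rangeRestrict) = DirectSum.toModule ℂ ι N φ := by
    refine DirectSum.linearMap_ext ℂ fun i => LinearMap.ext fun v => ?_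
    rw [LinearMap.comp_apply, LinearMap.comp_apply, LinearMap.comp_apply, DirectSum.lmap_lof,
      DirectSum.toModule_lof, DirectSum.coeLinearMap_lof]
    rfl
  have hx : DirectSum.toModule ℂ ι N φ x = 0 := by
    rw [← e]
    exact hy
  rw [(injective_iff_map_eq_zero _).1 h x hx, map_zero]

end Stable

lemma StableUnder.casimir {m : ℕ → ℕ} {p : Submodule ℂ (⨁ k, SymPow (m k))}
    (hp : ∀ z, StableUnder p fun k => symAct (m k) (imQuat z)) :
    StableUnder p fun k => (m k * (m k + 2) : ℂ) • (LinearMap.id : SymPow (m k) →ₗ[ℂ] SymPow (m k)) := by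
  have hE : StableUnder p fun k => symE (m k) := by
    have h := ((hp ![0, 0, 1]).smul (Complex.I / 2)).add ((hp ![0, 1, 0]).smul (-(1 / 2)))
    convert h using 2 with k
    rw [symE]
    module
  have hF : StableUnder p fun k => symF (m k) :=
    ((hp ![0, 0, 1]).smul (Complex.I / 2)).add ((hp ![0, 1, 0]).smul (1 / 2))
  have hH : StableUnder p fun k => symH (m k) := (hp ![1, 0, 0]).smul (-Complex.I)
  have h := (((hF.comp hE).smul 4).add (hH.comp hH)).add (hH.smul 2)
  convert h using 2 with k
  exact LinearMap.ext fun v => (SL3Kernel.casimir (m k) v).symm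

lemma natDegree_qPair_le (a : ℤ) (k : ℕ) (c : Fin 2) : (qPair a k c).natDegree ≤ mInd a k :=
  (mInv_qPair a k).1 c

/-- `Φ_{m(a,k)}`, for the parameter `a`. -/
def PhiA (a : ℤ) (k : ℕ) : SymPow (mInd a k) →ₗ[ℂ] (G → V) :=
  Phi (-lam2 (-(a : ℂ))) (mInd a k) (qPair a k)

lemma PhiA_symAct_eq_zero (a : ℤ) (k : ℕ) (z : Fin 3 → ℝ) {v : SymPow (mInd a k)}
    (hv : PhiA a k v = 0) : PhiA a k (symAct _ (imQuat z) v) = 0 := by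
  funext g
  have h := hasDerivAt_Phi_left (-lam2 (-(a : ℂ))) (mInd a k) (qPair a k) v z g
  refine h.unique ?_
  change HasDerivAt (fun t : ℝ => PhiA a k v ((embK (expK (t • z)))⁻¹ * g)) _ 0
  rw [hv]
  exact hasDerivAt_const _ _

lemma PhiA_ne_zero (a : ℤ) (k : ℕ) : PhiA a k ≠ 0 := by
  intro h
  obtain ⟨c, hc⟩ := qPair_ne_zero a k
  apply hc
  refine pairing_injective (natDegree_qPair_le a k c) (Polynomial.natDegree_zero.trans_le (Nat.zero_le _))
    fun v => ?_
  have h1 := congrFun (congrFun (LinearMap.congr_fun h v) (embK 1)) c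
  rw [PhiA, Phi_embK, PhiK_one] at h1
  rw [h1, pairing_eq]
  simp

/-- The kernel is stable under `𝔨`, and `S^m ℂ²` is irreducible, so a nonzero kernel would make the
map vanish; but the pair of polynomials is not zero. -/
lemma PhiA_injective (a : ℤ) (k : ℕ) : Function.Injective (PhiA a k) := by
  rw [← LinearMap.ker_eq_bot]
  by_contra hN
  have hz : ∀ z, ∀ v ∈ LinearMap.ker (PhiA a k), symAct _ (imQuat z) v ∈ LinearMap.ker (PhiA a k) :=
    fun z v hv => PhiA_symAct_eq_zero a k z hv
  have htop := eq_top_of_stable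
    (fun v hv => Submodule.sub_mem _ (Submodule.smul_mem _ _ (hz _ v hv))
      (Submodule.smul_mem _ _ (hz _ v hv)))
    (fun v hv => Submodule.add_mem _ (Submodule.smul_mem _ _ (hz _ v hv))
      (Submodule.smul_mem _ _ (hz _ v hv))) hN
  exact PhiA_ne_zero a k (LinearMap.ker_eq_top.1 htop)

/-- The sum of the maps `Φ_{m(a,k)}`. -/
def PhiSum (a : ℤ) : (⨁ k, SymPow (mInd a k)) →ₗ[ℂ] (G → V) :=
  DirectSum.toModule ℂ ℕ _ (PhiA a)

lemma PhiSum_lof (a : ℤ) (k : ℕ) (v : SymPow (mInd a k)) :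
    PhiSum a (DirectSum.lof ℂ ℕ (fun k => SymPow (mInd a k)) k v) = PhiA a k v :=
  DirectSum.toModule_lof (M := fun k => SymPow (mInd a k)) ℂ k v

lemma isKIntertwining_PhiSum (a : ℤ) : IsKIntertwining (mInd a) (PhiSum a) := by
  intro z x g
  induction x using DirectSum.induction_on with
  | zero =>
    simp only [map_zero, Pi.zero_apply]
    exact hasDerivAt_const _ _
  | of k v =>
    have h1 : DirectSum.lmap (fun k => symAct (mInd a k) (imQuat z))
        (DirectSum.lof ℂ ℕ (fun k => SymPow (mInd a k)) k v) =
        DirectSum.lof ℂ ℕ (fun k => SymPow (mInd a k)) k (symAct (mInd a k) (imQuat z) v) :=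
      DirectSum.lmap_lof _ _ _
    have h2 := hasDerivAt_Phi_left (-lam2 (-(a : ℂ))) (mInd a k) (qPair a k) v z g
    change HasDerivAt (fun t : ℝ => PhiSum a (DirectSum.lof ℂ ℕ (fun k => SymPow (mInd a k)) k v)
      ((embK (expK (t • z)))⁻¹ * g)) (PhiSum a (DirectSum.lmap (fun k => symAct (mInd a k) (imQuat z))
        (DirectSum.lof ℂ ℕ (fun k => SymPow (mInd a k)) k v)) g) 0
    rw [h1, PhiSum_lof, PhiSum_lof]
    exact h2
  | add x y hx hy =>
    rw [map_add, map_add, map_add]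
    exact hx.add hy

lemma mInd_casimir_injective (a : ℤ) :
    Function.Injective fun k : ℕ => ((mInd a k : ℂ) * (mInd a k + 2)) := by
  intro k l h
  simp only at h
  have h1 : mInd a k * (mInd a k + 2) = mInd a l * (mInd a l + 2) := by exact_mod_cast h
  have h2 : mInd a k = mInd a l := by nlinarith
  rw [mInd, mInd] at h2
  omega

/-- The kernel is stable under `𝔨`, hence under the Casimir operator, whose eigenvalues on the
summands are distinct. It therefore contains every component of its elements, and each `PhiA` is
injective. -/
lemma PhiSum_injective (a : ℤ) : Function.Injective (PhiSum a) := by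
  refine (injective_iff_map_eq_zero _).2 fun x hx => ?_
  have hst : ∀ z, StableUnder (LinearMap.ker (PhiSum a)) fun k => symAct (mInd a k) (imQuat z) := by
    intro z y hy
    rw [LinearMap.mem_ker] at hy ⊢
    funext g
    refine (isKIntertwining_PhiSum a z y g).unique ?_
    rw [hy]
    exact hasDerivAt_const _ _
  refine DFinsupp.ext fun k => ?_
  have h := lof_mem_of_lmap_smul_mem _ (mInd_casimir_injective a) (StableUnder.casimir hst)
    (LinearMap.mem_ker.2 hx) k
  rw [LinearMap.mem_ker, PhiSum_lof] at h
  exact PhiA_injective a k (h.trans (map_zero _).symm)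

lemma range_PhiSum (a : ℤ) : LinearMap.range (PhiSum a) = ⨆ k, LinearMap.range (PhiA a k) :=
  range_toModule (M := fun k => SymPow (mInd a k)) (PhiA a)

lemma iSupIndep_range_PhiA (a : ℤ) : iSupIndep fun k => LinearMap.range (PhiA a k) :=
  iSupIndep_range_of_toModule_injective (M := fun k => SymPow (mInd a k)) (PhiA a)
    (PhiSum_injective a)

end SL3Kernel

end

theorem mainTheorem4 :
    (∀ a : ℂ, (¬ ∃ n : ℤ, a = (n : ℂ)) → SL3Kernel.kerDK a = {0}) ∧
    ∀ a : ℤ,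
      SL3Kernel.kerDK (a : ℂ) =
        ((⨆ k : ℕ, LinearMap.range (SL3Kernel.Phi (-SL3Kernel.lam2 (-(a : ℂ)))
            (SL3Kernel.mInd a k) (SL3Kernel.qPair a k)) :
          Submodule ℂ (SL3Kernel.G → SL3Kernel.V)) : Set (SL3Kernel.G → SL3Kernel.V)) ∧
      iSupIndep (fun k : ℕ => LinearMap.range (SL3Kernel.Phi (-SL3Kernel.lam2 (-(a : ℂ)))
        (SL3Kernel.mInd a k) (SL3Kernel.qPair a k))) ∧
      ∃ e : (DirectSum ℕ fun k => SL3Kernel.SymPow (SL3Kernel.mInd a k)) →ₗ[ℂ]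
          (SL3Kernel.G → SL3Kernel.V),
        Function.Injective e ∧ Set.range e = SL3Kernel.kerDK (a : ℂ) ∧
          SL3Kernel.IsKIntertwining (SL3Kernel.mInd a) e := by
  refine ⟨fun a ha => SL3Kernel.kerDK_eq_zero ha, fun a => ⟨?_, SL3Kernel.iSupIndep_range_PhiA a,
    SL3Kernel.PhiSum a, SL3Kernel.PhiSum_injective a, ?_, SL3Kernel.isKIntertwining_PhiSum a⟩⟩
  · rw [← SL3Kernel.kerDKSub_eq]
    rfl
  · rw [← LinearMap.coe_range, SL3Kernel.range_PhiSum]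
    exact congrArg SetLike.coe (SL3Kernel.kerDKSub_eq a).symm
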